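/- Let $n\ge 1$, let $\bar M$ be a smooth compact $(n+1)$-dimensional manifold with boundary, with interior $M$, and let $\rho\colon\bar M\to[0,\infty)$ be a smooth defining function: $\rho^{-1}(0)=\partial M$ and $d\rho\ne 0$ on $\partial M$. Fix finitely many background coordinate charts $\Theta=(\theta,\rho)$ near $\partial M$ (with relatively compact domains, and extending smoothly past their closures), and countably many parametrizations $\Phi_i\colon B_2\to M$, where $B_r$ is the hyperbolic ball of radius $r$ about $(0,\dots,0,1)$ in the upper half space: finitely many of them are interior charts, smooth up to the closure of $B_2$, and the others are M\"obius parametrizations $(x,y)\mapsto(\theta_0+\rho_0x,\rho_0y)$ in background charts; the sets $\Phi_i(B_1)$ cover $M$ and the sets $\Phi_i(B_2)$ are uniformly locally finite. For $k\in\mathbb N_0$, $\alpha\in[0,1)$, $\delta\in\mathbb R$, let $C^{k,\alpha}_\delta(M)$ be the space of tensor fields $u$ with finite norm $\|u\|_{C^{k,\alpha}_\delta(M)}=\sup_i\|\Phi_i^*(\rho^{-\delta}u)\|_{C^{k,\alpha}(B_2)}$. For $0\le m\le k$, a covariant tensor field $u$ of rank $r$ belongs to $\mathscr C^{k,\alpha;m}(M)$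 if $\mathcal L_{X_1}\cdots\mathcal L_{X_j}u\in C^{k-j,\alpha}_r(M)$ for all $0\le j\le m$ and all smooth vector fields $X_1,\dots,X_j$ on $\bar M$; this space is normed by $\sum_{l=0}^m\|\bar\nabla^l u\|_{C^{k-l,\alpha}_{r+l}(M)}$, where $\bar\nabla$ is the Levi-Civita connection of a fixed smooth Riemannian metric $\bar h$ on $\bar M$ with $|d\rho|_{\bar h}=1$ on $\partial M$. For $k\ge2$ let $\mathscr M^{k,\alpha;2}_{\mathrm{weak}}$ be the set of Riemannian metrics $g$ on $M$ such that $\bar g=\rho^2g\in\mathscr C^{k,\alpha;2}(M)$ extends to a continuous nondegenerate metric on $\bar M$ and such that the curvature operator $\mathrm{Riem}[g]\colon\Lambda^2TM\to\Lambda^2TM$ (normalized to be $-\mathrm{Id}$ on hyperbolic space) satisfies $|\mathrm{Riem}[g]+\mathrm{Id}|_{\bar h}\to0$ as $\rho\to0$. Equip it with the distance $d(g,g')=\|\rho^2(g-g')\|_{\mathscr C^{k,\alpha;2}(M)}$. Let $\mathrm R[g]$ denote the scalar curvature. Lemma. Let $k\ge2$ and $\alpha\in[0,1)$. Every $g\in\mathscr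 M^{k,\alpha;2}_{\mathrm{weak}}$ is conformal on $M$ to some $\tilde g\in\mathscr M^{k,\alpha;2}_{\mathrm{weak}}$ with $\mathrm R[\tilde g]+n(n+1)\in C^{k-2,\alpha}_2(M)$. Moreover, $\tilde g$ can be chosen for all $g$ simultaneously so that $g\mapsto\tilde g$ is a locally Lipschitz map $\mathscr M^{k,\alpha;2}_{\mathrm{weak}}\to\mathscr M^{k,\alpha;2}_{\mathrm{weak}}$: every $g_0\in\mathscr M^{k,\alpha;2}_{\mathrm{weak}}$ has a neighbourhood on which the map is Lipschitz with respect to $d$. -/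

import Mathlib

open scoped Manifold ContDiff ENNReal Topology

namespace WeakAH

noncomputable section

/-! Everything takes place on a smooth compact manifold with boundary `M` of dimension `n + 1`
(the `M̄` of the usual notation), modelled on the half space `{y ∈ ℝⁿ⁺¹ | 0 ≤ y 0}`.  Its interior is
`(𝓡∂ (n + 1)).interior M`.  In half-space coordinates the coordinate of index `0` is the one normal
to the boundary, and the coordinates of index `1, …, n` are tangential. -/

/-- The coordinate space `ℝⁿ⁺¹`. -/
abbrev Coord (n : ℕ) : Type := EuclideanSpace ℝ (Fin (n + 1))

/-- The standard basis vectors of the coordinate space. -/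
def basisVec {n : ℕ} (i : Fin (n + 1)) : Coord n := EuclideanSpace.single i (1 : ℝ)

/-- The partial derivative `∂_i f` of a scalar function on the coordinate space. -/
def pd {n : ℕ} (i : Fin (n + 1)) (f : Coord n → ℝ) (y : Coord n) : ℝ := fderiv ℝ f y (basisVec i)

/-- Defining functions: smooth, nonnegative, vanishing exactly on the boundary, with nonvanishing
differential there. -/
structure IsDefiningFunction (n : ℕ) {M : Type*} [TopologicalSpace M]
    [ChartedSpace (EuclideanHalfSpace (n + 1)) M] (ρ : M → ℝ) : Prop where
  smooth : ContMDiff (𝓡∂ (n + 1)) 𝓘(ℝ, ℝ) ∞ ρ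
  nonneg : ∀ p, 0 ≤ ρ p
  eq_zero_iff : ∀ p, ρ p = 0 ↔ p ∈ (𝓡∂ (n + 1)).boundary M
  mfderiv_ne_zero : ∀ p ∈ (𝓡∂ (n + 1)).boundary M, mfderiv (𝓡∂ (n + 1)) 𝓘(ℝ, ℝ) ρ p ≠ 0

/-! ### Tensor fields -/

/-- (Not necessarily continuous) covariant tensor fields of rank `r`.  Only the values at interior
points are ever used; the values at boundary points are irrelevant. -/
abbrev CovTensor (n : ℕ) (M : Type*) [TopologicalSpace M]
    [ChartedSpace (EuclideanHalfSpace (n + 1)) M] (r : ℕ) : Type _ :=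
  ∀ p : M, ContinuousMultilinearMap ℝ (fun _ : Fin r => TangentSpace (𝓡∂ (n + 1)) p) ℝ

/-- The multilinear form on the coordinate space with components `c`. -/
def ofComponents {n r : ℕ} (c : (Fin r → Fin (n + 1)) → ℝ) :
    ContinuousMultilinearMap ℝ (fun _ : Fin r => Coord n) ℝ :=
  ∑ J, c J • (ContinuousMultilinearMap.mkPiAlgebra ℝ (Fin r) ℝ).compContinuousLinearMap
    (fun a => (EuclideanSpace.proj (J a) : Coord n →L[ℝ] ℝ))

section Manifold

variable {n : ℕ} {M : Type*} [TopologicalSpace M] [ChartedSpace (EuclideanHalfSpace (n + 1)) M]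

/-- A function, viewed as a tensor field of rank `0`. -/
def ofFun (f : M → ℝ) : CovTensor n M 0 := fun p =>
  ContinuousMultilinearMap.constOfIsEmpty ℝ (fun _ : Fin 0 => TangentSpace (𝓡∂ (n + 1)) p) (f p)

/-- The pullback `Φ^* u` of a covariant tensor field by a map `Φ` from the coordinate space. -/
def pullback {r : ℕ} (Φ : Coord n → M) (u : CovTensor n M r) (z : Coord n) :
    ContinuousMultilinearMap ℝ (fun _ : Fin r => Coord n) ℝ :=
  (u (Φ z)).compContinuousLinearMap
    (fun _ => (mfderiv 𝓘(ℝ, Coord n) (𝓡∂ (n + 1)) Φ z :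
      Coord n →L[ℝ] TangentSpace (𝓡∂ (n + 1)) (Φ z)))

/-- The component `u_J` of a covariant tensor field in the preferred chart at `p`, as a function on
the coordinate space. -/
def comp {r : ℕ} (p : M) (u : CovTensor n M r) (J : Fin r → Fin (n + 1)) (y : Coord n) : ℝ :=
  pullback (extChartAt (𝓡∂ (n + 1)) p).symm u y (fun a => basisVec (J a))

/-- The component `X^l` of a vector field in the preferred chart at `p`. -/
def vecComp (p : M) (X : ∀ q : M, TangentSpace (𝓡∂ (n + 1)) q) (l : Fin (n + 1)) (y : Coord n) :
    ℝ :=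
  let v : Coord n :=
    VectorField.mpullback 𝓘(ℝ, Coord n) (𝓡∂ (n + 1)) (extChartAt (𝓡∂ (n + 1)) p).symm X y
  v l

/-- The Lie derivative of a covariant tensor field (at interior points):
`(𝓛_X u)_J = X^l ∂_l u_J + ∑_a u_{J[a := l]} ∂_{J a} X^l`. The tangent space at `p` is
identified with the coordinate space by the preferred chart at `p`. -/
def lieDeriv {r : ℕ} (X : ∀ q : M, TangentSpace (𝓡∂ (n + 1)) q) (u : CovTensor n M r) :
    CovTensor n M r := fun p =>
  let y := extChartAt (𝓡∂ (n + 1)) p p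
  ofComponents (n := n) fun J =>
    ∑ l, vecComp p X l y * pd l (comp p u J) y +
      ∑ a, ∑ l, comp p u (Function.update J a l) y * pd (J a) (vecComp p X l) y

/-- Smooth vector fields on the manifold with boundary (smooth up to the boundary). -/
def IsSmoothVectorField [IsManifold (𝓡∂ (n + 1)) ∞ M]
    (X : ∀ q : M, TangentSpace (𝓡∂ (n + 1)) q) : Prop :=
  ContMDiff (𝓡∂ (n + 1)) ((𝓡∂ (n + 1)).prod 𝓘(ℝ, Coord n)) ∞
    (fun q => Bundle.TotalSpace.mk' (Coord n) q (X q))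

/-! ### Riemannian geometry in coordinates -/

/-- The matrix `g_{ij}` of a tensor field of rank `2` in the preferred chart at `p`. -/
def gram (p : M) (g : CovTensor n M 2) (y : Coord n) : Matrix (Fin (n + 1)) (Fin (n + 1)) ℝ :=
  Matrix.of fun i j => comp p g ![i, j] y

/-- The Christoffel symbols `Γ^m_{ij} = ½ g^{ml} (∂_i g_{jl} + ∂_j g_{il} - ∂_l g_{ij})` in the
preferred chart at `p`. -/
def christoffel (p : M) (g : CovTensor n M 2) (m i j : Fin (n + 1)) (y : Coord n) : ℝ :=
  1 / 2 * ∑ l, (gram p g y)⁻¹ m l *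
    (pd i (fun z => gram p g z j l) y + pd j (fun z => gram p g z i l) y
      - pd l (fun z => gram p g z i j) y)

/-- The curvature components `R_{ijk}^l`, where `R(∂_i, ∂_j) ∂_k = R_{ijk}^l ∂_l` and
`R(X, Y) Z = ∇_X ∇_Y Z - ∇_Y ∇_X Z - ∇_{[X, Y]} Z`, in the preferred chart at `p`, at `p`. -/
def curvature (g : CovTensor n M 2) (p : M) (i j k l : Fin (n + 1)) : ℝ :=
  let y := extChartAt (𝓡∂ (n + 1)) p p
  pd i (christoffel p g l j k) y - pd j (christoffel p g l i k) y +
    ∑ m, (christoffel p g m j k y * christoffel p g l i m y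
      - christoffel p g m i k y * christoffel p g l j m y)

/-- The components `Riem_{ij}^{kl} = g^{lq} R_{ijq}^k` of the curvature operator
`Riem[g] : Λ²TM → Λ²TM` at `p`. With this sign the round unit sphere has
`Riem_{ij}^{kl} = δ_i^k δ_j^l - δ_i^l δ_j^k`, and hyperbolic space has the opposite. -/
def riemOp (g : CovTensor n M 2) (p : M) (i j k l : Fin (n + 1)) : ℝ :=
  ∑ q, (gram p g (extChartAt (𝓡∂ (n + 1)) p p))⁻¹ l q * curvature g p i j q k

/-- The scalar curvature `R[g] = Riem_{ij}^{ij}`. -/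
def scalarCurvature (g : CovTensor n M 2) (p : M) : ℝ := ∑ i, ∑ j, riemOp g p i j i j

/-- The components `Id_{ij}^{kl} = δ_i^k δ_j^l - δ_i^l δ_j^k` of the identity of `Λ²TM`. -/
def idOp (i j k l : Fin (n + 1)) : ℝ :=
  (if i = k then 1 else 0) * (if j = l then 1 else 0)
    - (if i = l then 1 else 0) * (if j = k then 1 else 0)

/-- The norm, with respect to the metric `h`, of a tensor `A_{ij}^{kl}` at `p`. -/
def opNorm (h : CovTensor n M 2) (p : M) (A : Fin (n + 1) → Fin (n + 1) → Fin (n + 1) →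
    Fin (n + 1) → ℝ) : ℝ :=
  let H := gram p h (extChartAt (𝓡∂ (n + 1)) p p)
  √(∑ i, ∑ i', ∑ j, ∑ j', ∑ k, ∑ k', ∑ l, ∑ l',
    H⁻¹ i i' * H⁻¹ j j' * H k k' * H l l' * A i j k l * A i' j' k' l')

/-- The covariant derivative `∇u` of a covariant tensor field with respect to the Levi-Civita
connection of `h` (at interior points); the new index is the first one:
`(∇u)_{iJ} = ∂_i u_J - ∑_a Γ^m_{i J_a} u_{J[a := m]}`. -/
def nabla (h : CovTensor n M 2) {r : ℕ} (u : CovTensor n M r) : CovTensor n M (r + 1) := fun p =>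
  let y := extChartAt (𝓡∂ (n + 1)) p p
  ofComponents (n := n) fun I =>
    pd (I 0) (comp p u (Fin.tail I)) y -
      ∑ a, ∑ m, christoffel p h m (I 0) (Fin.tail I a) y *
        comp p u (Function.update (Fin.tail I) a m) y

/-- The iterated covariant derivative. -/
def nablaIter (h : CovTensor n M 2) {r : ℕ} (u : CovTensor n M r) : ∀ l : ℕ, CovTensor n M (r + l)
  | 0 => u
  | l + 1 => nabla h (nablaIter h u l)

/-- A smooth Riemannian metric on the manifold with boundary, viewed as a tensor field. -/
def toCovTensor [IsManifold (𝓡∂ (n + 1)) ∞ M]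
    (h : Bundle.ContMDiffRiemannianMetric (𝓡∂ (n + 1)) ∞ (Coord n)
      (fun p : M => TangentSpace (𝓡∂ (n + 1)) p)) : CovTensor n M 2 := fun p =>
  ofComponents (n := n) fun J => h.inner p (basisVec (J 0)) (basisVec (J 1))

/-- `|dρ|²` at `p` with respect to a smooth Riemannian metric. -/
def dNormSq [IsManifold (𝓡∂ (n + 1)) ∞ M]
    (h : Bundle.ContMDiffRiemannianMetric (𝓡∂ (n + 1)) ∞ (Coord n)
      (fun p : M => TangentSpace (𝓡∂ (n + 1)) p)) (ρ : M → ℝ) (p : M) : ℝ :=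
  let H : Matrix (Fin (n + 1)) (Fin (n + 1)) ℝ :=
    Matrix.of fun i j => h.inner p (basisVec i) (basisVec j)
  let d : Fin (n + 1) → ℝ := fun i => mfderiv (𝓡∂ (n + 1)) 𝓘(ℝ, ℝ) ρ p (basisVec i)
  ∑ i, ∑ j, H⁻¹ i j * d i * d j

end Manifold

/-! ### Möbius parametrizations -/

/-- The open ball of hyperbolic radius `s` about `(0, …, 0, 1)` in the upper half space model (the
height is the coordinate of index `0`). It is the Euclidean ball with centre at height `cosh s` and
radius `sinh s`. -/
def hypBall (n : ℕ) (s : ℝ) : Set (Coord n) :=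
  Metric.ball (Real.cosh s • basisVec 0) (Real.sinh s)

/-- The closed hyperbolic ball. -/
def hypClosedBall (n : ℕ) (s : ℝ) : Set (Coord n) :=
  Metric.closedBall (Real.cosh s • basisVec 0) (Real.sinh s)

/-- The defining property of the hyperbolic ball in terms of the hyperbolic distance `d`, which is
given by `cosh d(z, w) = 1 + |z - w|² / (2 z₀ w₀)`; the centre `basisVec 0` has height `1`. -/
theorem mem_hypBall_iff (n : ℕ) {s : ℝ} (hs : 0 < s) (z : Coord n) :
    z ∈ hypBall n s ↔ 0 < z 0 ∧ 1 + ‖z - basisVec 0‖ ^ 2 / (2 * z 0) < Real.cosh s := by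
  have key : ∀ t : ℝ, ‖z - t • basisVec 0‖ ^ 2 = ‖z‖ ^ 2 - 2 * t * z 0 + t ^ 2 := by
    intro t
    rw [@norm_sub_sq ℝ]
    simp only [basisVec, norm_smul, PiLp.norm_single, inner_smul_right,
      EuclideanSpace.inner_single_right, Real.norm_eq_abs, norm_one, mul_one, sq_abs]
    simp
    ring
  have hcs := Real.cosh_sq s
  have hsh : 0 < Real.sinh s := Real.sinh_pos_iff.2 hs
  have h1 := key 1
  rw [one_smul] at h1
  have hz0 : z 0 ^ 2 ≤ ‖z‖ ^ 2 := by
    have := PiLp.norm_apply_le z 0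
    rw [Real.norm_eq_abs] at this
    calc z 0 ^ 2 = |z 0| ^ 2 := (sq_abs _).symm
      _ ≤ _ := by gcongr
  have hb : z ∈ hypBall n s ↔ ‖z‖ ^ 2 - 2 * Real.cosh s * z 0 + 1 < 0 := by
    rw [hypBall, mem_ball_iff_norm, ← sq_lt_sq₀ (norm_nonneg _) hsh.le, key]
    constructor <;> intro h <;> linarith
  rw [hb]
  have hc := Real.cosh_pos s
  constructor
  · intro h
    have hpos : 0 < z 0 := by
      by_contra hneg
      nlinarith [sq_nonneg ‖z‖]
    refine ⟨hpos, ?_⟩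
    rw [h1, ← lt_sub_iff_add_lt', div_lt_iff₀ (by linarith)]
    nlinarith
  · rintro ⟨hpos, h⟩
    rw [h1, ← lt_sub_iff_add_lt', div_lt_iff₀ (by linarith)] at h
    nlinarith

/-- The map `(x, y) ↦ (θ₀ + ρ₀ x, ρ₀ y)`, for a point `c = (θ₀, ρ₀)` of the upper half space (the
heights `y` and `ρ₀` are the coordinates of index `0`). -/
def mobius {n : ℕ} (c z : Coord n) : Coord n := (c - (c 0) • basisVec 0) + (c 0) • z

/-- Background coordinates and Möbius parametrizations adapted to a defining function `ρ`:

* finitely many background charts whose normal coordinate is `ρ`, each with a relatively compact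
  coordinate domain (contained in the compact set `core a`) on which it is used;
* a countable family of parametrizations. Each is either one of finitely many charts of the
  interior, restricted to `B₂` and smooth up to the closure of `B₂`, or a Möbius parametrization
  `(x, y) ↦ (θ₀ + ρ₀ x, ρ₀ y)` of some background chart, centred at a point `(θ₀, ρ₀)` with `ρ₀ > 0`;
* the images of `B₁` cover the interior, and the images of `B₂` are uniformly locally finite. -/
structure Background (n : ℕ) (M : Type*) [TopologicalSpace M]
    [ChartedSpace (EuclideanHalfSpace (n + 1)) M] (ρ : M → ℝ) where
  numCharts : ℕ
  chart : Fin numCharts → OpenPartialHomeomorph M (EuclideanHalfSpace (n + 1))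
  chart_mem : ∀ a, chart a ∈ IsManifold.maximalAtlas (𝓡∂ (n + 1)) ∞ M
  normal_coord : ∀ a, ∀ p ∈ (chart a).source, (chart a).extend (𝓡∂ (n + 1)) p 0 = ρ p
  core : Fin numCharts → Set M
  core_compact : ∀ a, IsCompact (core a)
  core_subset : ∀ a, core a ⊆ (chart a).source
  ι : Type
  countable_ι : Countable ι
  param : ι → Coord n → M
  inner : Set ι
  inner_finite : inner.Finite
  param_inner : ∀ i ∈ inner, ∃ e ∈ IsManifold.maximalAtlas (𝓡∂ (n + 1)) ∞ M,
    hypClosedBall n 2 ⊆ (e.extend (𝓡∂ (n + 1))).target ∧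
      Set.EqOn (param i) (e.extend (𝓡∂ (n + 1))).symm (hypClosedBall n 2)
  param_boundary : ∀ i ∉ inner, ∃ (a : Fin numCharts) (c : Coord n), 0 < c 0 ∧
    ∀ z ∈ hypBall n 2, mobius c z ∈ ((chart a).extend (𝓡∂ (n + 1))).target ∧
      param i z = ((chart a).extend (𝓡∂ (n + 1))).symm (mobius c z) ∧ param i z ∈ core a
  cover : ⋃ i, param i '' hypBall n 1 = (𝓡∂ (n + 1)).interior M
  locally_finite : ∃ N : ℕ, ∀ i,
    {j | (param i '' hypBall n 2 ∩ param j '' hypBall n 2).Nonempty}.encard ≤ N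

/-! ### Hölder spaces -/

/-- The `C^{k,α}` norm on a set `S` of the coordinate space (used for open `S`):
`∑_{j ≤ k} sup_S |D^j F| + [D^k F]_{α, S}`. For `α = 0` the last term is at most twice the sup norm
of `D^k F`, and this is the `C^k` norm up to equivalence. -/
def holderNormOn {n : ℕ} {V : Type*} [NormedAddCommGroup V] [NormedSpace ℝ V] (k : ℕ) (α : ℝ)
    (F : Coord n → V) (S : Set (Coord n)) : ℝ≥0∞ :=
  (∑ j ∈ Finset.range (k + 1), ⨆ z ∈ S, ‖iteratedFDeriv ℝ j F z‖ₑ) +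
    ⨆ z ∈ S, ⨆ w ∈ S, ‖iteratedFDeriv ℝ k F z - iteratedFDeriv ℝ k F w‖ₑ / edist z w ^ α

section Spaces

variable {n : ℕ} {M : Type*} [TopologicalSpace M] [ChartedSpace (EuclideanHalfSpace (n + 1)) M]
  {ρ : M → ℝ}

/-- The tensor field `ρ^{-δ} u`. -/
def unweight (ρ : M → ℝ) (δ : ℝ) {r : ℕ} (u : CovTensor n M r) : CovTensor n M r :=
  fun p => ρ p ^ (-δ) • u p

/-- The norm of `C^{k,α}_δ(M)`: the supremum over the parametrizations `Φ_i` of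
`‖Φ_i^*(ρ^{-δ} u)‖_{C^{k,α}(B₂)}`. -/
def holderNorm (B : Background n M ρ) (k : ℕ) (α δ : ℝ) {r : ℕ} (u : CovTensor n M r) : ℝ≥0∞ :=
  ⨆ i, holderNormOn k α (pullback (B.param i) (unweight ρ δ u)) (hypBall n 2)

/-- Membership in the weighted Hölder space `C^{k,α}_δ(M) = ρ^δ C^{k,α}(M)`. -/
def MemHolder (B : Background n M ρ) (k : ℕ) (α δ : ℝ) {r : ℕ} (u : CovTensor n M r) : Prop :=
  (∀ i, ContDiffOn ℝ k (pullback (B.param i) (unweight ρ δ u)) (hypBall n 2)) ∧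
    holderNorm B k α δ u < ⊤

/-- Membership in `𝒞^{k,α;m}(M)` of a covariant tensor field of rank (hence weight) `r`:
`𝓛_{X₁} ⋯ 𝓛_{X_j} u ∈ C^{k-j,α}_r(M)` for all `0 ≤ j ≤ m` and all vector fields `X₁, …, X_j` that
are smooth up to the boundary. -/
def MemScript [IsManifold (𝓡∂ (n + 1)) ∞ M] (B : Background n M ρ) (k : ℕ) (α : ℝ) (m : ℕ) {r : ℕ}
    (u : CovTensor n M r) : Prop :=
  ∀ L : List (∀ q : M, TangentSpace (𝓡∂ (n + 1)) q), L.length ≤ m →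
    (∀ X ∈ L, IsSmoothVectorField X) → MemHolder B (k - L.length) α r (L.foldr lieDeriv u)

/-- The norm `∑_{l ≤ m} ‖∇̄^l u‖_{C^{k-l,α}_{r+l}(M)}` of `𝒞^{k,α;m}(M)`, where `∇̄` is the
Levi-Civita connection of the background metric `h`. -/
def scriptNorm (B : Background n M ρ) (h : CovTensor n M 2) (k : ℕ) (α : ℝ) (m : ℕ) {r : ℕ}
    (u : CovTensor n M r) : ℝ≥0∞ :=
  ∑ l ∈ Finset.range (m + 1), holderNorm B (k - l) α ((r + l : ℕ) : ℝ) (nablaIter h u l)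

/-- The compactification `ḡ = ρ² g`. -/
def bar (ρ : M → ℝ) (g : CovTensor n M 2) : CovTensor n M 2 := fun p => ρ p ^ 2 • g p

/-- `g` is a Riemannian metric on the interior (its regularity is imposed separately). -/
def IsMetric (g : CovTensor n M 2) : Prop :=
  ∀ p ∈ (𝓡∂ (n + 1)).interior M, (∀ v w, g p ![v, w] = g p ![w, v]) ∧ ∀ v, v ≠ 0 → 0 < g p ![v, v]

/-- The set `𝓜_weak^{k,α;m}` of metrics `g` on the interior such that `ḡ = ρ² g ∈ 𝒞^{k,α;m}(M)`
extends to a continuous (nondegenerate) Riemannian metric on the manifold with boundary and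
`Riem[g] → -Id` as `ρ → 0`. -/
structure MemWeak [IsManifold (𝓡∂ (n + 1)) ∞ M] (B : Background n M ρ)
    (h : CovTensor n M 2) (k : ℕ) (α : ℝ) (m : ℕ) (g : CovTensor n M 2) : Prop where
  isMetric : IsMetric g
  regular : MemScript B k α m (bar ρ g)
  extends_to_boundary : ∃ G : Bundle.ContinuousRiemannianMetric (Coord n)
      (fun p : M => TangentSpace (𝓡∂ (n + 1)) p),
    ∀ p ∈ (𝓡∂ (n + 1)).interior M, ∀ v w, bar ρ g p ![v, w] = G.inner p v w
  curvature_tendsto : Filter.Tendsto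
    (fun p => opNorm h p (fun i j k l => riemOp g p i j k l + idOp i j k l))
    (Filter.comap ρ (𝓝[>] 0)) (𝓝 0)

/-- `g'` is conformal to `g` on the interior. -/
def IsConformal (g g' : CovTensor n M 2) : Prop :=
  ∃ c : M → ℝ, ∀ p ∈ (𝓡∂ (n + 1)).interior M, 0 < c p ∧ g' p = c p • g p

/-- The distance on `𝓜_weak^{k,α;m}` given by the norm of `𝒞^{k,α;m}(M)`, applied to `ρ² (g - g')`. -/
def metricDist (B : Background n M ρ) (h : CovTensor n M 2) (k : ℕ) (α : ℝ) (m : ℕ)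
    (g g' : CovTensor n M 2) : ℝ≥0∞ :=
  scriptNorm B h k α m (bar ρ g - bar ρ g')

end Spaces

end

end WeakAH

set_option maxSynthPendingDepth 3

/-! ### Uniform Hölder calculus for families of functions on the ball `B₂`. -/

namespace WeakAH

/-! ### Partial derivatives -/

section Pd

variable {n : ℕ} {f g : Coord n → ℝ} {z : Coord n}

/-! Write `ḡ = ρ² g` and look for the conformal metric in the form `e^{-2v} g` with `v = ρ w`. In
dimension `n + 1`, with all operations on the right taken with respect to `ḡ`, its scalar curvature
is `e^{2v} (ρ² (R[ḡ] + 2n Δv - n(n-1)|dv|²) + 2n ρ Δρ - 2n(n-1) ρ ⟨dv, dρ⟩ - n(n+1)|dρ|²)`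
(`scalC_conf_log`). Put `F = |dρ|² - 1` (`defect`) and `a = ⟨dF, dρ⟩` (`defectDeriv`). The trace of
the curvature condition forces `F → 0` at the boundary (`Atl.innC_sub_one_small`). Following the
gradient of `ρ` towards the boundary then gives `F = ρ a + O(ρ²)` (`Atl.exists_expansion`). Hence
the part of order `ρ` in `e^{-2v} (R + n(n+1))` is `ρ (2n Δρ - n(n+1) a - 4n² w)`, where `4n² =
2n(n-1) + 2n(n+1)` collects the cross term and the expansion of `e^{-2v}`. It vanishes for `w = σ`,
the function `confCoeff`.

The choice `w = σ` is not admissible: `σ` contains derivatives of `ḡ`, so it has one derivative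
less, and one derivative along background fields less, than `ḡ`. Therefore `w` is the average of `σ`
at the scale of the parametrizations (`Bumps.avg`). Then `w - σ = O(ρ)`, which changes the curvature
only by `O(ρ²)`; `w` has arbitrarily many rescaled derivatives, and still one background derivative
(`Bumps.uL_avg`). Multiplication by `ρ` restores the second background derivative
(`UL.mul_of_ratio`), so `v` is as regular as `ḡ` (`ULMet.confLog`). Since `v = O(ρ)`, the boundary
values of `ḡ` and the limit of the curvature operator do not change
(`Atl.tendsto_curvature_exp_smul`), and `Bumps.uA_scalarCurvature` collects the remaining terms, all
of order `ρ²`.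

All estimates are made on components in the parametrizations, where `ρ` is comparable to a scale `s
i`. The class `UA α s m k` asks for `k` derivatives and a Hölder bound, the first `m` derivatives
being divided by `s`. The definition of the spaces by Lie derivatives, their norm by covariant
derivatives, and these component bounds describe the same fields (`Atl.UT.memScript`,
`Atl.uT_of_memScript`, `Atl.UT.exists_scriptNorm_le`, `Atl.uT_of_scriptNorm_le`).

For the Lipschitz property the classes are doubled: `UL` consists of pairs of families whose
difference divided by `d` is again in the class, and every operation in the construction preserves
`UL`. As the bounds are uniform over arbitrary index sets, all pairs of metrics near `g₀` can be
treated as one family, and the resulting constant is the Lipschitz constant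
(`Bumps.exists_metricDist_le`). -/

theorem pd_congr (h : f =ᶠ[𝓝 z] g) (j : Fin (n + 1)) : pd j f z = pd j g z := by
  rw [pd, pd, h.fderiv_eq]

@[simp] theorem pd_const (c : ℝ) (j : Fin (n + 1)) : pd j (fun _ => c) z = 0 := by
  simp [pd]

theorem pd_add (hf : DifferentiableAt ℝ f z) (hg : DifferentiableAt ℝ g z) (j : Fin (n + 1)) :
    pd j (fun y => f y + g y) z = pd j f z + pd j g z := by
  simp only [pd]; rw [fderiv_fun_add hf hg]; rfl

theorem pd_const_mul (c : ℝ) (j : Fin (n + 1)) :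
    pd j (fun y => c * f y) z = c * pd j f z := by
  have : (fun y => c * f y) = c • f := rfl
  rw [pd, pd, this, fderiv_const_smul_field]; rfl

theorem pd_neg (j : Fin (n + 1)) : pd j (fun y => -f y) z = -pd j f z := by
  simp only [pd]; rw [fderiv_fun_neg]; rfl

theorem pd_mul (hf : DifferentiableAt ℝ f z) (hg : DifferentiableAt ℝ g z) (j : Fin (n + 1)) :
    pd j (fun y => f y * g y) z = pd j f z * g z + f z * pd j g z := by
  simp only [pd]; rw [fderiv_fun_mul hf hg]; simp; ring

theorem pd_inv (hf : DifferentiableAt ℝ f z) (h0 : f z ≠ 0) (j : Fin (n + 1)) :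
    pd j (fun y => (f y)⁻¹) z = -((f z)⁻¹ * (f z)⁻¹ * pd j f z) := by
  have := ((hasDerivAt_inv h0).comp_hasFDerivAt z hf.hasFDerivAt).fderiv
  simp only [pd]
  change fderiv ℝ (Inv.inv ∘ f) z _ = _
  rw [this]
  simp only [smul_apply, smul_eq_mul, sq, mul_inv]
  ring

theorem pd_exp (hf : DifferentiableAt ℝ f z) (j : Fin (n + 1)) :
    pd j (fun y => Real.exp (f y)) z = Real.exp (f z) * pd j f z := by
  simp only [pd]; rw [hf.hasFDerivAt.exp.fderiv]; simp

theorem pd_log (hf : DifferentiableAt ℝ f z) (h0 : f z ≠ 0) (j : Fin (n + 1)) :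
    pd j (fun y => Real.log (f y)) z = (f z)⁻¹ * pd j f z := by
  simp only [pd]; rw [(hf.hasFDerivAt.log h0).fderiv]; simp

theorem pd_sum {κ : Type*} (A : Finset κ) {F : κ → Coord n → ℝ}
    (hf : ∀ a ∈ A, DifferentiableAt ℝ (F a) z) (j : Fin (n + 1)) :
    pd j (fun y => ∑ a ∈ A, F a y) z = ∑ a ∈ A, pd j (F a) z := by
  simp only [pd]; rw [fderiv_fun_sum hf]; simp

theorem fderiv_apply_eq_sum_pd (v : Coord n) : fderiv ℝ f z v = ∑ j, v j * pd j f z := by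
  have hv : v = ∑ j, v j • (basisVec j : Coord n) := by
    ext l; simp [basisVec, Pi.single_apply]
  conv_lhs => rw [hv]
  simp [pd]

end Pd

/-! ### Uniform Hölder classes

For a family of functions `φ i` on the ball `B₂` and scales `s i`, the class `UA α s m k` asks for
bounds, uniform in `i`, of the `C^{k - l, α}` norms of `s⁻¹ ^ l` times the derivatives of order `l`,
for all `l ≤ m`. -/

section UA

variable {n : ℕ} {α : ℝ} {I : Type*} {s : I → ℝ}

/-- Uniformly bounded families of functions. -/
def UB (φ : I → Coord n → ℝ) : Prop := ∃ C, ∀ i, ∀ z ∈ hypBall n 2, |φ i z| ≤ C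

/-- Uniformly Hölder continuous families of functions. -/
def UHol (α : ℝ) (φ : I → Coord n → ℝ) : Prop :=
  ∃ C, ∀ i, ∀ z ∈ hypBall n 2, ∀ w ∈ hypBall n 2, |φ i z - φ i w| ≤ C * ‖z - w‖ ^ α

/-- The weight of a derivative. -/
noncomputable def wt (m : ℕ) (t : ℝ) : ℝ := if m = 0 then 1 else t⁻¹

/-- Uniform Hölder classes. -/
def UA (α : ℝ) (s : I → ℝ) : ℕ → ℕ → (I → Coord n → ℝ) → Prop
  | _, 0, φ => UB φ ∧ (∀ i, ContinuousOn (φ i) (hypBall n 2)) ∧ UHol α φ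
  | m, k + 1, φ => UB φ ∧ (∀ i, DifferentiableOn ℝ (φ i) (hypBall n 2)) ∧
      -- The subtraction truncates and the weight for `m = 0` is `1`: the first `m` derivatives are
      -- divided by `s i`, all later ones are left alone.
      ∀ j, UA α s (m - 1) k (fun i z => wt m (s i) * pd j (φ i) z)

/-- Admissible exponents and scales. -/
structure IsScale (α : ℝ) (s : I → ℝ) : Prop where
  nonneg : 0 ≤ α
  le_one : α ≤ 1
  pos : ∀ i, 0 < s i
  bdd : ∃ S, ∀ i, s i ≤ S

theorem isOpen_hypBall (n : ℕ) (t : ℝ) : IsOpen (hypBall n t) := Metric.isOpen_ball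

theorem convex_hypBall (n : ℕ) (t : ℝ) : Convex ℝ (hypBall n t) := convex_ball _ _

theorem hypBall_mem_nhds {z : Coord n} {t : ℝ} (hz : z ∈ hypBall n t) : hypBall n t ∈ 𝓝 z :=
  (isOpen_hypBall n t).mem_nhds hz

theorem norm_sub_le_of_mem_hypBall {z w : Coord n} (hz : z ∈ hypBall n 2) (hw : w ∈ hypBall n 2) :
    ‖z - w‖ ≤ 2 * Real.sinh 2 := by
  rw [hypBall, mem_ball_iff_norm] at hz hw
  calc ‖z - w‖ = ‖(z - Real.cosh 2 • basisVec 0) - (w - Real.cosh 2 • basisVec 0)‖ := by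
        congr 1; abel
    _ ≤ _ := norm_sub_le _ _
    _ ≤ _ := by linarith

theorem UB.congr {φ ψ : I → Coord n → ℝ} (h : ∀ i, ∀ z ∈ hypBall n 2, φ i z = ψ i z)
    (hφ : UB φ) : UB ψ := by
  obtain ⟨C, hC⟩ := hφ
  exact ⟨C, fun i z hz => h i z hz ▸ hC i z hz⟩

theorem UB.nonneg_bound {φ : I → Coord n → ℝ} (hφ : UB φ) :
    ∃ C, 0 ≤ C ∧ ∀ i, ∀ z ∈ hypBall n 2, |φ i z| ≤ C := by
  obtain ⟨C, hC⟩ := hφ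
  exact ⟨max C 0, le_max_right _ _, fun i z hz => (hC i z hz).trans (le_max_left _ _)⟩

theorem UB.add {φ ψ : I → Coord n → ℝ} (hφ : UB φ) (hψ : UB ψ) :
    UB (fun i z => φ i z + ψ i z) := by
  obtain ⟨C, hC⟩ := hφ
  obtain ⟨D, hD⟩ := hψ
  exact ⟨C + D, fun i z hz => (abs_add_le _ _).trans (add_le_add (hC i z hz) (hD i z hz))⟩

theorem UB.mul {φ ψ : I → Coord n → ℝ} (hφ : UB φ) (hψ : UB ψ) :
    UB (fun i z => φ i z * ψ i z) := by
  obtain ⟨C, hC0, hC⟩ := hφ.nonneg_bound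
  obtain ⟨D, hD0, hD⟩ := hψ.nonneg_bound
  exact ⟨C * D, fun i z hz => by
    rw [abs_mul]; exact mul_le_mul (hC i z hz) (hD i z hz) (abs_nonneg _) hC0⟩

theorem UHol.nonneg_bound {φ : I → Coord n → ℝ} (hφ : UHol α φ) :
    ∃ C, 0 ≤ C ∧ ∀ i, ∀ z ∈ hypBall n 2, ∀ w ∈ hypBall n 2,
      |φ i z - φ i w| ≤ C * ‖z - w‖ ^ α := by
  obtain ⟨C, hC⟩ := hφ
  exact ⟨max C 0, le_max_right _ _, fun i z hz w hw => (hC i z hz w hw).trans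
    (mul_le_mul_of_nonneg_right (le_max_left _ _) (Real.rpow_nonneg (norm_nonneg _) _))⟩

theorem pd_eqOn {f g : Coord n → ℝ} (h : ∀ z ∈ hypBall n 2, f z = g z) {z : Coord n}
    (hz : z ∈ hypBall n 2) (j : Fin (n + 1)) : pd j f z = pd j g z :=
  pd_congr (Filter.eventually_of_mem (hypBall_mem_nhds hz) h) j

theorem UA.ub {m k : ℕ} {φ : I → Coord n → ℝ} (h : UA α s m k φ) : UB φ := by
  cases k <;> exact h.1

theorem UA.congr {m k : ℕ} {φ ψ : I → Coord n → ℝ} (h : ∀ i, ∀ z ∈ hypBall n 2, φ i z = ψ i z)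
    (hφ : UA α s m k φ) : UA α s m k ψ := by
  induction k generalizing m φ ψ with
  | zero =>
    obtain ⟨h1, h2, C, h3⟩ := hφ
    exact ⟨h1.congr h, fun i => (h2 i).congr fun z hz => (h i z hz).symm, C, fun i z hz w hw => by
      rw [← h i z hz, ← h i w hw]; exact h3 i z hz w hw⟩
  | succ k ih =>
    obtain ⟨h1, h2, h3⟩ := hφ
    exact ⟨h1.congr h, fun i => (h2 i).congr fun z hz => (h i z hz).symm, fun j =>
      ih (fun i z hz => by rw [pd_eqOn (h i) hz]) (h3 j)⟩

theorem UA.continuousOn {m k : ℕ} {φ : I → Coord n → ℝ} (h : UA α s m k φ) (i : I) :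
    ContinuousOn (φ i) (hypBall n 2) := by
  cases k with
  | zero => exact h.2.1 i
  | succ k => exact (h.2.1 i).continuousOn

theorem UA.differentiableAt {m k : ℕ} {φ : I → Coord n → ℝ} (h : UA α s m (k + 1) φ) (i : I)
    {z : Coord n} (hz : z ∈ hypBall n 2) : DifferentiableAt ℝ (φ i) z :=
  (h.2.1 i z hz).differentiableAt (hypBall_mem_nhds hz)

theorem UA.const_mul {m k : ℕ} {φ : I → Coord n → ℝ} (hφ : UA α s m k φ) {c : I → ℝ}
    (hc : ∃ C, ∀ i, |c i| ≤ C) : UA α s m k (fun i z => c i * φ i z) := by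
  obtain ⟨C, hC⟩ := hc
  have hub : UB (n := n) (fun i _ => c i) := ⟨C, fun i _ _ => hC i⟩
  induction k generalizing m φ with
  | zero =>
    obtain ⟨h1, h2, h3⟩ := hφ
    obtain ⟨D, hD0, hD⟩ := h3.nonneg_bound
    refine ⟨hub.mul h1, fun i => continuousOn_const.mul (h2 i), C * D, fun i z hz w hw => ?_⟩
    rw [← mul_sub, abs_mul, mul_assoc]
    exact mul_le_mul (hC i) (hD i z hz w hw) (abs_nonneg _) ((abs_nonneg _).trans (hC i))
  | succ k ih =>
    obtain ⟨h1, h2, h3⟩ := hφ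
    refine ⟨hub.mul h1, fun i => (h2 i).const_mul _, fun j => ?_⟩
    refine UA.congr (fun i z hz => ?_) (ih (h3 j))
    rw [pd_const_mul]; ring

theorem UA.const {m k : ℕ} {c : I → ℝ} (hc : ∃ C, ∀ i, |c i| ≤ C) :
    UA (n := n) α s m k (fun i _ => c i) := by
  induction k generalizing m c with
  | zero =>
    exact ⟨hc.imp fun C h i _ _ => h i, fun i => continuousOn_const, 0, fun i z _ w _ => by simp⟩
  | succ k ih =>
    refine ⟨hc.imp fun C h i _ _ => h i, fun i => differentiableOn_const _, fun j => ?_⟩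
    exact UA.congr (fun i z _ => by simp) (ih (m := m - 1) (c := fun _ => 0) ⟨0, by simp⟩)

theorem UA.const' {m k : ℕ} (c : ℝ) : UA (n := n) α s m k (fun _ _ => c) :=
  UA.const ⟨|c|, fun _ => le_rfl⟩

theorem UA.add {m k : ℕ} {φ ψ : I → Coord n → ℝ} (hφ : UA α s m k φ) (hψ : UA α s m k ψ) :
    UA α s m k (fun i z => φ i z + ψ i z) := by
  induction k generalizing m φ ψ with
  | zero =>
    obtain ⟨h1, h2, C, h3⟩ := hφ
    obtain ⟨h1', h2', C', h3'⟩ := hψ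
    refine ⟨h1.add h1', fun i => (h2 i).add (h2' i), C + C', fun i z hz w hw => ?_⟩
    rw [add_sub_add_comm, add_mul]
    exact (abs_add_le _ _).trans (add_le_add (h3 i z hz w hw) (h3' i z hz w hw))
  | succ k ih =>
    obtain ⟨h1, h2, h3⟩ := id hφ
    obtain ⟨h1', h2', h3'⟩ := id hψ
    refine ⟨h1.add h1', fun i => (h2 i).add (h2' i), fun j => ?_⟩
    refine UA.congr (fun i z hz => ?_) (ih (h3 j) (h3' j))
    rw [pd_add (hφ.differentiableAt i hz) (hψ.differentiableAt i hz)]; ring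

theorem UA.neg {m k : ℕ} {φ : I → Coord n → ℝ} (hφ : UA α s m k φ) :
    UA α s m k (fun i z => -φ i z) :=
  (hφ.const_mul (c := fun _ => -1) ⟨1, by simp⟩).congr fun _ _ _ => by ring

theorem UA.sub {m k : ℕ} {φ ψ : I → Coord n → ℝ} (hφ : UA α s m k φ) (hψ : UA α s m k ψ) :
    UA α s m k (fun i z => φ i z - ψ i z) :=
  (hφ.add hψ.neg).congr fun _ _ _ => by ring

theorem UA.finset_sum {m k : ℕ} {κ : Type*} (A : Finset κ) {F : κ → I → Coord n → ℝ}
    (h : ∀ a ∈ A, UA α s m k (F a)) : UA α s m k (fun i z => ∑ a ∈ A, F a i z) := by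
  classical
  induction A using Finset.induction_on with
  | empty => simpa using UA.const' 0
  | insert a A ha ih =>
    refine UA.congr (fun i z _ => (Finset.sum_insert ha).symm)
      ((h a (Finset.mem_insert_self _ _)).add (ih fun b hb => h b (Finset.mem_insert_of_mem hb)))

theorem UA.sum {m k : ℕ} {κ : Type*} [Fintype κ] {F : κ → I → Coord n → ℝ}
    (h : ∀ a, UA α s m k (F a)) : UA α s m k (fun i z => ∑ a, F a i z) :=
  UA.finset_sum _ fun a _ => h a

theorem UA.reindex {I' : Type*} (f : I' → I) {m k : ℕ} {φ : I → Coord n → ℝ}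
    (hφ : UA α s m k φ) : UA α (fun i => s (f i)) m k (fun i => φ (f i)) := by
  induction k generalizing m φ with
  | zero =>
    obtain ⟨⟨C, h1⟩, h2, C', h3⟩ := hφ
    exact ⟨⟨C, fun i => h1 _⟩, fun i => h2 _, C', fun i => h3 _⟩
  | succ k ih =>
    obtain ⟨⟨C, h1⟩, h2, h3⟩ := hφ
    exact ⟨⟨C, fun i => h1 _⟩, fun i => h2 _, fun j => ih (h3 j)⟩

/-- The set of summation may change with `i`, as long as its cardinality stays bounded. In this form
the uniform local finiteness of the parametrizations enters. -/
theorem UA.sum_fiber {κ : Type*} {A : I → Finset κ} {N : ℕ} (hN : ∀ i, (A i).card ≤ N) {m k : ℕ}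
    {F : I × κ → Coord n → ℝ} (hF : UA α (fun x : I × κ => s x.1) m k F) :
    UA α s m k (fun i z => ∑ a ∈ A i, F (i, a) z) := by
  induction k generalizing m F with
  | zero =>
    obtain ⟨h1, h2, h3⟩ := hF
    obtain ⟨C, hC0, hC⟩ := h1.nonneg_bound
    obtain ⟨D, hD0, hD⟩ := h3.nonneg_bound
    refine ⟨⟨N * C, fun i z hz => ?_⟩, fun i => continuousOn_finsetSum _ fun a _ => h2 _, N * D,
      fun i z hz w hw => ?_⟩
    · refine (Finset.abs_sum_le_sum_abs _ _).trans
        ((Finset.sum_le_card_nsmul _ _ C fun a _ => hC _ z hz).trans ?_)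
      rw [nsmul_eq_mul]
      exact mul_le_mul_of_nonneg_right (by exact_mod_cast hN i) hC0
    · rw [← Finset.sum_sub_distrib]
      refine (Finset.abs_sum_le_sum_abs _ _).trans
        ((Finset.sum_le_card_nsmul _ _ _ fun a _ => hD _ z hz w hw).trans ?_)
      rw [nsmul_eq_mul, mul_assoc]
      exact mul_le_mul_of_nonneg_right (by exact_mod_cast hN i)
        (mul_nonneg hD0 (Real.rpow_nonneg (norm_nonneg _) _))
  | succ k ih =>
    obtain ⟨h1, h2, h3⟩ := id hF
    obtain ⟨C, hC0, hC⟩ := h1.nonneg_bound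
    refine ⟨⟨N * C, fun i z hz => ?_⟩,
      fun i => DifferentiableOn.fun_sum fun a _ => h2 _, fun j => ?_⟩
    · refine (Finset.abs_sum_le_sum_abs _ _).trans
        ((Finset.sum_le_card_nsmul _ _ C fun a _ => hC _ z hz).trans ?_)
      rw [nsmul_eq_mul]
      exact mul_le_mul_of_nonneg_right (by exact_mod_cast hN i) hC0
    · refine UA.congr (fun i z hz => ?_) (ih (h3 j))
      rw [pd_sum _ fun a _ => hF.differentiableAt _ hz, Finset.mul_sum]

theorem wt_pos {t : ℝ} (ht : 0 < t) (m : ℕ) : 0 < wt m t := by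
  unfold wt; split_ifs <;> positivity

theorem IsScale.exists_inv_wt_le (hs : IsScale α s) (m : ℕ) : ∃ C, 0 ≤ C ∧ ∀ i, (wt m (s i))⁻¹ ≤ C := by
  obtain ⟨S, hS⟩ := hs.bdd
  refine ⟨max 1 S, zero_le_one.trans (le_max_left _ _), fun i => ?_⟩
  unfold wt
  split_ifs
  · simp
  · simpa using Or.inr (hS i)

theorem IsScale.wt_div_bdd (hs : IsScale α s) {m m' : ℕ} (h : m' ≤ m) :
    ∃ C, ∀ i, |wt m' (s i) * (wt m (s i))⁻¹| ≤ C := by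
  obtain ⟨C, hC0, hC⟩ := hs.exists_inv_wt_le m
  refine ⟨max 1 C, fun i => ?_⟩
  have h1 := wt_pos (hs.pos i) m
  rw [abs_of_pos (mul_pos (wt_pos (hs.pos i) m') (inv_pos.2 h1))]
  by_cases hm' : m' = 0
  · simpa [wt, hm'] using Or.inr (hC i)
  · have hm : m ≠ 0 := by omega
    have := (hs.pos i).ne'
    simp [wt, hm', hm, this]

theorem norm_fderiv_le_of_pd {f : Coord n → ℝ} {z : Coord n} {C : ℝ}
    (h : ∀ j, |pd j f z| ≤ C) : ‖fderiv ℝ f z‖ ≤ (n + 1) * C := by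
  have hC : 0 ≤ C := (abs_nonneg _).trans (h 0)
  refine ContinuousLinearMap.opNorm_le_bound _ (by positivity) fun v => ?_
  rw [fderiv_apply_eq_sum_pd, Real.norm_eq_abs]
  calc |∑ j, v j * pd j f z| ≤ ∑ j : Fin (n + 1), |v j * pd j f z| := Finset.abs_sum_le_sum_abs _ _
    _ ≤ ∑ j : Fin (n + 1), ‖v‖ * C := by
        refine Finset.sum_le_sum fun j _ => ?_
        rw [abs_mul]
        exact mul_le_mul (PiLp.norm_apply_le v j) (h j) (abs_nonneg _) (norm_nonneg _)
    _ = _ := by simp; ring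

theorem abs_sub_le_of_pd {f : Coord n → ℝ} {C : ℝ} {S : Set (Coord n)} (hS : Convex ℝ S)
    (hf : ∀ z ∈ S, DifferentiableAt ℝ f z)
    (h : ∀ z ∈ S, ∀ j, |pd j f z| ≤ C) {z w : Coord n} (hz : z ∈ S) (hw : w ∈ S) :
    |f z - f w| ≤ (n + 1) * C * ‖z - w‖ :=
  hS.norm_image_sub_le_of_norm_fderiv_le hf
    (fun x hx => norm_fderiv_le_of_pd (h x hx)) hw hz

/-- The ball has finite diameter, so Lipschitz bounds imply Hölder bounds; `α ≤ 1` makes the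
remaining exponent `1 - α` nonnegative. -/
theorem norm_le_mul_rpow (h1 : α ≤ 1) :
    ∃ K, 0 ≤ K ∧ ∀ z ∈ hypBall n 2, ∀ w ∈ hypBall n 2, ‖z - w‖ ≤ K * ‖z - w‖ ^ α := by
  refine ⟨(2 * Real.sinh 2) ^ (1 - α), by
    have : 0 ≤ Real.sinh 2 := Real.sinh_nonneg_iff.2 (by norm_num)
    positivity, fun z hz w hw => ?_⟩
  rcases (norm_nonneg (z - w)).eq_or_lt with h | h
  · rw [← h]; exact mul_nonneg (Real.rpow_nonneg (by
      have : 0 ≤ Real.sinh 2 := Real.sinh_nonneg_iff.2 (by norm_num)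
      positivity) _) (Real.rpow_nonneg le_rfl _)
  · calc ‖z - w‖ = ‖z - w‖ ^ (1 - α) * ‖z - w‖ ^ α := by
          rw [← Real.rpow_add h]; simp
      _ ≤ _ := by
          gcongr
          · exact norm_sub_le_of_mem_hypBall hz hw

theorem UHol.of_pd (h0 : 0 ≤ α) (h1 : α ≤ 1) {φ : I → Coord n → ℝ}
    (hd : ∀ i, DifferentiableOn ℝ (φ i) (hypBall n 2))
    (h : ∃ C, ∀ i, ∀ z ∈ hypBall n 2, ∀ j, |pd j (φ i) z| ≤ C) : UHol α φ := by
  obtain ⟨C, hC⟩ := h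
  obtain ⟨K, hK0, hK⟩ := norm_le_mul_rpow (n := n) h1
  refine ⟨(n + 1) * C * K, fun i z hz w hw => ?_⟩
  have hC0 : 0 ≤ C := (abs_nonneg _).trans (hC i z hz 0)
  refine (abs_sub_le_of_pd (convex_hypBall n 2)
    (fun z hz => (hd i z hz).differentiableAt (hypBall_mem_nhds hz)) (hC i) hz hw).trans ?_
  rw [mul_assoc _ K]
  exact mul_le_mul_of_nonneg_left (hK z hz w hw) (by positivity)

theorem UA.exists_pd_bound (hs : IsScale α s) {m k : ℕ} {φ : I → Coord n → ℝ}
    (h : UA α s m (k + 1) φ) : ∃ C, ∀ i, ∀ z ∈ hypBall n 2, ∀ j,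
      |pd j (φ i) z| ≤ C * (wt m (s i))⁻¹ := by
  choose C hC using fun j => (h.2.2 j).ub
  refine ⟨∑ j, |C j|, fun i z hz j => ?_⟩
  have hw := wt_pos (hs.pos i) m
  have := hC j i z hz
  rw [abs_mul, abs_of_pos hw] at this
  rw [← div_eq_mul_inv, le_div_iff₀ hw, mul_comm]
  exact this.trans ((le_abs_self _).trans
    (Finset.single_le_sum (f := fun j => |C j|) (fun _ _ => abs_nonneg _) (Finset.mem_univ j)))

/-- Bounded first derivatives give the Hölder bound. At order zero there is no derivative left to be
weighted, so `m'` is arbitrary. -/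
theorem UA.zero_of_succ (hs : IsScale α s) {m m' k : ℕ} {φ : I → Coord n → ℝ}
    (h : UA α s m (k + 1) φ) : UA α s m' 0 φ := by
  obtain ⟨C, hC⟩ := h.exists_pd_bound hs
  obtain ⟨K, hK0, hK⟩ := hs.exists_inv_wt_le m
  refine ⟨h.ub, fun i => h.continuousOn i, UHol.of_pd hs.nonneg hs.le_one h.2.1
    ⟨|C| * K, fun i z hz j => (hC i z hz j).trans ?_⟩⟩
  have := wt_pos (hs.pos i) m
  calc C * (wt m (s i))⁻¹ ≤ |C| * (wt m (s i))⁻¹ := by gcongr; exact le_abs_self _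
    _ ≤ _ := by gcongr; exact hK i

/-- In the Leibniz and chain rules a differentiated factor lies in the class `(m - 1, k)`, and the
undifferentiated one has to be put into the same class. Giving up one derivative costs at most one
weighted derivative. -/
theorem UA.pred (hs : IsScale α s) {m k : ℕ} {φ : I → Coord n → ℝ}
    (h : UA α s m (k + 1) φ) : UA α s (m - 1) k φ := by
  induction k generalizing m φ with
  | zero => exact h.zero_of_succ hs
  | succ k ih =>
    refine ⟨h.ub, h.2.1, fun j => ?_⟩
    refine UA.congr (fun i z hz => ?_)
      ((ih (h.2.2 j)).const_mul (hs.wt_div_bdd (Nat.sub_le m 1)))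
    have := (wt_pos (hs.pos i) m).ne'
    field_simp

/-- The scales are bounded above, so a smaller weight is at most a constant times a larger one. -/
theorem UA.mono_left (hs : IsScale α s) {m m' k : ℕ} (hm : m' ≤ m) {φ : I → Coord n → ℝ}
    (h : UA α s m k φ) : UA α s m' k φ := by
  induction k generalizing m m' φ with
  | zero => exact h
  | succ k ih =>
    refine ⟨h.ub, h.2.1, fun j => ?_⟩
    refine UA.congr (fun i z hz => ?_)
      ((ih (m' := m' - 1) (by omega) (h.2.2 j)).const_mul (hs.wt_div_bdd hm))
    have := (wt_pos (hs.pos i) m).ne'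
    field_simp

theorem UA.of_succ (hs : IsScale α s) {m k : ℕ} {φ : I → Coord n → ℝ}
    (h : UA α s m (k + 1) φ) : UA α s m k φ := by
  induction k generalizing m φ with
  | zero => exact h.zero_of_succ hs
  | succ k ih => exact ⟨h.ub, h.2.1, fun j => ih (h.2.2 j)⟩

theorem UA.mono (hs : IsScale α s) {m m' k k' : ℕ} (hm : m' ≤ m) (hk : k' ≤ k)
    {φ : I → Coord n → ℝ} (h : UA α s m k φ) : UA α s m' k' φ := by
  induction k, hk using Nat.le_induction with
  | base => exact h.mono_left hs hm
  | succ k _ ih => exact ih (h.of_succ hs)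

theorem UA.mul (hs : IsScale α s) {m k : ℕ} {φ ψ : I → Coord n → ℝ} (hφ : UA α s m k φ)
    (hψ : UA α s m k ψ) : UA α s m k (fun i z => φ i z * ψ i z) := by
  induction k generalizing m φ ψ with
  | zero =>
    obtain ⟨h1, h2, h3⟩ := hφ
    obtain ⟨h1', h2', h3'⟩ := hψ
    obtain ⟨C, hC0, hC⟩ := h1.nonneg_bound
    obtain ⟨C', hC0', hC'⟩ := h1'.nonneg_bound
    obtain ⟨D, hD0, hD⟩ := h3.nonneg_bound
    obtain ⟨D', hD0', hD'⟩ := h3'.nonneg_bound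
    refine ⟨h1.mul h1', fun i => (h2 i).mul (h2' i), D * C' + C * D', fun i z hz w hw => ?_⟩
    have e : φ i z * ψ i z - φ i w * ψ i w =
      (φ i z - φ i w) * ψ i z + φ i w * (ψ i z - ψ i w) := by ring
    rw [e]
    refine (abs_add_le _ _).trans ?_
    rw [abs_mul, abs_mul]
    have e1 := mul_le_mul (hD i z hz w hw) (hC' i z hz) (abs_nonneg _)
      (mul_nonneg hD0 (Real.rpow_nonneg (norm_nonneg _) _))
    have e2 := mul_le_mul (hC i w hw) (hD' i z hz w hw) (abs_nonneg _) hC0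
    linarith
  | succ k ih =>
    refine ⟨hφ.ub.mul hψ.ub, fun i => (hφ.2.1 i).mul (hψ.2.1 i), fun j => ?_⟩
    refine UA.congr (fun i z hz => ?_)
      ((ih (hφ.2.2 j) (hψ.pred hs)).add (ih (hφ.pred hs) (hψ.2.2 j)))
    rw [pd_mul (hφ.differentiableAt i hz) (hψ.differentiableAt i hz)]; ring

theorem UA.pow (hs : IsScale α s) {m k : ℕ} {φ : I → Coord n → ℝ} (hφ : UA α s m k φ) (d : ℕ) :
    UA α s m k (fun i z => φ i z ^ d) := by
  induction d with
  | zero => simpa using UA.const' 1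
  | succ d ih => exact UA.congr (fun i z _ => (pow_succ _ _).symm) (ih.mul hs hφ)

theorem UA.inv (hs : IsScale α s) {m k : ℕ} {φ : I → Coord n → ℝ} (hφ : UA α s m k φ) {c : ℝ}
    (hc : 0 < c) (hcφ : ∀ i, ∀ z ∈ hypBall n 2, c ≤ φ i z) :
    UA α s m k (fun i z => (φ i z)⁻¹) := by
  have hp : ∀ i, ∀ z ∈ hypBall n 2, 0 < φ i z := fun i z hz => hc.trans_le (hcφ i z hz)
  have hub : ∀ i, ∀ z ∈ hypBall n 2, |(φ i z)⁻¹| ≤ c⁻¹ := fun i z hz => by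
    rw [abs_of_pos (inv_pos.2 (hp i z hz))]
    exact inv_anti₀ hc (hcφ i z hz)
  induction k generalizing m with
  | zero =>
    obtain ⟨h1, h2, h3⟩ := hφ
    obtain ⟨D, hD0, hD⟩ := h3.nonneg_bound
    refine ⟨⟨c⁻¹, hub⟩, fun i => (h2 i).inv₀ fun z hz => (hp i z hz).ne', c⁻¹ * c⁻¹ * D,
      fun i z hz w hw => ?_⟩
    have e : (φ i z)⁻¹ - (φ i w)⁻¹ = -((φ i z)⁻¹ * (φ i w)⁻¹ * (φ i z - φ i w)) := by
      have := (hp i z hz).ne'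
      have := (hp i w hw).ne'
      field_simp
      ring
    rw [e, abs_neg, abs_mul, abs_mul, mul_assoc _ D]
    exact mul_le_mul (mul_le_mul (hub i z hz) (hub i w hw) (abs_nonneg _) (by positivity))
      (hD i z hz w hw) (abs_nonneg _) (by positivity)
  | succ k ih =>
    refine ⟨⟨c⁻¹, hub⟩, fun i => (hφ.2.1 i).fun_inv fun z hz => (hp i z hz).ne', fun j => ?_⟩
    have hi := ih (hφ.pred hs)
    refine UA.congr (fun i z hz => ?_) (((hi.mul hs hi).mul hs (hφ.2.2 j)).neg)
    rw [pd_inv (hφ.differentiableAt i hz) (hp i z hz).ne']; ring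

theorem UA.exp (hs : IsScale α s) {m k : ℕ} {φ : I → Coord n → ℝ} (hφ : UA α s m k φ) :
    UA α s m k (fun i z => Real.exp (φ i z)) := by
  obtain ⟨C, hC0, hC⟩ := hφ.ub.nonneg_bound
  have hub : ∀ i, ∀ z ∈ hypBall n 2, |Real.exp (φ i z)| ≤ Real.exp C := fun i z hz => by
    rw [abs_of_pos (Real.exp_pos _)]
    exact Real.exp_le_exp.2 ((le_abs_self _).trans (hC i z hz))
  induction k generalizing m with
  | zero =>
    obtain ⟨h1, h2, h3⟩ := hφ
    obtain ⟨D, hD0, hD⟩ := h3.nonneg_bound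
    refine ⟨⟨_, hub⟩, fun i => (h2 i).rexp, Real.exp C * D, fun i z hz w hw => ?_⟩
    have key : |Real.exp (φ i z) - Real.exp (φ i w)| ≤ Real.exp C * |φ i z - φ i w| := by
      have := (convex_Icc (-C) C).norm_image_sub_le_of_norm_deriv_le (f := Real.exp)
        (C := Real.exp C) (fun x _ => Real.differentiableAt_exp) (fun x hx => by
          rw [Real.deriv_exp, Real.norm_eq_abs, abs_of_pos (Real.exp_pos _)]
          exact Real.exp_le_exp.2 hx.2) (abs_le.1 (hC i w hw)) (abs_le.1 (hC i z hz))
      exact this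
    refine key.trans ?_
    rw [mul_assoc]
    exact mul_le_mul_of_nonneg_left (hD i z hz w hw) (Real.exp_pos _).le
  | succ k ih =>
    refine ⟨⟨_, hub⟩, fun i => (hφ.2.1 i).exp, fun j => ?_⟩
    refine UA.congr (fun i z hz => ?_) ((ih (hφ.pred hs)).mul hs (hφ.2.2 j))
    rw [pd_exp (hφ.differentiableAt i hz)]; ring

theorem UA.inv_scale_mul_pd {m k : ℕ} {φ : I → Coord n → ℝ} (hφ : UA α s (m + 1) (k + 1) φ)
    (j : Fin (n + 1)) : UA α s m k (fun i z => (s i)⁻¹ * pd j (φ i) z) := by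
  simpa [wt] using hφ.2.2 j

theorem UA.of_pd_succ {m k : ℕ} {φ : I → Coord n → ℝ} (hub : UB φ)
    (hd : ∀ i, DifferentiableOn ℝ (φ i) (hypBall n 2))
    (h : ∀ j, UA α s m k (fun i z => (s i)⁻¹ * pd j (φ i) z)) : UA α s (m + 1) (k + 1) φ :=
  ⟨hub, hd, fun j => by simpa [wt] using h j⟩

theorem UA.pd_zero {k : ℕ} {φ : I → Coord n → ℝ} (hφ : UA α s 0 (k + 1) φ)
    (j : Fin (n + 1)) : UA α s 0 k (fun i z => pd j (φ i) z) := by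
  simpa [wt] using hφ.2.2 j

theorem UA.of_pd_zero {k : ℕ} {φ : I → Coord n → ℝ} (hub : UB φ)
    (hd : ∀ i, DifferentiableOn ℝ (φ i) (hypBall n 2))
    (h : ∀ j, UA α s 0 k (fun i z => pd j (φ i) z)) : UA α s 0 (k + 1) φ :=
  ⟨hub, hd, fun j => by simpa [wt] using h j⟩

theorem IsScale.abs_bdd (hs : IsScale α s) : ∃ C, ∀ i, |s i| ≤ C :=
  hs.bdd.imp fun _ h i => by rw [abs_of_pos (hs.pos i)]; exact h i

theorem UA.pd (hs : IsScale α s) {m k : ℕ} {φ : I → Coord n → ℝ} (hφ : UA α s m (k + 1) φ)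
    (j : Fin (n + 1)) : UA α s (m - 1) k (fun i z => pd j (φ i) z) := by
  obtain ⟨C, hC0, hC⟩ := hs.exists_inv_wt_le m
  refine UA.congr (fun i z hz => ?_) ((hφ.2.2 j).const_mul (c := fun i => (wt m (s i))⁻¹)
    ⟨C, fun i => by rw [abs_of_pos (inv_pos.2 (wt_pos (hs.pos i) m))]; exact hC i⟩)
  have := (wt_pos (hs.pos i) m).ne'
  field_simp

/-- The factor `s i` pays for one further weight `(s i)⁻¹`; the total number of derivatives stays
the same. -/
theorem UA.scale_mul (hs : IsScale α s) {m k : ℕ} {φ : I → Coord n → ℝ} (hφ : UA α s m k φ) :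
    UA α s (m + 1) k (fun i z => s i * φ i z) := by
  induction k generalizing m φ with
  | zero => exact hφ.const_mul hs.abs_bdd
  | succ k ih =>
    refine UA.of_pd_succ (hφ.const_mul hs.abs_bdd).ub (fun i => (hφ.2.1 i).const_mul _)
      fun j => ?_
    cases m with
    | zero =>
      refine UA.congr (fun i z hz => ?_) (hφ.pd_zero j)
      have := (hs.pos i).ne'
      rw [pd_const_mul]; field_simp
    | succ m =>
      refine UA.congr (fun i z hz => ?_) (ih (hφ.inv_scale_mul_pd j))
      have := (hs.pos i).ne'
      rw [pd_const_mul]; field_simp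

/-- A family in `UA (m + 1) (k + 1)` that is `O(s)` is `s` times a bounded family of `C^{k + 1, α}`
functions. -/
theorem UA.inv_scale_mul (hs : IsScale α s) {m k : ℕ} {φ : I → Coord n → ℝ}
    (hφ : UA α s (m + 1) (k + 1) φ) (h : UB fun i z => (s i)⁻¹ * φ i z) :
    UA α s 0 (k + 1) (fun i z => (s i)⁻¹ * φ i z) := by
  refine UA.of_pd_zero h (fun i => (hφ.2.1 i).const_mul _) fun j => ?_
  refine UA.congr (fun i z hz => ?_) ((hφ.inv_scale_mul_pd j).mono_left hs (Nat.zero_le m))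
  rw [pd_const_mul]

/-- One weighted derivative means a gradient of size `O(s)`, and the ball is convex and bounded. -/
theorem UA.osc (hs : IsScale α s) {m k : ℕ} {φ : I → Coord n → ℝ}
    (hφ : UA α s (m + 1) (k + 1) φ) :
    ∃ C, 0 ≤ C ∧ ∀ i, ∀ z ∈ hypBall n 2, ∀ w ∈ hypBall n 2, |φ i z - φ i w| ≤ C * s i := by
  obtain ⟨C, hC⟩ := hφ.exists_pd_bound hs
  have h2 : 0 ≤ Real.sinh 2 := Real.sinh_nonneg_iff.2 (by norm_num)
  refine ⟨(n + 1) * |C| * (2 * Real.sinh 2), by positivity, fun i z hz w hw => ?_⟩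
  have hi := (hs.pos i).le
  have := abs_sub_le_of_pd (convex_hypBall n 2) (fun z hz => hφ.differentiableAt i hz)
    (C := |C| * s i) (fun z hz j => (hC i z hz j).trans (by
      simp only [wt, Nat.add_eq_zero_iff, one_ne_zero, and_false, if_false, inv_inv]
      gcongr
      exact le_abs_self _)) hz hw
  refine this.trans ?_
  calc (n + 1) * (|C| * s i) * ‖z - w‖ ≤ (n + 1) * (|C| * s i) * (2 * Real.sinh 2) := by
        gcongr; exact norm_sub_le_of_mem_hypBall hz hw
    _ = _ := by ring

theorem UA.contDiffOn {m k : ℕ} (hs : IsScale α s) {φ : I → Coord n → ℝ} (hφ : UA α s m k φ)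
    (i : I) : ContDiffOn ℝ k (φ i) (hypBall n 2) := by
  induction k generalizing m φ with
  | zero => exact contDiffOn_zero.2 (hφ.continuousOn i)
  | succ k ih =>
    rw [Nat.cast_add, Nat.cast_one, contDiffOn_succ_iff_fderiv_of_isOpen (isOpen_hypBall n 2)]
    refine ⟨hφ.2.1 i, by simp, ?_⟩
    have : ∀ z, fderiv ℝ (φ i) z = ∑ j, WeakAH.pd j (φ i) z • (EuclideanSpace.proj j : Coord n →L[ℝ] ℝ) := by
      intro z; ext v
      rw [fderiv_apply_eq_sum_pd]
      simp [mul_comm]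
    rw [show fderiv ℝ (φ i) = fun z => ∑ j, WeakAH.pd j (φ i) z •
      (EuclideanSpace.proj j : Coord n →L[ℝ] ℝ) from funext this]
    exact ContDiffOn.sum fun j _ => (ih (hφ.pd hs j)).smul contDiffOn_const

end UA

end WeakAH

namespace WeakAH

/-! ### Comparison with the Hölder norms -/

section Transfer

variable {n : ℕ} {α : ℝ} {I : Type*} {s : I → ℝ}

/-- Families of vector-valued functions that are uniformly bounded in `C^{k,α}(B₂)`. -/
def UnifHolder {V : Type*} [NormedAddCommGroup V] [NormedSpace ℝ V] (k : ℕ) (α : ℝ)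
    (F : I → Coord n → V) : Prop :=
  ∃ C : ℝ, (∀ i, ∀ l ≤ k, ∀ z ∈ hypBall n 2, ‖iteratedFDeriv ℝ l (F i) z‖ ≤ C) ∧
    ∀ i, ∀ z ∈ hypBall n 2, ∀ w ∈ hypBall n 2,
      ‖iteratedFDeriv ℝ k (F i) z - iteratedFDeriv ℝ k (F i) w‖ ≤ C * ‖z - w‖ ^ α

/-- Currying is a linear isometry, so the Hölder seminorm of the top derivative can be read off from
the first derivative. This drives the inductions on `k`. -/
theorem norm_iteratedFDeriv_sub_fderiv {V : Type*} [NormedAddCommGroup V] [NormedSpace ℝ V]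
    (k : ℕ) (F : Coord n → V) (z w : Coord n) :
    ‖iteratedFDeriv ℝ k (fderiv ℝ F) z - iteratedFDeriv ℝ k (fderiv ℝ F) w‖ =
      ‖iteratedFDeriv ℝ (k + 1) F z - iteratedFDeriv ℝ (k + 1) F w‖ := by
  rw [iteratedFDeriv_succ_eq_comp_right, iteratedFDeriv_succ_eq_comp_right]
  have := (continuousMultilinearCurryRightEquiv' ℝ k (Coord n) V).symm.dist_map
    (iteratedFDeriv ℝ k (fderiv ℝ F) z) (iteratedFDeriv ℝ k (fderiv ℝ F) w)
  rw [dist_eq_norm, dist_eq_norm] at this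
  exact this.symm

theorem UnifHolder.fderiv {V : Type*} [NormedAddCommGroup V] [NormedSpace ℝ V] {k : ℕ}
    {F : I → Coord n → V} (h : UnifHolder (k + 1) α F) :
    UnifHolder k α (fun i => fderiv ℝ (F i)) := by
  obtain ⟨C, h1, h2⟩ := h
  refine ⟨C, fun i l hl z hz => ?_, fun i z hz w hw => ?_⟩
  · rw [norm_iteratedFDeriv_fderiv]; exact h1 i (l + 1) (by omega) z hz
  · rw [norm_iteratedFDeriv_sub_fderiv]; exact h2 i z hz w hw

theorem UnifHolder.of_fderiv {V : Type*} [NormedAddCommGroup V] [NormedSpace ℝ V] {k : ℕ}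
    {F : I → Coord n → V} (h0 : ∃ C, ∀ i, ∀ z ∈ hypBall n 2, ‖F i z‖ ≤ C)
    (h : UnifHolder k α (fun i => _root_.fderiv ℝ (F i))) :
    UnifHolder (k + 1) α F := by
  obtain ⟨C, h1, h2⟩ := h
  obtain ⟨D, h0⟩ := h0
  refine ⟨max C D, fun i l hl z hz => ?_, fun i z hz w hw => ?_⟩
  · cases l with
    | zero => rw [norm_iteratedFDeriv_zero]; exact (h0 i z hz).trans (le_max_right _ _)
    | succ l =>
      rw [← norm_iteratedFDeriv_fderiv]
      exact (h1 i l (by omega) z hz).trans (le_max_left _ _)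
  · rw [← norm_iteratedFDeriv_sub_fderiv]
    exact (h2 i z hz w hw).trans
      (mul_le_mul_of_nonneg_right (le_max_left _ _) (Real.rpow_nonneg (norm_nonneg _) _))

theorem pd_clm_comp {V : Type*} [NormedAddCommGroup V] [NormedSpace ℝ V] (L : V →L[ℝ] ℝ)
    {F : Coord n → V} {z : Coord n} (hF : DifferentiableAt ℝ F z) (j : Fin (n + 1)) :
    pd j (fun y => L (F y)) z = L (fderiv ℝ F z (basisVec j)) := by
  have := (L.hasFDerivAt.comp z hF.hasFDerivAt).fderiv
  rw [pd]
  change fderiv ℝ (L ∘ F) z _ = _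
  rw [this]; rfl

/-- For `m = 0` no weights occur, which is why the scales `s` are arbitrary here. -/
theorem UnifHolder.clm_comp {V : Type*} [NormedAddCommGroup V] [NormedSpace ℝ V] {k : ℕ}
    {F : I → Coord n → V} (hF : ∀ i, ContDiffOn ℝ k (F i) (hypBall n 2))
    (h : UnifHolder k α F) (L : V →L[ℝ] ℝ) : UA α s 0 k (fun i z => L (F i z)) := by
  have hub : UB fun i z => L (F i z) := by
    obtain ⟨C, h1, -⟩ := h
    refine ⟨‖L‖ * C, fun i z hz => (L.le_opNorm _).trans ?_⟩
    have := h1 i 0 (Nat.zero_le _) z hz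
    rw [norm_iteratedFDeriv_zero] at this
    gcongr
  induction k generalizing V with
  | zero =>
    refine ⟨hub, fun i => L.continuous.comp_continuousOn (hF i).continuousOn, ?_⟩
    obtain ⟨C, -, h2⟩ := h
    refine ⟨‖L‖ * C, fun i z hz w hw => ?_⟩
    rw [← map_sub, ← Real.norm_eq_abs]
    refine (L.le_opNorm _).trans ?_
    have := h2 i z hz w hw
    rw [iteratedFDeriv_zero_eq_comp, Function.comp_apply, Function.comp_apply,
      ← map_sub, LinearIsometryEquiv.norm_map] at this
    rw [mul_assoc]
    gcongr
  | succ k ih =>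
    have hd : ∀ i, DifferentiableOn ℝ (F i) (hypBall n 2) := fun i =>
      (hF i).differentiableOn (by simp)
    refine UA.of_pd_zero hub (fun i => L.differentiable.comp_differentiableOn (hd i)) fun j => ?_
    have hF' : ∀ i, ContDiffOn ℝ k (_root_.fderiv ℝ (F i)) (hypBall n 2) := fun i => by
      have := hF i
      rw [Nat.cast_add, Nat.cast_one,
        contDiffOn_succ_iff_fderiv_of_isOpen (isOpen_hypBall n 2)] at this
      exact this.2.2
    refine UA.congr (fun i z hz => ?_) (ih hF' h.fderiv
      (L.comp (ContinuousLinearMap.apply ℝ V (basisVec j : Coord n))) ?_)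
    · rw [pd_clm_comp L ((hd i z hz).differentiableAt (hypBall_mem_nhds hz))]; rfl
    · obtain ⟨C, h1, -⟩ := h.fderiv
      refine ⟨‖L.comp (ContinuousLinearMap.apply ℝ V (basisVec j : Coord n))‖ * C,
        fun i z hz => ((L.comp (ContinuousLinearMap.apply ℝ V (basisVec j : Coord n))).le_opNorm
          (_root_.fderiv ℝ (F i) z)).trans ?_⟩
      have := h1 i 0 (Nat.zero_le _) z hz
      rw [norm_iteratedFDeriv_zero] at this
      gcongr

theorem UA.unifHolder {V : Type*} [NormedAddCommGroup V] [NormedSpace ℝ V] {k : ℕ}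
    {κ : Type*} [Fintype κ] {φ : κ → I → Coord n → ℝ} (hφ : ∀ J, UA α s 0 k (φ J)) (b : κ → V)
    {F : I → Coord n → V} (hF : ∀ i, ∀ z ∈ hypBall n 2, F i z = ∑ J, φ J i z • b J) :
    UnifHolder k α F := by
  have hub : ∃ C, ∀ i, ∀ z ∈ hypBall n 2, ‖F i z‖ ≤ C := by
    choose C hC using fun J => (hφ J).ub
    refine ⟨∑ J, C J * ‖b J‖, fun i z hz => ?_⟩
    rw [hF i z hz]
    refine (norm_sum_le _ _).trans (Finset.sum_le_sum fun J _ => ?_)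
    rw [norm_smul]
    exact mul_le_mul_of_nonneg_right (hC J i z hz) (norm_nonneg _)
  -- The derivative has the same shape as `F`, with partial derivatives as coefficients, constant
  -- vectors indexed by `κ × Fin (n + 1)`, and values in another space; hence the induction runs
  -- over all `V` and `κ`.
  induction k generalizing V κ with
  | zero =>
    obtain ⟨C, hC⟩ := hub
    choose D hD using fun J => (hφ J).2.2
    refine ⟨max C (∑ J, D J * ‖b J‖), fun i l hl z hz => ?_, fun i z hz w hw => ?_⟩
    · obtain rfl : l = 0 := by omega
      rw [norm_iteratedFDeriv_zero]; exact (hC i z hz).trans (le_max_left _ _)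
    · rw [iteratedFDeriv_zero_eq_comp, Function.comp_apply, Function.comp_apply,
        ← map_sub, LinearIsometryEquiv.norm_map]
      refine le_trans ?_ (mul_le_mul_of_nonneg_right (le_max_right _ _)
        (Real.rpow_nonneg (norm_nonneg _) _))
      rw [hF i z hz, hF i w hw, ← Finset.sum_sub_distrib, Finset.sum_mul]
      refine (norm_sum_le _ _).trans (Finset.sum_le_sum fun J _ => ?_)
      rw [← sub_smul, norm_smul, mul_right_comm]
      exact mul_le_mul_of_nonneg_right (hD J i z hz w hw) (norm_nonneg _)
  | succ k ih =>
    refine UnifHolder.of_fderiv hub ?_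
    have hder : ∀ i, ∀ z ∈ hypBall n 2, fderiv ℝ (F i) z = ∑ x : κ × Fin (n + 1),
        WeakAH.pd x.2 (φ x.1 i) z • (EuclideanSpace.proj x.2 : Coord n →L[ℝ] ℝ).smulRight (b x.1) := by
      intro i z hz
      have hd : ∀ J, DifferentiableAt ℝ (φ J i) z := fun J => (hφ J).differentiableAt i hz
      rw [Filter.EventuallyEq.fderiv_eq (Filter.eventually_of_mem (hypBall_mem_nhds hz) (hF i)),
        fderiv_fun_sum fun J _ => (hd J).smul_const _, Fintype.sum_prod_type]
      refine Finset.sum_congr rfl fun J _ => ?_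
      rw [fderiv_smul_const (hd J)]
      ext v
      simp only [ContinuousLinearMap.smulRight_apply, fderiv_apply_eq_sum_pd, Finset.sum_smul,
        sum_apply, smul_apply, smul_smul]
      exact Finset.sum_congr rfl fun j _ => by simp [mul_comm]
    have hub' : ∃ C, ∀ i, ∀ z ∈ hypBall n 2, ‖fderiv ℝ (F i) z‖ ≤ C := by
      choose C hC using fun x : κ × Fin (n + 1) => ((hφ x.1).pd_zero x.2).ub
      refine ⟨∑ x : κ × Fin (n + 1),
        C x * ‖(EuclideanSpace.proj x.2 : Coord n →L[ℝ] ℝ).smulRight (b x.1)‖, fun i z hz => ?_⟩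
      rw [hder i z hz]
      refine (norm_sum_le _ _).trans (Finset.sum_le_sum fun x _ => ?_)
      rw [norm_smul]
      exact mul_le_mul_of_nonneg_right (hC x i z hz) (norm_nonneg _)
    exact ih (fun x : κ × Fin (n + 1) => (hφ x.1).pd_zero x.2) _ hder hub'

theorem enorm_iSup_le {X Y : Type*} [NormedAddCommGroup Y] {S : Set X} {f : X → Y} {C : ℝ}
    (h : ∀ x ∈ S, ‖f x‖ ≤ C) : ⨆ x ∈ S, ‖f x‖ₑ ≤ ENNReal.ofReal C :=
  iSup₂_le fun x hx => by
    rw [← ofReal_norm]; exact ENNReal.ofReal_le_ofReal (h x hx)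

theorem enorm_div_edist_rpow_le {Y : Type*} [NormedAddCommGroup Y] {a b : Y} {z w : Coord n}
    {C : ℝ} (hC : 0 ≤ C) (h0 : 0 ≤ α) (h : ‖a - b‖ ≤ C * ‖z - w‖ ^ α) :
    ‖a - b‖ₑ / edist z w ^ α ≤ ENNReal.ofReal C := by
  refine ENNReal.div_le_of_le_mul ?_
  rw [edist_dist, dist_eq_norm, ENNReal.ofReal_rpow_of_nonneg (norm_nonneg _) h0,
    ← ENNReal.ofReal_mul hC, ← ofReal_norm]
  exact ENNReal.ofReal_le_ofReal h

theorem le_of_enorm_div_edist_rpow_le {Y : Type*} [NormedAddCommGroup Y] {a b : Y} {z w : Coord n}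
    {C : ℝ} (h0 : 0 ≤ α) (hC : 0 ≤ C) (hab : z = w → a = b)
    (h : ‖a - b‖ₑ / edist z w ^ α ≤ ENNReal.ofReal C) : ‖a - b‖ ≤ C * ‖z - w‖ ^ α := by
  -- At coincident points the quotient may be `0 / 0` and carries no information, so this case uses
  -- `hab`.
  by_cases hzw : z = w
  · rw [hab hzw]
    simpa using mul_nonneg hC (Real.rpow_nonneg (norm_nonneg _) _)
  have hpos : 0 < ‖z - w‖ := norm_pos_iff.2 (sub_ne_zero.2 hzw)
  rw [edist_dist, dist_eq_norm, ENNReal.ofReal_rpow_of_nonneg (norm_nonneg _) h0,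
    ← ofReal_norm, ENNReal.div_le_iff_le_mul (Or.inl (by
      simpa using Real.rpow_pos_of_pos hpos α)) (Or.inl ENNReal.ofReal_ne_top),
    ← ENNReal.ofReal_mul hC, ENNReal.ofReal_le_ofReal_iff (by positivity)] at h
  exact h

theorem UnifHolder.exists_holderNormOn_le {V : Type*} [NormedAddCommGroup V] [NormedSpace ℝ V]
    {k : ℕ} (h0 : 0 ≤ α) {F : I → Coord n → V} (h : UnifHolder k α F) :
    ∃ C : NNReal, ∀ i, holderNormOn k α (F i) (hypBall n 2) ≤ C := by
  obtain ⟨C, h1, h2⟩ := h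
  have h2' : ∀ i, ∀ z ∈ hypBall n 2, ∀ w ∈ hypBall n 2,
      ‖iteratedFDeriv ℝ k (F i) z - iteratedFDeriv ℝ k (F i) w‖ ≤ |C| * ‖z - w‖ ^ α :=
    fun i z hz w hw => (h2 i z hz w hw).trans
      (mul_le_mul_of_nonneg_right (le_abs_self C) (Real.rpow_nonneg (norm_nonneg _) _))
  refine ⟨∑ _l ∈ Finset.range (k + 1), Real.toNNReal C + Real.toNNReal |C|, fun i => ?_⟩
  rw [ENNReal.coe_add, ENNReal.ofNNReal_finsetSum]
  refine add_le_add (Finset.sum_le_sum fun l hl => enorm_iSup_le fun z hz =>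
    h1 i l (Nat.lt_succ_iff.1 (Finset.mem_range.1 hl)) z hz) ?_
  exact iSup₂_le fun z hz => iSup₂_le fun w hw =>
    enorm_div_edist_rpow_le (abs_nonneg C) h0 (h2' i z hz w hw)

theorem unifHolder_of_holderNormOn_le {V : Type*} [NormedAddCommGroup V] [NormedSpace ℝ V]
    {k : ℕ} (h0 : 0 ≤ α) {F : I → Coord n → V}
    (h : ∃ C : NNReal, ∀ i, holderNormOn k α (F i) (hypBall n 2) ≤ C) : UnifHolder k α F := by
  obtain ⟨C, hC⟩ := h
  refine ⟨C, fun i l hl z hz => ?_, fun i z hz w hw => ?_⟩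
  · have e : ‖iteratedFDeriv ℝ l (F i) z‖ₑ ≤ C := by
      refine le_trans ?_ ((le_add_right (Finset.single_le_sum
        (f := fun l => ⨆ z ∈ hypBall n 2, ‖iteratedFDeriv ℝ l (F i) z‖ₑ)
        (fun _ _ => zero_le) (Finset.mem_range.2 (Nat.lt_succ_iff.2 hl)))).trans (hC i))
      exact le_iSup₂ (f := fun z (_ : z ∈ hypBall n 2) => ‖iteratedFDeriv ℝ l (F i) z‖ₑ) z hz
    exact_mod_cast e
  · refine le_of_enorm_div_edist_rpow_le h0 C.2 (fun h => h ▸ rfl) ?_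
    rw [ENNReal.ofReal_coe_nnreal]
    refine le_trans ?_ (le_add_self.trans (hC i))
    refine le_trans ?_ (le_iSup₂ (f := fun z (_ : z ∈ hypBall n 2) => ⨆ w ∈ hypBall n 2,
      ‖iteratedFDeriv ℝ k (F i) z - iteratedFDeriv ℝ k (F i) w‖ₑ / edist z w ^ α) z hz)
    exact le_iSup₂ (f := fun w (_ : w ∈ hypBall n 2) =>
      ‖iteratedFDeriv ℝ k (F i) z - iteratedFDeriv ℝ k (F i) w‖ₑ / edist z w ^ α) w hw

end Transfer

end WeakAH

/-! ### Coordinate tensor calculus: naturality, contractions, conformal changes. -/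

namespace WeakAH

noncomputable section

/-! ### Tensor calculus in coordinates -/

section Coordinates

variable {n r : ℕ}

/-- Covariant tensors on the coordinate space. -/
abbrev Tens (n r : ℕ) : Type := ContinuousMultilinearMap ℝ (fun _ : Fin r => Coord n) ℝ

/-- Components of a field of covariant tensors. -/
def cmp (t : Coord n → Tens n r) (J : Fin r → Fin (n + 1)) (y : Coord n) : ℝ :=
  t y (fun a => basisVec (J a))

/-- The matrix of a bilinear form. -/
def gramT (T : Tens n 2) : Matrix (Fin (n + 1)) (Fin (n + 1)) ℝ :=
  Matrix.of fun i j => T (fun a => basisVec ((![i, j] : Fin 2 → Fin (n + 1)) a))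

/-- Christoffel symbols in coordinates. -/
def christC (G : Coord n → Tens n 2) (m i j : Fin (n + 1)) (y : Coord n) : ℝ :=
  1 / 2 * ∑ l, (gramT (G y))⁻¹ m l *
    (pd i (fun z => gramT (G z) j l) y + pd j (fun z => gramT (G z) i l) y
      - pd l (fun z => gramT (G z) i j) y)

/-- Curvature components in coordinates. -/
def curvC (G : Coord n → Tens n 2) (y : Coord n) (i j k l : Fin (n + 1)) : ℝ :=
  pd i (christC G l j k) y - pd j (christC G l i k) y +
    ∑ m, (christC G m j k y * christC G l i m y - christC G m i k y * christC G l j m y)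

/-- The curvature operator in coordinates. -/
def riemC (G : Coord n → Tens n 2) (y : Coord n) (i j k l : Fin (n + 1)) : ℝ :=
  ∑ q, (gramT (G y))⁻¹ l q * curvC G y i j q k

/-- The covariant derivative in coordinates. -/
def nablaC (G : Coord n → Tens n 2) (t : Coord n → Tens n r) (y : Coord n) : Tens n (r + 1) :=
  ofComponents fun I =>
    pd (I 0) (cmp t (Fin.tail I)) y -
      ∑ a, ∑ m, christC G m (I 0) (Fin.tail I a) y *
        cmp t (Function.update (Fin.tail I) a m) y

/-- The Lie derivative in coordinates. -/
def lieC (X : Coord n → Coord n) (t : Coord n → Tens n r) (y : Coord n) : Tens n r :=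
  ofComponents fun J =>
    ∑ l, X y l * pd l (cmp t J) y +
      ∑ a, ∑ l, cmp t (Function.update J a l) y * pd (J a) (fun z => X z l) y

/-- The Christoffel symbols as a bilinear map. -/
def gamC (G : Coord n → Tens n 2) (y : Coord n) : Coord n →L[ℝ] Coord n →L[ℝ] Coord n :=
  ∑ x : Fin (n + 1) × Fin (n + 1) × Fin (n + 1), christC G x.1 x.2.1 x.2.2 y •
    (EuclideanSpace.proj x.2.1 : Coord n →L[ℝ] ℝ).smulRight
      ((EuclideanSpace.proj x.2.2 : Coord n →L[ℝ] ℝ).smulRight (basisVec x.1 : Coord n))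

/-- The derivation of the tensor algebra induced by an endomorphism. -/
def act (A : Coord n →L[ℝ] Coord n) (t : Tens n r) : Tens n r :=
  t.fderivCompContinuousLinearMap (fun _ => ContinuousLinearMap.id ℝ _) (fun _ => A)

/-- Positive definite symmetric bilinear forms. -/
structure IsMet (T : Tens n 2) : Prop where
  symm : ∀ v w, T ![v, w] = T ![w, v]
  pos : ∀ v, v ≠ 0 → 0 < T ![v, v]

/-- The trace of a bilinear form with respect to a metric. -/
def ctr (G t : Tens n 2) : ℝ := ∑ i, ∑ j, (gramT G)⁻¹ i j * gramT t i j

/-- The pullback of a field of tensors by a map of the coordinate space. -/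
def pbC (τ : Coord n → Coord n) (t : Coord n → Tens n r) (z : Coord n) : Tens n r :=
  (t (τ z)).compContinuousLinearMap fun _ => fderiv ℝ τ z

theorem update_clm_apply {A : Fin r → Coord n →L[ℝ] Coord n} (a : Fin r)
    (A' : Coord n →L[ℝ] Coord n) (v : Fin r → Coord n) :
    (fun b => (Function.update A a A' b) (v b)) =
      Function.update (fun b => A b (v b)) a (A' (v a)) := by
  funext b
  by_cases h : b = a
  · subst h; simp
  · simp [h]

@[simp] theorem act_apply (A : Coord n →L[ℝ] Coord n) (t : Tens n r) (v : Fin r → Coord n) :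
    act A t v = ∑ a, t (Function.update v a (A (v a))) := by
  simp [act, ContinuousMultilinearMap.fderivCompContinuousLinearMap_apply, update_clm_apply]

theorem gramT_apply (T : Tens n 2) (i j : Fin (n + 1)) :
    gramT T i j = T ![basisVec i, basisVec j] := by
  simp only [gramT, Matrix.of_apply]
  congr 1; ext a; fin_cases a <;> rfl

@[simp] theorem basisVec_apply (i j : Fin (n + 1)) :
    (basisVec i : Coord n) j = if j = i then 1 else 0 := by
  simp [basisVec]

theorem sum_smul_basisVec (v : Coord n) : ∑ j, v j • (basisVec j : Coord n) = v := by
  ext l; simp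

theorem ofComponents_apply (c : (Fin r → Fin (n + 1)) → ℝ) (v : Fin r → Coord n) :
    ofComponents c v = ∑ J, c J * ∏ a, v a (J a) := by
  simp [ofComponents]

theorem tens_apply_eq_sum (t : Tens n r) (v : Fin r → Coord n) :
    t v = ∑ J : Fin r → Fin (n + 1), t (fun a => basisVec (J a)) * ∏ a, v a (J a) := by
  classical
  have hv : v = fun a => ∑ j, v a j • (basisVec j : Coord n) := by
    funext a; exact (sum_smul_basisVec (v a)).symm
  conv_lhs => rw [hv]
  rw [ContinuousMultilinearMap.map_sum]
  refine Finset.sum_congr rfl fun J _ => ?_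
  rw [ContinuousMultilinearMap.map_smul_univ, smul_eq_mul, mul_comm]

theorem ofComponents_cmp (t : Tens n r) :
    ofComponents (fun J => t (fun a => basisVec (J a))) = t := by
  ext v; rw [ofComponents_apply, ← tens_apply_eq_sum]

theorem ofComponents_basisVec (c : (Fin r → Fin (n + 1)) → ℝ) (J : Fin r → Fin (n + 1)) :
    ofComponents c (fun a => basisVec (J a)) = c J := by
  classical
  rw [ofComponents_apply, Finset.sum_eq_single J]
  · simp
  · intro K _ hK
    obtain ⟨a, ha⟩ := Function.ne_iff.1 hK
    rw [Finset.prod_eq_zero (Finset.mem_univ a), mul_zero]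
    simp [ha]
  · simp

theorem tens_ext {t t' : Tens n r}
    (h : ∀ J : Fin r → Fin (n + 1), t (fun a => basisVec (J a)) = t' (fun a => basisVec (J a))) :
    t = t' := by
  rw [← ofComponents_cmp t, ← ofComponents_cmp t']; simp only [h]

theorem pd_cmp {t : Coord n → Tens n r} {y : Coord n} (ht : DifferentiableAt ℝ t y)
    (J : Fin r → Fin (n + 1)) (i : Fin (n + 1)) :
    pd i (cmp t J) y = fderiv ℝ t y (basisVec i) (fun a => basisVec (J a)) :=
  pd_clm_comp (ContinuousMultilinearMap.apply ℝ (fun _ : Fin r => Coord n) ℝ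
    (fun a => basisVec (J a))) ht i

theorem gamC_apply (G : Coord n → Tens n 2) (y u v : Coord n) :
    gamC G y u v = ∑ m, (∑ i, ∑ j, christC G m i j y * u i * v j) • (basisVec m : Coord n) := by
  simp only [gamC, sum_apply, smul_apply, ContinuousLinearMap.smulRight_apply,
    Fintype.sum_prod_type, Finset.sum_smul, smul_smul]
  simp [mul_assoc]

theorem gamC_apply_apply (G : Coord n → Tens n 2) (y u v : Coord n) (m : Fin (n + 1)) :
    gamC G y u v m = ∑ i, ∑ j, christC G m i j y * u i * v j := by
  rw [gamC_apply]; simp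

theorem gamC_basisVec (G : Coord n → Tens n 2) (y : Coord n) (i j m : Fin (n + 1)) :
    gamC G y (basisVec i) (basisVec j) m = christC G m i j y := by
  rw [gamC_apply_apply]; simp

theorem gamC_basisVec' (G : Coord n → Tens n 2) (y : Coord n) (i j : Fin (n + 1)) :
    gamC G y (basisVec i) (basisVec j) = ∑ m, christC G m i j y • (basisVec m : Coord n) := by
  rw [← sum_smul_basisVec (gamC G y (basisVec i) (basisVec j))]
  simp only [gamC_basisVec]

theorem update_sum_smul (t : Tens n r) (v : Fin r → Coord n) (a : Fin r) (c : Fin (n + 1) → ℝ) :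
    t (Function.update v a (∑ m, c m • (basisVec m : Coord n))) =
      ∑ m, c m * t (Function.update v a (basisVec m)) := by
  have : ∀ x, t (Function.update v a x) = t.toContinuousLinearMap v a x := fun _ => rfl
  rw [this, map_sum]
  simp [← this]

theorem update_basisVec (J : Fin r → Fin (n + 1)) (a : Fin r) (m : Fin (n + 1)) :
    Function.update (fun b => (basisVec (J b) : Coord n)) a (basisVec m) =
      fun b => basisVec (Function.update J a m b) := by
  funext b
  by_cases h : b = a
  · subst h; simp
  · simp [h]

/-- Index-free form of the covariant derivative, in which naturality follows from the chain rule. -/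
theorem nablaC_apply (G : Coord n → Tens n 2) {t : Coord n → Tens n r} {y : Coord n}
    (ht : DifferentiableAt ℝ t y) (v : Fin (r + 1) → Coord n) :
    nablaC G t y v = (fderiv ℝ t y (v 0) - act (gamC G y (v 0)) (t y)) (Fin.tail v) := by
  have key : ∀ i : Fin (n + 1), ∀ J : Fin r → Fin (n + 1),
      pd i (cmp t J) y - ∑ a, ∑ m, christC G m i (J a) y * cmp t (Function.update J a m) y =
      (fderiv ℝ t y (basisVec i) - act (gamC G y (basisVec i)) (t y))
        (fun a => basisVec (J a)) := by
    intro i J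
    rw [pd_cmp ht, sub_apply, act_apply]
    congr 1
    refine Finset.sum_congr rfl fun a _ => ?_
    rw [gamC_basisVec', update_sum_smul]
    refine Finset.sum_congr rfl fun m _ => ?_
    rw [update_basisVec]; rfl
  have lin : ∀ J : Fin r → Fin (n + 1), (fderiv ℝ t y (v 0) - act (gamC G y (v 0)) (t y))
      (fun a => basisVec (J a)) = ∑ i, v 0 i * (fderiv ℝ t y (basisVec i) -
        act (gamC G y (basisVec i)) (t y)) (fun a => basisVec (J a)) := by
    intro J
    have e1 : fderiv ℝ t y (v 0) = ∑ i, v 0 i • fderiv ℝ t y (basisVec i) := by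
      conv_lhs => rw [← sum_smul_basisVec (v 0)]
      simp
    have e2 : act (gamC G y (v 0)) (t y) = ∑ i, v 0 i • act (gamC G y (basisVec i)) (t y) := by
      have : ∀ u, act (gamC G y u) (t y) = ((t y).fderivCompContinuousLinearMap
        (fun _ => ContinuousLinearMap.id ℝ _)) (fun _ => gamC G y u) := fun _ => rfl
      simp only [this, ← map_smul, ← map_sum]
      congr 1
      funext a
      conv_lhs => rw [← sum_smul_basisVec (v 0)]
      simp
    rw [e1, e2, ← Finset.sum_sub_distrib]
    simp [mul_sub]
  rw [nablaC, ofComponents_apply, tens_apply_eq_sum _ (Fin.tail v),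
    ← (Fin.consEquiv fun _ => Fin (n + 1)).sum_comp, Fintype.sum_prod_type, Finset.sum_comm]
  refine Finset.sum_congr rfl fun J _ => ?_
  rw [lin, Finset.sum_mul]
  refine Finset.sum_congr rfl fun i _ => ?_
  rw [← key]
  have e : (Fin.consEquiv fun _ => Fin (n + 1)) (i, J) = Fin.cons i J := rfl
  simp only [e, Fin.cons_zero, Fin.tail_cons, Fin.prod_univ_succ, Fin.cons_succ]
  simp only [Fin.tail]
  ring

/-- The index-free counterpart for the Lie derivative. -/
theorem lieC_eq (X : Coord n → Coord n) {t : Coord n → Tens n r} {y : Coord n}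
    (ht : DifferentiableAt ℝ t y) (hX : DifferentiableAt ℝ X y) :
    lieC X t y = fderiv ℝ t y (X y) + act (fderiv ℝ X y) (t y) := by
  refine tens_ext fun J => ?_
  rw [lieC, ofComponents_basisVec, add_apply, act_apply]
  congr 1
  · conv_rhs => rw [← sum_smul_basisVec (X y)]
    simp [pd_cmp ht]
  · refine Finset.sum_congr rfl fun a _ => ?_
    rw [← sum_smul_basisVec (fderiv ℝ X y (basisVec (J a))), update_sum_smul]
    refine Finset.sum_congr rfl fun l _ => ?_
    rw [update_basisVec, mul_comm]
    congr 1
    exact pd_clm_comp (EuclideanSpace.proj l : Coord n →L[ℝ] ℝ) hX (J a)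

/-- Product rule: besides the derivative of `t`, each argument contributes a term with the second
derivative of `τ`. In the naturality statements below these extra terms have to cancel. -/
theorem fderiv_pbC {τ : Coord n → Coord n} {t : Coord n → Tens n r} {z : Coord n}
    (hτ : ContDiffAt ℝ 2 τ z) (ht : DifferentiableAt ℝ t (τ z)) (w : Coord n)
    (v : Fin r → Coord n) :
    fderiv ℝ (pbC τ t) z w v =
      fderiv ℝ t (τ z) (fderiv ℝ τ z w) (fun a => fderiv ℝ τ z (v a)) +
      ∑ a, t (τ z) (Function.update (fun a => fderiv ℝ τ z (v a)) a
        (fderiv ℝ (fderiv ℝ τ) z w (v a))) := by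
  have h1 : DifferentiableAt ℝ τ z := hτ.differentiableAt (by norm_num)
  have h2 : DifferentiableAt ℝ (fderiv ℝ τ) z :=
    (hτ.fderiv_right (m := 1) (by norm_num)).differentiableAt (by norm_num)
  have := ((ht.hasFDerivAt.comp z h1.hasFDerivAt).continuousMultilinearMapCompContinuousLinearMap
    (g := fun _ => fderiv ℝ τ) (fun _ : Fin r => h2.hasFDerivAt)).fderiv
  have e : pbC τ t = fun x => ((t ∘ τ) x).compContinuousLinearMap fun _ => fderiv ℝ τ x := rfl
  rw [e, this]
  simp [ContinuousMultilinearMap.fderivCompContinuousLinearMap_apply, update_clm_apply]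

theorem differentiableAt_pbC {τ : Coord n → Coord n} {t : Coord n → Tens n r} {z : Coord n}
    (hτ : ContDiffAt ℝ 2 τ z) (ht : DifferentiableAt ℝ t (τ z)) :
    DifferentiableAt ℝ (pbC τ t) z := by
  have h1 : DifferentiableAt ℝ τ z := hτ.differentiableAt (by norm_num)
  have h2 : DifferentiableAt ℝ (fderiv ℝ τ) z :=
    (hτ.fderiv_right (m := 1) (by norm_num)).differentiableAt (by norm_num)
  exact ((ht.hasFDerivAt.comp z
    h1.hasFDerivAt).continuousMultilinearMapCompContinuousLinearMap
    (g := fun _ => fderiv ℝ τ) (fun _ : Fin r => h2.hasFDerivAt)).differentiableAt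

/-- Differentiating the relation between `X'` and `X` expresses the sum of the second derivative of
`τ` along `X'` and the pushed forward derivative of `X'` through the derivative of `X`. That sum is
exactly what each argument contributes on the left. -/
theorem lieC_pbC {τ : Coord n → Coord n} {X X' : Coord n → Coord n} {t : Coord n → Tens n r}
    {z : Coord n} (hτ : ContDiffAt ℝ 2 τ z) (ht : DifferentiableAt ℝ t (τ z))
    (hX : DifferentiableAt ℝ X (τ z)) (hX' : DifferentiableAt ℝ X' z)
    (h : ∀ᶠ z' in 𝓝 z, fderiv ℝ τ z' (X' z') = X (τ z')) :
    lieC X' (pbC τ t) z = pbC τ (lieC X t) z := by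
  have h1 : DifferentiableAt ℝ τ z := hτ.differentiableAt (by norm_num)
  have h2 : DifferentiableAt ℝ (fderiv ℝ τ) z :=
    (hτ.fderiv_right (m := 1) (by norm_num)).differentiableAt (by norm_num)
  have hsymm : IsSymmSndFDerivAt ℝ τ z := hτ.isSymmSndFDerivAt (by simp)
  have hder : ∀ w, fderiv ℝ (fderiv ℝ τ) z w (X' z) + fderiv ℝ τ z (fderiv ℝ X' z w) =
      fderiv ℝ X (τ z) (fderiv ℝ τ z w) := by
    intro w
    have e1 := (h2.hasFDerivAt.clm_apply hX'.hasFDerivAt).fderiv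
    have e2 := (hX.hasFDerivAt.comp z h1.hasFDerivAt).fderiv
    have e3 : fderiv ℝ (fun z' => fderiv ℝ τ z' (X' z')) z = fderiv ℝ (X ∘ τ) z :=
      Filter.EventuallyEq.fderiv_eq h
    have e4 : fderiv ℝ (fun z' => fderiv ℝ τ z' (X' z')) z w = fderiv ℝ (X ∘ τ) z w := by rw [e3]
    rw [e1, e2] at e4
    simpa [add_comm] using e4
  rw [lieC_eq _ (differentiableAt_pbC hτ ht) hX']
  simp only [pbC] at *
  rw [lieC_eq _ ht hX]
  ext v
  rw [add_apply, act_apply]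
  change fderiv ℝ (pbC τ t) z _ _ + _ = _
  rw [fderiv_pbC hτ ht, h.self_of_nhds]
  simp only [ContinuousMultilinearMap.compContinuousLinearMap_apply,
    add_apply, act_apply]
  rw [add_assoc, ← Finset.sum_add_distrib]
  congr 1
  refine Finset.sum_congr rfl fun a _ => ?_
  rw [← hder, ContinuousMultilinearMap.map_update_add, hsymm.eq]
  congr 2
  funext b
  by_cases hb : b = a
  · subst hb; simp
  · simp [hb]

end Coordinates

end

end WeakAH

namespace WeakAH

noncomputable section

/-! ### Naturality of the tensor calculus -/

section Naturality

variable {n r : ℕ}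

theorem comp_vec2 {X Y : Type*} (f : X → Y) (a b : X) :
    (fun i => f ((![a, b] : Fin 2 → X) i)) = ![f a, f b] := by
  funext i; fin_cases i <;> rfl

theorem update_vec2_zero {X : Type*} (a b x : X) : Function.update ![a, b] 0 x = ![x, b] := by
  funext i; fin_cases i <;> rfl

theorem update_vec2_one {X : Type*} (a b x : X) : Function.update ![a, b] 1 x = ![a, x] := by
  funext i; fin_cases i <;> rfl

theorem tens2_add_left (T : Tens n 2) (u u' v : Coord n) :
    T ![u + u', v] = T ![u, v] + T ![u', v] := by
  simpa [update_vec2_zero] using T.map_update_add ![u, v] 0 u u'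

theorem tens2_smul_left (T : Tens n 2) (c : ℝ) (u v : Coord n) :
    T ![c • u, v] = c * T ![u, v] := by
  simpa [update_vec2_zero] using T.map_update_smul ![u, v] 0 c u

theorem tens2_sub_left (T : Tens n 2) (u u' v : Coord n) :
    T ![u - u', v] = T ![u, v] - T ![u', v] := by
  simpa [update_vec2_zero] using T.map_update_sub ![u, v] 0 u u'

theorem tens2_apply (T : Tens n 2) (v w : Coord n) :
    T ![v, w] = ∑ i, ∑ j, v i * w j * gramT T i j := by
  rw [tens_apply_eq_sum, ← (finTwoArrowEquiv (Fin (n + 1))).symm.sum_comp, Fintype.sum_prod_type]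
  refine Finset.sum_congr rfl fun i _ => Finset.sum_congr rfl fun j _ => ?_
  simp [gramT, Fin.prod_univ_two, mul_comm]

theorem gramT_comp (T : Tens n 2) (A : Coord n →L[ℝ] Coord n) (i j : Fin (n + 1)) :
    gramT (T.compContinuousLinearMap fun _ => A) i j = T ![A (basisVec i), A (basisVec j)] := by
  rw [gramT_apply, ContinuousMultilinearMap.compContinuousLinearMap_apply]
  congr 1; funext a; fin_cases a <;> rfl

theorem IsMet.posDef {T : Tens n 2} (h : IsMet T) : (gramT T).PosDef := by
  refine Matrix.PosDef.of_dotProduct_mulVec_pos ?_ fun x hx => ?_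
  · refine Matrix.IsHermitian.ext fun i j => ?_
    rw [gramT_apply, gramT_apply, star_trivial]
    exact h.symm _ _
  · have h1 := h.pos (WithLp.toLp 2 x) (by simpa using hx)
    rw [tens2_apply] at h1
    refine lt_of_lt_of_eq h1 ?_
    simp only [dotProduct, Matrix.mulVec, star_trivial, Finset.mul_sum]
    exact Finset.sum_congr rfl fun i _ => Finset.sum_congr rfl fun j _ => by ring

theorem IsMet.isUnit_det {T : Tens n 2} (h : IsMet T) : IsUnit (gramT T).det :=
  h.posDef.det_pos.ne'.isUnit

theorem IsMet.gramT_symm {T : Tens n 2} (h : IsMet T) (i j : Fin (n + 1)) :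
    gramT T i j = gramT T j i := by
  rw [gramT_apply, gramT_apply, h.symm]

theorem IsMet.transpose {T : Tens n 2} (h : IsMet T) : (gramT T).transpose = gramT T := by
  ext i j; exact h.gramT_symm j i

theorem IsMet.inv_symm {T : Tens n 2} (h : IsMet T) (i j : Fin (n + 1)) :
    (gramT T)⁻¹ i j = (gramT T)⁻¹ j i := by
  have := Matrix.transpose_nonsing_inv (gramT T)
  rw [h.transpose] at this
  exact congrFun (congrFun this j) i

theorem IsMet.comp {T : Tens n 2} (h : IsMet T) {A : Coord n →L[ℝ] Coord n}
    (hA : Function.Injective A) : IsMet (T.compContinuousLinearMap fun _ => A) := by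
  have e : ∀ v w, (T.compContinuousLinearMap fun _ => A) ![v, w] = T ![A v, A w] := fun v w => by
    rw [ContinuousMultilinearMap.compContinuousLinearMap_apply, comp_vec2]
  refine ⟨fun v w => by rw [e, e, h.symm], fun v hv => ?_⟩
  rw [e]
  exact h.pos _ fun h0 => hv (hA (h0.trans (map_zero A).symm))

theorem IsMet.eq_of_forall {T : Tens n 2} (h : IsMet T) {x y : Coord n}
    (hxy : ∀ w, T ![x, w] = T ![y, w]) : x = y := by
  by_contra hne
  have := h.pos (x - y) (sub_ne_zero.2 hne)
  rw [tens2_sub_left, hxy, sub_self] at this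
  exact lt_irrefl _ this

theorem gramT_inv_apply (T : Tens n 2) (i j : Fin (n + 1)) :
    (gramT T)⁻¹ i j = (gramT T).det⁻¹ * (gramT T).adjugate i j := by
  rw [Matrix.inv_def, Ring.inverse_eq_inv', Matrix.smul_apply, smul_eq_mul]

theorem pd_gramT {G : Coord n → Tens n 2} {y : Coord n} (hG : DifferentiableAt ℝ G y)
    (i j l : Fin (n + 1)) :
    pd l (fun z => gramT (G z) i j) y = fderiv ℝ G y (basisVec l) ![basisVec i, basisVec j] := by
  have := pd_cmp hG ![i, j] l
  rw [comp_vec2] at this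
  exact this

/-- This identity determines the Christoffel symbols without the inverse matrix. The transformation
laws under diffeomorphisms and conformal changes are proved by checking it. -/
theorem koszul {G : Coord n → Tens n 2} {y : Coord n} (hG : DifferentiableAt ℝ G y)
    (hm : IsMet (G y)) (u v w : Coord n) :
    G y ![gamC G y u v, w] = 1 / 2 * (fderiv ℝ G y u ![v, w] + fderiv ℝ G y v ![u, w] -
      fderiv ℝ G y w ![u, v]) := by
  have key : ∀ i j l, ∑ m, christC G m i j y * gramT (G y) m l =
      1 / 2 * (gramT (fderiv ℝ G y (basisVec i)) j l + gramT (fderiv ℝ G y (basisVec j)) i l -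
        gramT (fderiv ℝ G y (basisVec l)) i j) := by
    intro i j l
    simp only [christC, pd_gramT hG, ← gramT_apply]
    set K : Fin (n + 1) → ℝ := fun q => gramT (fderiv ℝ G y (basisVec i)) j q +
      gramT (fderiv ℝ G y (basisVec j)) i q - gramT (fderiv ℝ G y (basisVec q)) i j with hK
    calc ∑ m, (1 / 2 * ∑ q, (gramT (G y))⁻¹ m q * K q) * gramT (G y) m l
        = 1 / 2 * ∑ m, ∑ q, (gramT (G y))⁻¹ q m * gramT (G y) m l * K q := by
          rw [Finset.mul_sum]
          refine Finset.sum_congr rfl fun m _ => ?_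
          rw [mul_assoc, Finset.sum_mul]
          congr 1
          exact Finset.sum_congr rfl fun q _ => by rw [hm.inv_symm m q]; ring
      _ = 1 / 2 * ∑ q, ((gramT (G y))⁻¹ * gramT (G y)) q l * K q := by
          rw [Finset.sum_comm]
          congr 1
          refine Finset.sum_congr rfl fun q _ => ?_
          rw [Matrix.mul_apply, Finset.sum_mul]
      _ = 1 / 2 * K l := by
          rw [Matrix.nonsing_inv_mul _ hm.isUnit_det]
          simp [Matrix.one_apply]
  have e : ∀ x a b, fderiv ℝ G y x ![a, b] =
      ∑ i, ∑ j, ∑ l, x i * a j * b l * gramT (fderiv ℝ G y (basisVec i)) j l := by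
    intro x a b
    conv_lhs => rw [← sum_smul_basisVec x]
    simp only [map_sum, map_smul, sum_apply, smul_apply, smul_eq_mul, tens2_apply, Finset.mul_sum]
    exact Finset.sum_congr rfl fun i _ => Finset.sum_congr rfl fun j _ =>
      Finset.sum_congr rfl fun l _ => by ring
  have e1 : G y ![gamC G y u v, w] = ∑ i, ∑ j, ∑ l, u i * v j * w l *
      ∑ m, christC G m i j y * gramT (G y) m l := by
    rw [tens2_apply]
    simp only [gamC_apply_apply, Finset.sum_mul, Finset.mul_sum]
    calc _ = ∑ m, ∑ i, ∑ l, ∑ j, christC G m i j y * u i * v j * w l * gramT (G y) m l :=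
          Finset.sum_congr rfl fun m _ => Finset.sum_comm
      _ = ∑ i, ∑ m, ∑ j, ∑ l, christC G m i j y * u i * v j * w l * gramT (G y) m l := by
          rw [Finset.sum_comm]
          exact Finset.sum_congr rfl fun i _ => Finset.sum_congr rfl fun m _ => Finset.sum_comm
      _ = ∑ i, ∑ j, ∑ l, ∑ m, christC G m i j y * u i * v j * w l * gramT (G y) m l := by
          refine Finset.sum_congr rfl fun i _ => ?_
          rw [Finset.sum_comm]
          exact Finset.sum_congr rfl fun j _ => Finset.sum_comm
      _ = _ := Finset.sum_congr rfl fun i _ => Finset.sum_congr rfl fun j _ =>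
          Finset.sum_congr rfl fun l _ => Finset.sum_congr rfl fun m _ => by ring
  have e2 : fderiv ℝ G y v ![u, w] = ∑ i, ∑ j, ∑ l, u i * v j * w l *
      gramT (fderiv ℝ G y (basisVec j)) i l := by
    rw [e, Finset.sum_comm]
    exact Finset.sum_congr rfl fun i _ => Finset.sum_congr rfl fun j _ =>
      Finset.sum_congr rfl fun l _ => by ring
  have e3 : fderiv ℝ G y w ![u, v] = ∑ i, ∑ j, ∑ l, u i * v j * w l *
      gramT (fderiv ℝ G y (basisVec l)) i j := by
    rw [e, Finset.sum_comm]
    refine Finset.sum_congr rfl fun i _ => ?_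
    rw [Finset.sum_comm]
    exact Finset.sum_congr rfl fun j _ => Finset.sum_congr rfl fun l _ => by ring
  rw [e1, e u v w, e2, e3]
  simp only [key, ← Finset.sum_add_distrib, ← Finset.sum_sub_distrib, Finset.mul_sum]
  exact Finset.sum_congr rfl fun i _ => Finset.sum_congr rfl fun j _ =>
    Finset.sum_congr rfl fun l _ => by ring

theorem gamC_eq_of_koszul {G : Coord n → Tens n 2} {y : Coord n} (hG : DifferentiableAt ℝ G y)
    (hm : IsMet (G y)) {u v x : Coord n}
    (h : ∀ w, G y ![x, w] = 1 / 2 * (fderiv ℝ G y u ![v, w] + fderiv ℝ G y v ![u, w] -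
      fderiv ℝ G y w ![u, v])) : gamC G y u v = x :=
  hm.eq_of_forall fun w => by rw [koszul hG hm, h]

theorem fderiv_symm_of_isMet {G : Coord n → Tens n 2} {y : Coord n} (hG : DifferentiableAt ℝ G y)
    (hm : ∀ᶠ z in 𝓝 y, IsMet (G z)) (u v w : Coord n) :
    fderiv ℝ G y u ![v, w] = fderiv ℝ G y u ![w, v] := by
  have h : ∀ a b, fderiv ℝ G y u ![a, b] = fderiv ℝ (fun z => G z ![a, b]) y u := by
    intro a b
    have := ((ContinuousMultilinearMap.apply ℝ (fun _ : Fin 2 => Coord n) ℝ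
      ![a, b]).hasFDerivAt.comp y hG.hasFDerivAt).fderiv
    have e : (fun z => G z ![a, b]) = (ContinuousMultilinearMap.apply ℝ (fun _ : Fin 2 => Coord n) ℝ
      ![a, b]) ∘ G := rfl
    rw [e, this]; rfl
  rw [h, h, Filter.EventuallyEq.fderiv_eq (hm.mono fun z hz => hz.symm v w)]

theorem gamC_symm {G : Coord n → Tens n 2} {y : Coord n} (hG : DifferentiableAt ℝ G y)
    (hm : ∀ᶠ z in 𝓝 y, IsMet (G z)) (u v : Coord n) : gamC G y u v = gamC G y v u := by
  refine hm.self_of_nhds.eq_of_forall fun w => ?_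
  rw [koszul hG hm.self_of_nhds, koszul hG hm.self_of_nhds, fderiv_symm_of_isMet hG hm w u v]
  ring

/-- The Koszul formula for the pulled back metric contains six terms with second derivatives of `τ`.
By symmetry four of them cancel and two agree, which leaves the inhomogeneous term. -/
theorem gamC_pbC {τ : Coord n → Coord n} {G : Coord n → Tens n 2} {z : Coord n}
    (hτ : ContDiffAt ℝ 2 τ z) (hG : DifferentiableAt ℝ G (τ z)) (hm : ∀ᶠ y in 𝓝 (τ z), IsMet (G y))
    (hinv : (fderiv ℝ τ z).IsInvertible) (u v : Coord n) :
    fderiv ℝ τ z (gamC (pbC τ G) z u v) =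
      gamC G (τ z) (fderiv ℝ τ z u) (fderiv ℝ τ z v) + fderiv ℝ (fderiv ℝ τ) z u v := by
  have hsymm : IsSymmSndFDerivAt ℝ τ z := hτ.isSymmSndFDerivAt (by simp)
  have hmz := hm.self_of_nhds
  have hm' : IsMet (pbC τ G z) := hmz.comp hinv.injective
  refine hmz.eq_of_forall fun w' => ?_
  obtain ⟨w, rfl⟩ := hinv.surjective w'
  have e : ∀ a b, pbC τ G z ![a, b] = G (τ z) ![fderiv ℝ τ z a, fderiv ℝ τ z b] := fun a b => by
    rw [pbC, ContinuousMultilinearMap.compContinuousLinearMap_apply, comp_vec2]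
  rw [← e, koszul (differentiableAt_pbC hτ hG) hm', tens2_add_left, koszul hG hmz,
    fderiv_pbC hτ hG, fderiv_pbC hτ hG, fderiv_pbC hτ hG]
  simp only [Fin.sum_univ_two, comp_vec2, update_vec2_zero, update_vec2_one,
    Matrix.cons_val_zero, Matrix.cons_val_one]
  rw [hsymm.eq v u, hsymm.eq w u, hsymm.eq w v,
    hmz.symm (fderiv ℝ τ z u) (fderiv ℝ (fderiv ℝ τ) z v w),
    hmz.symm (fderiv ℝ τ z v) (fderiv ℝ (fderiv ℝ τ) z u w)]
  ring

/-- The inhomogeneous terms of the Christoffel symbols cancel the second derivatives of `τ` produced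
by `fderiv_pbC`, argument by argument. -/
theorem nablaC_pbC {τ : Coord n → Coord n} {G : Coord n → Tens n 2} {t : Coord n → Tens n r}
    {z : Coord n} (hτ : ContDiffAt ℝ 2 τ z) (hG : DifferentiableAt ℝ G (τ z))
    (hm : ∀ᶠ y in 𝓝 (τ z), IsMet (G y)) (ht : DifferentiableAt ℝ t (τ z))
    (hinv : (fderiv ℝ τ z).IsInvertible) :
    nablaC (pbC τ G) (pbC τ t) z = pbC τ (nablaC G t) z := by
  ext v
  rw [nablaC_apply _ (differentiableAt_pbC hτ ht), pbC.eq_def τ (nablaC G t),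
    ContinuousMultilinearMap.compContinuousLinearMap_apply, nablaC_apply _ ht,
    sub_apply, sub_apply, fderiv_pbC hτ ht]
  have e : (Fin.tail fun i => fderiv ℝ τ z (v i)) = fun a => fderiv ℝ τ z (Fin.tail v a) := rfl
  rw [e, act_apply, act_apply, add_sub_assoc, sub_eq_add_neg (fderiv ℝ t _ _ _)]
  congr 1
  rw [← Finset.sum_sub_distrib, ← Finset.sum_neg_distrib]
  refine Finset.sum_congr rfl fun a _ => ?_
  rw [pbC, ContinuousMultilinearMap.compContinuousLinearMap_apply]
  have e2 : (fun i => fderiv ℝ τ z (Function.update (Fin.tail v) a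
      (gamC (pbC τ G) z (v 0) (Fin.tail v a)) i)) =
      Function.update (fun a => fderiv ℝ τ z (Fin.tail v a)) a
        (fderiv ℝ τ z (gamC (pbC τ G) z (v 0) (Fin.tail v a))) := by
    funext b
    by_cases hb : b = a
    · subst hb; simp
    · simp [hb]
  rw [e2, gamC_pbC hτ hG hm hinv, ContinuousMultilinearMap.map_update_add]
  ring

/-! ### Curvature -/

/-- The curvature tensor `R(u, v) w` as a trilinear map. -/
def curvL (G : Coord n → Tens n 2) (y : Coord n) :
    Coord n →L[ℝ] Coord n →L[ℝ] Coord n →L[ℝ] Coord n :=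
  let D := fderiv ℝ (gamC G) y
  let Q := (ContinuousLinearMap.compL ℝ (Coord n) (Coord n) (Coord n)).bilinearComp
    (gamC G y) (gamC G y)
  D - D.flip + Q - Q.flip

theorem curvL_apply (G : Coord n → Tens n 2) (y u v w : Coord n) :
    curvL G y u v w = fderiv ℝ (gamC G) y u v w - fderiv ℝ (gamC G) y v u w +
      gamC G y u (gamC G y v w) - gamC G y v (gamC G y u w) := rfl

theorem curvC_eq {G : Coord n → Tens n 2} {y : Coord n} (h : DifferentiableAt ℝ (gamC G) y)
    (i j k l : Fin (n + 1)) :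
    curvC G y i j k l = curvL G y (basisVec i) (basisVec j) (basisVec k) l := by
  have e : ∀ i l j k, pd i (christC G l j k) y =
      fderiv ℝ (gamC G) y (basisVec i) (basisVec j) (basisVec k) l := by
    intro i l j k
    have := pd_clm_comp ((EuclideanSpace.proj l : Coord n →L[ℝ] ℝ).comp
      ((ContinuousLinearMap.apply ℝ (Coord n) (basisVec k : Coord n)).comp
        (ContinuousLinearMap.apply ℝ (Coord n →L[ℝ] Coord n) (basisVec j : Coord n)))) h i
    have e : christC G l j k = fun y => gamC G y (basisVec j) (basisVec k) l :=
      funext fun y => (gamC_basisVec G y j k l).symm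
    rw [e]
    exact this
  have e2 : ∀ a b c, gamC G y (basisVec a) (gamC G y (basisVec b) (basisVec c)) l =
      ∑ m, christC G m b c y * christC G l a m y := by
    intro a b c
    rw [gamC_basisVec' G y b c]
    simp only [map_sum, map_smul, WithLp.ofLp_sum, Finset.sum_apply, PiLp.smul_apply, gamC_basisVec,
      smul_eq_mul]
  rw [curvC, curvL_apply, e, e, Finset.sum_sub_distrib, ← e2, ← e2]
  simp only [PiLp.sub_apply, PiLp.add_apply]
  ring

theorem contDiffAt_gramT_inv {G : Coord n → Tens n 2} {y : Coord n} {N : ℕ∞ω}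
    (hG : ContDiffAt ℝ N G y) (hm : IsMet (G y)) (i j : Fin (n + 1)) :
    ContDiffAt ℝ N (fun z => (gramT (G z))⁻¹ i j) y := by
  have hent : ∀ a b, ContDiffAt ℝ N (fun z => gramT (G z) a b) y := fun a b =>
    (ContinuousMultilinearMap.apply ℝ (fun _ : Fin 2 => Coord n) ℝ _).contDiff.contDiffAt.comp y hG
  have hdet : ∀ A : Coord n → Matrix (Fin (n + 1)) (Fin (n + 1)) ℝ,
      (∀ a b, ContDiffAt ℝ N (fun z => A z a b) y) → ContDiffAt ℝ N (fun z => (A z).det) y := by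
    intro A hA
    simp only [Matrix.det_apply]
    refine ContDiffAt.sum fun σ _ => ContDiffAt.const_smul _ ?_
    exact contDiffAt_prod fun a _ => hA _ _
  simp only [gramT_inv_apply]
  refine ((hdet _ hent).inv hm.isUnit_det.ne_zero).mul ?_
  simp only [Matrix.adjugate_apply]
  refine hdet _ fun a b => ?_
  by_cases ha : a = j
  · subst ha; simp only [Matrix.updateRow_self]; exact contDiffAt_const
  · simp only [Matrix.updateRow_ne ha]; exact hent a b

theorem contDiffAt_gamC {G : Coord n → Tens n 2} {y : Coord n} {N : ℕ}
    (hG : ContDiffAt ℝ (N + 1) G y) (hm : IsMet (G y)) : ContDiffAt ℝ N (gamC G) y := by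
  have hpd : ∀ a b c, ContDiffAt ℝ N (fun y => pd c (fun z => gramT (G z) a b) y) y := by
    intro a b c
    have : ContDiffAt ℝ (N + 1) (fun z => gramT (G z) a b) y :=
      (ContinuousMultilinearMap.apply ℝ (fun _ : Fin 2 => Coord n) ℝ _).contDiff.contDiffAt.comp y hG
    exact (this.fderiv_right le_rfl).clm_apply contDiffAt_const
  have hchr : ∀ m i j, ContDiffAt ℝ N (christC G m i j) y := by
    intro m i j
    refine contDiffAt_const.mul (ContDiffAt.sum fun l _ => ?_)
    exact (contDiffAt_gramT_inv (hG.of_le (by norm_cast; omega)) hm m l).mul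
      (((hpd _ _ _).add (hpd _ _ _)).sub (hpd _ _ _))
  exact ContDiffAt.sum fun x _ => (hchr _ _ _).smul contDiffAt_const

theorem differentiableAt_gamC {G : Coord n → Tens n 2} {y : Coord n}
    (hG : ContDiffAt ℝ 2 G y) (hm : IsMet (G y)) : DifferentiableAt ℝ (gamC G) y :=
  (contDiffAt_gamC (N := 1) (by norm_num; exact hG) hm).differentiableAt (by norm_num)

theorem contDiffAt_pbC {τ : Coord n → Coord n} {t : Coord n → Tens n r} {z : Coord n} {N : ℕ}
    (hτ : ContDiffAt ℝ (N + 1) τ z) (ht : ContDiffAt ℝ N t (τ z)) :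
    ContDiffAt ℝ N (pbC τ t) z := by
  have h := (ContinuousMultilinearMap.compContinuousLinearMapContinuousMultilinear ℝ
    (fun _ : Fin r => Coord n) (fun _ => Coord n) ℝ).contDiff (n := N)
  have h1 : ContDiffAt ℝ N (fun z => fun _ : Fin r => fderiv ℝ τ z) z :=
    contDiffAt_pi.2 fun _ => hτ.fderiv_right le_rfl
  exact (h.contDiffAt.comp z h1).clm_apply (ht.comp z (hτ.of_le (by norm_cast; omega)))

theorem fderiv_gamC_pbC {τ : Coord n → Coord n} {G : Coord n → Tens n 2} {z : Coord n}
    (hτ : ContDiffAt ℝ 3 τ z) (hG : ContDiffAt ℝ 2 G (τ z)) (hm : ∀ᶠ y in 𝓝 (τ z), IsMet (G y))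
    (hinv : ∀ᶠ z' in 𝓝 z, (fderiv ℝ τ z').IsInvertible) :
    ∀ x a b, fderiv ℝ (fderiv ℝ τ) z x (gamC (pbC τ G) z a b) +
      fderiv ℝ τ z (fderiv ℝ (gamC (pbC τ G)) z x a b) =
      fderiv ℝ (gamC G) (τ z) (fderiv ℝ τ z x) (fderiv ℝ τ z a) (fderiv ℝ τ z b) +
      gamC G (τ z) (fderiv ℝ (fderiv ℝ τ) z x a) (fderiv ℝ τ z b) +
      gamC G (τ z) (fderiv ℝ τ z a) (fderiv ℝ (fderiv ℝ τ) z x b) +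
      fderiv ℝ (fderiv ℝ (fderiv ℝ τ)) z x a b := by
  have hτ2 : ContDiffAt ℝ 2 τ z := hτ.of_le (by norm_num)
  have h1 : DifferentiableAt ℝ τ z := hτ.differentiableAt (by norm_num)
  have hf : ContDiffAt ℝ 2 (fderiv ℝ τ) z := hτ.fderiv_right (by norm_num)
  have h2 : DifferentiableAt ℝ (fderiv ℝ τ) z := hf.differentiableAt (by norm_num)
  have h3 : DifferentiableAt ℝ (fderiv ℝ (fderiv ℝ τ)) z :=
    (hf.fderiv_right (m := 1) (by norm_num)).differentiableAt (by norm_num)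
  have hmz := hm.self_of_nhds
  have hcont : ContinuousAt τ z := h1.continuousAt
  have hm' : IsMet (pbC τ G z) := hmz.comp hinv.self_of_nhds.injective
  have hΓ : DifferentiableAt ℝ (gamC G) (τ z) := differentiableAt_gamC hG hmz
  have hΓ' : DifferentiableAt ℝ (gamC (pbC τ G)) z :=
    differentiableAt_gamC (contDiffAt_pbC (N := 2) (by norm_num; exact hτ) hG) hm'
  have hGd : ∀ᶠ y in 𝓝 (τ z), DifferentiableAt ℝ G y :=
    (hG.eventually (by simp)).mono fun y hy => hy.differentiableAt (by norm_num)
  -- The transformation law holds on a whole neighbourhood of `z` and can therefore be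
  -- differentiated at `z`.
  have hev : ∀ a b, ∀ᶠ z' in 𝓝 z, fderiv ℝ τ z' (gamC (pbC τ G) z' a b) =
      gamC G (τ z') (fderiv ℝ τ z' a) (fderiv ℝ τ z' b) + fderiv ℝ (fderiv ℝ τ) z' a b := by
    intro a b
    filter_upwards [hτ2.eventually (by simp), hcont.eventually hGd,
      hcont.eventually hm.eventually_nhds, hinv] with z' a1 a2 a3 a4
    exact gamC_pbC a1 a2 a3 a4 a b
  intro x a b
  have e3 := Filter.EventuallyEq.fderiv_eq (𝕜 := ℝ) (hev a b)
  have eL := (h2.hasFDerivAt.clm_apply ((hΓ'.hasFDerivAt.clm_apply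
    (hasFDerivAt_const a z)).clm_apply (hasFDerivAt_const b z))).fderiv
  have eR := ((((hΓ.hasFDerivAt.comp z h1.hasFDerivAt).clm_apply (h2.hasFDerivAt.clm_apply
    (hasFDerivAt_const a z))).clm_apply (h2.hasFDerivAt.clm_apply
    (hasFDerivAt_const b z))).add ((h3.hasFDerivAt.clm_apply
    (hasFDerivAt_const a z)).clm_apply (hasFDerivAt_const b z))).fderiv
  have e4 := congrArg (fun L : Coord n →L[ℝ] Coord n => L x) (eL.symm.trans (e3.trans eR))
  simp at e4
  rw [add_comm, e4]
  abel

/-- Antisymmetrization in `u` and `v` removes the third derivative of `τ`, which is symmetric in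
them; the second derivatives cancel against those in the quadratic terms. -/
theorem curvL_pbC {τ : Coord n → Coord n} {G : Coord n → Tens n 2} {z : Coord n}
    (hτ : ContDiffAt ℝ 3 τ z) (hG : ContDiffAt ℝ 2 G (τ z)) (hm : ∀ᶠ y in 𝓝 (τ z), IsMet (G y))
    (hinv : ∀ᶠ z' in 𝓝 z, (fderiv ℝ τ z').IsInvertible) (u v w : Coord n) :
    fderiv ℝ τ z (curvL (pbC τ G) z u v w) =
      curvL G (τ z) (fderiv ℝ τ z u) (fderiv ℝ τ z v) (fderiv ℝ τ z w) := by
  have hτ2 : ContDiffAt ℝ 2 τ z := hτ.of_le (by norm_num)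
  have hf : ContDiffAt ℝ 2 (fderiv ℝ τ) z := hτ.fderiv_right (by norm_num)
  have hs : IsSymmSndFDerivAt ℝ τ z := hτ2.isSymmSndFDerivAt (by simp)
  have hs3 : IsSymmSndFDerivAt ℝ (fderiv ℝ τ) z := hf.isSymmSndFDerivAt (by simp)
  have hz := gamC_pbC hτ2 (hG.differentiableAt (by norm_num)) hm hinv.self_of_nhds
  have d1 := fderiv_gamC_pbC hτ hG hm hinv u v w
  have d2 := fderiv_gamC_pbC hτ hG hm hinv v u w
  rw [curvL_apply, curvL_apply]
  simp only [map_add, map_sub]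
  rw [← eq_sub_iff_add_eq'] at d1 d2
  rw [d1, d2, hz u, hz v (gamC _ _ _ _), hz v w, hz u w, hs.eq v u, hs3.eq v u]
  simp only [map_add]
  abel

end Naturality

end

end WeakAH

namespace WeakAH

noncomputable section

/-! ### Invariance of contractions and norms -/

section Contractions

variable {n : ℕ}

/-- The matrix of a linear endomorphism of the coordinate space. -/
def jac (A : Coord n →L[ℝ] Coord n) : Matrix (Fin (n + 1)) (Fin (n + 1)) ℝ :=
  Matrix.of fun a i => A (basisVec i) a

theorem clm_apply_eq_jac (A : Coord n →L[ℝ] Coord n) (x : Coord n) (a : Fin (n + 1)) :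
    A x a = ∑ i, jac A a i * x i := by
  conv_lhs => rw [← sum_smul_basisVec x]
  simp [jac, mul_comm]

theorem jac_mul {A A' : Coord n →L[ℝ] Coord n} (h : ∀ x, A (A' x) = x) : jac A * jac A' = 1 := by
  ext a i
  rw [Matrix.mul_apply]
  have := clm_apply_eq_jac A (A' (basisVec i)) a
  rw [h, basisVec_apply] at this
  simpa [Matrix.one_apply, jac] using this.symm

theorem gramT_comp_eq (T : Tens n 2) (A : Coord n →L[ℝ] Coord n) :
    gramT (T.compContinuousLinearMap fun _ => A) = (jac A).transpose * gramT T * jac A := by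
  ext i j
  rw [gramT_comp, tens2_apply]
  simp only [Matrix.mul_apply, Matrix.transpose_apply, jac, Matrix.of_apply, Finset.sum_mul]
  rw [Finset.sum_comm]
  exact Finset.sum_congr rfl fun a _ => Finset.sum_congr rfl fun b _ => by ring

theorem inv_conj {H J J' : Matrix (Fin (n + 1)) (Fin (n + 1)) ℝ} (h : J * J' = 1)
    (hH : IsUnit H.det) : (J.transpose * H * J)⁻¹ = J' * H⁻¹ * J'.transpose := by
  have h' : J' * J = 1 := mul_eq_one_comm.1 h
  apply Matrix.inv_eq_right_inv
  calc J.transpose * H * J * (J' * H⁻¹ * J'.transpose)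
      = J.transpose * H * (J * J') * H⁻¹ * J'.transpose := by simp only [Matrix.mul_assoc]
    _ = J.transpose * (H * H⁻¹) * J'.transpose := by rw [h, Matrix.mul_one]; simp only [Matrix.mul_assoc]
    _ = 1 := by
      rw [Matrix.mul_nonsing_inv _ hH, Matrix.mul_one, ← Matrix.transpose_mul, h',
        Matrix.transpose_one]

theorem ctr_eq_trace (G t : Tens n 2) : ctr G t = ((gramT G)⁻¹ * (gramT t).transpose).trace := by
  simp [ctr, Matrix.trace, Matrix.mul_apply]

theorem ctr_comp {G t : Tens n 2} (hG : IsMet G) {A A' : Coord n →L[ℝ] Coord n}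
    (h : ∀ x, A (A' x) = x) :
    ctr (G.compContinuousLinearMap fun _ => A) (t.compContinuousLinearMap fun _ => A) = ctr G t := by
  have hJ := jac_mul h
  rw [ctr_eq_trace, ctr_eq_trace, gramT_comp_eq, gramT_comp_eq, inv_conj hJ hG.isUnit_det]
  simp only [Matrix.transpose_mul, Matrix.transpose_transpose]
  have e : jac A' * (gramT G)⁻¹ * (jac A').transpose * ((jac A).transpose *
      ((gramT t).transpose * jac A)) = jac A' * ((gramT G)⁻¹ * ((jac A').transpose *
      (jac A).transpose) * (gramT t).transpose * jac A) := by simp only [Matrix.mul_assoc]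
  rw [e, ← Matrix.transpose_mul, hJ, Matrix.transpose_one, Matrix.mul_one, Matrix.trace_mul_comm,
    Matrix.mul_assoc, hJ, Matrix.mul_one]

/-- The transformation law of tensors with two lower and two upper indices. -/
def trans22 (J J' : Matrix (Fin (n + 1)) (Fin (n + 1)) ℝ)
    (R : Fin (n + 1) → Fin (n + 1) → Fin (n + 1) → Fin (n + 1) → ℝ) (i j k l : Fin (n + 1)) : ℝ :=
  ∑ a, ∑ b, ∑ c, ∑ d, J a i * J b j * J' k c * J' l d * R a b c d

theorem sum_contract {J J' : Matrix (Fin (n + 1)) (Fin (n + 1)) ℝ} (h : J * J' = 1)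
    (f : Fin (n + 1) → Fin (n + 1) → ℝ) :
    ∑ j, ∑ b, ∑ d, J b j * J' j d * f b d = ∑ b, f b b := by
  have hJ : ∀ b d, ∑ j, J b j * J' j d = if b = d then 1 else 0 := fun b d => by
    rw [← Matrix.mul_apply, h, Matrix.one_apply]
  rw [Finset.sum_comm]
  refine Finset.sum_congr rfl fun b _ => ?_
  rw [Finset.sum_comm]
  simp only [← Finset.sum_mul, hJ]
  simp

/-- Each contracted pair of indices carries one factor `J` and one factor `J'`, which multiply to
the identity. Hence the scalar curvature can be computed in any coordinates. -/
theorem trace_trans22 {J J' : Matrix (Fin (n + 1)) (Fin (n + 1)) ℝ} (h : J * J' = 1)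
    (R : Fin (n + 1) → Fin (n + 1) → Fin (n + 1) → Fin (n + 1) → ℝ) :
    ∑ i, ∑ j, trans22 J J' R i j i j = ∑ i, ∑ j, R i j i j := by
  have e1 : ∀ i, ∑ j, trans22 J J' R i j i j =
      ∑ a, ∑ c, J a i * J' i c * ∑ b, R a b c b := by
    intro i
    rw [show (∑ a, ∑ c, J a i * J' i c * ∑ b, R a b c b) =
      ∑ b, ∑ a, ∑ c, J a i * J' i c * R a b c b from by
        simp only [Finset.mul_sum]
        simp only [← Fintype.sum_prod_type']
        exact Fintype.sum_equiv ⟨fun x => (x.2.2, x.1, x.2.1), fun x => (x.2.1, x.2.2, x.1),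
          fun _ => rfl, fun _ => rfl⟩ _ _ fun x => rfl,
      ← sum_contract h (fun b d => ∑ a, ∑ c, J a i * J' i c * R a b c d)]
    refine Finset.sum_congr rfl fun j _ => ?_
    rw [trans22]
    simp only [Finset.mul_sum]
    rw [Finset.sum_comm]
    refine Finset.sum_congr rfl fun b _ => ?_
    rw [show (∑ d, ∑ a, ∑ c, J b j * J' j d * (J a i * J' i c * R a b c d)) =
      ∑ a, ∑ c, ∑ d, J b j * J' j d * (J a i * J' i c * R a b c d) from by
        rw [Finset.sum_comm]
        exact Finset.sum_congr rfl fun a _ => Finset.sum_comm]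
    exact Finset.sum_congr rfl fun a _ => Finset.sum_congr rfl fun c _ =>
      Finset.sum_congr rfl fun d _ => by ring
  rw [Finset.sum_congr rfl fun i _ => e1 i, sum_contract h fun a c => ∑ b, R a b c b]

/-- The squared norm of a tensor with two lower and two upper indices. -/
def opSq (H : Matrix (Fin (n + 1)) (Fin (n + 1)) ℝ)
    (A : Fin (n + 1) → Fin (n + 1) → Fin (n + 1) → Fin (n + 1) → ℝ) : ℝ :=
  ∑ i, ∑ i', ∑ j, ∑ j', ∑ k, ∑ k', ∑ l, ∑ l',
    H⁻¹ i i' * H⁻¹ j j' * H k k' * H l l' * A i j k l * A i' j' k' l'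

-- As the quadratic form of a Kronecker product, the squared norm is visibly nonnegative for a
-- positive definite `H`, and its invariance becomes an identity between matrix products.
open Kronecker in
theorem opSq_eq_dotProduct (H : Matrix (Fin (n + 1)) (Fin (n + 1)) ℝ)
    (A : Fin (n + 1) → Fin (n + 1) → Fin (n + 1) → Fin (n + 1) → ℝ) :
    opSq H A = (fun x : (Fin (n + 1) × Fin (n + 1)) × Fin (n + 1) × Fin (n + 1) =>
        A x.1.1 x.1.2 x.2.1 x.2.2) ⬝ᵥ (((H⁻¹ ⊗ₖ H⁻¹) ⊗ₖ (H ⊗ₖ H)).mulVec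
        fun x => A x.1.1 x.1.2 x.2.1 x.2.2) := by
  simp only [opSq, dotProduct, Matrix.mulVec, Finset.mul_sum]
  simp only [← Fintype.sum_prod_type']
  refine Fintype.sum_equiv ⟨fun x => (((x.1, x.2.2.1), (x.2.2.2.2.1, x.2.2.2.2.2.2.1)),
    ((x.2.1, x.2.2.2.1), (x.2.2.2.2.2.1, x.2.2.2.2.2.2.2))),
    fun y => (y.1.1.1, y.2.1.1, y.1.1.2, y.2.1.2, y.1.2.1, y.2.2.1, y.1.2.2, y.2.2.2),
    fun _ => rfl, fun _ => rfl⟩ _ _ fun x => ?_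
  simp only [Equiv.coe_fn_mk, Matrix.kroneckerMap_apply]
  ring

open Kronecker in
theorem trans22_eq_mulVec (J J' : Matrix (Fin (n + 1)) (Fin (n + 1)) ℝ)
    (R : Fin (n + 1) → Fin (n + 1) → Fin (n + 1) → Fin (n + 1) → ℝ) :
    (fun x : (Fin (n + 1) × Fin (n + 1)) × Fin (n + 1) × Fin (n + 1) =>
      trans22 J J' R x.1.1 x.1.2 x.2.1 x.2.2) =
    ((J.transpose ⊗ₖ J.transpose) ⊗ₖ (J' ⊗ₖ J')).mulVec
      fun x => R x.1.1 x.1.2 x.2.1 x.2.2 := by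
  funext x
  simp only [trans22, Matrix.mulVec, dotProduct, Fintype.sum_prod_type, Matrix.kroneckerMap_apply,
    Matrix.transpose_apply]
  exact Finset.sum_congr rfl fun a _ => Finset.sum_congr rfl fun b _ =>
    Finset.sum_congr rfl fun c _ => Finset.sum_congr rfl fun d _ => by ring

open Kronecker in
theorem opSq_trans22 {H J J' : Matrix (Fin (n + 1)) (Fin (n + 1)) ℝ} (h : J * J' = 1)
    (hH : IsUnit H.det) (R : Fin (n + 1) → Fin (n + 1) → Fin (n + 1) → Fin (n + 1) → ℝ) :
    opSq (J.transpose * H * J) (trans22 J J' R) = opSq H R := by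
  have e1 : J * (J' * H⁻¹ * J'.transpose) * J.transpose = H⁻¹ := by
    rw [show J * (J' * H⁻¹ * J'.transpose) * J.transpose =
      (J * J') * H⁻¹ * (J'.transpose * J.transpose) by simp only [Matrix.mul_assoc],
      ← Matrix.transpose_mul, h]
    simp
  have e2 : J'.transpose * (J.transpose * H * J) * J' = H := by
    rw [show J'.transpose * (J.transpose * H * J) * J' =
      (J'.transpose * J.transpose) * H * (J * J') by simp only [Matrix.mul_assoc],
      ← Matrix.transpose_mul, h]
    simp
  rw [opSq_eq_dotProduct, opSq_eq_dotProduct, trans22_eq_mulVec, inv_conj h hH,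
    Matrix.mulVec_mulVec, dotProduct_comm, ← Matrix.dotProduct_transpose_mulVec,
    Matrix.mulVec_mulVec]
  congr 2
  rw [← Matrix.kroneckerMap_transpose, ← Matrix.kroneckerMap_transpose,
    ← Matrix.kroneckerMap_transpose,
    Matrix.transpose_transpose, ← Matrix.mul_kronecker_mul, ← Matrix.mul_kronecker_mul,
    ← Matrix.mul_kronecker_mul, ← Matrix.mul_kronecker_mul, ← Matrix.mul_kronecker_mul,
    ← Matrix.mul_kronecker_mul, ← Matrix.mul_assoc, e1, ← Matrix.mul_assoc, e2]

theorem opSq_one (A : Fin (n + 1) → Fin (n + 1) → Fin (n + 1) → Fin (n + 1) → ℝ) :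
    opSq 1 A = ∑ i, ∑ j, ∑ k, ∑ l, A i j k l ^ 2 := by
  simp only [opSq, inv_one, Matrix.one_apply]
  simp [sq, Finset.sum_ite_eq, ite_mul]

-- Factor `H = Sᵀ S` and change the frame by `S⁻¹`: the trace and the norm are invariant, and `H`
-- becomes the identity, for which every entry is bounded by the norm. The trace has `(n + 1)²`
-- entries.
open scoped MatrixOrder ComplexOrder Matrix.Norms.L2Operator in
theorem abs_trace_le_opSq {H : Matrix (Fin (n + 1)) (Fin (n + 1)) ℝ} (hH : H.PosDef)
    (R : Fin (n + 1) → Fin (n + 1) → Fin (n + 1) → Fin (n + 1) → ℝ) :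
    |∑ i, ∑ j, R i j i j| ≤ (n + 1) ^ 2 * √(opSq H R) := by
  obtain ⟨S, hS⟩ := CStarAlgebra.nonneg_iff_eq_star_mul_self.mp hH.posSemidef.nonneg
  have hS' : H = S.transpose * S := by rw [hS]; rfl
  have hdet : IsUnit S.det := by
    have := hH.det_pos.ne'
    rw [hS', Matrix.det_mul] at this
    exact (right_ne_zero_of_mul this).isUnit
  have h1 : S⁻¹ * S = 1 := Matrix.nonsing_inv_mul _ hdet
  have h2 : (S⁻¹).transpose * H * S⁻¹ = 1 := by
    rw [hS', show (S⁻¹).transpose * (S.transpose * S) * S⁻¹ =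
      ((S⁻¹).transpose * S.transpose) * (S * S⁻¹) by simp only [Matrix.mul_assoc],
      ← Matrix.transpose_mul, Matrix.mul_nonsing_inv _ hdet]
    simp
  rw [← opSq_trans22 h1 hH.det_pos.ne'.isUnit R, h2, opSq_one, ← trace_trans22 h1 R]
  set A := trans22 S⁻¹ S R
  have key : ∀ i j, |A i j i j| ≤ √(∑ i, ∑ j, ∑ k, ∑ l, A i j k l ^ 2) := by
    intro i j
    refine Real.abs_le_sqrt ?_
    have s1 : ∀ {f : Fin (n + 1) → ℝ}, (∀ x, 0 ≤ f x) → ∀ x, f x ≤ ∑ y, f y := fun hf x =>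
      Finset.single_le_sum (fun y _ => hf y) (Finset.mem_univ x)
    refine (s1 (f := fun l => A i j i l ^ 2) (fun _ => by positivity) j).trans ?_
    refine (s1 (f := fun k => ∑ l, A i j k l ^ 2) (fun _ => by positivity) i).trans ?_
    refine (s1 (f := fun j => ∑ k, ∑ l, A i j k l ^ 2) (fun _ => by positivity) j).trans ?_
    exact s1 (f := fun i => ∑ j, ∑ k, ∑ l, A i j k l ^ 2) (fun _ => by positivity) i
  calc |∑ i, ∑ j, A i j i j| ≤ ∑ i, ∑ j, |A i j i j| :=
        (Finset.abs_sum_le_sum_abs _ _).trans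
          (Finset.sum_le_sum fun i _ => Finset.abs_sum_le_sum_abs _ _)
    _ ≤ ∑ _i : Fin (n + 1), ∑ _j : Fin (n + 1), √(∑ i, ∑ j, ∑ k, ∑ l, A i j k l ^ 2) :=
        Finset.sum_le_sum fun i _ => Finset.sum_le_sum fun j _ => key i j
    _ = _ := by simp; ring

theorem opSq_le {H : Matrix (Fin (n + 1)) (Fin (n + 1)) ℝ} {C C' m : ℝ}
    (h1 : ∀ i j, |H i j| ≤ C) (h2 : ∀ i j, |H⁻¹ i j| ≤ C')
    {R : Fin (n + 1) → Fin (n + 1) → Fin (n + 1) → Fin (n + 1) → ℝ}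
    (hR : ∀ i j k l, |R i j k l| ≤ m) : opSq H R ≤ (n + 1) ^ 8 * (C' * C) ^ 2 * m ^ 2 := by
  have hC : 0 ≤ C := (abs_nonneg _).trans (h1 0 0)
  have hC' : 0 ≤ C' := (abs_nonneg _).trans (h2 0 0)
  have hm : 0 ≤ m := (abs_nonneg _).trans (hR 0 0 0 0)
  have key : ∀ i i' j j' k k' l l', H⁻¹ i i' * H⁻¹ j j' * H k k' * H l l' * R i j k l *
      R i' j' k' l' ≤ (C' * C) ^ 2 * m ^ 2 := by
    intro i i' j j' k k' l l'
    refine (le_abs_self _).trans ?_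
    simp only [abs_mul]
    calc _ ≤ C' * C' * C * C * m * m := by
          gcongr <;> first | apply h1 | apply h2 | apply hR
      _ = _ := by ring
  have s1 : ∀ {f : Fin (n + 1) → ℝ} {c : ℝ}, (∀ x, f x ≤ c) → ∑ x, f x ≤ (n + 1) * c :=
    fun hf => (Finset.sum_le_card_nsmul _ _ _ fun x _ => hf x).trans_eq (by simp)
  refine (s1 fun i => s1 fun i' => s1 fun j => s1 fun j' => s1 fun k => s1 fun k' => s1 fun l =>
    s1 fun l' => key i i' j j' k k' l l').trans_eq (by ring)

theorem opSq_nonneg {H : Matrix (Fin (n + 1)) (Fin (n + 1)) ℝ} (hH : H.PosDef)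
    (A : Fin (n + 1) → Fin (n + 1) → Fin (n + 1) → Fin (n + 1) → ℝ) : 0 ≤ opSq H A := by
  rw [opSq_eq_dotProduct]
  have h := (hH.inv.posSemidef.kronecker hH.inv.posSemidef).kronecker
    (hH.posSemidef.kronecker hH.posSemidef)
  simpa using h.dotProduct_mulVec_nonneg fun x => A x.1.1 x.1.2 x.2.1 x.2.2

/-- Parallelogram identity, with the squared norm of the difference dropped. It serves as a triangle
inequality for squared norms. -/
theorem opSq_add_le {H : Matrix (Fin (n + 1)) (Fin (n + 1)) ℝ} (hH : H.PosDef)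
    (A A' : Fin (n + 1) → Fin (n + 1) → Fin (n + 1) → Fin (n + 1) → ℝ) :
    opSq H (fun i j k l => A i j k l + A' i j k l) ≤ 2 * opSq H A + 2 * opSq H A' := by
  have h := opSq_nonneg hH fun i j k l => A i j k l - A' i j k l
  have e : opSq H (fun i j k l => A i j k l + A' i j k l) +
      opSq H (fun i j k l => A i j k l - A' i j k l) = 2 * opSq H A + 2 * opSq H A' := by
    simp only [opSq, ← Finset.sum_add_distrib, Finset.mul_sum]
    iterate 8 refine Finset.sum_congr rfl fun _ _ => ?_
    ring
  linarith

/-- The vector dual to the coordinate `l` with respect to a metric. -/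
def sharp (T : Tens n 2) (l : Fin (n + 1)) : Coord n :=
  ∑ q, (gramT T)⁻¹ l q • (basisVec q : Coord n)

theorem sharp_apply (T : Tens n 2) (l q : Fin (n + 1)) : sharp T l q = (gramT T)⁻¹ l q := by
  simp [sharp]

theorem IsMet.sharp_left {T : Tens n 2} (h : IsMet T) (l : Fin (n + 1)) (w : Coord n) :
    T ![sharp T l, w] = w l := by
  rw [tens2_apply]
  simp only [sharp_apply]
  rw [Finset.sum_comm]
  have : ∀ j, ∑ q, (gramT T)⁻¹ l q * w j * gramT T q j = if l = j then w j else 0 := by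
    intro j
    calc _ = (∑ q, (gramT T)⁻¹ l q * gramT T q j) * w j := by
          rw [Finset.sum_mul]; exact Finset.sum_congr rfl fun q _ => by ring
      _ = _ := by
        rw [← Matrix.mul_apply, Matrix.nonsing_inv_mul _ h.isUnit_det, Matrix.one_apply]; simp
  simp [this]

theorem riemC_eq {G : Coord n → Tens n 2} {y : Coord n} (h : DifferentiableAt ℝ (gamC G) y)
    (i j k l : Fin (n + 1)) :
    riemC G y i j k l = curvL G y (basisVec i) (basisVec j) (sharp (G y) l) k := by
  simp [riemC, sharp, curvC_eq h]

/-- Both sides are tested against all vectors: `sharp` is characterized by reproducing a coordinate,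
and coordinates transform by the inverse Jacobian. -/
theorem sharp_comp {T : Tens n 2} (h : IsMet T) {A A' : Coord n →L[ℝ] Coord n}
    (h1 : ∀ x, A (A' x) = x) (h2 : ∀ x, A' (A x) = x) (l : Fin (n + 1)) :
    A (sharp (T.compContinuousLinearMap fun _ => A) l) = ∑ d, jac A' l d • sharp T d := by
  have hinj : Function.Injective A := Function.LeftInverse.injective h2
  refine h.eq_of_forall fun w => ?_
  rw [← h1 w]
  have e : T ![A (sharp (T.compContinuousLinearMap fun _ => A) l), A (A' w)] =
      (T.compContinuousLinearMap fun _ => A) ![sharp (T.compContinuousLinearMap fun _ => A) l,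
        A' w] := by
    rw [ContinuousMultilinearMap.compContinuousLinearMap_apply, comp_vec2]
  rw [e, (h.comp hinj).sharp_left, h1, clm_apply_eq_jac]
  have : ∀ x, T ![x, w] = T.toContinuousLinearMap ![0, w] 0 x := fun x => by
    change _ = T (Function.update _ _ _); rw [update_vec2_zero]
  rw [this, map_sum]
  refine Finset.sum_congr rfl fun d _ => ?_
  rw [map_smul, ← this, h.sharp_left, smul_eq_mul]

theorem riemC_pbC {τ : Coord n → Coord n} {G : Coord n → Tens n 2} {z : Coord n}
    (hτ : ContDiffAt ℝ 3 τ z) (hG : ContDiffAt ℝ 2 G (τ z)) (hm : ∀ᶠ y in 𝓝 (τ z), IsMet (G y))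
    (hinv : ∀ᶠ z' in 𝓝 z, (fderiv ℝ τ z').IsInvertible) {A' : Coord n →L[ℝ] Coord n}
    (h1 : ∀ x, fderiv ℝ τ z (A' x) = x) (h2 : ∀ x, A' (fderiv ℝ τ z x) = x)
    (i j k l : Fin (n + 1)) :
    riemC (pbC τ G) z i j k l = trans22 (jac (fderiv ℝ τ z)) (jac A') (riemC G (τ z)) i j k l := by
  have hm' : IsMet (pbC τ G z) := hm.self_of_nhds.comp hinv.self_of_nhds.injective
  rw [riemC_eq (differentiableAt_gamC (contDiffAt_pbC (N := 2) (by norm_num; exact hτ) hG) hm')]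
  have e := curvL_pbC hτ hG hm hinv (basisVec i) (basisVec j) (sharp (pbC τ G z) l)
  rw [← h2 (curvL (pbC τ G) z _ _ _), e, pbC, sharp_comp hm.self_of_nhds h1 h2,
    clm_apply_eq_jac A']
  have hb : ∀ i, fderiv ℝ τ z (basisVec i) = ∑ a, jac (fderiv ℝ τ z) a i • (basisVec a : Coord n) :=
    fun i => (sum_smul_basisVec (fderiv ℝ τ z (basisVec i))).symm
  rw [hb i, hb j]
  simp only [map_sum, map_smul, sum_apply, smul_apply, WithLp.ofLp_sum, Finset.sum_apply,
    PiLp.smul_apply, smul_eq_mul, ← riemC_eq (differentiableAt_gamC hG hm.self_of_nhds)]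
  simp only [trans22, Finset.mul_sum]
  simp only [← Fintype.sum_prod_type']
  refine Fintype.sum_equiv ⟨fun x => (x.2.2.2, x.2.2.1, x.1, x.2.1),
    fun x => (x.2.2.1, x.2.2.2, x.2.1, x.1), fun _ => rfl, fun _ => rfl⟩ _ _ fun x => ?_
  simp only [Equiv.coe_fn_mk]
  ring

end Contractions

end

end WeakAH

namespace WeakAH

noncomputable section

/-! ### Conformal changes -/

section Conformal

variable {n : ℕ}

/-- The conformal metric `e^{2 φ} G`. -/
def conf (φ : Coord n → ℝ) (G : Coord n → Tens n 2) (y : Coord n) : Tens n 2 :=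
  Real.exp (2 * φ y) • G y

/-- The gradient of a function. -/
def gradC (φ : Coord n → ℝ) (G : Coord n → Tens n 2) (y : Coord n) : Coord n :=
  ∑ l, pd l φ y • sharp (G y) l

/-- The squared norm of the differential of a function. -/
def normSqC (φ : Coord n → ℝ) (G : Coord n → Tens n 2) (y : Coord n) : ℝ :=
  ∑ j, ∑ l, (gramT (G y))⁻¹ j l * (pd j φ y * pd l φ y)

/-- The Hessian of a function. -/
def hessC (φ : Coord n → ℝ) (G : Coord n → Tens n 2) (y : Coord n) (j q : Fin (n + 1)) : ℝ :=
  pd j (pd q φ) y - ∑ m, christC G m j q y * pd m φ y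

/-- The tensor governing the conformal change of the curvature. -/
def confB (φ : Coord n → ℝ) (G : Coord n → Tens n 2) (y : Coord n) (j q : Fin (n + 1)) : ℝ :=
  -hessC φ G y j q + pd j φ y * pd q φ y - 1 / 2 * normSqC φ G y * gramT (G y) j q

/-- The tensor `confB` with its second index raised. -/
def confBup (φ : Coord n → ℝ) (G : Coord n → Tens n 2) (y : Coord n) (j l : Fin (n + 1)) : ℝ :=
  ∑ q, (gramT (G y))⁻¹ l q * confB φ G y j q

theorem tens2_add_right (T : Tens n 2) (u v v' : Coord n) :
    T ![u, v + v'] = T ![u, v] + T ![u, v'] := by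
  simpa [update_vec2_one] using T.map_update_add ![u, v] 1 v v'

theorem tens2_smul_right (T : Tens n 2) (c : ℝ) (u v : Coord n) :
    T ![u, c • v] = c * T ![u, v] := by
  simpa [update_vec2_one] using T.map_update_smul ![u, v] 1 c v

theorem tens2_sub_right (T : Tens n 2) (u v v' : Coord n) :
    T ![u, v - v'] = T ![u, v] - T ![u, v'] := by
  simpa [update_vec2_one] using T.map_update_sub ![u, v] 1 v v'

theorem tens2_sum_left {κ : Type*} (A : Finset κ) (T : Tens n 2) (u : κ → Coord n) (v : Coord n) :
    T ![∑ a ∈ A, u a, v] = ∑ a ∈ A, T ![u a, v] := by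
  have : ∀ x, T ![x, v] = T.toContinuousLinearMap ![0, v] 0 x := fun x => by
    change _ = T (Function.update _ _ _); rw [update_vec2_zero]
  simp only [this, map_sum]

theorem IsMet.smul {T : Tens n 2} (h : IsMet T) {c : ℝ} (hc : 0 < c) : IsMet (c • T) :=
  ⟨fun v w => by simp [h.symm v w], fun v hv => by simpa using mul_pos hc (h.pos v hv)⟩

theorem gramT_smul (c : ℝ) (T : Tens n 2) : gramT (c • T) = c • gramT T := rfl

theorem IsMet.gramT_smul_inv {T : Tens n 2} (h : IsMet T) {c : ℝ} (hc : c ≠ 0) :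
    (gramT (c • T))⁻¹ = c⁻¹ • (gramT T)⁻¹ := by
  rw [gramT_smul]
  apply Matrix.inv_eq_right_inv
  rw [Matrix.smul_mul, Matrix.mul_smul, smul_smul, mul_inv_cancel₀ hc, one_smul,
    Matrix.mul_nonsing_inv _ h.isUnit_det]

theorem IsMet.sharp_smul {T : Tens n 2} (h : IsMet T) {c : ℝ} (hc : c ≠ 0) (l : Fin (n + 1)) :
    sharp (c • T) l = c⁻¹ • sharp T l := by
  ext q; simp [sharp_apply, h.gramT_smul_inv hc]

theorem gradC_left {φ : Coord n → ℝ} {G : Coord n → Tens n 2} {y : Coord n} (hm : IsMet (G y))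
    (w : Coord n) : G y ![gradC φ G y, w] = fderiv ℝ φ y w := by
  rw [gradC, tens2_sum_left, fderiv_apply_eq_sum_pd]
  exact Finset.sum_congr rfl fun l _ => by
    rw [tens2_smul_left, hm.sharp_left, mul_comm]

theorem fderiv_gradC {φ : Coord n → ℝ} {G : Coord n → Tens n 2} {y : Coord n} :
    fderiv ℝ φ y (gradC φ G y) = normSqC φ G y := by
  rw [gradC, map_sum, normSqC]
  refine Finset.sum_congr rfl fun j _ => ?_
  rw [map_smul, fderiv_apply_eq_sum_pd, smul_eq_mul, Finset.mul_sum]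
  exact Finset.sum_congr rfl fun l _ => by rw [sharp_apply]; ring

theorem fderiv_conf {φ : Coord n → ℝ} {G : Coord n → Tens n 2} {y : Coord n}
    (hφ : DifferentiableAt ℝ φ y) (hG : DifferentiableAt ℝ G y) (u a b : Coord n) :
    fderiv ℝ (conf φ G) y u ![a, b] = Real.exp (2 * φ y) *
      (2 * fderiv ℝ φ y u * G y ![a, b] + fderiv ℝ G y u ![a, b]) := by
  have := ((hφ.hasFDerivAt.const_mul 2).exp.smul hG.hasFDerivAt).fderiv
  change fderiv ℝ ((fun y => Real.exp (2 * φ y)) • G) y u _ = _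
  rw [this]
  simp
  ring

/-- It is enough to check the Koszul identity for the conformal metric, where the extra terms come
from differentiating the factor `exp (2 φ)`. -/
theorem gamC_conf {φ : Coord n → ℝ} {G : Coord n → Tens n 2} {y : Coord n}
    (hφ : DifferentiableAt ℝ φ y) (hG : DifferentiableAt ℝ G y) (hm : IsMet (G y))
    (u v : Coord n) :
    gamC (conf φ G) y u v = gamC G y u v + fderiv ℝ φ y u • v + fderiv ℝ φ y v • u -
      G y ![u, v] • gradC φ G y := by
  have hd : DifferentiableAt ℝ (conf φ G) y :=
    ((hφ.hasFDerivAt.const_mul 2).exp.smul hG.hasFDerivAt).differentiableAt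
  refine gamC_eq_of_koszul hd (hm.smul (Real.exp_pos _)) fun w => ?_
  rw [fderiv_conf hφ hG, fderiv_conf hφ hG, fderiv_conf hφ hG, conf, smul_apply, smul_eq_mul,
    tens2_sub_left, tens2_add_left, tens2_add_left, koszul hG hm, tens2_smul_left, tens2_smul_left,
    tens2_smul_left, gradC_left hm]
  ring

theorem metric_compat {G : Coord n → Tens n 2} {y : Coord n} (hG : DifferentiableAt ℝ G y)
    (hm : ∀ᶠ z in 𝓝 y, IsMet (G z)) (x a b : Coord n) :
    fderiv ℝ G y x ![a, b] = G y ![gamC G y x a, b] + G y ![a, gamC G y x b] := by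
  have hmy := hm.self_of_nhds
  rw [hmy.symm a, koszul hG hmy, koszul hG hmy, fderiv_symm_of_isMet hG hm a x b,
    fderiv_symm_of_isMet hG hm b x a, fderiv_symm_of_isMet hG hm x b a]
  ring

theorem contDiffAt_pd {φ : Coord n → ℝ} {y : Coord n} {N : ℕ} (hφ : ContDiffAt ℝ (N + 1) φ y)
    (j : Fin (n + 1)) : ContDiffAt ℝ N (pd j φ) y :=
  (hφ.fderiv_right le_rfl).clm_apply contDiffAt_const

theorem contDiffAt_gradC {φ : Coord n → ℝ} {G : Coord n → Tens n 2} {y : Coord n}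
    (hφ : ContDiffAt ℝ 2 φ y) (hG : ContDiffAt ℝ 2 G y) (hm : IsMet (G y)) :
    DifferentiableAt ℝ (gradC φ G) y := by
  have h : ContDiffAt ℝ 1 (gradC φ G) y := by
    refine ContDiffAt.sum fun l _ => ?_
    refine (contDiffAt_pd (N := 1) (by norm_num; exact hφ) l).smul (ContDiffAt.sum fun q _ => ?_)
    exact (contDiffAt_gramT_inv (hG.of_le (by norm_num)) hm l q).smul contDiffAt_const
  exact h.differentiableAt (by norm_num)

theorem hasFDerivAt_apply₂ {G : Coord n → Tens n 2} {y : Coord n} (hG : DifferentiableAt ℝ G y)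
    (a b : Coord n) : HasFDerivAt (fun z => G z ![a, b])
      ((ContinuousMultilinearMap.apply ℝ (fun _ : Fin 2 => Coord n) ℝ ![a, b]).comp
        (fderiv ℝ G y)) y :=
  (ContinuousMultilinearMap.apply ℝ (fun _ : Fin 2 => Coord n) ℝ ![a, b]).hasFDerivAt.comp y
    hG.hasFDerivAt

theorem fderiv_gamC_conf {φ : Coord n → ℝ} {G : Coord n → Tens n 2} {y : Coord n}
    (hφ : ContDiffAt ℝ 2 φ y) (hG : ContDiffAt ℝ 2 G y) (hm : ∀ᶠ z in 𝓝 y, IsMet (G z))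
    (x a b : Coord n) :
    fderiv ℝ (gamC (conf φ G)) y x a b = fderiv ℝ (gamC G) y x a b +
      fderiv ℝ (fderiv ℝ φ) y x a • b + fderiv ℝ (fderiv ℝ φ) y x b • a -
      (fderiv ℝ G y x ![a, b] • gradC φ G y + G y ![a, b] • fderiv ℝ (gradC φ G) y x) := by
  have hmy := hm.self_of_nhds
  have hGd := hG.differentiableAt (by norm_num)
  have h2 : DifferentiableAt ℝ (fderiv ℝ φ) y :=
    (hφ.fderiv_right (m := 1) (by norm_num)).differentiableAt (by norm_num)
  have hΓ := differentiableAt_gamC hG hmy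
  have hc : ContDiffAt ℝ 2 (conf φ G) y := ((contDiffAt_const.mul hφ).exp).smul hG
  have hΓ' := differentiableAt_gamC hc (hmy.smul (Real.exp_pos _))
  have hX := contDiffAt_gradC hφ hG hmy
  have hev : ∀ᶠ z in 𝓝 y, gamC (conf φ G) z a b = gamC G z a b + fderiv ℝ φ z a • b +
      fderiv ℝ φ z b • a - G z ![a, b] • gradC φ G z := by
    filter_upwards [hφ.eventually (by simp), hG.eventually (by simp), hm] with z h1 h2 h3
    exact gamC_conf (h1.differentiableAt (by norm_num)) (h2.differentiableAt (by norm_num)) h3 a b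
  have eL := ((hΓ'.hasFDerivAt.clm_apply (hasFDerivAt_const a y)).clm_apply
    (hasFDerivAt_const b y)).fderiv
  have eR := (((((hΓ.hasFDerivAt.clm_apply (hasFDerivAt_const a y)).clm_apply
    (hasFDerivAt_const b y)).add ((h2.hasFDerivAt.clm_apply (hasFDerivAt_const a y)).smul
    (hasFDerivAt_const b y))).add ((h2.hasFDerivAt.clm_apply (hasFDerivAt_const b y)).smul
    (hasFDerivAt_const a y))).sub ((hasFDerivAt_apply₂ hGd a b).smul hX.hasFDerivAt)).fderiv
  have e3 := Filter.EventuallyEq.fderiv_eq (𝕜 := ℝ) hev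
  have e4 := congrArg (fun L : Coord n →L[ℝ] Coord n => L x) (eL.symm.trans (e3.trans eR))
  simp at e4
  rw [e4]
  abel

/-- Here `N` is the Hessian of `φ` as a bilinear form and `Y` the covariant derivative of its
gradient. Both are kept; metric compatibility identifies them only after an index is raised, in
`riemC_conf`. -/
theorem curvL_conf {φ : Coord n → ℝ} {G : Coord n → Tens n 2} {y : Coord n}
    (hφ : ContDiffAt ℝ 2 φ y) (hG : ContDiffAt ℝ 2 G y) (hm : ∀ᶠ z in 𝓝 y, IsMet (G z))
    (u v w : Coord n) :
    let f := fderiv ℝ φ y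
    let N := fun a b => fderiv ℝ (fderiv ℝ φ) y a b - f (gamC G y a b)
    let X := gradC φ G y
    let Y := fun a => fderiv ℝ (gradC φ G) y a + gamC G y a X
    curvL (conf φ G) y u v w = curvL G y u v w +
      ((N u w - f u * f w + f X * G y ![u, w]) • v - (N v w - f v * f w + f X * G y ![v, w]) • u -
      G y ![v, w] • (Y u - f u • X) + G y ![u, w] • (Y v - f v • X)) := by
  intro f N X Y
  have hmy := hm.self_of_nhds
  have hGd := hG.differentiableAt (by norm_num)
  have hs : IsSymmSndFDerivAt ℝ φ y := hφ.isSymmSndFDerivAt (by simp)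
  have hΓ := gamC_conf (hφ.differentiableAt (by norm_num)) hGd hmy
  have hXr : ∀ z, G y ![z, X] = f z := fun z => by rw [hmy.symm]; exact gradC_left hmy z
  rw [curvL_apply, curvL_apply, fderiv_gamC_conf hφ hG hm, fderiv_gamC_conf hφ hG hm,
    hΓ v w, hΓ u w, hΓ u, hΓ v, metric_compat hGd hm, metric_compat hGd hm]
  simp only [map_add, map_sub, map_smul, tens2_add_right, tens2_sub_right, tens2_smul_right]
  rw [gamC_symm hGd hm v u, hs.eq v u, hmy.symm v u]
  have e1 : ∀ z, fderiv ℝ φ y z = f z := fun _ => rfl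
  have e2 : gradC φ G y = X := rfl
  simp only [e1, e2, hXr, N, Y, smul_eq_mul]
  rw [hmy.symm v (gamC G y u w), hmy.symm u (gamC G y v w)]
  module

theorem fderiv_fderiv_eq_pd {φ : Coord n → ℝ} {y : Coord n} (hφ : ContDiffAt ℝ 2 φ y)
    (j q : Fin (n + 1)) :
    fderiv ℝ (fderiv ℝ φ) y (basisVec j) (basisVec q) = pd j (pd q φ) y := by
  have h2 : DifferentiableAt ℝ (fderiv ℝ φ) y :=
    (hφ.fderiv_right (m := 1) (by norm_num)).differentiableAt (by norm_num)
  have := (h2.hasFDerivAt.clm_apply (hasFDerivAt_const (basisVec q : Coord n) y)).fderiv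
  rw [pd]
  change _ = fderiv ℝ (fun y => fderiv ℝ φ y (basisVec q)) y (basisVec j)
  rw [this]; simp

theorem confB_eq {φ : Coord n → ℝ} {G : Coord n → Tens n 2} {y : Coord n}
    (hφ : ContDiffAt ℝ 2 φ y) (j q : Fin (n + 1)) :
    confB φ G y j q = -(fderiv ℝ (fderiv ℝ φ) y (basisVec j) (basisVec q) -
      fderiv ℝ φ y (gamC G y (basisVec j) (basisVec q))) +
      fderiv ℝ φ y (basisVec j) * fderiv ℝ φ y (basisVec q) -
      1 / 2 * fderiv ℝ φ y (gradC φ G y) * G y ![basisVec j, basisVec q] := by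
  rw [confB, hessC, fderiv_fderiv_eq_pd hφ, fderiv_gradC, gramT_apply,
    fderiv_apply_eq_sum_pd (v := gamC G y (basisVec j) (basisVec q))]
  simp only [gamC_basisVec]
  rfl

/-- The factor `exp (-2 φ)` comes from raising one index with the conformal metric. Everything else
in `curvL_conf` is expressed through the single tensor `confBup`, the multiples of `|dφ|²` being
shared equally between the two kinds of terms. -/
theorem riemC_conf {φ : Coord n → ℝ} {G : Coord n → Tens n 2} {y : Coord n}
    (hφ : ContDiffAt ℝ 2 φ y) (hG : ContDiffAt ℝ 2 G y) (hm : ∀ᶠ z in 𝓝 y, IsMet (G z))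
    (i j k l : Fin (n + 1)) :
    riemC (conf φ G) y i j k l = Real.exp (-(2 * φ y)) * (riemC G y i j k l +
      ((if i = k then 1 else 0) * confBup φ G y j l - (if i = l then 1 else 0) * confBup φ G y j k -
      (if j = k then 1 else 0) * confBup φ G y i l +
      (if j = l then 1 else 0) * confBup φ G y i k)) := by
  have hmy := hm.self_of_nhds
  have hGd := hG.differentiableAt (by norm_num)
  have hφd := hφ.differentiableAt (by norm_num : (2 : ℕ∞ω) ≠ 0)
  have h2 : DifferentiableAt ℝ (fderiv ℝ φ) y :=
    (hφ.fderiv_right (m := 1) (by norm_num)).differentiableAt (by norm_num)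
  have hX := contDiffAt_gradC hφ hG hmy
  have hc : ContDiffAt ℝ 2 (conf φ G) y := ((contDiffAt_const.mul hφ).exp).smul hG
  have hΓ' := differentiableAt_gamC hc (hmy.smul (Real.exp_pos _))
  have hbl : ∀ a : Fin (n + 1), ∀ l, confBup φ G y a l =
      -(fderiv ℝ (fderiv ℝ φ) y (basisVec a) (sharp (G y) l) -
        fderiv ℝ φ y (gamC G y (basisVec a) (sharp (G y) l))) +
      fderiv ℝ φ y (basisVec a) * fderiv ℝ φ y (sharp (G y) l) -
      1 / 2 * fderiv ℝ φ y (gradC φ G y) * G y ![basisVec a, sharp (G y) l] := by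
    intro a l
    have hs : G y ![basisVec a, sharp (G y) l] =
        ∑ q, (gramT (G y))⁻¹ l q * G y ![basisVec a, basisVec q] := by
      rw [hmy.symm, sharp, tens2_sum_left]
      exact Finset.sum_congr rfl fun q _ => by rw [tens2_smul_left, hmy.symm]
    rw [hs, sharp]
    simp only [map_sum, map_smul, confBup, smul_eq_mul, Finset.mul_sum,
      ← Finset.sum_sub_distrib, ← Finset.sum_neg_distrib, ← Finset.sum_add_distrib]
    refine Finset.sum_congr rfl fun q _ => ?_
    rw [confB_eq hφ]; ring
  -- the raised tensor in terms of the derivative of the gradient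
  have hY : ∀ a w : Coord n, G y ![fderiv ℝ (gradC φ G) y a + gamC G y a (gradC φ G y), w] =
      fderiv ℝ (fderiv ℝ φ) y a w - fderiv ℝ φ y (gamC G y a w) := by
    intro a w
    have hev : (fun z => G z ![gradC φ G z, w]) =ᶠ[𝓝 y] fun z => fderiv ℝ φ z w :=
      hm.mono fun z hz => gradC_left hz w
    have e3 := congrArg (fun L : Coord n →L[ℝ] ℝ => L a) (Filter.EventuallyEq.fderiv_eq (𝕜 := ℝ) hev)
    have eR := (h2.hasFDerivAt.clm_apply (hasFDerivAt_const w y)).fderiv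
    have eL : fderiv ℝ (fun z => G z ![gradC φ G z, w]) y a =
        fderiv ℝ G y a ![gradC φ G y, w] + G y ![fderiv ℝ (gradC φ G) y a, w] := by
      have e : (fun z => G z ![gradC φ G z, w]) = fun z =>
          ∑ q, gradC φ G z q * G z ![basisVec q, w] := by
        funext z
        conv_lhs => rw [← sum_smul_basisVec (gradC φ G z)]
        rw [tens2_sum_left]
        exact Finset.sum_congr rfl fun q _ => tens2_smul_left _ _ _ _
      have hq : ∀ q : Fin (n + 1), HasFDerivAt (fun z => gradC φ G z q)
          ((EuclideanSpace.proj q : Coord n →L[ℝ] ℝ).comp (fderiv ℝ (gradC φ G) y)) y := fun q =>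
        (EuclideanSpace.proj q : Coord n →L[ℝ] ℝ).hasFDerivAt.comp y hX.hasFDerivAt
      rw [e, (HasFDerivAt.fun_sum fun q _ => (hq q).fun_mul
        (hasFDerivAt_apply₂ hGd (basisVec q) w)).fderiv]
      conv_rhs => rw [← sum_smul_basisVec (gradC φ G y),
        ← sum_smul_basisVec (fderiv ℝ (gradC φ G) y a)]
      rw [tens2_sum_left, tens2_sum_left, ← Finset.sum_add_distrib, sum_apply]
      refine Finset.sum_congr rfl fun q _ => ?_
      rw [tens2_smul_left, tens2_smul_left]
      simp
      ring
    rw [eL, eR, metric_compat hGd hm, gradC_left hmy] at e3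
    simp at e3
    rw [tens2_add_left, hmy.symm (gamC G y a (gradC φ G y))]
    rw [hmy.symm (gamC G y a (gradC φ G y))] at e3
    linarith
  have hYk : ∀ a k : Fin (n + 1), (fderiv ℝ (gradC φ G) y (basisVec a) +
      gamC G y (basisVec a) (gradC φ G y) - fderiv ℝ φ y (basisVec a) • gradC φ G y) k =
      -confBup φ G y a k - 1 / 2 * fderiv ℝ φ y (gradC φ G y) * (if k = a then 1 else 0) := by
    intro a k
    rw [← hmy.sharp_left k (_ - _), hmy.symm, tens2_sub_left, tens2_smul_left, hY, gradC_left hmy,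
      hbl, hmy.symm (basisVec a), hmy.sharp_left, basisVec_apply]
    ring
  rw [riemC_eq hΓ', conf, hmy.sharp_smul (Real.exp_pos _).ne', map_smul, PiLp.smul_apply,
    curvL_conf hφ hG hm, ← Real.exp_neg, smul_eq_mul,
    riemC_eq (differentiableAt_gamC hG hmy)]
  congr 1
  have hsj : ∀ a, G y ![basisVec a, sharp (G y) l] = if l = a then 1 else 0 := fun a => by
    rw [hmy.symm, hmy.sharp_left, basisVec_apply]
  simp only [PiLp.add_apply, PiLp.sub_apply, PiLp.smul_apply, smul_eq_mul, basisVec_apply] at hYk ⊢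
  rw [hYk, hYk, hbl j l, hbl i l, hsj, hsj]
  simp only [eq_comm (a := k), eq_comm (a := l)]
  ring

/-- The Laplacian of a function. -/
def lapC (φ : Coord n → ℝ) (G : Coord n → Tens n 2) (y : Coord n) : ℝ :=
  ∑ j, ∑ q, (gramT (G y))⁻¹ j q * hessC φ G y j q

/-- The scalar curvature in coordinates. -/
def scalC (G : Coord n → Tens n 2) (y : Coord n) : ℝ := ∑ i, ∑ j, riemC G y i j i j

theorem sum_inv_mul_gramT {T : Tens n 2} (h : IsMet T) :
    ∑ j, ∑ q, (gramT T)⁻¹ j q * gramT T j q = (n : ℝ) + 1 := by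
  have : ∀ j, ∑ q, (gramT T)⁻¹ j q * gramT T j q = 1 := fun j => by
    have e : ∀ q, gramT T j q = gramT T q j := fun q => by
      simp only [gramT_apply]; exact h.symm _ _
    simp only [e]
    rw [← Matrix.mul_apply, Matrix.nonsing_inv_mul _ h.isUnit_det, Matrix.one_apply_eq]
  simp [this]

theorem sum_confBup {φ : Coord n → ℝ} {G : Coord n → Tens n 2} {y : Coord n} (hm : IsMet (G y)) :
    ∑ j, confBup φ G y j j = -lapC φ G y - ((n : ℝ) - 1) / 2 * normSqC φ G y := by
  have h : ∑ j, confBup φ G y j j = -lapC φ G y + normSqC φ G y -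
      1 / 2 * normSqC φ G y * ∑ j, ∑ q, (gramT (G y))⁻¹ j q * gramT (G y) j q := by
    have hN : normSqC φ G y = ∑ j, ∑ q, (gramT (G y))⁻¹ j q * (pd j φ y * pd q φ y) := rfl
    simp only [lapC, confBup, confB, Finset.mul_sum, ← Finset.sum_neg_distrib]
    conv_rhs => enter [1, 2]; rw [hN]
    simp only [← Finset.sum_add_distrib, ← Finset.sum_sub_distrib]
    exact Finset.sum_congr rfl fun j _ => Finset.sum_congr rfl fun q _ => by ring
  rw [h, sum_inv_mul_gramT hm]; ring

/-- In the double trace the correction contributes the trace of `confBup` twice `n + 1` times, minus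
twice from the diagonal, hence with the factor `2n`. -/
theorem scalC_conf {φ : Coord n → ℝ} {G : Coord n → Tens n 2} {y : Coord n}
    (hφ : ContDiffAt ℝ 2 φ y) (hG : ContDiffAt ℝ 2 G y) (hm : ∀ᶠ z in 𝓝 y, IsMet (G z)) :
    scalC (conf φ G) y = Real.exp (-(2 * φ y)) *
      (scalC G y - 2 * n * lapC φ G y - n * ((n : ℝ) - 1) * normSqC φ G y) := by
  have h : scalC (conf φ G) y = Real.exp (-(2 * φ y)) *
      (scalC G y + 2 * n * ∑ j, confBup φ G y j j) := by
    have e : ∀ i j : Fin (n + 1), riemC (conf φ G) y i j i j = Real.exp (-(2 * φ y)) *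
        (riemC G y i j i j + (confBup φ G y j j + confBup φ G y i i) -
          (if i = j then confBup φ G y j i + confBup φ G y i j else 0)) := fun i j => by
      rw [riemC_conf hφ hG hm]
      by_cases hij : i = j
      · subst hij; simp
      · simp [hij, Ne.symm hij]
    simp only [scalC, e, ← Finset.mul_sum, Finset.sum_sub_distrib, Finset.sum_add_distrib]
    congr 1
    simp only [Finset.sum_const, Finset.card_univ, Fintype.card_fin, Finset.sum_ite_eq, Finset.mem_univ,
      if_true, Finset.sum_add_distrib, ← Finset.smul_sum]
    simp
    ring
  rw [h, sum_confBup hm.self_of_nhds]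
  ring

end Conformal

end

end WeakAH

/-! ### From coordinates to the manifold: charts, parametrizations, frames. -/

namespace WeakAH

noncomputable section

/-! ### Congruence of the coordinate operations -/

section Congruence

variable {n r : ℕ}

theorem christC_congr {G G' : Coord n → Tens n 2} {y : Coord n} (h : G =ᶠ[𝓝 y] G')
    (m i j : Fin (n + 1)) : christC G m i j =ᶠ[𝓝 y] christC G' m i j := by
  refine h.eventually_nhds.mono fun z hz => ?_
  have hz' : ∀ a b c, pd a (fun z => gramT (G z) b c) z = pd a (fun z => gramT (G' z) b c) z :=
    fun a b c => pd_congr (hz.mono fun x hx => by simp only [hx]) a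
  simp only [christC, hz', hz.self_of_nhds]

theorem riemC_congr {G G' : Coord n → Tens n 2} {y : Coord n} (h : G =ᶠ[𝓝 y] G')
    (i j k l : Fin (n + 1)) : riemC G y i j k l = riemC G' y i j k l := by
  have h1 : ∀ i m j k, pd i (christC G m j k) y = pd i (christC G' m j k) y := fun i m j k =>
    pd_congr (christC_congr h m j k) i
  have h2 : ∀ m j k, christC G m j k y = christC G' m j k y := fun m j k =>
    (christC_congr h m j k).self_of_nhds
  simp only [riemC, curvC, h1, h2, h.self_of_nhds]

theorem cmp_congr {t t' : Coord n → Tens n r} {y : Coord n} (h : t =ᶠ[𝓝 y] t')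
    (J : Fin r → Fin (n + 1)) : cmp t J =ᶠ[𝓝 y] cmp t' J :=
  h.mono fun z hz => by simp only [cmp, hz]

theorem nablaC_congr {G G' : Coord n → Tens n 2} {t t' : Coord n → Tens n r} {y : Coord n}
    (hG : G =ᶠ[𝓝 y] G') (ht : t =ᶠ[𝓝 y] t') : nablaC G t y = nablaC G' t' y := by
  have h1 : ∀ i J, pd i (cmp t J) y = pd i (cmp t' J) y := fun i J => pd_congr (cmp_congr ht J) i
  have h2 : ∀ m j k, christC G m j k y = christC G' m j k y := fun m j k =>
    (christC_congr hG m j k).self_of_nhds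
  have h3 : ∀ J, cmp t J y = cmp t' J y := fun J => (cmp_congr ht J).self_of_nhds
  simp only [nablaC, h1, h2, h3]

theorem lieC_congr {X X' : Coord n → Coord n} {t t' : Coord n → Tens n r} {y : Coord n}
    (hX : X =ᶠ[𝓝 y] X') (ht : t =ᶠ[𝓝 y] t') : lieC X t y = lieC X' t' y := by
  have h1 : ∀ i J, pd i (cmp t J) y = pd i (cmp t' J) y := fun i J => pd_congr (cmp_congr ht J) i
  have h2 : ∀ i l, pd i (fun z => X z l) y = pd i (fun z => X' z l) y := fun i l =>
    pd_congr (hX.mono fun z hz => by simp only [hz]) i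
  have h3 : ∀ J, cmp t J y = cmp t' J y := fun J => (cmp_congr ht J).self_of_nhds
  simp only [lieC, h1, h2, h3, hX.self_of_nhds]

/-- A function as a field of tensors of rank `0`. -/
def cst (φ : Coord n → ℝ) (y : Coord n) : Tens n 0 :=
  ContinuousMultilinearMap.constOfIsEmpty ℝ _ (φ y)

/-- The inner product of the differentials of two functions. -/
def innC (φ ψ : Coord n → ℝ) (G : Coord n → Tens n 2) (y : Coord n) : ℝ :=
  ∑ j, ∑ l, (gramT (G y))⁻¹ j l * (pd j φ y * pd l ψ y)

/-- The tensor product of two covectors. -/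
def prodT (a b : Tens n 1) : Tens n 2 :=
  ofComponents fun I => a (fun _ => basisVec (I 0)) * b (fun _ => basisVec (I 1))

theorem cmp_cst (φ : Coord n → ℝ) (J : Fin 0 → Fin (n + 1)) : cmp (cst φ) J = φ := rfl

theorem nablaC_cst (φ : Coord n → ℝ) (G : Coord n → Tens n 2) (J : Fin 1 → Fin (n + 1)) :
    cmp (nablaC G (cst φ)) J = pd (J 0) φ := by
  funext y
  rw [cmp, nablaC, ofComponents_basisVec, cmp_cst]
  simp

theorem ctr_hess (φ : Coord n → ℝ) (G : Coord n → Tens n 2) (y : Coord n) :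
    ctr (G y) (nablaC G (nablaC G (cst φ)) y) = lapC φ G y := by
  simp only [ctr, lapC, hessC]
  refine Finset.sum_congr rfl fun i _ => Finset.sum_congr rfl fun j _ => ?_
  congr 1
  rw [gramT, Matrix.of_apply, nablaC, ofComponents_basisVec, nablaC_cst]
  simp [nablaC_cst, Fin.tail]

theorem prodT_apply (a b : Tens n 1) (v : Fin 2 → Coord n) :
    prodT a b v = a (fun _ => v 0) * b (fun _ => v 1) := by
  have h : ∀ (a : Tens n 1) (x : Coord n),
      a (fun _ => x) = ∑ i, x i * a (fun _ => basisVec i) := fun a x => by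
    have e : ∀ x, a (fun _ => x) = a.toContinuousLinearMap (fun _ => 0) 0 x := fun x => by
      change _ = a (Function.update _ _ _)
      congr 1; funext b; rw [Subsingleton.elim b 0]; simp
    conv_lhs => rw [← sum_smul_basisVec x]
    rw [e, map_sum]
    exact Finset.sum_congr rfl fun i _ => by rw [map_smul, smul_eq_mul, e (basisVec i)]
  rw [prodT, ofComponents_apply, h a, h b, Finset.sum_mul_sum, ← Fintype.sum_prod_type']
  refine Fintype.sum_equiv (finTwoArrowEquiv _) _ _ fun I => ?_
  simp [Fin.prod_univ_two]
  ring

theorem prodT_comp (a b : Tens n 1) (A : Coord n →L[ℝ] Coord n) :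
    (prodT a b).compContinuousLinearMap (fun _ => A) =
      prodT (a.compContinuousLinearMap fun _ => A) (b.compContinuousLinearMap fun _ => A) := by
  ext v
  simp [prodT_apply]

theorem ctr_prodT (φ ψ : Coord n → ℝ) (G : Coord n → Tens n 2) (y : Coord n) :
    ctr (G y) (prodT (nablaC G (cst φ) y) (nablaC G (cst ψ) y)) = innC φ ψ G y := by
  simp only [ctr, innC]
  refine Finset.sum_congr rfl fun i _ => Finset.sum_congr rfl fun j _ => ?_
  have h := fun φ : Coord n → ℝ => fun i : Fin (n + 1) =>
    congrFun (nablaC_cst φ G (fun _ => i)) y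
  simp only [cmp] at h
  congr 1
  rw [gramT, Matrix.of_apply, prodT_apply]
  simp [h]

end Congruence

/-! ### Local parametrizations -/

section Local

variable {n : ℕ} {M : Type*} [TopologicalSpace M] [ChartedSpace (EuclideanHalfSpace (n + 1)) M]

/-- The derivative of a map from the coordinate space to `M`, in the preferred charts. -/
def dM (Φ : Coord n → M) (z : Coord n) : Coord n →L[ℝ] Coord n :=
  mfderiv 𝓘(ℝ, Coord n) (𝓡∂ (n + 1)) Φ z

/-- The value of a tensor field in the preferred chart. -/
def val {r : ℕ} (u : CovTensor n M r) (p : M) : Tens n r := u p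

theorem pullback_eq {r : ℕ} (Φ : Coord n → M) (u : CovTensor n M r) (z : Coord n) :
    pullback Φ u z = (val u (Φ z)).compContinuousLinearMap fun _ => dM Φ z := rfl

/-- `Φ` is a smooth local parametrization of `M` near `z`. -/
structure IsLoc (Φ : Coord n → M) (z : Coord n) : Prop where
  smooth : ContMDiffAt 𝓘(ℝ, Coord n) (𝓡∂ (n + 1)) ∞ Φ z
  inv : (dM Φ z).IsInvertible

theorem IsLoc.mdifferentiableAt {Φ : Coord n → M} {z : Coord n} (h : IsLoc Φ z) :
    MDifferentiableAt 𝓘(ℝ, Coord n) (𝓡∂ (n + 1)) Φ z :=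
  h.smooth.mdifferentiableAt (by simp)

theorem dM_congr {Φ Ψ : Coord n → M} {y : Coord n} (h : Φ =ᶠ[𝓝 y] Ψ) : dM Φ y = dM Ψ y :=
  h.mfderiv_eq

theorem pullback_congr {r : ℕ} {Φ Ψ : Coord n → M} {y : Coord n} (h : Φ =ᶠ[𝓝 y] Ψ)
    (u : CovTensor n M r) : pullback Φ u y = pullback Ψ u y := by
  rw [pullback_eq, pullback_eq, h.self_of_nhds, dM_congr h]

theorem dM_comp {Φ : Coord n → M} {τ : Coord n → Coord n} {y : Coord n}
    (hτ : DifferentiableAt ℝ τ y)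
    (hΦ : MDifferentiableAt 𝓘(ℝ, Coord n) (𝓡∂ (n + 1)) Φ (τ y)) :
    dM (Φ ∘ τ) y = (dM Φ (τ y)).comp (fderiv ℝ τ y) := by
  rw [dM, mfderiv_comp y hΦ hτ.mdifferentiableAt, mfderiv_eq_fderiv]; rfl

theorem pullback_comp {r : ℕ} {Φ : Coord n → M} {τ : Coord n → Coord n} {y : Coord n}
    (hτ : DifferentiableAt ℝ τ y)
    (hΦ : MDifferentiableAt 𝓘(ℝ, Coord n) (𝓡∂ (n + 1)) Φ (τ y)) (u : CovTensor n M r) :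
    pullback (Φ ∘ τ) u y = pbC τ (pullback Φ u) y := by
  rw [pullback_eq, dM_comp hτ hΦ, pbC, pullback_eq]
  rfl

/-- The coordinates of a point in its preferred chart. -/
def ctrPt (p : M) : Coord n := extChartAt (𝓡∂ (n + 1)) p p

/-- The inverse of the preferred chart. -/
def chInv (p : M) : Coord n → M := (extChartAt (𝓡∂ (n + 1)) p).symm

theorem mdifferentiableAt_extChartAt_self (p : M) : MDifferentiableAt (𝓡∂ (n + 1)) 𝓘(ℝ, Coord n)
    (extChartAt (𝓡∂ (n + 1)) p) p :=
  (contMDiffAt_extChartAt (I := 𝓡∂ (n + 1)) (x := p) (n := ∞)).mdifferentiableAt (by simp)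

/-- The tangent space at `p` is the model space, identified through the preferred chart at `p`; the
derivative of that chart at `p` is therefore the identity. -/
theorem mfderiv_extChartAt_self (p : M) (v : Coord n) :
    (mfderiv (𝓡∂ (n + 1)) 𝓘(ℝ, Coord n) (extChartAt (𝓡∂ (n + 1)) p) p v : Coord n) = v := by
  have h : fderivWithin ℝ (writtenInExtChartAt (𝓡∂ (n + 1)) 𝓘(ℝ, Coord n) p
      (extChartAt (𝓡∂ (n + 1)) p)) (Set.range (𝓡∂ (n + 1))) (extChartAt (𝓡∂ (n + 1)) p p) =
      ContinuousLinearMap.id ℝ (Coord n) := by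
    rw [Filter.EventuallyEq.fderivWithin_eq (f := id), fderivWithin_id]
    · exact (𝓡∂ (n + 1)).uniqueDiffOn _ (Set.mem_range_self _)
    · filter_upwards [extChartAt_target_mem_nhdsWithin (I := 𝓡∂ (n + 1)) p] with y hy
      exact (extChartAt (𝓡∂ (n + 1)) p).right_inv hy
    · exact (extChartAt (𝓡∂ (n + 1)) p).right_inv (mem_extChartAt_target p)
  have h2 := (mdifferentiableAt_extChartAt_self (n := n) p).mfderiv
  exact (DFunLike.congr_fun h2 v).trans (DFunLike.congr_fun h v)

theorem IsLoc.mem_interior {Φ : Coord n → M} {z : Coord n} (h : IsLoc Φ z) :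
    Φ z ∈ (𝓡∂ (n + 1)).interior M :=
  h.mdifferentiableAt.isInteriorPoint_of_surjective_mfderiv h.inv.surjective
    BoundarylessManifold.isInteriorPoint

theorem isInvertible_eventually {τ : Coord n → Coord n} {z : Coord n} (hτ : ContDiffAt ℝ ∞ τ z)
    (h : (fderiv ℝ τ z).IsInvertible) : ∀ᶠ z' in 𝓝 z, (fderiv ℝ τ z').IsInvertible := by
  obtain ⟨A, hA⟩ := h
  have hc : ContinuousAt (fderiv ℝ τ) z :=
    (hτ.of_le (m := 1) (by norm_num)).continuousAt_fderiv (by norm_num)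
  have := hc.preimage_mem_nhds (hA ▸ ContinuousLinearEquiv.nhds A)
  exact Filter.mem_of_superset this fun z' hz' => hz'

theorem IsLoc.pullback_chInv {r : ℕ} {Φ : Coord n → M} {τ : Coord n → Coord n} {z y : Coord n}
    (h : ∀ᶠ y in 𝓝 y, (fderiv ℝ τ y).IsInvertible ∧ chInv (Φ z) =ᶠ[𝓝 y] Φ ∘ τ ∧
      DifferentiableAt ℝ τ y ∧ MDifferentiableAt 𝓘(ℝ, Coord n) (𝓡∂ (n + 1)) Φ (τ y))
    (t : CovTensor n M r) : pullback (chInv (Φ z)) t =ᶠ[𝓝 y] pbC τ (pullback Φ t) :=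
  h.mono fun y hy => by rw [pullback_congr hy.2.1, pullback_comp hy.2.2.1 hy.2.2.2]

theorem isMet_val {g : CovTensor n M 2} (hg : IsMetric g) {p : M}
    (hp : p ∈ (𝓡∂ (n + 1)).interior M) : IsMet (val g p) :=
  ⟨(hg p hp).1, (hg p hp).2⟩

/-- The pullback of a vector field. -/
def mpb (Φ : Coord n → M) (X : ∀ q : M, TangentSpace (𝓡∂ (n + 1)) q) (z : Coord n) : Coord n :=
  (dM Φ z).inverse (X (Φ z))

theorem mpb_comp {Φ : Coord n → M} {τ : Coord n → Coord n} {y : Coord n}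
    (hτ : DifferentiableAt ℝ τ y) (hi : (fderiv ℝ τ y).IsInvertible)
    (hΦ : MDifferentiableAt 𝓘(ℝ, Coord n) (𝓡∂ (n + 1)) Φ (τ y))
    (X : ∀ q : M, TangentSpace (𝓡∂ (n + 1)) q) :
    fderiv ℝ τ y (mpb (Φ ∘ τ) X y) = mpb Φ X (τ y) := by
  rw [mpb, dM_comp hτ hΦ, hi.inverse_comp_of_right]
  exact hi.self_apply_inverse _

theorem IsLoc.isMet_pullback {Φ : Coord n → M} {z : Coord n} (hΦ : IsLoc Φ z)
    {g : CovTensor n M 2} (hg : IsMetric g) : IsMet (pullback Φ g z) := by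
  rw [pullback_eq]
  exact (isMet_val hg hΦ.mem_interior).comp hΦ.inv.injective

variable [IsManifold (𝓡∂ (n + 1)) ∞ M]

theorem IsLoc.eventually {Φ : Coord n → M} {z : Coord n} (h : IsLoc Φ z) :
    ∀ᶠ z' in 𝓝 z, MDifferentiableAt 𝓘(ℝ, Coord n) (𝓡∂ (n + 1)) Φ z' := by
  have : IsManifold (𝓡∂ (n + 1)) 1 M := IsManifold.of_le (n := ∞) (by norm_num)
  have h1 : ContMDiffAt 𝓘(ℝ, Coord n) (𝓡∂ (n + 1)) 1 Φ z := h.smooth.of_le (by norm_num)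
  filter_upwards [(contMDiffAt_iff_contMDiffAt_nhds (by simp)).1 h1] with z' hz'
  exact hz'.mdifferentiableAt (by simp)

/-- A local parametrization has a smooth local inverse in the preferred chart. -/
theorem IsLoc.exists_inverse {Φ : Coord n → M} {z : Coord n} (h : IsLoc Φ z) :
    ∃ τ : Coord n → Coord n, ContDiffAt ℝ ∞ τ (ctrPt (Φ z)) ∧
      τ (ctrPt (Φ z)) = z ∧
      (∀ᶠ y in 𝓝 (ctrPt (Φ z)), (fderiv ℝ τ y).IsInvertible ∧
        chInv (Φ z) =ᶠ[𝓝 y] Φ ∘ τ ∧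
        DifferentiableAt ℝ τ y ∧ MDifferentiableAt 𝓘(ℝ, Coord n) (𝓡∂ (n + 1)) Φ (τ y)) ∧
      (∀ v, fderiv ℝ τ (ctrPt (Φ z)) (dM Φ z v) = v) ∧
      (∀ v, dM Φ z (fderiv ℝ τ (ctrPt (Φ z)) v) = v) := by
  set c := extChartAt (𝓡∂ (n + 1)) (Φ z)
  set σ : Coord n → Coord n := c ∘ Φ
  have hσm : ContMDiffAt 𝓘(ℝ, Coord n) 𝓘(ℝ, Coord n) ∞ σ z :=
    ContMDiffAt.comp z (contMDiffAt_extChartAt (x := Φ z)) h.smooth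
  have hσ : ContDiffAt ℝ ∞ σ z := hσm.contDiffAt
  have hd : ∀ v, fderiv ℝ σ z v = dM Φ z v := fun v => by
    rw [← mfderiv_eq_fderiv,
      mfderiv_comp z (mdifferentiableAt_extChartAt_self _) h.mdifferentiableAt]
    exact mfderiv_extChartAt_self _ _
  obtain ⟨A, hA0⟩ := h.inv
  have hA : ∀ v, A v = dM Φ z v := fun v => DFunLike.congr_fun hA0 v
  have hA' : HasFDerivAt σ (A : Coord n →L[ℝ] Coord n) z := by
    have : (A : Coord n →L[ℝ] Coord n) = fderiv ℝ σ z := by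
      ext1 v; exact (hA v).trans (hd v).symm
    rw [this]; exact (hσ.differentiableAt (by simp)).hasFDerivAt
  set τ := hσ.localInverse hA' (by simp)
  have hτ : ContDiffAt ℝ ∞ τ (σ z) := hσ.to_localInverse hA' (by simp)
  have hs := hσ.hasStrictFDerivAt' hA' (by simp)
  have hr : ∀ᶠ y in 𝓝 (σ z), σ (τ y) = y := hs.eventually_right_inverse
  have hl : ∀ᶠ z' in 𝓝 z, τ (σ z') = z' := hs.eventually_left_inverse
  have hτz : τ (σ z) = z := hl.self_of_nhds
  have hAl : ∀ v, fderiv ℝ τ (σ z) (A v) = v := fun v => by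
    have h1 := ((hτ.differentiableAt (by simp)).hasFDerivAt.comp z hA').fderiv
    have h2 : fderiv ℝ (τ ∘ σ) z = ContinuousLinearMap.id ℝ _ := by
      have hl' : τ ∘ σ =ᶠ[𝓝 z] id := hl
      rw [hl'.fderiv_eq, fderiv_id]
    exact (DFunLike.congr_fun (h1.symm.trans h2) v)
  have hAr : ∀ v, fderiv ℝ τ (σ z) v = A.symm v := fun v => by
    rw [← hAl (A.symm v), A.apply_symm_apply]
  have hinv : (fderiv ℝ τ (σ z)).IsInvertible := ⟨A.symm, by ext1 v; exact (hAr v).symm⟩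
  have htend : Filter.Tendsto τ (𝓝 (σ z)) (𝓝 z) := by
    conv_rhs => rw [← hτz]
    exact hτ.continuousAt
  have hsrc : ∀ᶠ z' in 𝓝 z, Φ z' ∈ c.source :=
    h.smooth.continuousAt.preimage_mem_nhds (extChartAt_source_mem_nhds _)
  have heq : c.symm =ᶠ[𝓝 (σ z)] Φ ∘ τ := by
    filter_upwards [hr, htend.eventually hsrc] with y h1 h2
    rw [← h1]
    change c.symm (c (Φ (τ y))) = _
    rw [c.left_inv h2, h1]; rfl
  refine ⟨τ, hτ, hτz, ?_, fun v => ?_, fun v => ?_⟩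
  · filter_upwards [isInvertible_eventually hτ hinv, heq.eventually_nhds,
      (hτ.of_le (m := 1) (by norm_num)).eventually (by simp), htend.eventually h.eventually]
      with y h1 h2 h3 h4
    exact ⟨h1, h2, h3.differentiableAt (by norm_num), h4⟩
  · exact (congrArg _ (hA v).symm).trans (hAl v)
  · refine (hA _).symm.trans ?_
    change A (fderiv ℝ τ (σ z) v) = v
    rw [hAr, A.apply_symm_apply]

/-- By definition `nabla` is evaluated at each point in the preferred chart of that very point. The
local inverse `τ` of `Φ` is a change of coordinates from that chart to `Φ`, so the naturality
`nablaC_pbC` makes a single coordinate formula valid along all of `Φ`. -/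
theorem IsLoc.pullback_nabla {r : ℕ} {Φ : Coord n → M} {z : Coord n} (hΦ : IsLoc Φ z)
    {h : CovTensor n M 2} {u : CovTensor n M r} (hh : DifferentiableAt ℝ (pullback Φ h) z)
    (hm : ∀ᶠ z' in 𝓝 z, IsMet (pullback Φ h z')) (hu : DifferentiableAt ℝ (pullback Φ u) z) :
    pullback Φ (nabla h u) z = nablaC (pullback Φ h) (pullback Φ u) z := by
  obtain ⟨τ, h1, h2, h3, h4, h5⟩ := hΦ.exists_inverse
  have hpb := fun {s : ℕ} (t : CovTensor n M s) => IsLoc.pullback_chInv h3 t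
  have e : val (nabla h u) (Φ z) = nablaC (pullback (chInv (Φ z)) h)
    (pullback (chInv (Φ z)) u) (ctrPt (Φ z)) := rfl
  rw [pullback_eq, e, nablaC_congr (hpb h) (hpb u), nablaC_pbC (h1.of_le (by norm_cast))
    (by rwa [h2]) (by rwa [h2]) (by rwa [h2]) h3.self_of_nhds.1, pbC, h2]
  ext v
  simp [h4]

theorem IsLoc.pullback_lieDeriv {r : ℕ} {Φ : Coord n → M} {z : Coord n} (hΦ : IsLoc Φ z)
    {X : ∀ q : M, TangentSpace (𝓡∂ (n + 1)) q} {u : CovTensor n M r}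
    (hX : ContDiffAt ℝ 1 (mpb Φ X) z) (hu : DifferentiableAt ℝ (pullback Φ u) z) :
    pullback Φ (lieDeriv X u) z = lieC (mpb Φ X) (pullback Φ u) z := by
  obtain ⟨τ, h1, h2, h3, h4, h5⟩ := hΦ.exists_inverse
  have hpb := fun {s : ℕ} (t : CovTensor n M s) => IsLoc.pullback_chInv h3 t
  have e : val (lieDeriv X u) (Φ z) = lieC (mpb (chInv (Φ z)) X)
    (pullback (chInv (Φ z)) u) (ctrPt (Φ z)) := rfl
  -- In the preferred chart the field is the pushforward of its representation in `Φ` by the inverse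
  -- of `τ`; this also shows that it is differentiable there.
  have hX' : mpb (chInv (Φ z)) X =ᶠ[𝓝 (ctrPt (Φ z))]
      fun y => (fderiv ℝ τ y).inverse (mpb Φ X (τ y)) := h3.mono fun y hy => by
    change _ = (fderiv ℝ τ y).inverse (mpb Φ X (τ y))
    rw [← mpb_comp hy.2.2.1 hy.1 hy.2.2.2]
    have e1 : mpb (chInv (Φ z)) X y = mpb (Φ ∘ τ) X y := by
      simp only [mpb]
      rw [dM_congr hy.2.1, hy.2.1.self_of_nhds]
    rw [e1]
    exact (hy.1.inverse_apply_eq.2 rfl).symm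
  have hd : DifferentiableAt ℝ (fun y => (fderiv ℝ τ y).inverse (mpb Φ X (τ y)))
      (ctrPt (Φ z)) := by
    have hi := h3.self_of_nhds.1
    obtain ⟨A, hA⟩ := hi
    have hc : ContDiffAt ℝ 1 (fun y => (fderiv ℝ τ y).inverse) (ctrPt (Φ z)) := by
      have := contDiffAt_map_inverse (𝕜 := ℝ) (n := 1) A
      rw [hA] at this
      exact this.comp _ (h1.fderiv_right (m := 1) (by norm_cast))
    have hx : ContDiffAt ℝ 1 (fun y => mpb Φ X (τ y)) (ctrPt (Φ z)) :=
      ContDiffAt.comp _ (by rwa [h2]) (h1.of_le (by norm_cast))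
    exact (hc.clm_apply hx).differentiableAt (by norm_num)
  rw [pullback_eq, e, lieC_congr hX' (hpb u), lieC_pbC (h1.of_le (by norm_cast)) (by rwa [h2])
    (by rw [h2]; exact hX.differentiableAt (by norm_num)) hd
    (h3.mono fun y hy => hy.1.self_apply_inverse _), pbC, h2]
  ext v
  simp [h4]

/-- The contraction of a bilinear form with a metric. -/
def ctrM (g t : CovTensor n M 2) (p : M) : ℝ := ctr (val g p) (val t p)

theorem IsLoc.ctrM_eq {Φ : Coord n → M} {z : Coord n} (hΦ : IsLoc Φ z) {g : CovTensor n M 2}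
    (hg : IsMet (val g (Φ z))) (t : CovTensor n M 2) :
    ctrM g t (Φ z) = ctr (pullback Φ g z) (pullback Φ t z) := by
  obtain ⟨τ, h1, h2, h3, h4, h5⟩ := hΦ.exists_inverse
  rw [pullback_eq, pullback_eq, ctr_comp hg h5, ctrM]

theorem IsLoc.riemOp_eq {Φ : Coord n → M} {z : Coord n} (hΦ : IsLoc Φ z) {g : CovTensor n M 2}
    (hg : ContDiffAt ℝ 2 (pullback Φ g) z) (hm : ∀ᶠ z' in 𝓝 z, IsMet (pullback Φ g z')) :
    ∃ A' : Coord n →L[ℝ] Coord n, (∀ x, A' (dM Φ z x) = x) ∧ (∀ x, dM Φ z (A' x) = x) ∧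
      ∀ i j k l, riemOp g (Φ z) i j k l =
        trans22 (jac A') (jac (dM Φ z)) (riemC (pullback Φ g) z) i j k l := by
  obtain ⟨τ, h1, h2, h3, h4, h5⟩ := hΦ.exists_inverse
  refine ⟨fderiv ℝ τ (ctrPt (Φ z)), h4, h5, fun i j k l => ?_⟩
  have e : riemOp g (Φ z) i j k l = riemC (pullback (chInv (Φ z)) g) (ctrPt (Φ z)) i j k l := rfl
  rw [e, riemC_congr (IsLoc.pullback_chInv h3 g), riemC_pbC (h1.of_le (by norm_cast)) (by rwa [h2])
    (by rwa [h2]) (h3.mono fun y hy => hy.1) h4 h5, h2]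

theorem IsLoc.scalarCurvature_eq {Φ : Coord n → M} {z : Coord n} (hΦ : IsLoc Φ z)
    {g : CovTensor n M 2} (hg : ContDiffAt ℝ 2 (pullback Φ g) z)
    (hm : ∀ᶠ z' in 𝓝 z, IsMet (pullback Φ g z')) :
    scalarCurvature g (Φ z) = scalC (pullback Φ g) z := by
  obtain ⟨A', h1, h2, h3⟩ := hΦ.riemOp_eq hg hm
  simp only [scalarCurvature, h3, scalC]
  exact trace_trans22 (jac_mul h1) _

/-- The identity is invariant under changes of coordinates. -/
theorem trans22_idOp {J J' : Matrix (Fin (n + 1)) (Fin (n + 1)) ℝ} (h : J' * J = 1)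
    (i j k l : Fin (n + 1)) : trans22 J J' idOp i j k l = idOp i j k l := by
  have hJ : ∀ k i, ∑ a, J' k a * J a i = if k = i then 1 else 0 := fun k i => by
    rw [← Matrix.mul_apply, h, Matrix.one_apply]
  have e : trans22 J J' idOp i j k l = (∑ a, J' k a * J a i) * (∑ b, J' l b * J b j) -
      (∑ a, J' l a * J a i) * (∑ b, J' k b * J b j) := by
    simp only [trans22, idOp, mul_sub, Finset.sum_sub_distrib, Finset.sum_mul_sum]
    congr 1 <;> refine Finset.sum_congr rfl fun a _ => Finset.sum_congr rfl fun b _ => ?_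
    · simp [Finset.sum_ite_eq]; ring
    · simp [Finset.sum_ite_eq]; ring
  rw [e, hJ, hJ, hJ, hJ, idOp]
  simp only [eq_comm]

end Local

end

end WeakAH

namespace WeakAH

noncomputable section

/-! ### Charts and parametrizations -/

section Charts

variable {n : ℕ} {M : Type*} [TopologicalSpace M]

/-- The target of an extended chart. -/
def exT (e : OpenPartialHomeomorph M (EuclideanHalfSpace (n + 1))) : Set (Coord n) :=
  (e.extend (𝓡∂ (n + 1))).target

/-- The inverse of an extended chart. -/
def exS (e : OpenPartialHomeomorph M (EuclideanHalfSpace (n + 1))) : Coord n → M :=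
  (e.extend (𝓡∂ (n + 1))).symm

/-- An extended chart. -/
def exF (e : OpenPartialHomeomorph M (EuclideanHalfSpace (n + 1))) : M → Coord n :=
  e.extend (𝓡∂ (n + 1))

variable {e : OpenPartialHomeomorph M (EuclideanHalfSpace (n + 1))}

theorem exF_exS {y : Coord n} (hy : y ∈ exT e) : exF e (exS e y) = y :=
  (e.extend (𝓡∂ (n + 1))).right_inv hy

theorem exS_exF {p : M} (hp : p ∈ e.source) : exS e (exF e p) = p := e.extend_left_inv hp

theorem exF_mem {p : M} (hp : p ∈ e.source) : exF e p ∈ exT e :=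
  (e.extend (𝓡∂ (n + 1))).map_source (by rwa [e.extend_source])

theorem exS_mem {y : Coord n} (hy : y ∈ exT e) : exS e y ∈ e.source := by
  have := (e.extend (𝓡∂ (n + 1))).map_target hy
  rwa [e.extend_source] at this

theorem continuousOn_exS : ContinuousOn (exS e) (exT e) := e.continuousOn_extend_symm

theorem continuousOn_exF : ContinuousOn (exF e) e.source := by
  have := e.continuousOn_extend (I := 𝓡∂ (n + 1))
  rwa [e.extend_source] at this

theorem exT_mem_nhds {y : Coord n} (hy : y ∈ exT e) (h0 : 0 < y 0) : exT e ∈ 𝓝 y := by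
  have h1 := e.extend_target_mem_nhdsWithin (I := 𝓡∂ (n + 1)) (exS_mem hy)
  change exT e ∈ 𝓝[_] (exF e (exS e y)) at h1
  rw [exF_exS hy, nhdsWithin_eq_nhds.2] at h1
  · exact h1
  · rw [← mem_interior_iff_mem_nhds, interior_range_modelWithCornersEuclideanHalfSpace]
    exact h0

/-- Targets of charts are relatively open in the half space. Derivatives within them are thus well
defined up to the boundary face, where full derivatives make no sense. -/
theorem uniqueDiffOn_exT : UniqueDiffOn ℝ (exT e) := by
  intro y hy
  have h1 := (𝓡∂ (n + 1)).uniqueDiffOn y (e.extend_target_subset_range hy)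
  have h2 := e.extend_target_mem_nhdsWithin (I := 𝓡∂ (n + 1)) (exS_mem hy)
  change exT e ∈ 𝓝[_] (exF e (exS e y)) at h2
  rw [exF_exS hy] at h2
  exact (h1.inter' h2).mono Set.inter_subset_right

variable [ChartedSpace (EuclideanHalfSpace (n + 1)) M]

theorem contMDiffOn_exS (he : e ∈ IsManifold.maximalAtlas (𝓡∂ (n + 1)) ∞ M) :
    ContMDiffOn 𝓘(ℝ, Coord n) (𝓡∂ (n + 1)) ∞ (exS e) (exT e) := by
  have := contMDiffOn_extend_symm he
  rwa [← e.extend_target'] at this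

theorem contMDiffOn_exF (he : e ∈ IsManifold.maximalAtlas (𝓡∂ (n + 1)) ∞ M) :
    ContMDiffOn (𝓡∂ (n + 1)) 𝓘(ℝ, Coord n) ∞ (exF e) e.source :=
  e.contMDiffOn_extend he

theorem contMDiffAt_exS (he : e ∈ IsManifold.maximalAtlas (𝓡∂ (n + 1)) ∞ M) {y : Coord n}
    (hy : y ∈ exT e) (h0 : 0 < y 0) : ContMDiffAt 𝓘(ℝ, Coord n) (𝓡∂ (n + 1)) ∞ (exS e) y :=
  (contMDiffOn_exS he).contMDiffAt (exT_mem_nhds hy h0)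

/-- The inverse of a chart is a local parametrization at points of the interior. -/
theorem isLoc_exS (he : e ∈ IsManifold.maximalAtlas (𝓡∂ (n + 1)) ∞ M) {y : Coord n}
    (hy : y ∈ exT e) (h0 : 0 < y 0) : IsLoc (exS e) y := by
  have hs := contMDiffAt_exS he hy h0
  refine ⟨hs, ?_⟩
  have hf : ContMDiffAt (𝓡∂ (n + 1)) 𝓘(ℝ, Coord n) ∞ (exF e) (exS e y) :=
    (contMDiffOn_exF he).contMDiffAt (e.open_source.mem_nhds (exS_mem hy))
  have hsd := hs.mdifferentiableAt (by simp)
  have hfd := hf.mdifferentiableAt (by simp)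
  set L : Coord n →L[ℝ] Coord n := mfderiv (𝓡∂ (n + 1)) 𝓘(ℝ, Coord n) (exF e) (exS e y)
  have h1 : L.comp (dM (exS e) y) = ContinuousLinearMap.id ℝ _ := by
    have e1 := mfderiv_comp y hfd hsd
    have e2 : exF e ∘ exS e =ᶠ[𝓝 y] id :=
      Filter.eventually_of_mem (exT_mem_nhds hy h0) fun z hz => exF_exS hz
    rw [e2.mfderiv_eq, mfderiv_id] at e1
    exact e1.symm
  have hinj : Function.Injective (dM (exS e) y) := fun v w h => by
    have := congrArg L h
    change L.comp (dM (exS e) y) v = L.comp (dM (exS e) y) w at this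
    rwa [h1] at this
  exact ⟨(LinearEquiv.ofInjectiveEndo (dM (exS e) y : Coord n →ₗ[ℝ] Coord n)
    hinj).toContinuousLinearEquiv, by ext1 v; rfl⟩

theorem IsLoc.comp_affine {Φ : Coord n → M} {z b : Coord n} {s : ℝ} (hs : s ≠ 0)
    (h : IsLoc Φ (s • z + b)) : IsLoc (fun z => Φ (s • z + b)) z := by
  have hd : HasFDerivAt (fun z : Coord n => s • z + b) (s • ContinuousLinearMap.id ℝ (Coord n)) z :=
    ((hasFDerivAt_id z).const_smul s).add_const b
  refine ⟨ContMDiffAt.comp z h.smooth ?_, ?_⟩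
  · exact ((contDiff_id.const_smul s).add contDiff_const).contMDiff.contMDiffAt
  · have e := dM_comp (τ := fun z : Coord n => s • z + b) hd.differentiableAt h.mdifferentiableAt
    change (dM (Φ ∘ fun z => s • z + b) z).IsInvertible
    rw [e, hd.fderiv]
    refine h.inv.comp ⟨ContinuousLinearEquiv.smulLeft (Units.mk0 s hs), ?_⟩
    ext1 v; rfl

theorem dM_comp_affine {Φ : Coord n → M} {z b : Coord n} {s : ℝ}
    (h : IsLoc Φ (s • z + b)) : dM (fun z => Φ (s • z + b)) z = s • dM Φ (s • z + b) := by
  have hd : HasFDerivAt (fun z : Coord n => s • z + b) (s • ContinuousLinearMap.id ℝ (Coord n)) z :=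
    ((hasFDerivAt_id z).const_smul s).add_const b
  have e := dM_comp (τ := fun z : Coord n => s • z + b) hd.differentiableAt h.mdifferentiableAt
  change dM (Φ ∘ fun z => s • z + b) z = _
  rw [e, hd.fderiv]
  ext1 v; simp

end Charts

/-! ### The norm of the curvature -/

section OpNorm

variable {n : ℕ} {M : Type*} [TopologicalSpace M] [ChartedSpace (EuclideanHalfSpace (n + 1)) M]
  [IsManifold (𝓡∂ (n + 1)) ∞ M]

theorem IsLoc.opNorm_eq {Φ : Coord n → M} {z : Coord n} (hΦ : IsLoc Φ z) {g h : CovTensor n M 2}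
    (hg : ContDiffAt ℝ 2 (pullback Φ g) z) (hm : ∀ᶠ z' in 𝓝 z, IsMet (pullback Φ g z'))
    (hh : IsMet (pullback Φ h z)) :
    opNorm h (Φ z) (fun i j k l => riemOp g (Φ z) i j k l + idOp i j k l) =
      √(opSq (gramT (pullback Φ h z)) fun i j k l => riemC (pullback Φ g) z i j k l +
        idOp i j k l) := by
  obtain ⟨τ, h1, h2, h3, h4, h5⟩ := hΦ.exists_inverse
  have eR : ∀ i j k l, riemOp g (Φ z) i j k l =
      trans22 (jac (fderiv ℝ τ (ctrPt (Φ z)))) (jac (dM Φ z)) (riemC (pullback Φ g) z) i j k l := by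
    intro i j k l
    have e : riemOp g (Φ z) i j k l = riemC (pullback (chInv (Φ z)) g) (ctrPt (Φ z)) i j k l := rfl
    rw [e, riemC_congr (IsLoc.pullback_chInv h3 g), riemC_pbC (h1.of_le (by norm_cast))
      (by rwa [h2]) (by rwa [h2]) (h3.mono fun y hy => hy.1) h4 h5, h2]
  have eh : opNorm h (Φ z) (fun i j k l => riemOp g (Φ z) i j k l + idOp i j k l) =
      √(opSq (gramT (pullback (chInv (Φ z)) h (ctrPt (Φ z))))
        fun i j k l => riemOp g (Φ z) i j k l + idOp i j k l) := rfl
  have eA : (fun i j k l => riemOp g (Φ z) i j k l + idOp i j k l) =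
      trans22 (jac (fderiv ℝ τ (ctrPt (Φ z)))) (jac (dM Φ z))
        (fun i j k l => riemC (pullback Φ g) z i j k l + idOp i j k l) := by
    funext i j k l
    rw [eR, ← trans22_idOp (jac_mul h5) i j k l]
    simp only [trans22, mul_add, Finset.sum_add_distrib]
  rw [eh, (IsLoc.pullback_chInv h3 h).self_of_nhds, pbC, h2, gramT_comp_eq, eA,
    opSq_trans22 (jac_mul h4) hh.isUnit_det]

end OpNorm

end

end WeakAH

namespace WeakAH

noncomputable section

/-! ### Uniform description of the parametrizations -/

section Atlas

variable {n : ℕ} {M : Type*} [TopologicalSpace M] [ChartedSpace (EuclideanHalfSpace (n + 1)) M]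
  {ρ : M → ℝ}

theorem hypBall_height {z : Coord n} (hz : z ∈ hypBall n 2) :
    Real.exp (-2) < z 0 ∧ z 0 < Real.exp 2 := by
  rw [hypBall, mem_ball_iff_norm] at hz
  have h := PiLp.norm_apply_le (z - Real.cosh 2 • basisVec 0 : Coord n) 0
  have h' := abs_lt.1 ((h.trans_lt hz) : |_| < _)
  simp at h'
  have e1 := Real.cosh_sub_sinh 2
  have e2 := Real.cosh_add_sinh 2
  constructor <;> linarith

theorem hypClosedBall_height {z : Coord n} (hz : z ∈ hypClosedBall n 2) : 0 < z 0 := by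
  rw [hypClosedBall, mem_closedBall_iff_norm] at hz
  have h := PiLp.norm_apply_le (z - Real.cosh 2 • basisVec 0 : Coord n) 0
  have h' := abs_le.1 ((h.trans hz) : |_| ≤ _)
  simp at h'
  have e1 := Real.cosh_sub_sinh 2
  have := Real.exp_pos (-2)
  linarith

theorem basisVec_zero_mem_hypBall : (basisVec 0 : Coord n) ∈ hypBall n 2 := by
  rw [mem_hypBall_iff n (by norm_num)]
  simp [basisVec, Real.one_lt_cosh]

theorem hypBall_one_subset : hypBall n 1 ⊆ hypBall n 2 := by
  intro z hz
  rw [mem_hypBall_iff n (by norm_num)] at hz ⊢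
  exact ⟨hz.1, hz.2.trans (Real.cosh_lt_cosh.2 (by norm_num))⟩

/-- A description of all parametrizations in terms of finitely many charts. -/
structure Atl (B : Background n M ρ) where
  K : Type
  finite_K : Finite K
  e : K → OpenPartialHomeomorph M (EuclideanHalfSpace (n + 1))
  e_mem : ∀ a, e a ∈ IsManifold.maximalAtlas (𝓡∂ (n + 1)) ∞ M
  core : K → Set M
  core_compact : ∀ a, IsCompact (core a)
  core_subset : ∀ a, core a ⊆ (e a).source
  kap : B.ι → K
  s : B.ι → ℝ
  b : B.ι → Coord n
  s_pos : ∀ i, 0 < s i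
  s_bdd : ∃ S, ∀ i, s i ≤ S
  mem : ∀ i, ∀ z ∈ hypBall n 2, s i • z + b i ∈ exT (e (kap i))
  height : ∀ i, ∀ z ∈ hypBall n 2, 0 < (s i • z + b i) 0
  param_eq : ∀ i, ∀ z ∈ hypBall n 2, B.param i z = exS (e (kap i)) (s i • z + b i)
  mem_core : ∀ i, ∀ z ∈ hypBall n 2, B.param i z ∈ core (kap i)
  rho_lower : ∃ c, 0 < c ∧ ∀ i, ∀ z ∈ hypBall n 2, c * s i ≤ ρ (B.param i z)
  rho_upper : ∃ C, 0 < C ∧ ∀ i, ∀ z ∈ hypBall n 2, ρ (B.param i z) ≤ C * s i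

theorem IsDefiningFunction.pos (hρ : IsDefiningFunction n ρ) {p : M}
    (hp : p ∈ (𝓡∂ (n + 1)).interior M) : 0 < ρ p := by
  refine lt_of_le_of_ne (hρ.nonneg p) fun h => ?_
  have h1 := (hρ.eq_zero_iff p).1 h.symm
  exact Set.disjoint_left.1 (𝓡∂ (n + 1)).disjoint_interior_boundary hp h1

variable [CompactSpace M]

theorem IsDefiningFunction.exists_le (hρ : IsDefiningFunction n ρ) :
    ∃ C, 0 < C ∧ ∀ p, ρ p ≤ C := by
  obtain ⟨C, hC⟩ := (isCompact_univ (X := M)).exists_bound_of_continuousOn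
    hρ.smooth.continuous.continuousOn
  refine ⟨max C 1, by positivity, fun p => ?_⟩
  exact ((le_abs_self _).trans (hC p (Set.mem_univ _))).trans (le_max_left _ _)

/-- Every parametrization is the inverse of one of finitely many charts composed with `z ↦ s z + b`.
Interior charts get `s = 1` and `b = 0`; a Möbius parametrization gets `s = ρ₀`, and in it `ρ` is
`ρ₀` times the height. -/
theorem exists_atl (hρ : IsDefiningFunction n ρ) (B : Background n M ρ) : Nonempty (Atl B) := by
  classical
  obtain ⟨C, hC0, hC⟩ := hρ.exists_le
  choose ei hei1 hei2 hei3 using B.param_inner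
  choose ab cb hcb hpb using B.param_boundary
  have hfin : Finite B.inner := B.inner_finite
  have hb0 : ∀ i (hi : i ∉ B.inner), ∀ z ∈ hypBall n 2, ρ (B.param i z) = cb i hi 0 * z 0 := by
    intro i hi z hz
    obtain ⟨h1, h2, h3⟩ := hpb i hi z hz
    have h4 := B.normal_coord (ab i hi) (B.param i z) (B.core_subset _ h3)
    rw [← h4, h2]
    change exF (B.chart (ab i hi)) (exS _ _) 0 = _
    rw [exF_exS h1]
    simp [mobius]
  have hei : ∀ i (hi : i ∈ B.inner), ∀ z ∈ hypClosedBall n 2, z ∈ exT (ei i hi) ∧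
      B.param i z = exS (ei i hi) z ∧ 0 < ρ (B.param i z) := by
    intro i hi z hz
    refine ⟨hei2 i hi hz, hei3 i hi hz, ?_⟩
    rw [hei3 i hi hz]
    exact hρ.pos (isLoc_exS (hei1 i hi) (hei2 i hi hz) (hypClosedBall_height hz)).mem_interior
  have hcpt : IsCompact (hypClosedBall n 2) := isCompact_closedBall _ _
  have hcont : ∀ i (hi : i ∈ B.inner), ContinuousOn (exS (ei i hi)) (hypClosedBall n 2) :=
    fun i hi => continuousOn_exS.mono (hei2 i hi)
  -- The closed ball is compact and mapped into the interior, so `ρ` has a positive minimum on its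
  -- image.
  have hlow : ∀ i : B.inner, ∃ c, 0 < c ∧ ∀ z ∈ hypClosedBall n 2, c ≤ ρ (B.param i z) := by
    intro i
    obtain ⟨z, hz, hmin⟩ := hcpt.exists_isMinOn
      ⟨_, Metric.ball_subset_closedBall (basisVec_zero_mem_hypBall (n := n))⟩
      (hρ.smooth.continuous.comp_continuousOn (hcont i i.2))
    refine ⟨_, (hei i i.2 z hz).2.2, fun w hw => ?_⟩
    rw [(hei i i.2 z hz).2.1, (hei i i.2 w hw).2.1]
    exact hmin hw
  choose cl hcl0 hcl using hlow
  obtain ⟨c, hc0, hc⟩ : ∃ c, 0 < c ∧ ∀ i, c ≤ cl i := by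
    rcases isEmpty_or_nonempty B.inner with h | h
    · exact ⟨1, one_pos, fun i => h.elim i⟩
    · obtain ⟨i, hi⟩ := Finite.exists_min cl
      exact ⟨cl i, hcl0 i, hi⟩
  have hsub : hypBall n 2 ⊆ hypClosedBall n 2 := Metric.ball_subset_closedBall
  have hmob : ∀ (c z : Coord n), c 0 • z + (c - (c 0) • basisVec 0) = mobius c z := fun c z => by
    rw [mobius, add_comm]
  refine ⟨{
    K := Fin B.numCharts ⊕ B.inner
    finite_K := inferInstance
    e := Sum.elim B.chart fun i => ei i i.2
    e_mem := by rintro (a | i); exacts [B.chart_mem a, hei1 i i.2]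
    core := Sum.elim B.core fun i => exS (ei i i.2) '' hypClosedBall n 2
    core_compact := by
      rintro (a | i); exacts [B.core_compact a, hcpt.image_of_continuousOn (hcont i i.2)]
    core_subset := by
      rintro (a | i)
      · exact B.core_subset a
      · rintro _ ⟨z, hz, rfl⟩; exact exS_mem (hei2 i i.2 hz)
    kap := fun i => if h : i ∈ B.inner then Sum.inr ⟨i, h⟩ else Sum.inl (ab i h)
    s := fun i => if h : i ∈ B.inner then 1 else cb i h 0
    b := fun i => if h : i ∈ B.inner then 0 else cb i h - (cb i h 0) • basisVec 0
    s_pos := fun i => by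
      by_cases h : i ∈ B.inner
      · simp [h]
      · simp [h, hcb i h]
    -- At the centre, which has height `1`, the value of `ρ` is the scale itself, so the bound of
    -- `ρ` on the compact manifold bounds the scales.
    s_bdd := ⟨max 1 C, fun i => by
      by_cases h : i ∈ B.inner
      · simp [h]
      · have h1 := hb0 i h _ basisVec_zero_mem_hypBall
        simp only [basisVec_apply, if_true, mul_one] at h1
        simp only [h, dite_false, ← h1]
        exact (hC _).trans (le_max_right _ _)⟩
    mem := fun i z hz => by
      by_cases h : i ∈ B.inner
      · simp only [h, dite_true, one_smul, add_zero]; exact hei2 i h (hsub hz)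
      · simp only [h, dite_false, hmob]; exact (hpb i h z hz).1
    height := fun i z hz => by
      by_cases h : i ∈ B.inner
      · simp only [h, dite_true, one_smul, add_zero]; exact hypClosedBall_height (hsub hz)
      · simp only [h, dite_false, hmob]
        simp [mobius, hcb i h, hypClosedBall_height (hsub hz)]
    param_eq := fun i z hz => by
      by_cases h : i ∈ B.inner
      · simp only [h, dite_true, one_smul, add_zero]; exact (hei i h z (hsub hz)).2.1
      · simp only [h, dite_false, hmob]; exact (hpb i h z hz).2.1
    mem_core := fun i z hz => by
      by_cases h : i ∈ B.inner
      · simp only [h, dite_true]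
        exact ⟨z, hsub hz, ((hei i h z (hsub hz)).2.1).symm⟩
      · simp only [h, dite_false]; exact (hpb i h z hz).2.2
    rho_lower := ⟨min c (Real.exp (-2)), lt_min hc0 (Real.exp_pos _), fun i z hz => by
      by_cases h : i ∈ B.inner
      · simp only [h, dite_true, mul_one]
        exact (min_le_left _ _).trans ((hc ⟨i, h⟩).trans (hcl ⟨i, h⟩ z (hsub hz)))
      · simp only [h, dite_false]
        rw [hb0 i h z hz, mul_comm]
        gcongr
        · exact (hcb i h).le
        · exact (min_le_right _ _).trans (hypBall_height hz).1.le⟩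
    rho_upper := ⟨max C (Real.exp 2), by positivity, fun i z hz => by
      by_cases h : i ∈ B.inner
      · simp only [h, dite_true, mul_one]
        exact (hC _).trans (le_max_left _ _)
      · simp only [h, dite_false]
        rw [hb0 i h z hz, mul_comm]
        gcongr
        · exact (hcb i h).le
        · exact (hypBall_height hz).2.le.trans (le_max_right _ _)⟩ }⟩

end Atlas

/-! ### Smooth functions seen through the parametrizations. -/

section Smooth

variable {n : ℕ} {M : Type*} [TopologicalSpace M] [ChartedSpace (EuclideanHalfSpace (n + 1)) M]
  {ρ : M → ℝ} {B : Background n M ρ}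

/-- The image of the core of a chart in coordinates. -/
def Atl.Q (A : Atl B) (a : A.K) : Set (Coord n) := exF (A.e a) '' A.core a

theorem Atl.isCompact_Q (A : Atl B) (a : A.K) : IsCompact (A.Q a) :=
  (A.core_compact a).image_of_continuousOn (continuousOn_exF.mono (A.core_subset a))

theorem Atl.Q_subset (A : Atl B) (a : A.K) : A.Q a ⊆ exT (A.e a) := by
  rintro _ ⟨p, hp, rfl⟩
  exact exF_mem (A.core_subset a hp)

theorem Atl.mem_Q (A : Atl B) {i : B.ι} {z : Coord n} (hz : z ∈ hypBall n 2) :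
    A.s i • z + A.b i ∈ A.Q (A.kap i) :=
  ⟨B.param i z, A.mem_core i z hz, by rw [A.param_eq i z hz, exF_exS (A.mem i z hz)]⟩

theorem Atl.isScale (A : Atl B) {α : ℝ} (h0 : 0 ≤ α) (h1 : α ≤ 1) : IsScale α A.s :=
  ⟨h0, h1, A.s_pos, A.s_bdd⟩

theorem Atl.exists_bound (A : Atl B) {F : A.K → Coord n → ℝ}
    (hF : ∀ a, ContinuousOn (F a) (exT (A.e a))) : ∃ C, ∀ a, ∀ y ∈ A.Q a, |F a y| ≤ C := by
  have := A.finite_K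
  choose C hC using fun a => (A.isCompact_Q a).exists_bound_of_continuousOn
    ((hF a).mono (A.Q_subset a))
  obtain ⟨D, hD⟩ := (Set.finite_range C).bddAbove
  exact ⟨D, fun a y hy => (hC a y hy).trans (hD ⟨a, rfl⟩)⟩

theorem pd_comp_affine {F : Coord n → ℝ} {z b : Coord n} {s : ℝ}
    (hF : DifferentiableAt ℝ F (s • z + b)) (j : Fin (n + 1)) :
    pd j (fun z => F (s • z + b)) z = s * pd j F (s • z + b) := by
  have hd : HasFDerivAt (fun z : Coord n => s • z + b) (s • ContinuousLinearMap.id ℝ (Coord n)) z :=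
    ((hasFDerivAt_id z).const_smul s).add_const b
  have h := (hF.hasFDerivAt.comp z hd).fderiv
  change fderiv ℝ (F ∘ fun z => s • z + b) z _ = _
  rw [h]; simp [pd]

/-- Functions that are smooth up to the boundary in the charts give uniformly bounded functions. -/
theorem Atl.uA (A : Atl B) {α : ℝ} (h0 : 0 ≤ α) (h1 : α ≤ 1) (m k : ℕ)
    {F : A.K → Coord n → ℝ} (hF : ∀ a, ContDiffOn ℝ ∞ (F a) (exT (A.e a))) :
    UA α A.s m k fun i z => F (A.kap i) (A.s i • z + A.b i) := by
  have hs := A.isScale h0 h1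
  have hsmul : ∀ i, ContDiff ℝ ∞ fun z : Coord n => A.s i • z + A.b i := fun i =>
    (contDiff_id.const_smul _).add contDiff_const
  -- Each derivative of `F (s z + b)` produces a factor `s`, which absorbs a weight `s⁻¹`, and a new
  -- function `F'` with the same smoothness up to the boundary. So the bounds hold for every `m` and
  -- `k`.
  have main : ∀ {F : A.K → Coord n → ℝ} (_ : ∀ a, ContDiffOn ℝ ∞ (F a) (exT (A.e a))),
      (UB fun i z => F (A.kap i) (A.s i • z + A.b i)) ∧
      (∀ i, DifferentiableOn ℝ (fun z => F (A.kap i) (A.s i • z + A.b i)) (hypBall n 2)) ∧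
      ∃ F' : Fin (n + 1) → A.K → Coord n → ℝ,
        (∀ j a, ContDiffOn ℝ ∞ (F' j a) (exT (A.e a))) ∧ ∀ j i, ∀ z ∈ hypBall n 2,
          WeakAH.pd j (fun z => F (A.kap i) (A.s i • z + A.b i)) z =
            A.s i * F' j (A.kap i) (A.s i • z + A.b i) := by
    intro F hF
    have hFd : ∀ i, ∀ z ∈ hypBall n 2, DifferentiableAt ℝ (F (A.kap i)) (A.s i • z + A.b i) :=
      fun i z hz => ((hF _).contDiffAt
        (exT_mem_nhds (A.mem i z hz) (A.height i z hz))).differentiableAt (by simp)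
    refine ⟨?_, fun i z hz => ?_, ?_⟩
    · obtain ⟨C, hC⟩ := A.exists_bound fun a => (hF a).continuousOn
      exact ⟨C, fun i z hz => hC _ _ (A.mem_Q hz)⟩
    · exact ((hFd i z hz).comp z
        ((hsmul i).differentiable (by simp) z)).differentiableWithinAt
    · refine ⟨fun j a y => fderivWithin ℝ (F a) (exT (A.e a)) y (basisVec j), fun j a => ?_,
        fun j i z hz => ?_⟩
      · exact ((hF a).fderivWithin uniqueDiffOn_exT (m := ∞) (by simp)).clm_apply contDiffOn_const
      · dsimp only
        rw [pd_comp_affine (hFd i z hz), fderivWithin_of_mem_nhds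
          (exT_mem_nhds (A.mem i z hz) (A.height i z hz))]
        rfl
  induction k generalizing m F with
  | zero =>
    obtain ⟨h1', h2, F', h3, h4⟩ := main hF
    refine ⟨h1', fun i => (h2 i).continuousOn, UHol.of_pd h0 h1 h2 ?_⟩
    obtain ⟨S, hS⟩ := hs.abs_bdd
    choose C hC using fun j => (main (h3 j)).1
    refine ⟨S * ∑ j, |C j|, fun i z hz j => ?_⟩
    rw [h4 j i z hz, abs_mul]
    gcongr
    · exact (abs_nonneg _).trans (hS i)
    · exact hS i
    · exact (hC j i z hz).trans ((le_abs_self _).trans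
        (Finset.single_le_sum (f := fun j => |C j|) (fun _ _ => abs_nonneg _) (Finset.mem_univ j)))
  | succ k ih =>
    obtain ⟨h1', h2, F', h3, h4⟩ := main hF
    refine ⟨h1', h2, fun j => ?_⟩
    have hc : ∃ C, ∀ i, |wt m (A.s i) * A.s i| ≤ C := by
      rcases Nat.eq_zero_or_pos m with rfl | hm
      · simpa [wt] using hs.abs_bdd
      · exact ⟨1, fun i => by simp [wt, hm.ne', (A.s_pos i).ne']⟩
    refine ((ih (m - 1) (h3 j)).const_mul hc).congr fun i z hz => ?_
    rw [h4 j i z hz, mul_assoc]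

theorem Atl.isLoc (A : Atl B) {i : B.ι} {z : Coord n} (hz : z ∈ hypBall n 2) :
    IsLoc (B.param i) z := by
  have h := (isLoc_exS (A.e_mem _) (A.mem i z hz) (A.height i z hz)).comp_affine (A.s_pos i).ne'
  have he : B.param i =ᶠ[𝓝 z] fun z => exS (A.e (A.kap i)) (A.s i • z + A.b i) :=
    Filter.eventually_of_mem (hypBall_mem_nhds hz) fun w hw => A.param_eq i w hw
  exact ⟨h.smooth.congr_of_eventuallyEq he, by rw [dM_congr he]; exact h.inv⟩

theorem Atl.dM_eq (A : Atl B) {i : B.ι} {z : Coord n} (hz : z ∈ hypBall n 2) :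
    dM (B.param i) z = A.s i • dM (exS (A.e (A.kap i))) (A.s i • z + A.b i) := by
  have he : B.param i =ᶠ[𝓝 z] fun z => exS (A.e (A.kap i)) (A.s i • z + A.b i) :=
    Filter.eventually_of_mem (hypBall_mem_nhds hz) fun w hw => A.param_eq i w hw
  rw [dM_congr he, dM_comp_affine (isLoc_exS (A.e_mem _) (A.mem i z hz) (A.height i z hz))]

end Smooth

end

end WeakAH

namespace WeakAH

noncomputable section

/-! ### Frames, metrics and vector fields in charts -/

section Frames

variable {n : ℕ} {M : Type*} [TopologicalSpace M] [ChartedSpace (EuclideanHalfSpace (n + 1)) M]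
  {e : OpenPartialHomeomorph M (EuclideanHalfSpace (n + 1))}

/-- The derivative of the inverse of a chart, up to the boundary. -/
def frm (e : OpenPartialHomeomorph M (EuclideanHalfSpace (n + 1))) (y : Coord n) :
    Coord n →L[ℝ] Coord n :=
  mfderivWithin 𝓘(ℝ, Coord n) (𝓡∂ (n + 1)) (exS e) (exT e) y

theorem frm_eq {y : Coord n} (hy : y ∈ exT e) (h0 : 0 < y 0) : frm e y = dM (exS e) y :=
  mfderivWithin_of_mem_nhds (exT_mem_nhds hy h0)

/-- The derivative of the chart is a left inverse of the frame, also at boundary points. -/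
theorem frm_bijective (he : e ∈ IsManifold.maximalAtlas (𝓡∂ (n + 1)) ∞ M) {y : Coord n}
    (hy : y ∈ exT e) : ∃ L : Coord n →L[ℝ] Coord n,
      L = mfderiv (𝓡∂ (n + 1)) 𝓘(ℝ, Coord n) (exF e) (exS e y) ∧ ∀ v, L (frm e y v) = v := by
  have hf : ContMDiffAt (𝓡∂ (n + 1)) 𝓘(ℝ, Coord n) ∞ (exF e) (exS e y) :=
    (contMDiffOn_exF he).contMDiffAt (e.open_source.mem_nhds (exS_mem hy))
  have hsd := (contMDiffOn_exS he y hy).mdifferentiableWithinAt (by simp)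
  have hfd := hf.mdifferentiableAt (by simp)
  refine ⟨_, rfl, fun v => ?_⟩
  have hu : UniqueMDiffWithinAt 𝓘(ℝ, Coord n) (exT e) y := (uniqueDiffOn_exT y hy).uniqueMDiffWithinAt
  have e1 := mfderiv_comp_mfderivWithin y hfd hsd hu
  have e2 : mfderivWithin 𝓘(ℝ, Coord n) 𝓘(ℝ, Coord n) (exF e ∘ exS e) (exT e) y =
      mfderivWithin 𝓘(ℝ, Coord n) 𝓘(ℝ, Coord n) (id : Coord n → Coord n) (exT e) y :=
    mfderivWithin_congr (fun z hz => exF_exS hz) (exF_exS hy)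
  rw [e2, mfderivWithin_id hu] at e1
  exact (DFunLike.congr_fun e1 v).symm

theorem frm_injective (he : e ∈ IsManifold.maximalAtlas (𝓡∂ (n + 1)) ∞ M) {y : Coord n}
    (hy : y ∈ exT e) {v : Coord n} (hv : v ≠ 0) : frm e y v ≠ 0 := by
  obtain ⟨L, -, hL⟩ := frm_bijective he hy
  intro h
  have := hL v
  rw [h, map_zero] at this
  exact hv this.symm

/-- The components of a vector field in a chart. -/
def vfC (e : OpenPartialHomeomorph M (EuclideanHalfSpace (n + 1)))
    (X : ∀ q : M, TangentSpace (𝓡∂ (n + 1)) q) (y : Coord n) : Coord n :=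
  mfderiv (𝓡∂ (n + 1)) 𝓘(ℝ, Coord n) (exF e) (exS e y) (X (exS e y))

theorem mpb_exS (he : e ∈ IsManifold.maximalAtlas (𝓡∂ (n + 1)) ∞ M)
    (X : ∀ q : M, TangentSpace (𝓡∂ (n + 1)) q) {y : Coord n} (hy : y ∈ exT e) (h0 : 0 < y 0) :
    mpb (exS e) X y = vfC e X y := by
  obtain ⟨L, h1, h2⟩ := frm_bijective he hy
  have hi := (isLoc_exS he hy h0).inv
  have h3 : L (dM (exS e) y (mpb (exS e) X y)) = mpb (exS e) X y := by
    rw [← frm_eq hy h0]; exact h2 _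
  have h4 : dM (exS e) y (mpb (exS e) X y) = X (exS e y) := hi.self_apply_inverse _
  rw [← h3, h4, h1]
  rfl

variable [IsManifold (𝓡∂ (n + 1)) ∞ M]

theorem contMDiffOn_frm (he : e ∈ IsManifold.maximalAtlas (𝓡∂ (n + 1)) ∞ M) (v : Coord n) :
    ContMDiffOn 𝓘(ℝ, Coord n) ((𝓡∂ (n + 1)).prod 𝓘(ℝ, Coord n)) ∞
      (fun y => Bundle.TotalSpace.mk' (Coord n) (E := fun p : M => TangentSpace (𝓡∂ (n + 1)) p)
        (exS e y) (frm e y v)) (exT e) := by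
  have h1 := (contMDiffOn_exS he).contMDiffOn_tangentMapWithin (m := ∞) (by simp)
    uniqueDiffOn_exT.uniqueMDiffOn
  have h2 : ContMDiff 𝓘(ℝ, Coord n) (𝓘(ℝ, Coord n).prod 𝓘(ℝ, Coord n)) ∞
      (fun y : Coord n => Bundle.TotalSpace.mk' (Coord n)
        (E := fun p : Coord n => TangentSpace 𝓘(ℝ, Coord n) p) y v) :=
    contMDiff_vectorSpace_iff_contDiff.2 contDiff_const
  exact h1.comp h2.contMDiffOn fun y hy => hy

/-- The components of a smooth bundle metric are smooth in charts. -/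
theorem contDiffOn_metric_comp (he : e ∈ IsManifold.maximalAtlas (𝓡∂ (n + 1)) ∞ M)
    (h : Bundle.ContMDiffRiemannianMetric (𝓡∂ (n + 1)) ∞ (Coord n)
      (fun p : M => TangentSpace (𝓡∂ (n + 1)) p)) (v w : Coord n) :
    ContDiffOn ℝ ∞ (fun y => h.inner (exS e y) (frm e y v) (frm e y w)) (exT e) := by
  rw [← contMDiffOn_iff_contDiffOn]
  intro y hy
  have : ContMDiffWithinAt 𝓘(ℝ, Coord n) ((𝓡∂ (n + 1)).prod 𝓘(ℝ, ℝ)) ∞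
      (fun y => Bundle.TotalSpace.mk' ℝ (E := Bundle.Trivial M ℝ) (exS e y)
        (h.inner (exS e y) (frm e y v) (frm e y w))) (exT e) y := by
    apply ContMDiffWithinAt.clm_bundle_apply₂ (F₁ := Coord n) (F₂ := Coord n)
    · exact ContMDiffAt.comp_contMDiffWithinAt y h.contMDiff.contMDiffAt (contMDiffOn_exS he y hy)
    · exact contMDiffOn_frm he v y hy
    · exact contMDiffOn_frm he w y hy
  simp only [Bundle.contMDiffWithinAt_totalSpace] at this
  exact this.2

/-- The components of a continuous bundle metric are continuous in charts. -/
theorem continuousOn_metric_comp (he : e ∈ IsManifold.maximalAtlas (𝓡∂ (n + 1)) ∞ M)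
    (G : Bundle.ContinuousRiemannianMetric (Coord n)
      (fun p : M => TangentSpace (𝓡∂ (n + 1)) p)) (v w : Coord n) :
    ContinuousOn (fun y => G.inner (exS e y) (frm e y v) (frm e y w)) (exT e) := by
  have : IsManifold (𝓡∂ (n + 1)) 1 M := IsManifold.of_le (n := ∞) (by norm_num)
  rw [← contDiffOn_zero (𝕜 := ℝ), ← contMDiffOn_iff_contDiffOn]
  intro y hy
  have : ContMDiffWithinAt 𝓘(ℝ, Coord n) ((𝓡∂ (n + 1)).prod 𝓘(ℝ, ℝ)) 0
      (fun y => Bundle.TotalSpace.mk' ℝ (E := Bundle.Trivial M ℝ) (exS e y)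
        (G.inner (exS e y) (frm e y v) (frm e y w))) (exT e) y := by
    apply ContMDiffWithinAt.clm_bundle_apply₂ (F₁ := Coord n) (F₂ := Coord n)
    · exact ContMDiffAt.comp_contMDiffWithinAt y (contMDiff_zero_iff.2 G.continuous).contMDiffAt
        ((contMDiffOn_exS he y hy).of_le (by simp))
    · exact (contMDiffOn_frm he v y hy).of_le (by simp)
    · exact (contMDiffOn_frm he w y hy).of_le (by simp)
  simp only [Bundle.contMDiffWithinAt_totalSpace] at this
  exact this.2

theorem contDiffOn_vfC (he : e ∈ IsManifold.maximalAtlas (𝓡∂ (n + 1)) ∞ M)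
    {X : ∀ q : M, TangentSpace (𝓡∂ (n + 1)) q} (hX : IsSmoothVectorField X) :
    ContDiffOn ℝ ∞ (vfC e X) (exT e) := by
  have h1 := (contMDiffOn_exF he).contMDiffOn_tangentMapWithin (m := ∞) (by simp)
    e.open_source.uniqueMDiffOn
  have h2 : ContMDiffOn 𝓘(ℝ, Coord n) (𝓘(ℝ, Coord n).prod 𝓘(ℝ, Coord n)) ∞
      (fun y => tangentMapWithin (𝓡∂ (n + 1)) 𝓘(ℝ, Coord n) (exF e) e.source
        (Bundle.TotalSpace.mk' (Coord n) (E := fun p : M => TangentSpace (𝓡∂ (n + 1)) p)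
          (exS e y) (X (exS e y)))) (exT e) :=
    h1.comp (hX.comp_contMDiffOn (contMDiffOn_exS he)) fun y hy => exS_mem hy
  refine contMDiffOn_vectorSpace_iff_contDiffOn.1 (h2.congr fun y hy => ?_)
  have aux : ∀ (a b : Coord n) (_ : a = b) (v : Coord n), Bundle.TotalSpace.mk' (Coord n)
      (E := fun p : Coord n => TangentSpace 𝓘(ℝ, Coord n) p) a v =
      Bundle.TotalSpace.mk' (Coord n) (E := fun p : Coord n => TangentSpace 𝓘(ℝ, Coord n) p) b v := by
    rintro a b rfl v; rfl
  refine (aux y _ (exF_exS hy).symm _).trans ?_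
  have h4 : mfderivWithin (𝓡∂ (n + 1)) 𝓘(ℝ, Coord n) (exF e) e.source (exS e y) =
      mfderiv (𝓡∂ (n + 1)) 𝓘(ℝ, Coord n) (exF e) (exS e y) :=
    mfderivWithin_of_mem_nhds (e.open_source.mem_nhds (exS_mem hy))
  rw [tangentMapWithin, h4]
  rfl

end Frames

end

end WeakAH

namespace WeakAH

noncomputable section

/-! ### Coordinate fields -/

section Fields

/-- The components of a smooth vector field in a parametrization. -/
theorem Atl.mpb_eq {n : ℕ} {M : Type*} [TopologicalSpace M] [ChartedSpace (EuclideanHalfSpace (n + 1)) M]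
    {ρ : M → ℝ} {B : Background n M ρ} (A : Atl B) (X : ∀ q : M, TangentSpace (𝓡∂ (n + 1)) q) {i : B.ι} {z : Coord n}
    (hz : z ∈ hypBall n 2) :
    mpb (B.param i) X z = (A.s i)⁻¹ • vfC (A.e (A.kap i)) X (A.s i • z + A.b i) := by
  have hl := isLoc_exS (A.e_mem _) (A.mem i z hz) (A.height i z hz)
  rw [← mpb_exS (A.e_mem _) X (A.mem i z hz) (A.height i z hz)]
  refine ((A.isLoc hz).inv.inverse_apply_eq).2 ?_
  rw [A.dM_eq hz]
  have h4 : dM (exS (A.e (A.kap i))) (A.s i • z + A.b i)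
      (mpb (exS (A.e (A.kap i))) X (A.s i • z + A.b i)) =
      X (exS (A.e (A.kap i)) (A.s i • z + A.b i)) := hl.inv.self_apply_inverse _
  simp only [smul_apply, map_smul, h4]
  have h6 : ∀ v : Coord n, v = (A.s i)⁻¹ • A.s i • v := fun v => by
    rw [smul_smul, inv_mul_cancel₀ (A.s_pos i).ne', one_smul]
  let Y : M → Coord n := X
  exact (congrArg Y (A.param_eq i z hz)).trans (h6 _)

variable {n : ℕ} {M : Type*} [TopologicalSpace M] [T2Space M] [CompactSpace M]
  [ChartedSpace (EuclideanHalfSpace (n + 1)) M] [IsManifold (𝓡∂ (n + 1)) ∞ M]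
  {e : OpenPartialHomeomorph M (EuclideanHalfSpace (n + 1))}

/-- A coordinate field of a chart, cut off outside a compact set, is a global vector field. -/
theorem exists_coordinate_field (he : e ∈ IsManifold.maximalAtlas (𝓡∂ (n + 1)) ∞ M) {K : Set M}
    (hK : IsCompact K) (hKe : K ⊆ e.source) (v : Coord n) :
    ∃ X : ∀ q : M, TangentSpace (𝓡∂ (n + 1)) q, IsSmoothVectorField X ∧
      ∀ q ∈ K, X q = frm e (exF e q) v := by
  obtain ⟨f, hf0, hf1, -⟩ := exists_contMDiffMap_zero_one_nhds_of_isClosed (𝓡∂ (n + 1)) (n := (⊤ : ℕ∞))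
    e.open_source.isClosed_compl hK.isClosed
    (Set.disjoint_left.2 fun q hq hq' => hq (hKe hq'))
  let Y : ∀ q : M, TangentSpace (𝓡∂ (n + 1)) q := fun q => frm e (exF e q) v
  have hts : tsupport f ⊆ e.source := by
    intro q hq
    by_contra hne
    have h1 : ∀ᶠ x in 𝓝 q, f x = 0 := Filter.Eventually.filter_mono (nhds_le_nhdsSet hne) hf0
    exact (notMem_tsupport_iff_eventuallyEq.2 h1) hq
  have hY : ContMDiffOn (𝓡∂ (n + 1)) ((𝓡∂ (n + 1)).prod 𝓘(ℝ, Coord n)) ∞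
      (fun q => Bundle.TotalSpace.mk' (Coord n) q (Y q)) e.source := by
    refine ((contMDiffOn_frm he v).comp (contMDiffOn_exF he) fun q hq => exF_mem hq).congr ?_
    intro q hq
    have aux : ∀ (a b : M) (_ : a = b) (v : Coord n), Bundle.TotalSpace.mk' (Coord n)
        (E := fun p : M => TangentSpace (𝓡∂ (n + 1)) p) a v =
        Bundle.TotalSpace.mk' (Coord n) (E := fun p : M => TangentSpace (𝓡∂ (n + 1)) p) b v := by
      rintro a b rfl v; rfl
    exact aux q _ (exS_exF hq).symm _
  refine ⟨(f : M → ℝ) • Y, ?_, fun q hq => ?_⟩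
  · exact ContMDiffOn.smul_section_of_tsupport f.contMDiff.contMDiffOn e.open_source hts hY
  · have : f q = 1 := hf1.self_of_nhdsSet q hq
    change f q • Y q = _
    rw [this, one_smul]

variable {ρ : M → ℝ} {B : Background n M ρ}

/-- Among the vector fields that are smooth up to the boundary there are some which, in all
parametrizations belonging to a given chart, are `s⁻¹` times a coordinate field. Lie derivatives
along them recover the weighted partial derivatives. -/
theorem Atl.exists_field (A : Atl B) (a : A.K) (l : Fin (n + 1)) :
    ∃ X : ∀ q : M, TangentSpace (𝓡∂ (n + 1)) q, IsSmoothVectorField X ∧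
      ∀ i, A.kap i = a → ∀ z ∈ hypBall n 2, mpb (B.param i) X z = (A.s i)⁻¹ • basisVec l := by
  obtain ⟨X, hX, hXe⟩ := exists_coordinate_field (A.e_mem a) (A.core_compact a) (A.core_subset a)
    (basisVec l)
  refine ⟨X, hX, ?_⟩
  rintro i rfl z hz
  have h1 : X (B.param i z) = (dM (B.param i) z ((A.s i)⁻¹ • basisVec l) : Coord n) := by
    rw [hXe _ (A.mem_core i z hz), A.dM_eq hz]
    conv_lhs => rw [A.param_eq i z hz, exF_exS (A.mem i z hz),
      frm_eq (A.mem i z hz) (A.height i z hz)]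
    simp [smul_smul, (A.s_pos i).ne']
    rfl
  have h2 : mpb (B.param i) X z =
      (dM (B.param i) z).inverse (dM (B.param i) z ((A.s i)⁻¹ • basisVec l)) :=
    congrArg _ h1
  rw [h2, (A.isLoc hz).inv.inverse_apply_self]

end Fields

/-! ### Weighted spaces in terms of components -/

section Weighted

variable {n r : ℕ} {α : ℝ} {I : Type*} {s : I → ℝ}

/-- The scaled components of a family of tensor fields. -/
def sC (s : I → ℝ) (d : ℕ) (t : I → Coord n → Tens n r) (J : Fin r → Fin (n + 1)) (i : I)
    (z : Coord n) : ℝ := (s i ^ d)⁻¹ * cmp (t i) J z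

/-- The basis tensors. -/
def tb (J : Fin r → Fin (n + 1)) : Tens n r :=
  (ContinuousMultilinearMap.mkPiAlgebra ℝ (Fin r) ℝ).compContinuousLinearMap
    (fun a => (EuclideanSpace.proj (J a) : Coord n →L[ℝ] ℝ))

theorem eq_sum_tb (t : Tens n r) :
    t = ∑ J, t (fun a => basisVec (J a)) • tb J := (ofComponents_cmp t).symm

variable {M : Type*} [TopologicalSpace M] [ChartedSpace (EuclideanHalfSpace (n + 1)) M]
  {ρ : M → ℝ} {B : Background n M ρ}

theorem Atl.uA_smooth (A : Atl B) (h0 : 0 ≤ α) (h1 : α ≤ 1) (m k : ℕ) {f : M → ℝ}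
    (hf : ContMDiff (𝓡∂ (n + 1)) 𝓘(ℝ, ℝ) ∞ f) : UA α A.s m k fun i z => f (B.param i z) := by
  refine (A.uA h0 h1 m k (F := fun a y => f (exS (A.e a) y)) fun a => ?_).congr fun i z hz => ?_
  · rw [← contMDiffOn_iff_contDiffOn]
    exact hf.comp_contMDiffOn (contMDiffOn_exS (A.e_mem a))
  · rw [A.param_eq i z hz]

/-- As `ρ` is smooth and of size `O(s)`, the quotient `ρ / s` is controlled with all rescaled
derivatives. Together with the lower bound this makes weights in `ρ` and in `s` interchangeable. -/
theorem Atl.uA_ratio (A : Atl B) (hρ : IsDefiningFunction n ρ) (h0 : 0 ≤ α) (h1 : α ≤ 1) (k : ℕ) :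
    UA α A.s 0 k fun i z => (A.s i)⁻¹ * ρ (B.param i z) := by
  have hs := A.isScale h0 h1
  refine ((A.uA_smooth h0 h1 1 (k + 1) hρ.smooth).inv_scale_mul hs ?_).of_succ hs
  obtain ⟨C, -, hC⟩ := A.rho_upper
  obtain ⟨c, hc0, hc⟩ := A.rho_lower
  refine ⟨C, fun i z hz => ?_⟩
  have hp := A.s_pos i
  rw [abs_of_nonneg (mul_nonneg (inv_nonneg.2 hp.le) (hρ.nonneg _)), inv_mul_le_iff₀ hp, mul_comm]
  exact hC i z hz

theorem Atl.uA_ratio_inv (A : Atl B) (hρ : IsDefiningFunction n ρ) (h0 : 0 ≤ α) (h1 : α ≤ 1)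
    (k : ℕ) : UA α A.s 0 k fun i z => ((A.s i)⁻¹ * ρ (B.param i z))⁻¹ := by
  obtain ⟨c, hc0, hc⟩ := A.rho_lower
  refine (A.uA_ratio hρ h0 h1 k).inv (A.isScale h0 h1) hc0 fun i z hz => ?_
  rw [inv_mul_eq_div, le_div_iff₀ (A.s_pos i)]
  exact hc i z hz

theorem Atl.rho_pos (A : Atl B) {i : B.ι} {z : Coord n} (hz : z ∈ hypBall n 2) :
    0 < ρ (B.param i z) := by
  obtain ⟨c, hc0, hc⟩ := A.rho_lower
  exact (mul_pos hc0 (A.s_pos i)).trans_le (hc i z hz)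

theorem rpow_neg_natCast (x : ℝ) (d : ℕ) : x ^ (-(d : ℝ)) = (x ^ d)⁻¹ := by
  rcases eq_or_ne d 0 with rfl | hd
  · simp
  · by_cases hx : 0 ≤ x
    · rw [Real.rpow_neg hx, Real.rpow_natCast]
    · rw [← Int.cast_natCast, ← Int.cast_neg, Real.rpow_intCast, zpow_neg, zpow_natCast]

variable {Λ : Type*}

theorem pullback_unweight (Φ : Coord n → M) (d : ℕ) (u : CovTensor n M r) (z : Coord n) :
    pullback Φ (unweight ρ d u) z = (ρ (Φ z) ^ d)⁻¹ • pullback Φ u z := by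
  rw [pullback_eq, pullback_eq, ← rpow_neg_natCast]
  rfl

/-- Uniform bounds in weighted Hölder spaces yield uniform bounds for the scaled components. -/
theorem Atl.uA_of_holder (A : Atl B) (hρ : IsDefiningFunction n ρ) (h0 : 0 ≤ α) (h1 : α ≤ 1)
    {k d : ℕ} {u : Λ → CovTensor n M r}
    (hu : ∀ l i, ContDiffOn ℝ k (pullback (B.param i) (unweight ρ d (u l))) (hypBall n 2))
    (hb : ∃ C : NNReal, ∀ l, holderNorm B k α d (u l) ≤ C) (J : Fin r → Fin (n + 1)) :
    UA α (fun x : B.ι × Λ => A.s x.1) 0 k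
      (sC (fun x : B.ι × Λ => A.s x.1) d (fun x => pullback (B.param x.1) (u x.2)) J) := by
  have hs : IsScale α (fun x : B.ι × Λ => A.s x.1) :=
    ⟨h0, h1, fun x => A.s_pos _, A.s_bdd.imp fun C h x => h x.1⟩
  obtain ⟨C, hC⟩ := hb
  have hU : UnifHolder k α fun x : B.ι × Λ => pullback (B.param x.1) (unweight ρ d (u x.2)) :=
    unifHolder_of_holderNormOn_le h0 ⟨C, fun x => (le_iSup (fun i => holderNormOn k α
      (pullback (B.param i) (unweight ρ d (u x.2))) (hypBall n 2)) x.1).trans (hC x.2)⟩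
  have h2 := hU.clm_comp (s := fun x : B.ι × Λ => A.s x.1) (fun x => hu x.2 x.1)
    (ContinuousMultilinearMap.apply ℝ (fun _ : Fin r => Coord n) ℝ (fun a => basisVec (J a)))
  have h3 := ((A.uA_ratio hρ h0 h1 k).reindex (Prod.fst : B.ι × Λ → B.ι)).pow hs d
  refine (h3.mul hs h2).congr fun x z hz => ?_
  have hp := (A.rho_pos (i := x.1) hz).ne'
  simp only [sC, cmp, ContinuousMultilinearMap.apply_apply, pullback_unweight, smul_apply,
    smul_eq_mul, mul_pow, inv_pow]
  field_simp

/-- Uniform bounds for the scaled components yield uniform bounds in weighted Hölder spaces. -/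
theorem Atl.holder_of_uA (A : Atl B) (hρ : IsDefiningFunction n ρ) (h0 : 0 ≤ α) (h1 : α ≤ 1)
    {k d : ℕ} {u : Λ → CovTensor n M r} (h : ∀ J, UA α (fun x : B.ι × Λ => A.s x.1) 0 k
      (sC (fun x : B.ι × Λ => A.s x.1) d (fun x => pullback (B.param x.1) (u x.2)) J)) :
    (∀ l i, ContDiffOn ℝ k (pullback (B.param i) (unweight ρ d (u l))) (hypBall n 2)) ∧
    ∃ C : NNReal, ∀ l, holderNorm B k α d (u l) ≤ C := by
  have hs : IsScale α (fun x : B.ι × Λ => A.s x.1) :=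
    ⟨h0, h1, fun x => A.s_pos _, A.s_bdd.imp fun C h x => h x.1⟩
  have h3 := ((A.uA_ratio_inv hρ h0 h1 k).reindex (Prod.fst : B.ι × Λ → B.ι)).pow hs d
  have hφ := fun J => h3.mul hs (h J)
  have hF : ∀ x : B.ι × Λ, ∀ z ∈ hypBall n 2, pullback (B.param x.1) (unweight ρ d (u x.2)) z =
      ∑ J, (((A.s x.1)⁻¹ * ρ (B.param x.1 z))⁻¹ ^ d *
        sC (fun x : B.ι × Λ => A.s x.1) d (fun x => pullback (B.param x.1) (u x.2)) J x z) •
          tb J := by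
    intro x z hz
    have hp := (A.rho_pos (i := x.1) hz).ne'
    have hp' := (A.s_pos x.1).ne'
    rw [pullback_unweight]
    conv_lhs => rw [eq_sum_tb (pullback (B.param x.1) (u x.2) z), Finset.smul_sum]
    refine Finset.sum_congr rfl fun J _ => ?_
    rw [smul_smul, sC, cmp]
    congr 1
    simp only [mul_inv, inv_inv, mul_pow, inv_pow]
    field_simp
  refine ⟨fun l i => ?_, ?_⟩
  · refine (ContDiffOn.sum fun J _ => ((hφ J).contDiffOn hs (i, l)).smul
      (contDiffOn_const (c := tb J))).congr (hF (i, l))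
  · obtain ⟨C, hC⟩ := (UA.unifHolder hφ tb hF).exists_holderNormOn_le h0
    exact ⟨C, fun l => iSup_le fun i => hC (i, l)⟩

end Weighted

end

end WeakAH

/-! ### Lipschitz pairs, and the geometry of uniform families of metrics. -/

namespace WeakAH

noncomputable section

/-! ### Pairs of families with controlled difference quotients -/

theorem pd_sub {n : ℕ} {f g : Coord n → ℝ} {z : Coord n} (hf : DifferentiableAt ℝ f z)
    (hg : DifferentiableAt ℝ g z) (j : Fin (n + 1)) :
    pd j (fun y => f y - g y) z = pd j f z - pd j g z := by
  simp only [pd]; rw [fderiv_fun_sub hf hg]; rfl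

section UL

variable {n : ℕ} {α : ℝ} {I : Type*} {s d : I → ℝ}

/-- Pairs of families in a uniform Hölder class, whose difference divided by `d` is in the class as
well. -/
structure UL (α : ℝ) (s d : I → ℝ) (m k : ℕ) (x x' : I → Coord n → ℝ) : Prop where
  left : UA α s m k x
  right : UA α s m k x'
  diff : UA α s m k (fun i z => (d i)⁻¹ * (x i z - x' i z))

variable {m m' k k' : ℕ} {x x' y y' : I → Coord n → ℝ}

theorem UL.refl (h : UA α s m k x) : UL α s d m k x x :=
  ⟨h, h, (UA.const' 0).congr fun _ _ _ => by simp⟩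

theorem UL.congr (hx : ∀ i, ∀ z ∈ hypBall n 2, x i z = y i z)
    (hx' : ∀ i, ∀ z ∈ hypBall n 2, x' i z = y' i z) (h : UL α s d m k x x') :
    UL α s d m k y y' :=
  ⟨h.left.congr hx, h.right.congr hx', h.diff.congr fun i z hz => by rw [hx i z hz, hx' i z hz]⟩

theorem UL.const {c c' : I → ℝ} (hc : ∃ C, ∀ i, |c i| ≤ C) (hc' : ∃ C, ∀ i, |c' i| ≤ C)
    (hd : ∃ C, ∀ i, |(d i)⁻¹ * (c i - c' i)| ≤ C) :
    UL (n := n) α s d m k (fun i _ => c i) (fun i _ => c' i) :=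
  ⟨UA.const hc, UA.const hc', UA.const hd⟩

theorem UL.const' (c : ℝ) : UL (n := n) α s d m k (fun _ _ => c) (fun _ _ => c) :=
  UL.refl (UA.const' c)

theorem UL.add (hx : UL α s d m k x x') (hy : UL α s d m k y y') :
    UL α s d m k (fun i z => x i z + y i z) (fun i z => x' i z + y' i z) :=
  ⟨hx.left.add hy.left, hx.right.add hy.right,
    (hx.diff.add hy.diff).congr fun _ _ _ => by ring⟩

theorem UL.const_mul (hx : UL α s d m k x x') {c : I → ℝ} (hc : ∃ C, ∀ i, |c i| ≤ C) :
    UL α s d m k (fun i z => c i * x i z) (fun i z => c i * x' i z) :=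
  ⟨hx.left.const_mul hc, hx.right.const_mul hc,
    (hx.diff.const_mul hc).congr fun _ _ _ => by ring⟩

theorem UL.const_mul' (hx : UL α s d m k x x') (c : ℝ) :
    UL α s d m k (fun i z => c * x i z) (fun i z => c * x' i z) :=
  hx.const_mul ⟨|c|, fun _ => le_rfl⟩

theorem UL.neg (hx : UL α s d m k x x') :
    UL α s d m k (fun i z => -x i z) (fun i z => -x' i z) :=
  (hx.const_mul' (-1)).congr (fun _ _ _ => by ring) fun _ _ _ => by ring

theorem UL.sub (hx : UL α s d m k x x') (hy : UL α s d m k y y') :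
    UL α s d m k (fun i z => x i z - y i z) (fun i z => x' i z - y' i z) :=
  (hx.add hy.neg).congr (fun _ _ _ => by ring) fun _ _ _ => by ring

theorem UL.finset_sum {κ : Type*} (A : Finset κ) {F F' : κ → I → Coord n → ℝ}
    (h : ∀ a ∈ A, UL α s d m k (F a) (F' a)) :
    UL α s d m k (fun i z => ∑ a ∈ A, F a i z) (fun i z => ∑ a ∈ A, F' a i z) :=
  ⟨UA.finset_sum A fun a ha => (h a ha).left, UA.finset_sum A fun a ha => (h a ha).right,
    (UA.finset_sum A fun a ha => (h a ha).diff).congr fun _ _ _ => by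
      rw [← Finset.sum_sub_distrib, Finset.mul_sum]⟩

theorem UL.sum {κ : Type*} [Fintype κ] {F F' : κ → I → Coord n → ℝ}
    (h : ∀ a, UL α s d m k (F a) (F' a)) :
    UL α s d m k (fun i z => ∑ a, F a i z) (fun i z => ∑ a, F' a i z) :=
  UL.finset_sum _ fun a _ => h a

theorem UL.reindex {I' : Type*} (f : I' → I) (h : UL α s d m k x x') :
    UL α (fun i => s (f i)) (fun i => d (f i)) m k (fun i => x (f i)) (fun i => x' (f i)) :=
  ⟨h.left.reindex f, h.right.reindex f, h.diff.reindex f⟩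

theorem UL.sum_fiber {κ : Type*} {A : I → Finset κ} {N : ℕ} (hN : ∀ i, (A i).card ≤ N)
    {F F' : I × κ → Coord n → ℝ}
    (h : UL α (fun x : I × κ => s x.1) (fun x : I × κ => d x.1) m k F F') :
    UL α s d m k (fun i z => ∑ a ∈ A i, F (i, a) z) (fun i z => ∑ a ∈ A i, F' (i, a) z) :=
  ⟨UA.sum_fiber hN h.left, UA.sum_fiber hN h.right,
    (UA.sum_fiber hN h.diff).congr fun _ _ _ => by
      rw [← Finset.sum_sub_distrib, Finset.mul_sum]⟩

theorem UL.mono (hs : IsScale α s) (hm : m' ≤ m) (hk : k' ≤ k) (h : UL α s d m k x x') :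
    UL α s d m' k' x x' :=
  ⟨h.left.mono hs hm hk, h.right.mono hs hm hk, h.diff.mono hs hm hk⟩

theorem UL.mul (hs : IsScale α s) (hx : UL α s d m k x x') (hy : UL α s d m k y y') :
    UL α s d m k (fun i z => x i z * y i z) (fun i z => x' i z * y' i z) :=
  ⟨hx.left.mul hs hy.left, hx.right.mul hs hy.right,
    ((hx.diff.mul hs hy.left).add (hx.right.mul hs hy.diff)).congr fun _ _ _ => by ring⟩

theorem UL.finset_prod (hs : IsScale α s) {κ : Type*} (A : Finset κ)
    {F F' : κ → I → Coord n → ℝ} (h : ∀ a ∈ A, UL α s d m k (F a) (F' a)) :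
    UL α s d m k (fun i z => ∏ a ∈ A, F a i z) (fun i z => ∏ a ∈ A, F' a i z) := by
  classical
  induction A using Finset.induction_on with
  | empty => simpa using UL.const' 1
  | insert a A ha ih =>
    simp only [Finset.prod_insert ha]
    exact (h a (Finset.mem_insert_self _ _)).mul hs
      (ih fun b hb => h b (Finset.mem_insert_of_mem hb))

theorem UL.inv (hs : IsScale α s) (hx : UL α s d m k x x') {c : ℝ} (hc : 0 < c)
    (h : ∀ i, ∀ z ∈ hypBall n 2, c ≤ x i z) (h' : ∀ i, ∀ z ∈ hypBall n 2, c ≤ x' i z) :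
    UL α s d m k (fun i z => (x i z)⁻¹) (fun i z => (x' i z)⁻¹) := by
  have h1 := hx.left.inv hs hc h
  have h2 := hx.right.inv hs hc h'
  refine ⟨h1, h2, ((hx.diff.mul hs (h1.mul hs h2)).neg).congr fun i z hz => ?_⟩
  have e1 := (hc.trans_le (h i z hz)).ne'
  have e2 := (hc.trans_le (h' i z hz)).ne'
  field_simp
  ring

theorem UL.differentiableAt (h : UL α s d m (k + 1) x x') (i : I) {z : Coord n}
    (hz : z ∈ hypBall n 2) : DifferentiableAt ℝ (x i) z ∧ DifferentiableAt ℝ (x' i) z :=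
  ⟨h.left.differentiableAt i hz, h.right.differentiableAt i hz⟩

theorem UL.pd_diff (h : UL α s d m (k + 1) x x') (i : I) {z : Coord n}
    (hz : z ∈ hypBall n 2) (j : Fin (n + 1)) :
    WeakAH.pd j (fun z => (d i)⁻¹ * (x i z - x' i z)) z
      = (d i)⁻¹ * (WeakAH.pd j (x i) z - WeakAH.pd j (x' i) z) := by
  obtain ⟨h1, h2⟩ := h.differentiableAt i hz
  rw [pd_const_mul, pd_sub h1 h2]

theorem UL.inv_scale_mul_pd (h : UL α s d (m + 1) (k + 1) x x') (j : Fin (n + 1)) :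
    UL α s d m k (fun i z => (s i)⁻¹ * WeakAH.pd j (x i) z)
      (fun i z => (s i)⁻¹ * WeakAH.pd j (x' i) z) :=
  ⟨h.left.inv_scale_mul_pd j, h.right.inv_scale_mul_pd j,
    (h.diff.inv_scale_mul_pd j).congr fun i z hz => by rw [h.pd_diff i hz]; ring⟩

theorem UL.of_pd_succ (hub : UL α s d 0 0 x x')
    (hd : ∀ i, DifferentiableOn ℝ (x i) (hypBall n 2))
    (hd' : ∀ i, DifferentiableOn ℝ (x' i) (hypBall n 2))
    (h : ∀ j, UL α s d m k (fun i z => (s i)⁻¹ * WeakAH.pd j (x i) z)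
      (fun i z => (s i)⁻¹ * WeakAH.pd j (x' i) z)) : UL α s d (m + 1) (k + 1) x x' :=
  ⟨UA.of_pd_succ hub.left.ub hd fun j => (h j).left,
    UA.of_pd_succ hub.right.ub hd' fun j => (h j).right,
    UA.of_pd_succ hub.diff.ub (fun i => ((hd i).sub (hd' i)).const_mul _) fun j =>
      (h j).diff.congr fun i z hz => by
        have h1 := (hd i z hz).differentiableAt (hypBall_mem_nhds hz)
        have h2 := (hd' i z hz).differentiableAt (hypBall_mem_nhds hz)
        rw [pd_const_mul, pd_sub h1 h2]; ring⟩

theorem UL.scale_mul (hs : IsScale α s) (h : UL α s d m k x x') :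
    UL α s d (m + 1) k (fun i z => s i * x i z) (fun i z => s i * x' i z) :=
  ⟨h.left.scale_mul hs, h.right.scale_mul hs,
    (h.diff.scale_mul hs).congr fun _ _ _ => by ring⟩

theorem abs_exp_sub_exp_le {a b C : ℝ} (ha : a ≤ C) (hb : b ≤ C) :
    |Real.exp a - Real.exp b| ≤ Real.exp C * |a - b| := by
  wlog h : b ≤ a generalizing a b
  · rw [abs_sub_comm, abs_sub_comm a b]; exact this hb ha (le_of_not_ge h)
  rw [abs_of_nonneg (sub_nonneg.2 (Real.exp_le_exp.2 h)), abs_of_nonneg (sub_nonneg.2 h)]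
  have h1 := Real.add_one_le_exp (b - a)
  have h2 : Real.exp a * Real.exp (b - a) = Real.exp b := by rw [← Real.exp_add]; congr 1; ring
  have h3 : Real.exp a ≤ Real.exp C := Real.exp_le_exp.2 ha
  nlinarith [Real.exp_pos a, sub_nonneg.2 h]

/-- The quotient `q = d⁻¹ (e^x - e^{x'})` satisfies `∂q = q ∂x + e^{x'} d⁻¹ ∂(x - x')`, so its
regularity is bootstrapped from boundedness. The Hölder bound at order zero comes from first
derivatives, which is why one derivative is assumed. -/
theorem UL.exp (hs : IsScale α s) (h : UL α s d m (k + 1) x x') :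
    UL α s d m (k + 1) (fun i z => Real.exp (x i z)) (fun i z => Real.exp (x' i z)) := by
  refine ⟨h.left.exp hs, h.right.exp hs, ?_⟩
  set q : I → Coord n → ℝ := fun i z => (d i)⁻¹ * (Real.exp (x i z) - Real.exp (x' i z)) with hq
  obtain ⟨C, hC⟩ := h.left.ub
  obtain ⟨C', hC'⟩ := h.right.ub
  obtain ⟨D, hD⟩ := h.diff.ub
  have hub : UB q := by
    refine ⟨Real.exp (max C C') * D, fun i z hz => ?_⟩
    have h1 := abs_exp_sub_exp_le (a := x i z) (b := x' i z) (C := max C C')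
      ((le_abs_self _).trans ((hC i z hz).trans (le_max_left _ _)))
      ((le_abs_self _).trans ((hC' i z hz).trans (le_max_right _ _)))
    have h2 := hD i z hz
    rw [abs_mul] at h2
    rw [hq, abs_mul]
    calc _ ≤ |(d i)⁻¹| * (Real.exp (max C C') * |x i z - x' i z|) := by gcongr
      _ = Real.exp (max C C') * (|(d i)⁻¹| * |x i z - x' i z|) := by ring
      _ ≤ _ := by gcongr
  have hd : ∀ i, DifferentiableOn ℝ (q i) (hypBall n 2) := fun i z hz => by
    obtain ⟨h1, h2⟩ := h.differentiableAt i hz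
    exact ((h1.exp.sub h2.exp).const_mul _).differentiableWithinAt
  have hpd : ∀ i, ∀ z ∈ hypBall n 2, ∀ j, q i z * WeakAH.pd j (x i) z
      + Real.exp (x' i z) * ((d i)⁻¹ * (WeakAH.pd j (x i) z - WeakAH.pd j (x' i) z))
      = WeakAH.pd j (q i) z := fun i z hz j => by
    obtain ⟨h1, h2⟩ := h.differentiableAt i hz
    rw [hq, pd_const_mul, pd_sub h1.exp h2.exp, pd_exp h1, pd_exp h2]
    ring
  -- One round of the bootstrap: control of `q` in the class of its derivative gives control of `q`
  -- one order higher.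
  have key : ∀ l ≤ k, ∀ m' ≤ m, UA α s (m' - 1) l q → UA α s m' (l + 1) q := by
    intro l hl m' hm' hql
    refine ⟨hub, hd, fun j => ?_⟩
    have e1 := (h.left.mono hs hm' (Nat.add_le_add_right hl 1)).2.2 j
    have e2 := (h.diff.mono hs hm' (Nat.add_le_add_right hl 1)).2.2 j
    have e3 := (h.right.exp hs).mono hs (m' := m' - 1) (k' := l) (by omega) (by omega)
    refine ((hql.mul hs e1).add (e3.mul hs e2)).congr fun i z hz => ?_
    rw [← hpd i z hz, h.pd_diff i hz]
    ring
  have h0 : ∀ m', UA α s m' 0 q := fun m' => by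
    refine ⟨hub, fun i => (hd i).continuousOn, UHol.of_pd hs.nonneg hs.le_one hd ?_⟩
    have e : ∀ j, UB fun i z => WeakAH.pd j (q i) z := fun j =>
      UB.congr (fun i z hz => hpd i z hz j) ((hub.mul (h.left.pd hs j).ub).add
        ((h.right.exp hs).ub.mul (UB.congr (fun i z hz => h.pd_diff i hz j)
          (h.diff.pd hs j).ub)))
    choose E hE using e
    exact ⟨∑ j, |E j|, fun i z hz j => (hE j i z hz).trans ((le_abs_self _).trans
      (Finset.single_le_sum (f := fun j => |E j|) (fun _ _ => abs_nonneg _) (Finset.mem_univ j)))⟩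
  have main : ∀ l ≤ k + 1, ∀ m' ≤ m, UA α s m' l q := by
    intro l
    induction l with
    | zero => exact fun _ m' _ => h0 m'
    | succ l ih => exact fun hl m' hm' => key l (by omega) m' hm' (ih (by omega) _ (by omega))
  exact main _ le_rfl _ le_rfl

/-- Composition with a smooth function of one variable. -/
theorem UA.comp_smooth (hs : IsScale α s) {f : ℝ → ℝ} (hf : ContDiff ℝ ∞ f)
    (hx : UA α s m k x) : UA α s m k (fun i z => f (x i z)) := by
  obtain ⟨C, hC⟩ := hx.ub
  have hb : ∀ g : ℝ → ℝ, Continuous g → ∃ D, 0 ≤ D ∧ ∀ t ∈ Set.Icc (-C) C, |g t| ≤ D :=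
    fun g hg => by
      obtain ⟨D, hD⟩ := isCompact_Icc.exists_bound_of_continuousOn (s := Set.Icc (-C) C)
        hg.continuousOn
      exact ⟨max D 0, le_max_right _ _, fun t ht => (hD t ht).trans (le_max_left _ _)⟩
  have hmem : ∀ i, ∀ z ∈ hypBall n 2, x i z ∈ Set.Icc (-C) C := fun i z hz =>
    abs_le.1 (hC i z hz)
  have hub : ∀ g : ℝ → ℝ, Continuous g → UB fun i z => g (x i z) := fun g hg => by
    obtain ⟨D, -, hD⟩ := hb g hg
    exact ⟨D, fun i z hz => hD _ (hmem i z hz)⟩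
  clear hC
  induction k generalizing m f with
  | zero =>
    refine ⟨hub f hf.continuous, fun i => hf.continuous.comp_continuousOn (hx.continuousOn i), ?_⟩
    obtain ⟨D, hD0, hD⟩ := hb (deriv f) (hf.continuous_deriv (by simp))
    obtain ⟨K, hK0, hK⟩ := hx.2.2.nonneg_bound
    refine ⟨D * K, fun i z hz w hw => ?_⟩
    have := (convex_Icc (-C) C).norm_image_sub_le_of_norm_deriv_le (f := f) (C := D)
      (fun t _ => hf.differentiable (by simp) t) (fun t ht => hD t ht) (hmem i w hw) (hmem i z hz)
    calc _ ≤ D * |x i z - x i w| := this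
      _ ≤ D * (K * ‖z - w‖ ^ α) := by gcongr; exact hK i z hz w hw
      _ = _ := by ring
  | succ k ih =>
    have hd : Differentiable ℝ f := hf.differentiable (by simp)
    refine ⟨hub f hf.continuous, fun i => hd.comp_differentiableOn (hx.2.1 i), fun j => ?_⟩
    have h1 := ih (f := deriv f) (contDiff_infty_iff_deriv.1 hf).2 (hx.pred hs)
    refine (h1.mul hs (hx.2.2 j)).congr fun i z hz => ?_
    have h2 := ((hd (x i z)).hasDerivAt.comp_hasFDerivAt z
      (hx.differentiableAt i hz).hasFDerivAt).fderiv
    have h3 : WeakAH.pd j (fun z => f (x i z)) z = deriv f (x i z) * WeakAH.pd j (x i) z := by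
      simp only [WeakAH.pd]
      change fderiv ℝ (f ∘ x i) z _ = _
      rw [h2]; simp
    rw [h3]; ring

end UL

end

end WeakAH

namespace WeakAH

noncomputable section

/-! ### Uniform families of metrics -/

section Metrics

variable {n : ℕ} {α : ℝ} {I : Type*} {s d : I → ℝ} {m k : ℕ}

theorem UL.det {κ : Type*} [Fintype κ] [DecidableEq κ] (hs : IsScale α s)
    {F F' : I → Coord n → Matrix κ κ ℝ}
    (h : ∀ a b, UL α s d m k (fun i z => F i z a b) (fun i z => F' i z a b)) :
    UL α s d m k (fun i z => (F i z).det) (fun i z => (F' i z).det) := by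
  simp only [Matrix.det_apply]
  refine UL.sum fun τ => ?_
  have := (UL.finset_prod hs Finset.univ fun a _ => h (τ a) a).const_mul'
    ((Equiv.Perm.sign τ : ℤ) : ℝ)
  exact this.congr (fun _ _ _ => by simp [Units.smul_def])
    fun _ _ _ => by simp [Units.smul_def]

theorem UL.adjugate {κ : Type*} [Fintype κ] [DecidableEq κ] (hs : IsScale α s)
    {F F' : I → Coord n → Matrix κ κ ℝ}
    (h : ∀ a b, UL α s d m k (fun i z => F i z a b) (fun i z => F' i z a b)) (a b : κ) :
    UL α s d m k (fun i z => (F i z).adjugate a b) (fun i z => (F' i z).adjugate a b) := by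
  simp only [Matrix.adjugate_apply]
  refine UL.det hs fun p q => ?_
  by_cases hp : p = b
  · subst hp
    simp only [Matrix.updateRow_self]
    exact UL.const' _
  · simp only [Matrix.updateRow_ne hp]
    exact h p q

/-- The determinant is the product of the `n + 1` eigenvalues, and each of them is the value of the
form at a unit eigenvector. -/
theorem IsMet.pow_le_det {T : Tens n 2} (hT : IsMet T) {c : ℝ} (hc : 0 ≤ c)
    (h : ∀ v, c * ‖v‖ ^ 2 ≤ T ![v, v]) : c ^ (n + 1) ≤ (gramT T).det := by
  have hH := hT.posDef.1
  rw [hH.det_eq_prod_eigenvalues]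
  have h1 : c ^ (n + 1) = ∏ _i : Fin (n + 1), c := by simp
  rw [h1]
  refine Finset.prod_le_prod (fun _ _ => hc) fun a _ => ?_
  set v : Coord n := hH.eigenvectorBasis a with hv
  have h2 := hH.mulVec_eigenvectorBasis a
  have h3 : T ![v, v] = ∑ p, ∑ q, v p * gramT T p q * v q := by
    rw [tens_apply_eq_sum, ← (finTwoArrowEquiv (Fin (n + 1))).symm.sum_comp, Fintype.sum_prod_type]
    refine Finset.sum_congr rfl fun p _ => Finset.sum_congr rfl fun q _ => ?_
    simp [gramT, Fin.prod_univ_two, finTwoArrowEquiv]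
    ring
  have h4 : T ![v, v] = hH.eigenvalues a * ‖v‖ ^ 2 := by
    rw [h3, EuclideanSpace.norm_sq_eq, Finset.mul_sum]
    refine Finset.sum_congr rfl fun p _ => ?_
    have := congrFun h2 p
    simp only [Matrix.mulVec, dotProduct, Pi.smul_apply, smul_eq_mul] at this
    simp only [mul_assoc, ← Finset.mul_sum]
    rw [Real.norm_eq_abs, sq_abs]
    rw [hv]
    rw [this]; ring
  have h5 : ‖v‖ = 1 := hH.eigenvectorBasis.orthonormal.1 a
  have := h v
  rw [h4, h5] at this
  simpa using this

/-- Pairs of families of metrics whose rescalings by `s⁻²` are uniformly elliptic and controlled in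
a uniform Hölder class. -/
structure ULMet (α : ℝ) (s d : I → ℝ) (m k : ℕ) (G G' : I → Coord n → Tens n 2) : Prop where
  comp : ∀ J, UL α s d m k (sC s 2 G J) (sC s 2 G' J)
  isMet : ∀ i, ∀ z ∈ hypBall n 2, IsMet (G i z)
  isMet' : ∀ i, ∀ z ∈ hypBall n 2, IsMet (G' i z)
  ell : ∃ c, 0 < c ∧ ∀ i, ∀ z ∈ hypBall n 2, ∀ v, c * s i ^ 2 * ‖v‖ ^ 2 ≤ G i z ![v, v]
  ell' : ∃ c, 0 < c ∧ ∀ i, ∀ z ∈ hypBall n 2, ∀ v, c * s i ^ 2 * ‖v‖ ^ 2 ≤ G' i z ![v, v]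

variable {G G' : I → Coord n → Tens n 2}

theorem ULMet.mono (hs : IsScale α s) {m' k' : ℕ} (hm : m' ≤ m) (hk : k' ≤ k)
    (h : ULMet α s d m k G G') : ULMet α s d m' k' G G' :=
  ⟨fun J => (h.comp J).mono hs hm hk, h.isMet, h.isMet', h.ell, h.ell'⟩

theorem ULMet.gram (h : ULMet α s d m k G G') (a b : Fin (n + 1)) :
    UL α s d m k (fun i z => (s i ^ 2)⁻¹ * gramT (G i z) a b)
      (fun i z => (s i ^ 2)⁻¹ * gramT (G' i z) a b) := h.comp ![a, b]

theorem inv_gramT_eq {T : Tens n 2} (hT : IsMet T) {t : ℝ} (ht : 0 < t) (a b : Fin (n + 1)) :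
    t ^ 2 * (gramT T)⁻¹ a b = (gramT ((t ^ 2)⁻¹ • T)).det⁻¹ *
      (gramT ((t ^ 2)⁻¹ • T)).adjugate a b := by
  rw [← gramT_inv_apply, hT.gramT_smul_inv (by positivity), inv_inv]
  rfl

/-- Cramer's rule for the metric rescaled by `s⁻²`. Ellipticity bounds its determinant below
uniformly; the smaller of the two ellipticity constants serves both families. -/
theorem ULMet.inv (hs : IsScale α s) (h : ULMet α s d m k G G') (a b : Fin (n + 1)) :
    UL α s d m k (fun i z => s i ^ 2 * (gramT (G i z))⁻¹ a b)
      (fun i z => s i ^ 2 * (gramT (G' i z))⁻¹ a b) := by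
  obtain ⟨c, hc, hG⟩ := h.ell
  obtain ⟨c', hc', hG'⟩ := h.ell'
  have key : ∀ {c : ℝ}, 0 < c → ∀ i, ∀ T : Tens n 2, IsMet T →
      (∀ v, c * s i ^ 2 * ‖v‖ ^ 2 ≤ T ![v, v]) → c ^ (n + 1) ≤ (gramT ((s i ^ 2)⁻¹ • T)).det := by
    intro c hc i T hT h
    have hi := hs.pos i
    refine (hT.smul (c := (s i ^ 2)⁻¹) (by positivity)).pow_le_det hc.le fun v => ?_
    change c * ‖v‖ ^ 2 ≤ (s i ^ 2)⁻¹ * T ![v, v]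
    rw [← div_eq_inv_mul, le_div_iff₀ (by positivity)]
    linarith [h v]
  have hdet := UL.det (d := d) (m := m) (k := k) hs
    (F := fun i z => gramT ((s i ^ 2)⁻¹ • G i z)) (F' := fun i z => gramT ((s i ^ 2)⁻¹ • G' i z))
    h.gram
  have hadj := UL.adjugate (d := d) (m := m) (k := k) hs
    (F := fun i z => gramT ((s i ^ 2)⁻¹ • G i z)) (F' := fun i z => gramT ((s i ^ 2)⁻¹ • G' i z))
    h.gram a b
  refine ((hdet.inv hs (c := min c c' ^ (n + 1)) (pow_pos (lt_min hc hc') _) ?_ ?_).mul hs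
    hadj).congr ?_ ?_
  · intro i z hz
    refine le_trans ?_ (key hc i _ (h.isMet i z hz) (hG i z hz))
    have := (lt_min hc hc').le
    gcongr
    exact min_le_left _ _
  · intro i z hz
    refine le_trans ?_ (key hc' i _ (h.isMet' i z hz) (hG' i z hz))
    have := (lt_min hc hc').le
    gcongr
    exact min_le_right _ _
  · exact fun i z hz => (inv_gramT_eq (h.isMet i z hz) (hs.pos i) a b).symm
  · exact fun i z hz => (inv_gramT_eq (h.isMet' i z hz) (hs.pos i) a b).symm

/-- Count of scales: the metric is of size `s²`, its inverse of size `s⁻²`, and a weighted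
derivative brings one factor `s`. The one derivative lowers both `m` and `k` by one. -/
theorem ULMet.christ (hs : IsScale α s) (h : ULMet α s d (m + 1) (k + 1) G G')
    (a b c : Fin (n + 1)) :
    UL α s d m k (fun i z => (s i)⁻¹ * christC (G i) a b c z)
      (fun i z => (s i)⁻¹ * christC (G' i) a b c z) := by
  have hi := (h.mono hs (Nat.le_succ m) (Nat.le_succ k)).inv hs
  have hp := fun a b j => (h.gram a b).inv_scale_mul_pd j
  simp only [pd_const_mul] at hp
  refine ((UL.sum fun l => (hi a l).mul hs (((hp c l b).add (hp b l c)).sub (hp b c l))).const_mul'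
    (1 / 2)).congr ?_ ?_ <;>
  · intro i z hz
    have := (hs.pos i).ne'
    simp only [christC, Finset.mul_sum]
    refine Finset.sum_congr rfl fun l _ => ?_
    field_simp

theorem ULMet.innC (hs : IsScale α s) (h : ULMet α s d m k G G') {φ φ' ψ ψ' : I → Coord n → ℝ}
    (hφ : UL α s d (m + 1) (k + 1) φ φ') (hψ : UL α s d (m + 1) (k + 1) ψ ψ') :
    UL α s d m k (fun i z => innC (φ i) (ψ i) (G i) z) (fun i z => innC (φ' i) (ψ' i) (G' i) z) := by
  refine (UL.sum fun a => UL.sum fun b => (h.inv hs a b).mul hs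
    ((hφ.inv_scale_mul_pd a).mul hs (hψ.inv_scale_mul_pd b))).congr ?_ ?_ <;>
  · intro i z hz
    have := (hs.pos i).ne'
    simp only [WeakAH.innC]
    refine Finset.sum_congr rfl fun a _ => Finset.sum_congr rfl fun b _ => ?_
    field_simp

theorem ULMet.lapC (hs : IsScale α s) (h : ULMet α s d (m + 1) (k + 1) G G')
    {φ φ' : I → Coord n → ℝ} (hφ : UL α s d (m + 2) (k + 2) φ φ') :
    UL α s d m k (fun i z => lapC (φ i) (G i) z) (fun i z => lapC (φ' i) (G' i) z) := by
  have hi := (h.mono hs (Nat.le_succ m) (Nat.le_succ k)).inv hs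
  have h2 := fun a b => (hφ.inv_scale_mul_pd a).inv_scale_mul_pd b
  simp only [pd_const_mul] at h2
  have h1 := fun a => (hφ.inv_scale_mul_pd a).mono hs (Nat.le_succ m) (Nat.le_succ k)
  refine (UL.sum fun a => UL.sum fun b => (hi a b).mul hs
    ((h2 b a).sub (UL.sum fun l => (h.christ hs l a b).mul hs (h1 l)))).congr ?_ ?_ <;>
  · intro i z hz
    have := (hs.pos i).ne'
    simp only [WeakAH.lapC, hessC]
    refine Finset.sum_congr rfl fun a _ => Finset.sum_congr rfl fun b _ => ?_
    have e : ∀ x y : ℝ, (s i)⁻¹ * x * ((s i)⁻¹ * y) = ((s i)⁻¹ * (s i)⁻¹) * (x * y) :=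
      fun x y => by ring
    simp only [e, ← Finset.mul_sum]
    field_simp

/-- With two lower and two upper indices the scales cancel: two weighted derivatives give `s²`,
against `s⁻²` from the raised index. Hence no normalizing factor is needed, here or for the scalar
curvature. -/
theorem ULMet.riemC (hs : IsScale α s) (h : ULMet α s d (m + 2) (k + 2) G G')
    (a b p l : Fin (n + 1)) :
    UL α s d m k (fun i z => riemC (G i) z a b p l) (fun i z => riemC (G' i) z a b p l) := by
  have hi := (h.mono hs (Nat.le_add_right m 2) (Nat.le_add_right k 2)).inv hs
  have h2 := fun a b c j => (h.christ hs a b c).inv_scale_mul_pd j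
  simp only [pd_const_mul] at h2
  have h1 := fun a b c => (h.mono hs (Nat.le_succ _) (Nat.le_succ _)).christ hs a b c
  refine (UL.sum fun q => (hi l q).mul hs
    (((h2 p b q a).sub (h2 p a q b)).add (UL.sum fun t =>
      ((h1 t b q).mul hs (h1 p a t)).sub ((h1 t a q).mul hs (h1 p b t))))).congr ?_ ?_ <;>
  · intro i z hz
    have := (hs.pos i).ne'
    simp only [WeakAH.riemC, curvC]
    refine Finset.sum_congr rfl fun q _ => ?_
    have e : ∀ x y x' y' : ℝ, (s i)⁻¹ * x * ((s i)⁻¹ * y) - (s i)⁻¹ * x' * ((s i)⁻¹ * y')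
      = ((s i)⁻¹ * (s i)⁻¹) * (x * y - x' * y') := fun x y x' y' => by ring
    simp only [e, ← Finset.mul_sum]
    field_simp

theorem ULMet.scalC (hs : IsScale α s) (h : ULMet α s d (m + 2) (k + 2) G G') :
    UL α s d m k (fun i z => scalC (G i) z) (fun i z => scalC (G' i) z) :=
  UL.sum fun a => UL.sum fun b => h.riemC hs a b a b

end Metrics

end

end WeakAH

/-! ### Agreement of the intrinsic function spaces with the component classes. -/

namespace WeakAH

noncomputable section

/-! ### Uniform classes of tensor fields -/

section UniformTensors

variable {n r : ℕ} {α : ℝ} {M : Type*} [TopologicalSpace M]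
  [ChartedSpace (EuclideanHalfSpace (n + 1)) M] {ρ : M → ℝ} {B : Background n M ρ} {Λ : Type*}

/-- The scale of the parametrizations, with an additional parameter. -/
abbrev Atl.sc (A : Atl B) (Λ : Type*) : B.ι × Λ → ℝ := fun x => A.s x.1

/-- The coordinate representations of a family of tensor fields. -/
abbrev pbF (B : Background n M ρ) (u : Λ → CovTensor n M r) : B.ι × Λ → Coord n → Tens n r :=
  fun x => pullback (B.param x.1) (u x.2)

/-- Families of tensor fields with scaled components in a uniform Hölder class. -/
def Atl.UT (A : Atl B) (α : ℝ) (m k : ℕ) (u : Λ → CovTensor n M r) : Prop :=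
  ∀ J, UA α (A.sc Λ) m k (sC (A.sc Λ) r (pbF B u) J)

theorem Atl.isScale_sc (A : Atl B) (h0 : 0 ≤ α) (h1 : α ≤ 1) : IsScale α (A.sc Λ) :=
  ⟨h0, h1, fun _ => A.s_pos _, A.s_bdd.imp fun _ h x => h x.1⟩

variable {A : Atl B} {m k : ℕ} {u : Λ → CovTensor n M r}

theorem pd_sC {I : Type*} (s : I → ℝ) (d : ℕ) (t : I → Coord n → Tens n r)
    (J : Fin r → Fin (n + 1)) (i : I) (j : Fin (n + 1)) (z : Coord n) :
    pd j (sC s d t J i) z = (s i ^ d)⁻¹ * pd j (cmp (t i) J) z := pd_const_mul _ _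

theorem contDiffAt_of_sC {I : Type*} {s : I → ℝ} {d : ℕ} {t : I → Coord n → Tens n r} {N : ℕ∞ω}
    {i : I} {z : Coord n} (hs : 0 < s i) (h : ∀ J, ContDiffAt ℝ N (sC s d t J i) z) :
    ContDiffAt ℝ N (t i) z := by
  have : t i = fun z => ∑ J, (s i ^ d * sC s d t J i z) • (tb J : Tens n r) := by
    funext z
    conv_lhs => rw [eq_sum_tb (t i z)]
    refine Finset.sum_congr rfl fun J _ => ?_
    rw [sC, ← mul_assoc, mul_inv_cancel₀ (by positivity), one_mul]
    rfl
  rw [this]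
  exact ContDiffAt.sum fun J _ => (contDiffAt_const.mul (h J)).smul contDiffAt_const

theorem UA.contDiffAt {I : Type*} {s : I → ℝ} (hs : IsScale α s) {φ : I → Coord n → ℝ}
    (h : UA α s m k φ) {i : I} {z : Coord n} (hz : z ∈ hypBall n 2) : ContDiffAt ℝ k (φ i) z :=
  (h.contDiffOn hs i).contDiffAt (hypBall_mem_nhds hz)

theorem Atl.UT.contDiffAt (h0 : 0 ≤ α) (h1 : α ≤ 1) (h : A.UT α m k u) (i : B.ι) (l : Λ)
    {z : Coord n} (hz : z ∈ hypBall n 2) : ContDiffAt ℝ k (pullback (B.param i) (u l)) z :=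
  contDiffAt_of_sC (s := A.sc Λ) (d := r) (t := pbF B u) (i := (i, l)) (A.s_pos i)
    fun J => (h J).contDiffAt (A.isScale_sc h0 h1) hz

theorem Atl.UT.differentiableAt (h0 : 0 ≤ α) (h1 : α ≤ 1) (h : A.UT α m (k + 1) u) (i : B.ι)
    (l : Λ) {z : Coord n} (hz : z ∈ hypBall n 2) :
    DifferentiableAt ℝ (pullback (B.param i) (u l)) z :=
  (h.contDiffAt h0 h1 i l hz).differentiableAt (by simp)

theorem Atl.UT.mono (h0 : 0 ≤ α) (h1 : α ≤ 1) {m' k' : ℕ} (hm : m' ≤ m) (hk : k' ≤ k)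
    (h : A.UT α m k u) : A.UT α m' k' u := fun J => (h J).mono (A.isScale_sc h0 h1) hm hk

theorem Atl.UT.reindex {Λ' : Type*} (f : Λ' → Λ) (h : A.UT α m k u) :
    A.UT α m k fun l => u (f l) := fun J => (h J).reindex fun x : B.ι × Λ' => (x.1, f x.2)

/-- Metrics that are uniformly controlled to all orders. -/
structure Atl.Back (A : Atl B) (α : ℝ) (h : CovTensor n M 2) : Prop where
  met : ∀ m k, ULMet α A.s (fun _ => 1) m k (fun i => pullback (B.param i) h)
    (fun i => pullback (B.param i) h)

theorem Atl.Back.christ (h0 : 0 ≤ α) (h1 : α ≤ 1) {h : CovTensor n M 2} (hh : A.Back α h)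
    (a b c : Fin (n + 1)) : UA α (A.sc Λ) m k
      fun x z => (A.s x.1)⁻¹ * christC (pullback (B.param x.1) h) a b c z :=
  (((hh.met (m + 1) (k + 1)).christ (A.isScale h0 h1) a b c).left).reindex Prod.fst

variable [IsManifold (𝓡∂ (n + 1)) ∞ M]

theorem Atl.cmp_nabla (A : Atl B) {h : CovTensor n M 2} {u : CovTensor n M r} {i : B.ι}
    {z : Coord n} (hz : z ∈ hypBall n 2) (hh : DifferentiableAt ℝ (pullback (B.param i) h) z)
    (hm : ∀ z ∈ hypBall n 2, IsMet (pullback (B.param i) h z))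
    (hu : DifferentiableAt ℝ (pullback (B.param i) u) z) (J : Fin (r + 1) → Fin (n + 1)) :
    cmp (pullback (B.param i) (nabla h u)) J z =
      pd (J 0) (cmp (pullback (B.param i) u) (Fin.tail J)) z -
      ∑ a, ∑ m, christC (pullback (B.param i) h) m (J 0) (Fin.tail J a) z *
        cmp (pullback (B.param i) u) (Function.update (Fin.tail J) a m) z := by
  rw [cmp, (A.isLoc hz).pullback_nabla hh
    (Filter.eventually_of_mem (hypBall_mem_nhds hz) hm) hu, nablaC, ofComponents_basisVec]

theorem Atl.Back.sC_nabla (h0 : 0 ≤ α) (h1 : α ≤ 1) {h : CovTensor n M 2} (hh : A.Back α h)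
    (hu : A.UT α m (k + 1) u) (J : Fin (r + 1) → Fin (n + 1)) {x : B.ι × Λ}
    {z : Coord n} (hz : z ∈ hypBall n 2) :
    sC (A.sc Λ) (r + 1) (pbF B fun l => nabla h (u l)) J x z =
      (A.s x.1)⁻¹ * pd (J 0) (sC (A.sc Λ) r (pbF B u) (Fin.tail J) x) z -
      ∑ a, ∑ m, ((A.s x.1)⁻¹ * christC (pullback (B.param x.1) h) m (J 0) (Fin.tail J a) z) *
        sC (A.sc Λ) r (pbF B u) (Function.update (Fin.tail J) a m) x z := by
  have hd : DifferentiableAt ℝ (pullback (B.param x.1) h) z :=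
    (contDiffAt_of_sC (s := A.s) (d := 2) (t := fun i => pullback (B.param i) h) (N := 1)
      (A.s_pos x.1) fun J => by
        have := ((hh.met 0 1).comp J).left.contDiffAt (A.isScale h0 h1) (i := x.1) hz
        exact_mod_cast this).differentiableAt (by simp)
  have e := A.cmp_nabla hz hd (fun z hz => (hh.met 0 0).isMet x.1 z hz)
    (hu.differentiableAt h0 h1 x.1 x.2 hz) J
  have hp := (A.s_pos x.1).ne'
  have hsc : A.sc Λ x = A.s x.1 := rfl
  simp only [pd_sC, sC, hsc]
  rw [e, mul_sub, Finset.mul_sum]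
  congr 1
  · field_simp; ring
  · refine Finset.sum_congr rfl fun a _ => ?_
    rw [Finset.mul_sum]
    refine Finset.sum_congr rfl fun m _ => ?_
    field_simp; ring

theorem Atl.UT.nabla (h0 : 0 ≤ α) (h1 : α ≤ 1) {h : CovTensor n M 2} (hh : A.Back α h)
    (hu : A.UT α (m + 1) (k + 1) u) : A.UT α m k fun l => nabla h (u l) := fun J => by
  have hs := A.isScale_sc (Λ := Λ) h0 h1
  refine (((hu (Fin.tail J)).inv_scale_mul_pd (J 0)).sub (UA.sum fun a => UA.sum fun m =>
    (hh.christ h0 h1 m (J 0) (Fin.tail J a)).mul hs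
      ((hu (Function.update (Fin.tail J) a m)).pred hs))).congr fun x z hz => ?_
  exact (hh.sC_nabla h0 h1 hu J hz).symm

/-- The weighted derivative of `u` is its covariant derivative plus Christoffel symbols times `u`.
As the symbols of `h` are controlled to all orders, the number of weighted derivatives of `u` rises
one at a time until that of the covariant derivative is exhausted. -/
theorem Atl.UT.of_nabla (h0 : 0 ≤ α) (h1 : α ≤ 1) {h : CovTensor n M 2} (hh : A.Back α h)
    (hu : A.UT α 0 (k + 1) u) (hn : A.UT α m k fun l => WeakAH.nabla h (u l)) :
    A.UT α (m + 1) (k + 1) u := by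
  have hs := A.isScale_sc (Λ := Λ) h0 h1
  suffices ∀ j ≤ m + 1, A.UT α j (k + 1) u from this _ le_rfl
  intro j
  induction j with
  | zero => exact fun _ => hu
  | succ j ih =>
    intro hj J
    have hj' := ih (by omega)
    refine UA.of_pd_succ (hu J).ub (hu J).2.1 fun l => ?_
    have e1 := (hn (Fin.cons l J)).mono hs (show j ≤ m by omega) le_rfl
    refine (e1.add (UA.sum fun a => UA.sum fun m =>
      (hh.christ h0 h1 m l (J a)).mul hs
        ((hj' (Function.update J a m)).of_succ hs))).congr fun x z hz => ?_
    have e := hh.sC_nabla h0 h1 hu (Fin.cons l J) (x := x) hz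
    simp only [Fin.cons_zero, Fin.tail_cons] at e
    rw [e]; ring

theorem Atl.uA_vfC (A : Atl B) (h0 : 0 ≤ α) (h1 : α ≤ 1)
    {X : ∀ q : M, TangentSpace (𝓡∂ (n + 1)) q} (hX : IsSmoothVectorField X) (l : Fin (n + 1)) :
    UA α (A.sc Λ) m k fun x z => vfC (A.e (A.kap x.1)) X (A.s x.1 • z + A.b x.1) l :=
  (A.uA h0 h1 m k (F := fun a y => vfC (A.e a) X y l) fun a =>
    contDiffOn_euclidean.1 (contDiffOn_vfC (A.e_mem a) hX) l).reindex Prod.fst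

theorem Atl.contDiffAt_mpb (A : Atl B) {X : ∀ q : M, TangentSpace (𝓡∂ (n + 1)) q}
    (hX : IsSmoothVectorField X) {i : B.ι} {z : Coord n} (hz : z ∈ hypBall n 2) :
    ContDiffAt ℝ 1 (mpb (B.param i) X) z := by
  have h1 : ContDiffAt ℝ 1 (vfC (A.e (A.kap i)) X) (A.s i • z + A.b i) :=
    (((contDiffOn_vfC (A.e_mem _) hX) _ (A.mem i z hz)).contDiffAt
      (exT_mem_nhds (A.mem i z hz) (A.height i z hz))).of_le (by norm_num)
  have h2 : ContDiffAt ℝ 1 (fun z => (A.s i)⁻¹ • vfC (A.e (A.kap i)) X (A.s i • z + A.b i)) z :=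
    (h1.comp z (f := fun z : Coord n => A.s i • z + A.b i)
      ((contDiffAt_id.const_smul _).add contDiffAt_const)).const_smul _
  exact h2.congr_of_eventuallyEq
    (Filter.eventually_of_mem (hypBall_mem_nhds hz) fun w hw => A.mpb_eq X hw)

theorem Atl.sC_lieDeriv (h0 : 0 ≤ α) (h1 : α ≤ 1) (hu : A.UT α m (k + 1) u)
    {X : ∀ q : M, TangentSpace (𝓡∂ (n + 1)) q} (hX : IsSmoothVectorField X)
    (J : Fin r → Fin (n + 1)) {x : B.ι × Λ} {z : Coord n} (hz : z ∈ hypBall n 2)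
    {Y : Coord n → Coord n} (hY : ∀ z ∈ hypBall n 2, mpb (B.param x.1) X z = (A.s x.1)⁻¹ • Y z) :
    sC (A.sc Λ) r (pbF B fun l => lieDeriv X (u l)) J x z =
      ∑ l, Y z l * ((A.s x.1)⁻¹ * pd l (sC (A.sc Λ) r (pbF B u) J x) z) +
      ∑ a, ∑ l, sC (A.sc Λ) r (pbF B u) (Function.update J a l) x z *
        ((A.s x.1)⁻¹ * pd (J a) (fun z => Y z l) z) := by
  have e : cmp (pullback (B.param x.1) (lieDeriv X (u x.2))) J z =
      cmp (lieC (mpb (B.param x.1) X) (pullback (B.param x.1) (u x.2))) J z := by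
    rw [cmp, cmp, (A.isLoc hz).pullback_lieDeriv (A.contDiffAt_mpb hX hz)
      (hu.differentiableAt h0 h1 x.1 x.2 hz)]
  have hYe : mpb (B.param x.1) X =ᶠ[𝓝 z] fun z => (A.s x.1)⁻¹ • Y z :=
    Filter.eventually_of_mem (hypBall_mem_nhds hz) hY
  rw [cmp, cmp, lieC_congr hYe Filter.EventuallyEq.rfl, lieC, ofComponents_basisVec] at e
  simp only [pd_sC, sC]
  rw [cmp, e, mul_add, Finset.mul_sum, Finset.mul_sum]
  congr 1
  · refine Finset.sum_congr rfl fun l _ => ?_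
    simp only [PiLp.smul_apply, smul_eq_mul]; ring
  · refine Finset.sum_congr rfl fun a _ => ?_
    rw [Finset.mul_sum]
    refine Finset.sum_congr rfl fun l _ => ?_
    simp only [PiLp.smul_apply, smul_eq_mul, pd_const_mul]; ring

theorem Atl.UT.lieDeriv (h0 : 0 ≤ α) (h1 : α ≤ 1) (hu : A.UT α (m + 1) (k + 1) u)
    {X : ∀ q : M, TangentSpace (𝓡∂ (n + 1)) q} (hX : IsSmoothVectorField X) :
    A.UT α m k fun l => lieDeriv X (u l) := fun J => by
  have hs := A.isScale_sc (Λ := Λ) h0 h1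
  refine ((UA.sum fun l => (A.uA_vfC h0 h1 hX l).mul hs ((hu J).inv_scale_mul_pd l)).add
    (UA.sum fun a => UA.sum fun l => ((hu (Function.update J a l)).pred hs).mul hs
      ((A.uA_vfC h0 h1 hX l (m := m + 1) (k := k + 1)).inv_scale_mul_pd (J a)))).congr
    fun x z hz => ?_
  exact (Atl.sC_lieDeriv h0 h1 hu hX J hz fun z hz => A.mpb_eq X hz).symm

variable [T2Space M] [CompactSpace M]

/-- The fields of `Atl.exists_field`, finitely many because there are finitely many charts, suffice:
in each parametrization one of them is a constant multiple of a coordinate field, so its Lie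
derivative is exactly a weighted partial derivative. -/
theorem Atl.UT.of_lieDeriv (h0 : 0 ≤ α) (h1 : α ≤ 1) (hu : A.UT α 0 (k + 1) u)
    (h : ∀ X : (∀ q : M, TangentSpace (𝓡∂ (n + 1)) q), IsSmoothVectorField X →
      A.UT α m k fun l => WeakAH.lieDeriv X (u l)) : A.UT α (m + 1) (k + 1) u := fun J => by
  classical
  have hs := A.isScale_sc (Λ := Λ) h0 h1
  have := A.finite_K
  have := Fintype.ofFinite A.K
  choose X hX hXe using A.exists_field
  refine UA.of_pd_succ (hu J).ub (hu J).2.1 fun l => ?_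
  refine (UA.sum fun a => (h (X a l) (hX a l) J).const_mul
    (c := fun x => if A.kap x.1 = a then 1 else 0) ⟨1, fun x => by split_ifs <;> simp⟩).congr
    fun x z hz => ?_
  rw [Finset.sum_eq_single (A.kap x.1) (fun a _ ha => by simp [ha.symm]) (by simp)]
  rw [Atl.sC_lieDeriv h0 h1 hu (hX _ l) J hz (fun z hz => hXe (A.kap x.1) l x.1 rfl z hz)]
  simp

end UniformTensors

end

end WeakAH

namespace WeakAH

noncomputable section

/-! ### The spaces `𝒞^{k,α;m}` in terms of components -/

section Script

variable {n r : ℕ} {α : ℝ} {M : Type*} [TopologicalSpace M]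
  [ChartedSpace (EuclideanHalfSpace (n + 1)) M] {ρ : M → ℝ} {B : Background n M ρ} {Λ : Type*}
  {A : Atl B} {m k : ℕ} [IsManifold (𝓡∂ (n + 1)) ∞ M]

theorem Atl.UT.nablaIter (h0 : 0 ≤ α) (h1 : α ≤ 1) {h : CovTensor n M 2} (hh : A.Back α h)
    {u : Λ → CovTensor n M r} (hu : A.UT α m k u) (hmk : m ≤ k) :
    ∀ l ≤ m, A.UT α (m - l) (k - l) fun a => nablaIter h (u a) l := by
  intro l
  induction l with
  | zero => exact fun _ => hu
  | succ l ih =>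
    intro hl
    have := ih (by omega)
    rw [show m - l = m - (l + 1) + 1 by omega, show k - l = k - (l + 1) + 1 by omega] at this
    exact this.nabla h0 h1 hh

theorem Atl.UT.exists_scriptNorm_le (hρ : IsDefiningFunction n ρ) (h0 : 0 ≤ α) (h1 : α ≤ 1)
    {h : CovTensor n M 2} (hh : A.Back α h) {u : Λ → CovTensor n M r} (hu : A.UT α m k u)
    (hmk : m ≤ k) : ∃ C : NNReal, ∀ a, scriptNorm B h k α m (u a) ≤ C := by
  choose! C hC using fun l (hl : l ≤ m) => (A.holder_of_uA hρ h0 h1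
    ((hu.nablaIter h0 h1 hh hmk l hl).mono h0 h1 (Nat.zero_le _) le_rfl)).2
  refine ⟨∑ l ∈ Finset.range (m + 1), C l, fun a => ?_⟩
  rw [scriptNorm, ENNReal.ofNNReal_finsetSum]
  exact Finset.sum_le_sum fun l hl => hC l (by simpa [Nat.lt_succ_iff] using hl) a

/-- A finite norm says nothing about differentiability, so each field is assumed to be in the class
individually; the common bound on the norms then makes the control uniform in the family. -/
theorem Atl.uT_of_scriptNorm_le (hρ : IsDefiningFunction n ρ) (h0 : 0 ≤ α) (h1 : α ≤ 1)
    {h : CovTensor n M 2} (hh : A.Back α h) {u : Λ → CovTensor n M r} (hmk : m ≤ k)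
    (hu : ∀ a, A.UT α m k fun _ : Unit => u a)
    (hb : ∃ C : NNReal, ∀ a, scriptNorm B h k α m (u a) ≤ C) : A.UT α m k u := by
  obtain ⟨C, hC⟩ := hb
  have hz : ∀ l ≤ m, A.UT α 0 (k - l) fun a => WeakAH.nablaIter h (u a) l := fun l hl =>
    A.uA_of_holder hρ h0 h1 (fun a => (A.holder_of_uA hρ h0 h1
      (((hu a).nablaIter h0 h1 hh hmk l hl).mono h0 h1 (Nat.zero_le _) le_rfl)).1 ())
      ⟨C, fun a => (Finset.single_le_sum (f := fun l => holderNorm B (k - l) α ((r + l : ℕ) : ℝ)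
        (WeakAH.nablaIter h (u a) l)) (fun _ _ => bot_le)
        (Finset.mem_range.2 (Nat.lt_succ_of_le hl))).trans (hC a)⟩
  -- Descending induction on the order `l` of the covariant derivative; `j` is the number of
  -- weighted derivatives still to be gained for it.
  have key : ∀ j l, l + j = m → A.UT α j (k - l) fun a => WeakAH.nablaIter h (u a) l := by
    intro j
    induction j with
    | zero => exact fun l hl => hz l (by omega)
    | succ j ih =>
      intro l hl
      have e1 := ih (l + 1) (by omega)
      have e2 := hz l (by omega)
      rw [show k - l = k - (l + 1) + 1 by omega] at e2 ⊢
      exact e2.of_nabla h0 h1 hh e1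
  exact key m 0 (by omega)

theorem Atl.UT.memScript (hρ : IsDefiningFunction n ρ) (h0 : 0 ≤ α) (h1 : α ≤ 1)
    {u : CovTensor n M r} (hu : A.UT α m k fun _ : Unit => u) (hmk : m ≤ k) :
    MemScript B k α m u := by
  have key : ∀ L : List (∀ q : M, TangentSpace (𝓡∂ (n + 1)) q), L.length ≤ m →
      (∀ X ∈ L, IsSmoothVectorField X) →
      A.UT α (m - L.length) (k - L.length) fun _ : Unit => L.foldr WeakAH.lieDeriv u := by
    intro L
    induction L with
    | nil => exact fun _ _ => hu
    | cons X L ih =>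
      intro hL hX
      simp only [List.length_cons] at hL
      have := ih (by omega) fun Y hY => hX Y (List.mem_cons_of_mem _ hY)
      rw [show m - L.length = m - (L.length + 1) + 1 by omega,
        show k - L.length = k - (L.length + 1) + 1 by omega] at this
      exact this.lieDeriv h0 h1 (hX X List.mem_cons_self)
  intro L hL hX
  obtain ⟨e1, C, e2⟩ := A.holder_of_uA hρ h0 h1
    ((key L hL hX).mono h0 h1 (Nat.zero_le _) le_rfl)
  exact ⟨e1 (), (e2 ()).trans_lt ENNReal.coe_lt_top⟩

variable [T2Space M] [CompactSpace M]

theorem Atl.uT_of_memScript (A : Atl B) (hρ : IsDefiningFunction n ρ) (h0 : 0 ≤ α) (h1 : α ≤ 1) :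
    ∀ {m k : ℕ} {u : CovTensor n M r}, MemScript B (k + m) α m u →
      A.UT α m (k + m) fun _ : Unit => u := by
  have hz : ∀ {k : ℕ} {u : CovTensor n M r}, MemHolder B k α r u →
      A.UT α 0 k fun _ : Unit => u := fun {k u} hu =>
    A.uA_of_holder hρ h0 h1 (fun _ => hu.1)
      ⟨(holderNorm B k α r u).toNNReal, fun _ => by rw [ENNReal.coe_toNNReal hu.2.ne]⟩
  intro m
  induction m with
  | zero => exact fun {k u} hu => hz (hu [] le_rfl (by simp))
  | succ m ih =>
    intro k u hu
    refine (hz (k := k + m + 1) (hu [] (Nat.zero_le _) (by simp))).of_lieDeriv h0 h1 fun X hX =>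
      ih fun L hL hL' => ?_
    -- `foldr` applies the last entry of the list first, so appending `X` makes it the innermost Lie
    -- derivative.
    have := hu (L ++ [X]) (by simpa using hL) fun Y hY => by
      rcases List.mem_append.1 hY with h | h
      · exact hL' Y h
      · rw [List.mem_singleton.1 h]; exact hX
    simp only [List.length_append, List.length_singleton, List.foldr_append, List.foldr_cons,
      List.foldr_nil] at this
    rwa [show k + (m + 1) - (L.length + 1) = k + m - L.length by omega] at this

end Script

/-! ### Ellipticity -/

section Ellipticity

variable {n : ℕ} {α : ℝ} {M : Type*} [TopologicalSpace M]
  [ChartedSpace (EuclideanHalfSpace (n + 1)) M] {ρ : M → ℝ} {B : Background n M ρ}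

theorem Atl.pullback_apply (A : Atl B) {g : CovTensor n M 2} {i : B.ι} {z : Coord n}
    (hz : z ∈ hypBall n 2) (v w : Coord n) :
    pullback (B.param i) g z ![v, w] = A.s i ^ 2 *
      val g (exS (A.e (A.kap i)) (A.s i • z + A.b i))
        ![frm (A.e (A.kap i)) (A.s i • z + A.b i) v, frm (A.e (A.kap i)) (A.s i • z + A.b i) w] := by
  rw [pullback_eq, A.dM_eq hz, ← frm_eq (A.mem i z hz) (A.height i z hz), A.param_eq i z hz]
  have e : ∀ (T : Tens n 2) (F : Coord n →L[ℝ] Coord n) (c : ℝ),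
      (T.compContinuousLinearMap fun _ => c • F) ![v, w] = c ^ 2 * T ![F v, F w] := by
    intro T F c
    have : (fun a : Fin 2 => (c • F) (![v, w] a)) = fun a => c • (![F v, F w] a) := by
      funext a; fin_cases a <;> rfl
    rw [ContinuousMultilinearMap.compContinuousLinearMap_apply, this]
    rw [ContinuousMultilinearMap.map_smul_univ]
    simp
  exact e _ _ _

variable [IsManifold (𝓡∂ (n + 1)) ∞ M]


/-- A bilinear form on the coordinate space is determined by its values on the basis. -/
theorem bilin_eq_sum (L : Coord n →L[ℝ] Coord n →L[ℝ] ℝ) (v w : Coord n) :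
    L v w = ∑ a, ∑ b, v a * w b * L (basisVec a) (basisVec b) := by
  conv_lhs => rw [← sum_smul_basisVec v, ← sum_smul_basisVec w]
  simp only [map_sum, map_smul, sum_apply, smul_apply, smul_eq_mul, Finset.mul_sum]
  rw [Finset.sum_comm]
  exact Finset.sum_congr rfl fun a _ => Finset.sum_congr rfl fun b _ => by ring

/-- Minimum over the compact product of `Q` and the unit sphere, followed by homogeneity. -/
theorem exists_pos_le_bilin {Q : Set (Coord n)} (hQ : IsCompact Q)
    {L : Coord n → Coord n →L[ℝ] Coord n →L[ℝ] ℝ}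
    (hL : ∀ p q, ContinuousOn (fun y => L y (basisVec p) (basisVec q)) Q)
    (hpos : ∀ y ∈ Q, ∀ v, v ≠ 0 → 0 < L y v v) :
    ∃ c, 0 < c ∧ ∀ y ∈ Q, ∀ v : Coord n, c * ‖v‖ ^ 2 ≤ L y v v := by
  have hcont : ContinuousOn (fun x : Coord n × Coord n => L x.1 x.2 x.2)
      (Q ×ˢ Metric.sphere 0 1) := by
    simp only [fun x : Coord n × Coord n => bilin_eq_sum (L x.1) x.2 x.2]
    refine continuousOn_finsetSum _ fun p _ => continuousOn_finsetSum _ fun q _ => ?_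
    refine ContinuousOn.mul (by fun_prop) ?_
    exact (hL p q).comp continuousOn_fst fun x hx => hx.1
  obtain ⟨c, hc, hcL⟩ : ∃ c, 0 < c ∧ ∀ x ∈ Q ×ˢ Metric.sphere (0 : Coord n) 1,
      c ≤ L x.1 x.2 x.2 := by
    rcases (Q ×ˢ Metric.sphere (0 : Coord n) 1).eq_empty_or_nonempty with he | he
    · exact ⟨1, one_pos, by simp [he]⟩
    · obtain ⟨x, hx, hmin⟩ := (hQ.prod (isCompact_sphere 0 1)).exists_isMinOn he hcont
      exact ⟨_, hpos x.1 hx.1 x.2 (ne_zero_of_mem_unit_sphere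
        (⟨x.2, hx.2⟩ : Metric.sphere (0 : Coord n) 1)), fun y hy => hmin hy⟩
  refine ⟨c, hc, fun y hy v => ?_⟩
  rcases eq_or_ne v 0 with rfl | hv
  · simp
  · have hn : ‖v‖ ≠ 0 := norm_ne_zero_iff.2 hv
    have := hcL (y, ‖v‖⁻¹ • v) ⟨hy, by simp [norm_smul, hn]⟩
    simp only [map_smul, smul_apply, smul_eq_mul] at this
    calc c * ‖v‖ ^ 2 ≤ (‖v‖⁻¹ * (‖v‖⁻¹ * L y v v)) * ‖v‖ ^ 2 := by gcongr
      _ = _ := by field_simp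

/-- The sets `A.Q a` are compact and may reach the boundary face. Here it is used that the metric is
continuous and nondegenerate up to the boundary. -/
theorem Atl.exists_elliptic (A : Atl B) (G : Bundle.ContinuousRiemannianMetric (Coord n)
      (fun p : M => TangentSpace (𝓡∂ (n + 1)) p)) :
    ∃ c, 0 < c ∧ ∀ a, ∀ y ∈ A.Q a, ∀ v : Coord n,
      c * ‖v‖ ^ 2 ≤ G.inner (exS (A.e a) y) (frm (A.e a) y v) (frm (A.e a) y v) := by
  have := A.finite_K
  have hc : ∀ a, ∃ c, 0 < c ∧ ∀ y ∈ A.Q a, ∀ v : Coord n,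
      c * ‖v‖ ^ 2 ≤ G.inner (exS (A.e a) y) (frm (A.e a) y v) (frm (A.e a) y v) := by
    intro a
    let L : Coord n → Coord n →L[ℝ] Coord n →L[ℝ] ℝ := fun y =>
      let F : Coord n →L[ℝ] Coord n := frm (A.e a) y
      let I : Coord n →L[ℝ] Coord n →L[ℝ] ℝ := G.inner (exS (A.e a) y)
      I.bilinearComp F F
    exact exists_pos_le_bilin (A.isCompact_Q a) (L := L)
      (fun p q => (continuousOn_metric_comp (A.e_mem a) G (basisVec p) (basisVec q)).mono
        (A.Q_subset a))
      fun y hy v hv => G.pos _ _ (frm_injective (A.e_mem a) (A.Q_subset a hy) hv)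
  choose c hc0 hc using hc
  rcases isEmpty_or_nonempty A.K with hK | hK
  · exact ⟨1, one_pos, fun a => (hK.false a).elim⟩
  obtain ⟨a₀, ha₀⟩ := Finite.exists_min c
  refine ⟨c a₀, hc0 a₀, fun a y hy v => le_trans ?_ (hc a y hy v)⟩
  gcongr
  exact ha₀ a

theorem Atl.elliptic_pullback (A : Atl B) {c : ℝ} {g : CovTensor n M 2}
    {G : Bundle.ContinuousRiemannianMetric (Coord n) (fun p : M => TangentSpace (𝓡∂ (n + 1)) p)}
    (hG : ∀ a, ∀ y ∈ A.Q a, ∀ v : Coord n,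
      c * ‖v‖ ^ 2 ≤ G.inner (exS (A.e a) y) (frm (A.e a) y v) (frm (A.e a) y v))
    (hg : ∀ p ∈ (𝓡∂ (n + 1)).interior M, ∀ v w, g p ![v, w] = G.inner p v w)
    (i : B.ι) {z : Coord n} (hz : z ∈ hypBall n 2) (v : Coord n) :
    c * A.s i ^ 2 * ‖v‖ ^ 2 ≤ pullback (B.param i) g z ![v, v] := by
  rw [A.pullback_apply hz]
  have hp : exS (A.e (A.kap i)) (A.s i • z + A.b i) ∈ (𝓡∂ (n + 1)).interior M := by
    rw [← A.param_eq i z hz]; exact (A.isLoc hz).mem_interior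
  have h1 := hG _ _ (A.mem_Q (i := i) hz) v
  have h2 := hg _ hp (frm (A.e (A.kap i)) (A.s i • z + A.b i) v)
    (frm (A.e (A.kap i)) (A.s i • z + A.b i) v)
  rw [← h2] at h1
  have h3 := A.s_pos i
  calc c * A.s i ^ 2 * ‖v‖ ^ 2 = A.s i ^ 2 * (c * ‖v‖ ^ 2) := by ring
    _ ≤ _ := by gcongr; exact h1

theorem ofComponents_bilin (L : Coord n →L[ℝ] Coord n →L[ℝ] ℝ) (v w : Coord n) :
    (ofComponents fun J : Fin 2 → Fin (n + 1) => L (basisVec (J 0)) (basisVec (J 1))) ![v, w] =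
      L v w := by
  rw [ofComponents_apply, bilin_eq_sum, ← (finTwoArrowEquiv (Fin (n + 1))).symm.sum_comp,
    Fintype.sum_prod_type]
  refine Finset.sum_congr rfl fun a _ => Finset.sum_congr rfl fun b _ => ?_
  simp [Fin.prod_univ_two, finTwoArrowEquiv]
  ring

theorem toCovTensor_apply (h : Bundle.ContMDiffRiemannianMetric (𝓡∂ (n + 1)) ∞ (Coord n)
      (fun p : M => TangentSpace (𝓡∂ (n + 1)) p)) (p : M) (v w : TangentSpace (𝓡∂ (n + 1)) p) :
    toCovTensor h p ![v, w] = h.inner p v w :=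
  ofComponents_bilin (h.inner p) v w

theorem isMetric_toCovTensor (h : Bundle.ContMDiffRiemannianMetric (𝓡∂ (n + 1)) ∞ (Coord n)
      (fun p : M => TangentSpace (𝓡∂ (n + 1)) p)) : IsMetric (toCovTensor h) := fun p _ =>
  ⟨fun v w => by rw [toCovTensor_apply, toCovTensor_apply, h.symm],
    fun v hv => by rw [toCovTensor_apply]; exact h.pos p v hv⟩

theorem Atl.back_toCovTensor (A : Atl B) (h0 : 0 ≤ α) (h1 : α ≤ 1)
    (h : Bundle.ContMDiffRiemannianMetric (𝓡∂ (n + 1)) ∞ (Coord n)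
      (fun p : M => TangentSpace (𝓡∂ (n + 1)) p)) : A.Back α (toCovTensor h) := by
  refine ⟨fun m k => ?_⟩
  have hm : ∀ i, ∀ z ∈ hypBall n 2, IsMet (pullback (B.param i) (toCovTensor h) z) :=
    fun i z hz => (A.isLoc hz).isMet_pullback (isMetric_toCovTensor h)
  obtain ⟨c, hc, hG⟩ := A.exists_elliptic h.toContinuousRiemannianMetric
  have hell := fun i z hz => A.elliptic_pullback hG (g := toCovTensor h)
    (fun p _ v w => toCovTensor_apply h p v w) i (z := z) hz
  refine ⟨fun J => UL.refl ?_, hm, hm, ⟨c, hc, hell⟩, ⟨c, hc, hell⟩⟩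
  refine (A.uA h0 h1 m k (F := fun a y => h.inner (exS (A.e a) y) (frm (A.e a) y (basisVec (J 0)))
    (frm (A.e a) y (basisVec (J 1)))) fun a =>
    contDiffOn_metric_comp (A.e_mem a) h _ _).congr fun i z hz => ?_
  have e : (fun a => basisVec (J a) : Fin 2 → Coord n) = ![basisVec (J 0), basisVec (J 1)] := by
    funext a; fin_cases a <;> rfl
  have hp := (A.s_pos i).ne'
  rw [sC, cmp, e, A.pullback_apply hz, ← mul_assoc, inv_mul_cancel₀ (by positivity), one_mul]
  exact (toCovTensor_apply h _ _ _).symm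

end Ellipticity

end

end WeakAH

namespace WeakAH

noncomputable section

/-! ### Smoothing at the scale of the parametrizations -/

section Cutoff

variable {n : ℕ} {M : Type*} [TopologicalSpace M] [T2Space M] [CompactSpace M]
  [ChartedSpace (EuclideanHalfSpace (n + 1)) M] [IsManifold (𝓡∂ (n + 1)) ∞ M]
  {e : OpenPartialHomeomorph M (EuclideanHalfSpace (n + 1))}

theorem exists_cutoff {K : Set M}
    (hK : IsCompact K) (hKe : K ⊆ e.source) :
    ∃ f : M → ℝ, ContMDiff (𝓡∂ (n + 1)) 𝓘(ℝ, ℝ) ∞ f ∧ (∀ p ∈ K, f p = 1) ∧ (∀ p, 0 ≤ f p) ∧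
      tsupport f ⊆ e.source := by
  obtain ⟨f, hf0, hf1, hf⟩ := exists_contMDiffMap_zero_one_nhds_of_isClosed (𝓡∂ (n + 1))
    (n := (⊤ : ℕ∞)) e.open_source.isClosed_compl hK.isClosed
    (Set.disjoint_left.2 fun q hq hq' => hq (hKe hq'))
  refine ⟨f, f.contMDiff, fun p hp => hf1.self_of_nhdsSet p hp, fun p => (hf p).1, fun q hq => ?_⟩
  by_contra hne
  have h1 : ∀ᶠ x in 𝓝 q, f x = 0 := Filter.Eventually.filter_mono (nhds_le_nhdsSet hne) hf0
  exact (notMem_tsupport_iff_eventuallyEq.2 h1) hq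

/-- The coordinates of a chart, cut off outside a compact set, are globally defined. -/
theorem exists_cutoff_coordinates (he : e ∈ IsManifold.maximalAtlas (𝓡∂ (n + 1)) ∞ M) {K : Set M}
    (hK : IsCompact K) (hKe : K ⊆ e.source) :
    ∃ (f : M → ℝ) (Y : M → Coord n), ContMDiff (𝓡∂ (n + 1)) 𝓘(ℝ, ℝ) ∞ f ∧
      (∀ l, ContMDiff (𝓡∂ (n + 1)) 𝓘(ℝ, ℝ) ∞ fun p => Y p l) ∧ (∀ p ∈ K, f p = 1) ∧
      (∀ p, 0 ≤ f p) ∧ ∀ p, f p ≠ 0 → p ∈ e.source ∧ Y p = exF e p := by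
  obtain ⟨f, hf, hf1, hf0, hfs⟩ := exists_cutoff hK hKe
  -- A second cutoff, equal to `1` on the support of the first, makes the coordinates globally
  -- smooth without changing them where `f` does not vanish.
  obtain ⟨f', hf', hf1', -, hfs'⟩ := exists_cutoff (isClosed_tsupport f).isCompact hfs
  refine ⟨f, fun p => f' p • exF e p, hf, fun l => ?_, hf1, hf0, fun p hp => ?_⟩
  · have h1 : ContMDiffOn (𝓡∂ (n + 1)) 𝓘(ℝ, ℝ) ∞ (fun p => (f' p • exF e p) l) e.source := by
      have h2 : ContMDiffOn (𝓡∂ (n + 1)) 𝓘(ℝ, ℝ) ∞ (fun p => exF e p l) e.source :=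
        ((EuclideanSpace.proj l : Coord n →L[ℝ] ℝ).contMDiff).comp_contMDiffOn
          (contMDiffOn_exF he)
      exact (hf'.contMDiffOn.mul h2).congr fun p _ => by simp
    refine contMDiff_of_contMDiffOn_union_of_isOpen h1 (t := (tsupport f')ᶜ) ?_ ?_ e.open_source
      (isClosed_tsupport f').isOpen_compl
    · refine (contMDiff_const (c := (0 : ℝ))).contMDiffOn.congr fun p hp => ?_
      simp [image_eq_zero_of_notMem_tsupport hp]
    · exact Set.compl_subset_iff_union.mp (Set.compl_subset_compl.mpr hfs')
  · have h1 := subset_tsupport f (Function.mem_support.2 hp)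
    exact ⟨hfs h1, by simp [hf1' p h1]⟩

theorem mem_hypBall_iff_sum {n : ℕ} {t : ℝ} (ht : 0 ≤ t) (z : Coord n) : z ∈ hypBall n t ↔
    0 < Real.sinh t ^ 2 - ∑ l, (z l - Real.cosh t * (basisVec 0 : Coord n) l) ^ 2 := by
  rw [hypBall, mem_ball_iff_norm, ← sq_lt_sq₀ (norm_nonneg _) (Real.sinh_nonneg_iff.2 ht),
    EuclideanSpace.norm_sq_eq, sub_pos]
  simp

theorem exists_norm_sub_le_of_mem_hypBall_one (n : ℕ) : ∃ R, R < Real.sinh 2 ∧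
    ∀ z ∈ hypBall n 1, ‖z - Real.cosh 2 • (basisVec 0 : Coord n)‖ ≤ R := by
  have e1 := Real.cosh_sub_sinh 1
  have e2 := Real.cosh_sub_sinh 2
  have e3 : Real.exp (-2) < Real.exp (-1) := Real.exp_lt_exp.2 (by norm_num)
  have e4 : Real.cosh 1 ≤ Real.cosh 2 := Real.cosh_le_cosh.2 (by norm_num)
  -- The two Euclidean balls have centres at heights `cosh 1` and `cosh 2`. This radius equals `cosh
  -- 2 - e⁻¹`, which is less than `cosh 2 - e⁻² = sinh 2`.
  refine ⟨Real.cosh 2 - Real.cosh 1 + Real.sinh 1, by linarith, fun z hz => ?_⟩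
  rw [hypBall, mem_ball_iff_norm] at hz
  have h2 : z - Real.cosh 2 • (basisVec 0 : Coord n) = (z - Real.cosh 1 • basisVec 0) +
    (Real.cosh 1 - Real.cosh 2) • basisVec 0 := by module
  rw [h2]
  refine (norm_add_le _ _).trans ?_
  rw [norm_smul, Real.norm_eq_abs, abs_sub_comm, abs_of_nonneg (sub_nonneg.2 e4)]
  have : ‖(basisVec 0 : Coord n)‖ = 1 := by simp [basisVec]
  rw [this]; linarith

theorem exists_pos_le_hypBall (n : ℕ) : ∃ c, 0 < c ∧ ∀ z ∈ hypBall n 1,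
    c ≤ Real.sinh 2 ^ 2 - ∑ l, (z l - Real.cosh 2 * (basisVec 0 : Coord n) l) ^ 2 := by
  obtain ⟨R, hR, h⟩ := exists_norm_sub_le_of_mem_hypBall_one n
  have hR0 : 0 ≤ R := (norm_nonneg _).trans (h (basisVec 0) (by
    rw [mem_hypBall_iff n one_pos]; simp [basisVec, Real.one_lt_cosh]))
  refine ⟨Real.sinh 2 ^ 2 - R ^ 2, sub_pos.2 (by gcongr), fun z hz => ?_⟩
  have h2 := pow_le_pow_left₀ (norm_nonneg _) (h z hz) 2
  rw [EuclideanSpace.norm_sq_eq] at h2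
  simp at h2 ⊢
  linarith

theorem exists_add_mem_hypBall (n : ℕ) : ∃ δ, 0 < δ ∧ ∀ z ∈ hypBall n 1, ∀ v : Coord n,
    ‖v‖ < δ → z + v ∈ hypBall n 2 := by
  obtain ⟨R, hR, h⟩ := exists_norm_sub_le_of_mem_hypBall_one n
  refine ⟨Real.sinh 2 - R, sub_pos.2 hR, fun z hz v hv => ?_⟩
  rw [hypBall, mem_ball_iff_norm, add_sub_right_comm]
  have := norm_add_le (z - Real.cosh 2 • (basisVec 0 : Coord n)) v
  linarith [h z hz]

variable {ρ : M → ℝ} {B : Background n M ρ} {α : ℝ}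

/-- Two parametrizations have overlapping images. -/
def Overlap {n : ℕ} {M : Type*} [TopologicalSpace M] [ChartedSpace (EuclideanHalfSpace (n + 1)) M]
    {ρ : M → ℝ} (B : Background n M ρ) (j i : B.ι) : Prop :=
  ∃ z ∈ hypBall n 2, ∃ w ∈ hypBall n 2, B.param j z = B.param i w

/-- At a common point of the two images both scales are comparable to the same value of `ρ`. -/
theorem Overlap.exists_ratio {n : ℕ} {M : Type*} [TopologicalSpace M]
    [ChartedSpace (EuclideanHalfSpace (n + 1)) M] {ρ : M → ℝ} {B : Background n M ρ}
    (A : Atl B) : ∃ C, 0 < C ∧ ∀ j i, Overlap B j i → A.s i ≤ C * A.s j ∧ A.s j ≤ C * A.s i := by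
  obtain ⟨c, hc, hl⟩ := A.rho_lower
  obtain ⟨C, hC, hu⟩ := A.rho_upper
  refine ⟨C / c, by positivity, ?_⟩
  rintro j i ⟨z, hz, w, hw, h⟩
  have h1 := hl i w hw
  have h2 := hu j z hz
  have h3 := hl j z hz
  have h4 := hu i w hw
  rw [h] at h2 h3
  constructor
  · rw [div_mul_eq_mul_div, le_div_iff₀ hc]; linarith
  · rw [div_mul_eq_mul_div, le_div_iff₀ hc]; linarith

/-- Cutoff functions adapted to the parametrizations. -/
theorem Atl.exists_bumps (A : Atl B) (h0 : 0 ≤ α) (h1 : α ≤ 1) :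
    ∃ η : B.ι → M → ℝ, (∀ i p, 0 ≤ η i p) ∧
      (∃ c, 0 < c ∧ ∀ i, ∀ z ∈ hypBall n 1, c ≤ η i (B.param i z)) ∧
      (∀ i p, η i p ≠ 0 → ∃ z ∈ hypBall n 2, p = B.param i z) ∧
      ∀ k, UA α (fun x : B.ι × B.ι => A.s x.1) 0 k fun x z => η x.2 (B.param x.1 z) := by
  classical
  choose f Y hf hY hf1 hf0 hfY using fun a =>
    exists_cutoff_coordinates (A.e_mem a) (A.core_compact a) (A.core_subset a)
  have hs : IsScale α (fun x : B.ι × B.ι => A.s x.1) :=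
    ⟨h0, h1, fun x => A.s_pos _, A.s_bdd.imp fun C h x => h x.1⟩
  have := A.finite_K
  have := Fintype.ofFinite A.K
  -- the rescaled coordinate, and the argument of the cutoff function
  let X : B.ι → M → Coord n := fun i p => (A.s i)⁻¹ • (Y (A.kap i) p - A.b i)
  let q : Coord n → ℝ := fun z =>
    Real.sinh 2 ^ 2 - ∑ l, (z l - Real.cosh 2 * (basisVec 0 : Coord n) l) ^ 2
  have hX : ∀ i, ∀ z ∈ hypBall n 2, X i (B.param i z) = z := fun i z hz => by
    have h2 := (hfY (A.kap i) (B.param i z) (by rw [hf1 _ _ (A.mem_core i z hz)]; simp)).2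
    simp only [X]
    rw [h2, A.param_eq i z hz, exF_exS (A.mem i z hz), add_sub_cancel_right, smul_smul,
      inv_mul_cancel₀ (A.s_pos i).ne', one_smul]
  have hX' : ∀ i p, f (A.kap i) p ≠ 0 → X i p ∈ hypBall n 2 → p = B.param i (X i p) := by
    intro i p hp hz
    obtain ⟨h2, h3⟩ := hfY _ p hp
    have h4 : A.s i • X i p + A.b i = exF (A.e (A.kap i)) p := by
      simp only [X]
      rw [smul_smul, mul_inv_cancel₀ (A.s_pos i).ne', one_smul, sub_add_cancel, h3]
    rw [A.param_eq i _ hz, h4, exS_exF h2]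
  have hsupp : ∀ i p, f (A.kap i) p * expNegInvGlue (q (X i p)) ≠ 0 →
      ∃ z ∈ hypBall n 2, p = B.param i z := by
    intro i p hp
    have h2 : X i p ∈ hypBall n 2 := by
      rw [mem_hypBall_iff_sum (by norm_num)]
      by_contra hq
      exact right_ne_zero_of_mul hp (expNegInvGlue.zero_of_nonpos (not_lt.1 hq))
    exact ⟨_, h2, hX' i p (left_ne_zero_of_mul hp) h2⟩
  refine ⟨fun i p => f (A.kap i) p * expNegInvGlue (q (X i p)),
    fun i p => mul_nonneg (hf0 _ _) (expNegInvGlue.nonneg _), ?_, hsupp, fun k => ?_⟩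
  · obtain ⟨c, hc, hcz⟩ := exists_pos_le_hypBall n
    refine ⟨expNegInvGlue c, expNegInvGlue.pos_of_pos hc, fun i z hz => ?_⟩
    have hz2 := hypBall_one_subset hz
    change _ ≤ f (A.kap i) (B.param i z) * expNegInvGlue (q (X i (B.param i z)))
    rw [hf1 _ _ (A.mem_core i z hz2), one_mul, hX i z hz2]
    exact expNegInvGlue.monotone (hcz z hz)
  · -- pairs without overlap do not contribute
    let χ : B.ι × B.ι → ℝ := fun x => if Overlap B x.1 x.2 then 1 else 0
    have hχ : ∃ C, ∀ x, |χ x| ≤ C := ⟨1, fun x => by simp only [χ]; split_ifs <;> simp⟩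
    have hfib : ∀ (F : A.K → M → ℝ), (∀ a, ContMDiff (𝓡∂ (n + 1)) 𝓘(ℝ, ℝ) ∞ (F a)) →
        ∀ m k, UA α (fun x : B.ι × B.ι => A.s x.1) m k
          fun x z => F (A.kap x.2) (B.param x.1 z) := fun F hF m k =>
      (UA.sum fun a => ((A.uA_smooth h0 h1 m k (hF a)).reindex Prod.fst).const_mul
        (c := fun x : B.ι × B.ι => if A.kap x.2 = a then 1 else 0)
        ⟨1, fun x => by split_ifs <;> simp⟩).congr fun x z _ => by simp
    obtain ⟨C, hC0, hC⟩ := Overlap.exists_ratio A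
    obtain ⟨S, hS⟩ := A.s_bdd
    have hYb : ∃ D, ∀ a p l, |Y a p l| ≤ D := by
      choose D hD using fun (x : A.K × Fin (n + 1)) =>
        (isCompact_univ (X := M)).exists_bound_of_continuousOn
          (hY x.1 x.2).continuous.continuousOn
      obtain ⟨D', hD'⟩ := (Set.finite_range D).bddAbove
      exact ⟨D', fun a p l => (hD (a, l) p (Set.mem_univ _)).trans (hD' ⟨(a, l), rfl⟩)⟩
    obtain ⟨D, hD⟩ := hYb
    have hball : ∀ z ∈ hypBall n 2, ∀ l, |z l| ≤ Real.cosh 2 + Real.sinh 2 := fun z hz l => by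
      rw [hypBall, mem_ball_iff_norm] at hz
      have h2 := PiLp.norm_apply_le z l
      rw [Real.norm_eq_abs] at h2
      have h3 : ‖Real.cosh 2 • (basisVec 0 : Coord n)‖ = Real.cosh 2 := by
        simp [norm_smul, basisVec, abs_of_pos (Real.cosh_pos 2)]
      calc |z l| ≤ ‖z‖ := h2
        _ = ‖Real.cosh 2 • (basisVec 0 : Coord n) + (z - Real.cosh 2 • basisVec 0)‖ := by
          congr 1; module
        _ ≤ _ := (norm_add_le _ _).trans (by rw [h3]; gcongr)
    set T := Real.cosh 2 + Real.sinh 2 with hT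
    have hT0 : 0 ≤ T := by rw [hT, Real.cosh_add_sinh]; positivity
    have hov : ∀ x : B.ι × B.ι, Overlap B x.1 x.2 → ∃ z ∈ hypBall n 2, ∃ w ∈ hypBall n 2,
        ∀ l, Y (A.kap x.2) (B.param x.1 z) l - A.b x.2 l = A.s x.2 * w l := by
      rintro x ⟨z, hz, w, hw, h⟩
      refine ⟨z, hz, w, hw, fun l => ?_⟩
      have h2 := hX x.2 w hw
      have h3 : A.s x.2 • X x.2 (B.param x.2 w) = Y (A.kap x.2) (B.param x.2 w) - A.b x.2 := by
        simp only [X]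
        rw [smul_smul, mul_inv_cancel₀ (A.s_pos _).ne', one_smul]
      rw [h2, ← h] at h3
      have := congrArg (fun v : Coord n => v l) h3
      simpa using this.symm
    -- For an overlapping pair the offset is the difference of a bounded coordinate of the common
    -- point and a bounded multiple of a point of the ball.
    have hb : ∀ l, ∃ E, ∀ x, |χ x * A.b x.2 l| ≤ E := fun l => by
      refine ⟨D + S * T, fun x => ?_⟩
      have hS0 : 0 ≤ S := (A.s_pos x.1).le.trans (hS _)
      have hD0 : 0 ≤ D := (abs_nonneg _).trans (hD (A.kap x.1) (B.param x.1 0) 0)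
      simp only [χ]
      split_ifs with hx
      · obtain ⟨z, hz, w, hw, h⟩ := hov x hx
        have h2 : A.b x.2 l = Y (A.kap x.2) (B.param x.1 z) l - A.s x.2 * w l := by
          rw [← h]; ring
        rw [one_mul, h2]
        refine (abs_sub _ _).trans (add_le_add (hD _ _ _) ?_)
        rw [abs_mul, abs_of_pos (A.s_pos _)]
        exact mul_le_mul (hS _) (hball w hw l) (abs_nonneg _) hS0
      · simp; positivity
    have hu : ∀ l, UA α (fun x : B.ι × B.ι => A.s x.1) 0 k
        fun x z => χ x * (X x.2 (B.param x.1 z)) l := fun l => by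
      have e1 : ∀ m k, UA α (fun x : B.ι × B.ι => A.s x.1) m k
          fun x z => χ x * (Y (A.kap x.2) (B.param x.1 z) l - A.b x.2 l) := fun m k =>
        (((hfib (fun a p => Y a p l) (fun a => hY a l) m k).const_mul hχ).sub
          (UA.const (hb l))).congr fun x z _ => by ring
      -- For an overlapping pair this coordinate difference is of size `O(s)` at a common point, and
      -- it oscillates by `O(s)` over the ball.
      have e2 : UB fun (x : B.ι × B.ι) z => (A.s x.1)⁻¹ *
          (χ x * (Y (A.kap x.2) (B.param x.1 z) l - A.b x.2 l)) := by
        obtain ⟨E, hE0, hE⟩ := (e1 1 1).osc hs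
        refine ⟨E + C * T, fun x z hz => ?_⟩
        have hp := A.s_pos x.1
        rw [abs_mul, abs_of_pos (inv_pos.2 hp), inv_mul_le_iff₀ hp]
        by_cases hx : Overlap B x.1 x.2
        · obtain ⟨z', hz', w, hw, h⟩ := hov x hx
          have h2 := hE x z hz z' hz'
          have h3 : χ x * (Y (A.kap x.2) (B.param x.1 z') l - A.b x.2 l) = A.s x.2 * w l := by
            rw [h]; simp [χ, hx]
          rw [h3] at h2
          have h4 : |A.s x.2 * w l| ≤ C * A.s x.1 * T := by
            rw [abs_mul, abs_of_pos (A.s_pos _)]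
            exact mul_le_mul (hC _ _ hx).1 (hball w hw l) (abs_nonneg _) (by positivity)
          have h5 := abs_sub_abs_le_abs_sub
            (χ x * (Y (A.kap x.2) (B.param x.1 z) l - A.b x.2 l)) (A.s x.2 * w l)
          linarith
        · have : χ x = 0 := by simp [χ, hx]
          rw [this]; simp; positivity
      have e3 := ((e1 1 (k + 1)).inv_scale_mul hs e2).of_succ hs
      -- Passage from the scale of the first parametrization to that of the second; the ratio is
      -- bounded for overlapping pairs.
      refine (e3.const_mul (c := fun x => χ x * (A.s x.1 * (A.s x.2)⁻¹))
        ⟨C, fun x => ?_⟩).congr fun x z hz => ?_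
      · simp only [χ]
        split_ifs with hx
        · have hp := A.s_pos x.2
          rw [one_mul, abs_of_pos (mul_pos (A.s_pos _) (inv_pos.2 hp)), ← div_eq_mul_inv,
            div_le_iff₀ hp]
          exact (hC _ _ hx).2
        · simp; positivity
      · have hp := (A.s_pos x.1).ne'
        simp only [X, χ, PiLp.smul_apply, PiLp.sub_apply, smul_eq_mul]
        split_ifs
        · field_simp
        · simp
    have hq : UA α (fun x : B.ι × B.ι => A.s x.1) 0 k fun x z => Real.sinh 2 ^ 2 -
        ∑ l, (χ x * (X x.2 (B.param x.1 z)) l - Real.cosh 2 * (basisVec 0 : Coord n) l) ^ 2 :=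
      (UA.const' _).sub (UA.sum fun l => ((hu l).sub (UA.const' _)).pow hs 2)
    refine ((((hfib f hf 0 k)).mul hs (hq.comp_smooth hs
      (f := expNegInvGlue) (expNegInvGlue.contDiff (n := (⊤ : ℕ∞))))).const_mul hχ).congr
      fun x z hz => ?_
    by_cases hx : Overlap B x.1 x.2
    · simp [χ, hx, q]
    · have : χ x = 0 := by simp [χ, hx]
      rw [this, zero_mul]
      -- A point where the cutoff does not vanish lies in the image of the second ball and would be
      -- an overlap.
      by_contra hne
      obtain ⟨w, hw, h⟩ := hsupp x.2 (B.param x.1 z) (Ne.symm hne)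
      exact hx ⟨z, hz, w, hw, h⟩

end Cutoff

end

end WeakAH

/-! ### Averaging against the cutoff functions. -/

namespace WeakAH

noncomputable section

section Average

variable {n : ℕ} {M : Type*} [TopologicalSpace M] [ChartedSpace (EuclideanHalfSpace (n + 1)) M]
  {ρ : M → ℝ} {B : Background n M ρ} {α : ℝ}

/-- Cutoff functions adapted to the parametrizations. -/
structure Bumps (A : Atl B) (α : ℝ) where
  η : B.ι → M → ℝ
  nonneg : ∀ i p, 0 ≤ η i p
  lower : ∃ c, 0 < c ∧ ∀ i, ∀ z ∈ hypBall n 1, c ≤ η i (B.param i z)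
  supp : ∀ i p, η i p ≠ 0 → ∃ z ∈ hypBall n 2, p = B.param i z
  uA : ∀ k, UA α (fun x : B.ι × B.ι => A.s x.1) 0 k fun x z => η x.2 (B.param x.1 z)

/-- The average of a function at the scale of the parametrizations. -/
def Bumps.avg {A : Atl B} (β : Bumps A α) (σ : M → ℝ) (p : M) : ℝ :=
  (∑ᶠ i, β.η i p)⁻¹ * ∑ᶠ i, β.η i p * σ (B.param i (basisVec 0))

theorem exists_overlap_finset (B : Background n M ρ) :
    ∃ (F : B.ι → Finset B.ι) (N : ℕ), (∀ j i, i ∈ F j ↔ Overlap B j i) ∧ ∀ j, (F j).card ≤ N := by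
  obtain ⟨N, hN⟩ := B.locally_finite
  have hset : ∀ j, {i | (B.param j '' hypBall n 2 ∩ B.param i '' hypBall n 2).Nonempty} =
      {i | Overlap B j i} := fun j => by
    ext i
    constructor
    · rintro ⟨p, ⟨z, hz, rfl⟩, w, hw, h⟩
      exact ⟨z, hz, w, hw, h.symm⟩
    · rintro ⟨z, hz, w, hw, h⟩
      exact ⟨_, ⟨z, hz, rfl⟩, w, hw, h.symm⟩
  simp only [hset] at hN
  have hfin : ∀ j, {i | Overlap B j i}.Finite := fun j =>
    Set.finite_of_encard_le_coe (hN j)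
  refine ⟨fun j => (hfin j).toFinset, N, fun j i => by simp, fun j => ?_⟩
  have := hN j
  rw [(hfin j).encard_eq_coe_toFinset_card] at this
  exact_mod_cast this

variable {A : Atl B} (β : Bumps A α) {Λ : Type*}

theorem Bumps.finsum_eq {F : B.ι → Finset B.ι} (hF : ∀ j i, i ∈ F j ↔ Overlap B j i) {j : B.ι}
    {z : Coord n} (hz : z ∈ hypBall n 2) (c : B.ι → ℝ) :
    ∑ᶠ i, β.η i (B.param j z) * c i = ∑ i ∈ F j, β.η i (B.param j z) * c i := by
  refine finsum_eq_sum_of_support_subset _ fun i hi => ?_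
  obtain ⟨w, hw, h⟩ := β.supp i _ (left_ne_zero_of_mul (Function.mem_support.1 hi))
  exact Finset.mem_coe.2 ((hF j i).2 ⟨z, hz, w, hw, h⟩)

theorem Bumps.avg_eq {F : B.ι → Finset B.ι} (hF : ∀ j i, i ∈ F j ↔ Overlap B j i) {j : B.ι}
    {z : Coord n} (hz : z ∈ hypBall n 2) (σ : M → ℝ) :
    β.avg σ (B.param j z) = (∑ i ∈ F j, β.η i (B.param j z))⁻¹ *
      ∑ i ∈ F j, β.η i (B.param j z) * σ (B.param i (basisVec 0)) := by
  have h1 := β.finsum_eq hF (j := j) hz fun _ => 1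
  simp only [mul_one] at h1
  rw [avg, h1, β.finsum_eq hF hz]

/-- Every interior point lies in the image of some `B₁`, and the single cutoff belonging to it
already gives the lower bound. -/
theorem Bumps.exists_sum_lower {F : B.ι → Finset B.ι} (hF : ∀ j i, i ∈ F j ↔ Overlap B j i) :
    ∃ c, 0 < c ∧ ∀ j, ∀ z ∈ hypBall n 2, c ≤ ∑ i ∈ F j, β.η i (B.param j z) := by
  obtain ⟨c, hc, h⟩ := β.lower
  refine ⟨c, hc, fun j z hz => ?_⟩
  have h1 : B.param j z ∈ ⋃ i, B.param i '' hypBall n 1 := by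
    rw [B.cover]; exact (A.isLoc hz).mem_interior
  obtain ⟨i, w, hw, hwz⟩ := Set.mem_iUnion.1 h1
  refine ((h i w hw).trans (le_of_eq (by rw [hwz]))).trans
    (Finset.single_le_sum (f := fun i => β.η i (B.param j z)) (fun i _ => β.nonneg i _)
      ((hF j i).2 ⟨z, hz, w, hypBall_one_subset hw, hwz.symm⟩))

/-- The average of a family of functions that oscillates little at the scale of the
parametrizations. -/
theorem Bumps.uL_avg (h0 : 0 ≤ α) (h1 : α ≤ 1) {d : Λ → ℝ} {σ σ' : Λ → M → ℝ} {k : ℕ}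
    (hσ : UL α (A.sc Λ) (fun x => d x.2) 1 (k + 1) (fun x z => σ x.2 (B.param x.1 z))
      (fun x z => σ' x.2 (B.param x.1 z))) (k' : ℕ) :
    UL α (A.sc Λ) (fun x => d x.2) 1 k' (fun x z => β.avg (σ x.2) (B.param x.1 z))
      (fun x z => β.avg (σ' x.2) (B.param x.1 z)) ∧
    UB (fun x : B.ι × Λ => fun z => (A.s x.1)⁻¹ *
      (β.avg (σ x.2) (B.param x.1 z) - σ x.2 (B.param x.1 z))) := by
  classical
  obtain ⟨F, N, hF, hN⟩ := exists_overlap_finset B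
  obtain ⟨c, hc, hlow⟩ := β.exists_sum_lower hF
  obtain ⟨C, hC0, hC⟩ := Overlap.exists_ratio A
  have hs := A.isScale_sc (Λ := Λ) h0 h1
  have he := basisVec_zero_mem_hypBall (n := n)
  -- Normalized differences between the values at the centres of overlapping parametrizations,
  -- bounded because the function oscillates by `O(s)`. The average is the value at one centre plus
  -- `s` times a combination of these constants, so its derivatives fall only on the cutoffs, and
  -- the factor `s` pays for one weighted derivative.
  let a : (Λ → M → ℝ) → (B.ι × Λ) × B.ι → ℝ := fun τ y => if Overlap B y.1.1 y.2 then
    (A.s y.1.1)⁻¹ * (τ y.1.2 (B.param y.2 (basisVec 0)) - τ y.1.2 (B.param y.1.1 (basisVec 0)))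
    else 0
  have ha : ∀ {τ : Λ → M → ℝ}, UA α (A.sc Λ) 1 (k + 1) (fun x z => τ x.2 (B.param x.1 z)) →
      ∃ E, ∀ y, |a τ y| ≤ E := by
    intro τ hτ
    obtain ⟨D, hD0, hD⟩ := hτ.osc hs
    refine ⟨D * C + D, fun y => ?_⟩
    simp only [a]
    split_ifs with hy
    · obtain ⟨z, hz, w, hw, h⟩ := hy
      have hp := A.s_pos y.1.1
      rw [abs_mul, abs_of_pos (inv_pos.2 hp), inv_mul_le_iff₀ hp]
      have e1 := hD (y.2, y.1.2) _ he w hw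
      have e2 := hD (y.1.1, y.1.2) z hz _ he
      simp only [← h] at e1
      have e3 : D * A.s y.2 ≤ D * (C * A.s y.1.1) := by
        gcongr; exact (hC y.1.1 y.2 ⟨z, hz, w, hw, h⟩).1
      have e4 := abs_sub_le (τ y.1.2 (B.param y.2 (basisVec 0))) (τ y.1.2 (B.param y.1.1 z))
        (τ y.1.2 (B.param y.1.1 (basisVec 0)))
      simp only [Atl.sc] at e1 e2
      linarith
    · simp; positivity
  -- the averages in terms of the differences
  have hrep : ∀ (τ : Λ → M → ℝ) (x : B.ι × Λ), ∀ z ∈ hypBall n 2,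
      τ x.2 (B.param x.1 (basisVec 0)) + A.s x.1 * ((∑ i ∈ F x.1, β.η i (B.param x.1 z))⁻¹ *
        ∑ i ∈ F x.1, β.η i (B.param x.1 z) * a τ (x, i)) = β.avg (τ x.2) (B.param x.1 z) := by
    intro τ x z hz
    have hS := (hc.trans_le (hlow x.1 z hz)).ne'
    have hp := (A.s_pos x.1).ne'
    rw [β.avg_eq hF hz]
    have e : ∑ i ∈ F x.1, β.η i (B.param x.1 z) * a τ (x, i) = (A.s x.1)⁻¹ *
        (∑ i ∈ F x.1, β.η i (B.param x.1 z) * τ x.2 (B.param i (basisVec 0)) -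
          (∑ i ∈ F x.1, β.η i (B.param x.1 z)) * τ x.2 (B.param x.1 (basisVec 0))) := by
      rw [Finset.sum_mul, ← Finset.sum_sub_distrib, Finset.mul_sum]
      refine Finset.sum_congr rfl fun i hi => ?_
      simp only [a, if_pos ((hF _ _).1 hi)]
      ring
    rw [e]
    field_simp
    ring
  have hη : ∀ k, UA α (fun y : (B.ι × Λ) × B.ι => A.sc Λ y.1) 0 k
      fun y z => β.η y.2 (B.param y.1.1 z) := fun k =>
    (β.uA k).reindex fun y : (B.ι × Λ) × B.ι => (y.1.1, y.2)
  have hSum : ∀ k, UA α (A.sc Λ) 0 k fun x z => (∑ i ∈ F x.1, β.η i (B.param x.1 z))⁻¹ :=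
    fun k => (UA.sum_fiber (A := fun x : B.ι × Λ => F x.1) (fun x => hN x.1) (hη k)).inv hs hc
      fun x z hz => hlow x.1 z hz
  have hθ : ∀ k, UL α (A.sc Λ) (fun x => d x.2) 0 k
      (fun x z => (∑ i ∈ F x.1, β.η i (B.param x.1 z))⁻¹ *
        ∑ i ∈ F x.1, β.η i (B.param x.1 z) * a σ (x, i))
      (fun x z => (∑ i ∈ F x.1, β.η i (B.param x.1 z))⁻¹ *
        ∑ i ∈ F x.1, β.η i (B.param x.1 z) * a σ' (x, i)) := fun k => by
    have hs' : IsScale α (fun y : (B.ι × Λ) × B.ι => A.sc Λ y.1) :=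
      ⟨h0, h1, fun _ => A.s_pos _, A.s_bdd.imp fun _ h x => h x.1.1⟩
    refine (UL.refl (hSum k)).mul hs (UL.sum_fiber (A := fun x : B.ι × Λ => F x.1)
      (fun x => hN x.1) ((UL.refl (hη k)).mul hs' (UL.const (c := a σ) (c' := a σ')
        (ha hσ.left) (ha hσ.right) ?_)))
    -- The normalized differences depend linearly on the function, so the difference quotient of the
    -- two families is treated as a third family.
    obtain ⟨E, hE⟩ := ha (τ := fun l p => (d l)⁻¹ * (σ l p - σ' l p)) hσ.diff
    refine ⟨E, fun y => (le_of_eq ?_).trans (hE y)⟩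
    simp only [a]
    split_ifs
    · congr 1; ring
    · simp
  constructor
  · obtain ⟨E, hE⟩ := hσ.left.ub
    obtain ⟨E', hE'⟩ := hσ.right.ub
    obtain ⟨E'', hE''⟩ := hσ.diff.ub
    exact ((UL.const (c := fun x : B.ι × Λ => σ x.2 (B.param x.1 (basisVec 0)))
      (c' := fun x : B.ι × Λ => σ' x.2 (B.param x.1 (basisVec 0)))
      ⟨E, fun x => hE x _ he⟩ ⟨E', fun x => hE' x _ he⟩ ⟨E'', fun x => hE'' x _ he⟩).add
      ((hθ k').scale_mul hs)).congr (hrep σ) (hrep σ')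
  -- The error splits into the oscillation of `σ` between the centre and the point, and `s` times
  -- the bounded combination; both are `O(s)`.
  · obtain ⟨E, hE⟩ := (hθ 0).left.ub
    obtain ⟨D, hD0, hD⟩ := hσ.left.osc hs
    refine ⟨D + E, fun x z hz => ?_⟩
    have hp := A.s_pos x.1
    have e1 := hE x z hz
    have e2 := hD x _ he z hz
    simp only at e1 ⊢
    rw [← hrep σ x z hz, abs_mul, abs_of_pos (inv_pos.2 hp), inv_mul_le_iff₀ hp]
    set θ := (∑ i ∈ F x.1, β.η i (B.param x.1 z))⁻¹ *
        ∑ i ∈ F x.1, β.η i (B.param x.1 z) * a σ (x, i)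
    have e3 : |A.s x.1 * θ| ≤ A.s x.1 * E := by
      rw [abs_mul, abs_of_pos hp]; gcongr
    have e4 := abs_add_le (σ x.2 (B.param x.1 (basisVec 0)) - σ x.2 (B.param x.1 z)) (A.s x.1 * θ)
    have e5 : σ x.2 (B.param x.1 (basisVec 0)) - σ x.2 (B.param x.1 z) + A.s x.1 * θ =
      σ x.2 (B.param x.1 (basisVec 0)) + A.s x.1 * θ - σ x.2 (B.param x.1 z) := by ring
    rw [e5] at e4
    simp only [Atl.sc] at e2
    linarith

end Average

end

end WeakAH

namespace WeakAH

noncomputable section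

/-! ### Differential operators on functions -/

section Operators

variable {n : ℕ} {α : ℝ} {M : Type*} [TopologicalSpace M]
  [ChartedSpace (EuclideanHalfSpace (n + 1)) M]

/-- The tensor product of the differentials of two functions. -/
def prodM (γ : CovTensor n M 2) (f u : M → ℝ) : CovTensor n M 2 := fun p =>
  prodT (val (nabla γ (ofFun f)) p) (val (nabla γ (ofFun u)) p)

/-- The inner product of the differentials of two functions. -/
def innM (γ : CovTensor n M 2) (f u : M → ℝ) (p : M) : ℝ := ctrM γ (prodM γ f u) p

/-- The Laplacian of a function. -/
def lapM (γ : CovTensor n M 2) (f : M → ℝ) (p : M) : ℝ :=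
  ctrM γ (nabla γ (nabla γ (ofFun f))) p

variable {ρ : M → ℝ} {B : Background n M ρ} {A : Atl B}

/-- The value at the point is recovered by pulling back along the inverse derivative. -/
theorem isMet_val_of_pullback {Φ : Coord n → M} {z : Coord n} (hΦ : IsLoc Φ z)
    {γ : CovTensor n M 2} (h : IsMet (pullback Φ γ z)) : IsMet (val γ (Φ z)) := by
  have e : val γ (Φ z) = (pullback Φ γ z).compContinuousLinearMap
      fun _ => (dM Φ z).inverse := by
    ext v
    rw [pullback_eq]
    simp only [ContinuousMultilinearMap.compContinuousLinearMap_apply]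
    congr 1
    funext a
    exact (hΦ.inv.self_apply_inverse (v a)).symm
  rw [e]
  obtain ⟨L, hL⟩ := hΦ.inv
  refine h.comp ?_
  rw [← hL, ContinuousLinearMap.inverse_equiv]
  exact L.symm.injective

variable [IsManifold (𝓡∂ (n + 1)) ∞ M]

theorem Atl.pullback_nabla (A : Atl B) {r : ℕ} {γ : CovTensor n M 2} {t : CovTensor n M r}
    {i : B.ι} (hγ : ∀ z ∈ hypBall n 2, DifferentiableAt ℝ (pullback (B.param i) γ) z)
    (hm : ∀ z ∈ hypBall n 2, IsMet (pullback (B.param i) γ z))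
    {z : Coord n} (hz : z ∈ hypBall n 2) (ht : DifferentiableAt ℝ (pullback (B.param i) t) z) :
    pullback (B.param i) (nabla γ t) z =
      nablaC (pullback (B.param i) γ) (pullback (B.param i) t) z :=
  (A.isLoc hz).pullback_nabla (hγ z hz)
    (Filter.eventually_of_mem (hypBall_mem_nhds hz) hm) ht

theorem differentiableAt_cst {φ : Coord n → ℝ} {z : Coord n} (h : DifferentiableAt ℝ φ z) :
    DifferentiableAt ℝ (cst φ) z := by
  have : cst φ = fun z => φ z • (ContinuousMultilinearMap.constOfIsEmpty ℝ _ 1 : Tens n 0) := by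
    funext z; ext v; simp [cst]
  rw [this]
  exact h.smul_const _

theorem Atl.innM_eq (A : Atl B) {γ : CovTensor n M 2} {f u : M → ℝ}
    {i : B.ι} (hγ : ∀ z ∈ hypBall n 2, DifferentiableAt ℝ (pullback (B.param i) γ) z)
    (hm : ∀ z ∈ hypBall n 2, IsMet (pullback (B.param i) γ z))
    {z : Coord n} (hz : z ∈ hypBall n 2) (hf : DifferentiableAt ℝ (fun z => f (B.param i z)) z)
    (hu : DifferentiableAt ℝ (fun z => u (B.param i z)) z) :
    innM γ f u (B.param i z) = innC (fun z => f (B.param i z)) (fun z => u (B.param i z))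
      (pullback (B.param i) γ) z := by
  have h1 := A.pullback_nabla hγ hm hz (t := ofFun f) (differentiableAt_cst hf)
  have h2 := A.pullback_nabla hγ hm hz (t := ofFun u) (differentiableAt_cst hu)
  rw [innM, (A.isLoc hz).ctrM_eq (isMet_val_of_pullback (A.isLoc hz) (hm z hz)), ← ctr_prodT]
  congr 1
  refine (prodT_comp (val (nabla γ (ofFun f)) (B.param i z))
    (val (nabla γ (ofFun u)) (B.param i z)) (dM (B.param i) z)).trans ?_
  rw [← pullback_eq, ← pullback_eq, h1, h2]
  rfl

theorem Atl.lapM_eq (A : Atl B) {γ : CovTensor n M 2} {f : M → ℝ}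
    {i : B.ι} (hγ : ∀ z ∈ hypBall n 2, DifferentiableAt ℝ (pullback (B.param i) γ) z)
    (hm : ∀ z ∈ hypBall n 2, IsMet (pullback (B.param i) γ z))
    {z : Coord n} (hz : z ∈ hypBall n 2)
    (hf : ∀ z ∈ hypBall n 2, ContDiffAt ℝ 2 (fun z => f (B.param i z)) z) :
    lapM γ f (B.param i z) = lapC (fun z => f (B.param i z)) (pullback (B.param i) γ) z := by
  have h1 : ∀ z ∈ hypBall n 2, pullback (B.param i) (nabla γ (ofFun f)) z =
      nablaC (pullback (B.param i) γ) (cst fun z => f (B.param i z)) z := fun z hz =>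
    A.pullback_nabla hγ hm hz (t := ofFun f)
      (differentiableAt_cst ((hf z hz).differentiableAt (by norm_num)))
  have h2 := Filter.eventuallyEq_of_mem (hypBall_mem_nhds hz) h1
  have h3 : DifferentiableAt ℝ (pullback (B.param i) (nabla γ (ofFun f))) z := by
    refine DifferentiableAt.congr_of_eventuallyEq ?_ h2
    refine (contDiffAt_of_sC (s := fun _ : Unit => (1 : ℝ)) (d := 0) (i := ()) (N := 1)
      (t := fun _ => nablaC (pullback (B.param i) γ) (cst fun z => f (B.param i z))) one_pos
      fun J => ?_).differentiableAt (by norm_num)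
    refine ((contDiffAt_pd (N := 1) (by norm_num; exact hf z hz) (J 0))).congr_of_eventuallyEq
      (Filter.Eventually.of_forall fun w => ?_)
    simp only [sC, nablaC_cst]
    simp
  rw [lapM, (A.isLoc hz).ctrM_eq (isMet_val_of_pullback (A.isLoc hz) (hm z hz)), ← ctr_hess,
    A.pullback_nabla hγ hm hz h3, nablaC_congr Filter.EventuallyEq.rfl h2]

variable {Λ : Type*} {d : Λ → ℝ} {γ γ' : Λ → CovTensor n M 2} {k m : ℕ}

theorem ULMet.contDiffAt {I : Type*} {s d : I → ℝ} {G G' : I → Coord n → Tens n 2}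
    (hs : IsScale α s) (h : ULMet α s d m k G G') (i : I) {z : Coord n} (hz : z ∈ hypBall n 2) :
    ContDiffAt ℝ k (G i) z ∧ ContDiffAt ℝ k (G' i) z :=
  ⟨contDiffAt_of_sC (s := s) (d := 2) (hs.pos i) fun J => (h.comp J).left.contDiffAt hs hz,
    contDiffAt_of_sC (s := s) (d := 2) (hs.pos i) fun J => (h.comp J).right.contDiffAt hs hz⟩

theorem ULMet.innM (h0 : 0 ≤ α) (h1 : α ≤ 1) {m' k' : ℕ} (hm : m ≤ m') (hk : k ≤ k' + 1)
    (h : ULMet α (A.sc Λ) (fun x => d x.2) m' (k' + 1) (pbF B γ) (pbF B γ'))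
    {f f' u u' : Λ → M → ℝ}
    (hf : UL α (A.sc Λ) (fun x => d x.2) (m + 1) (k + 1) (fun x z => f x.2 (B.param x.1 z))
      (fun x z => f' x.2 (B.param x.1 z)))
    (hu : UL α (A.sc Λ) (fun x => d x.2) (m + 1) (k + 1) (fun x z => u x.2 (B.param x.1 z))
      (fun x z => u' x.2 (B.param x.1 z))) :
    UL α (A.sc Λ) (fun x => d x.2) m k (fun x z => innM (γ x.2) (f x.2) (u x.2) (B.param x.1 z))
      (fun x z => innM (γ' x.2) (f' x.2) (u' x.2) (B.param x.1 z)) := by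
  have hs := A.isScale_sc (Λ := Λ) h0 h1
  have hd := fun x z hz => (h.contDiffAt hs x (z := z) hz).1.differentiableAt (by simp)
  have hd' := fun x z hz => (h.contDiffAt hs x (z := z) hz).2.differentiableAt (by simp)
  refine ((h.mono hs hm hk).innC hs hf hu).congr (fun x z hz => ?_) fun x z hz => ?_
  · exact (A.innM_eq (fun z hz => hd x z hz) (fun z hz => h.isMet x z hz) hz
      (hf.differentiableAt x hz).1 (hu.differentiableAt x hz).1).symm
  · exact (A.innM_eq (fun z hz => hd' x z hz) (fun z hz => h.isMet' x z hz) hz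
      (hf.differentiableAt x hz).2 (hu.differentiableAt x hz).2).symm

theorem ULMet.lapM (h0 : 0 ≤ α) (h1 : α ≤ 1)
    (h : ULMet α (A.sc Λ) (fun x => d x.2) (m + 1) (k + 1) (pbF B γ) (pbF B γ'))
    {f f' : Λ → M → ℝ}
    (hf : UL α (A.sc Λ) (fun x => d x.2) (m + 2) (k + 2) (fun x z => f x.2 (B.param x.1 z))
      (fun x z => f' x.2 (B.param x.1 z))) :
    UL α (A.sc Λ) (fun x => d x.2) m k (fun x z => lapM (γ x.2) (f x.2) (B.param x.1 z))
      (fun x z => lapM (γ' x.2) (f' x.2) (B.param x.1 z)) := by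
  have hs := A.isScale_sc (Λ := Λ) h0 h1
  have hd := fun x z hz => (h.contDiffAt hs x (z := z) hz).1.differentiableAt (by simp)
  have hd' := fun x z hz => (h.contDiffAt hs x (z := z) hz).2.differentiableAt (by simp)
  refine (h.lapC hs hf).congr (fun x z hz => ?_) fun x z hz => ?_
  · exact (A.lapM_eq (fun z hz => hd x z hz) (fun z hz => h.isMet x z hz) hz
      fun z hz => (hf.left.contDiffAt hs hz).of_le (by norm_cast; omega)).symm
  · exact (A.lapM_eq (fun z hz => hd' x z hz) (fun z hz => h.isMet' x z hz) hz
      fun z hz => (hf.right.contDiffAt hs hz).of_le (by norm_cast; omega)).symm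

end Operators

end

end WeakAH

/-! ### Expansion of `|dρ|² - 1` at the boundary. -/

namespace WeakAH

noncomputable section

/-! ### Taylor expansion at the boundary -/

section Taylor

variable {n : ℕ} {α : ℝ} {I : Type*} {s : I → ℝ} {k : ℕ}

/-- Subtract the derivative at `z` as a linear function. The gradient of the rest is the variation
of the gradient of `φ`, which is `O(s²)`: one factor `s` from the weight, one from the oscillation
of the weighted derivative. -/
theorem UA.taylor (hs : IsScale α s) {φ : I → Coord n → ℝ} (h : UA α s 2 (k + 2) φ) :
    ∃ C, 0 ≤ C ∧ ∀ i, ∀ z ∈ hypBall n 2, ∀ w ∈ hypBall n 2,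
      |φ i w - φ i z - ∑ j, (w - z) j * WeakAH.pd j (φ i) z| ≤ C * s i ^ 2 := by
  choose D hD0 hD using fun j => (h.inv_scale_mul_pd j).osc hs
  have h2 : 0 ≤ Real.sinh 2 := Real.sinh_nonneg_iff.2 (by norm_num)
  have hS : 0 ≤ ∑ j, D j := Finset.sum_nonneg fun j _ => hD0 j
  refine ⟨(n + 1) * (∑ j, D j) * (2 * Real.sinh 2), by positivity, fun i z hz w hw => ?_⟩
  have hp := hs.pos i
  have hdf : ∀ y ∈ hypBall n 2, DifferentiableAt ℝ (φ i) y := fun y hy => h.differentiableAt i hy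
  have hdl : ∀ y, DifferentiableAt ℝ (fun y => fderiv ℝ (φ i) z y) y := fun y =>
    (fderiv ℝ (φ i) z).differentiableAt
  have hpd : ∀ y ∈ hypBall n 2, ∀ j, WeakAH.pd j (fun y => φ i y - fderiv ℝ (φ i) z y) y =
      WeakAH.pd j (φ i) y - WeakAH.pd j (φ i) z := fun y hy j => by
    rw [pd_sub (hdf y hy) (hdl y)]
    congr 1
    simp only [WeakAH.pd]
    rw [ContinuousLinearMap.fderiv]
  have key := abs_sub_le_of_pd (f := fun y => φ i y - fderiv ℝ (φ i) z y)
    (C := (∑ j, D j) * s i ^ 2) (convex_hypBall n 2) (fun y hy => (hdf y hy).sub (hdl y))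
    (fun y hy j => by
      rw [hpd y hy]
      have h1 := hD j i y hy z hz
      rw [← mul_sub, abs_mul, abs_of_pos (inv_pos.2 hp), inv_mul_le_iff₀ hp] at h1
      calc _ ≤ _ := h1
        _ = D j * s i ^ 2 := by ring
        _ ≤ _ := by
          gcongr
          exact Finset.single_le_sum (f := D) (fun j _ => hD0 j) (Finset.mem_univ j)) hw hz
  rw [← fderiv_apply_eq_sum_pd]
  have e : φ i w - φ i z - fderiv ℝ (φ i) z (w - z) =
      φ i w - fderiv ℝ (φ i) z w - (φ i z - fderiv ℝ (φ i) z z) := by rw [map_sub]; ring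
  rw [e]
  refine key.trans ?_
  calc _ ≤ (n + 1) * ((∑ j, D j) * s i ^ 2) * (2 * Real.sinh 2) := by
        gcongr; exact norm_sub_le_of_mem_hypBall hw hz
    _ = _ := by ring

/-- A function is small if it changes little along a sequence of points that approaches the
boundary geometrically. -/
theorem abs_le_of_descent {X : Type*} {S : Set X} {ρ f : X → ℝ} {κ C : ℝ} {j : ℕ} (hκ0 : 0 ≤ κ)
    (hκ1 : κ < 1) (hj : j ≠ 0) (hC : 0 ≤ C) (hρ : ∀ p ∈ S, 0 ≤ ρ p)
    (hstep : ∀ p ∈ S, ∃ q ∈ S, ρ q ≤ κ * ρ p ∧ |f p - f q| ≤ C * ρ p ^ j)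
    (hlim : ∀ ε > 0, ∃ δ > 0, ∀ p ∈ S, ρ p < δ → |f p| ≤ ε) {p : X} (hp : p ∈ S) :
    |f p| ≤ C / (1 - κ) * ρ p ^ j := by
  have hit : ∀ m : ℕ, ∃ q ∈ S, ρ q ≤ κ ^ m * ρ p ∧
      |f p - f q| ≤ C * ρ p ^ j * ∑ i ∈ Finset.range m, κ ^ i := by
    intro m
    induction m with
    | zero => exact ⟨p, hp, by simp, by simp⟩
    | succ m ih =>
      obtain ⟨q, hq, h1, h2⟩ := ih
      obtain ⟨q', hq', h3, h4⟩ := hstep q hq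
      refine ⟨q', hq', ?_, ?_⟩
      · calc _ ≤ κ * (κ ^ m * ρ p) := h3.trans (by gcongr)
          _ = _ := by ring
      · rw [Finset.sum_range_succ, mul_add]
        refine (abs_sub_le (f p) (f q) (f q')).trans (add_le_add h2 (h4.trans ?_))
        have h5 : κ ^ m ≤ 1 := pow_le_one₀ hκ0 hκ1.le
        have h6 : 0 ≤ κ ^ m := pow_nonneg hκ0 m
        have hρp := hρ p hp
        calc C * ρ q ^ j ≤ C * (κ ^ m * ρ p) ^ j := by
              gcongr; exact hρ q hq
          _ = C * ρ p ^ j * (κ ^ m) ^ j := by rw [mul_pow]; ring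
          -- The powers of `κ ^ m` decrease, so the bounds on the steps are dominated by the
          -- geometric series with ratio `κ`, whatever the positive exponent `j`.
          _ ≤ _ := by gcongr; exact pow_le_of_le_one h6 h5 hj
  have hsum : ∀ m : ℕ, ∑ i ∈ Finset.range m, κ ^ i ≤ (1 - κ)⁻¹ := fun m => by
    rw [← tsum_geometric_of_lt_one hκ0 hκ1]
    exact (summable_geometric_of_lt_one hκ0 hκ1).sum_le_tsum _ fun i _ => pow_nonneg hκ0 i
  refine le_of_forall_pos_le_add fun ε hε => ?_
  obtain ⟨δ, hδ, hlim⟩ := hlim ε hε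
  have ht : Filter.Tendsto (fun m : ℕ => κ ^ m * ρ p) Filter.atTop (𝓝 0) := by
    simpa using (tendsto_pow_atTop_nhds_zero_of_lt_one hκ0 hκ1).mul_const (ρ p)
  obtain ⟨m, hm⟩ := (ht.eventually (gt_mem_nhds hδ)).exists
  obtain ⟨q, hq, h1, h2⟩ := hit m
  have h3 := hlim q hq (h1.trans_lt hm)
  have h4 : |f p| ≤ |f p - f q| + |f q| := by
    have := abs_add_le (f p - f q) (f q); rwa [sub_add_cancel] at this
  have hρp := hρ p hp
  have h5 : C * ρ p ^ j * ∑ i ∈ Finset.range m, κ ^ i ≤ C / (1 - κ) * ρ p ^ j := by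
    rw [div_eq_mul_inv, mul_right_comm C]
    gcongr
    exact hsum m
  linarith

variable {M : Type*} [TopologicalSpace M] [ChartedSpace (EuclideanHalfSpace (n + 1)) M]
  {ρ : M → ℝ} {B : Background n M ρ}

/-- Following the gradient of `ρ` inside a parametrization towards the boundary. -/
theorem Atl.exists_descent (A : Atl B) (h0 : 0 ≤ α) (h1 : α ≤ 1)
    {G : B.ι → Coord n → Tens n 2} (hG : ULMet α A.s (fun _ => 1) 0 0 G G)
    (hρ : UA α A.s 2 2 fun i z => ρ (B.param i z)) {F a : M → ℝ}
    (hF : UA α A.s 2 2 fun i z => F (B.param i z)) (ha : UA α A.s 1 1 fun i z => a (B.param i z))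
    (e1 : ∀ i, ∀ z ∈ hypBall n 2, innC (fun z => ρ (B.param i z)) (fun z => ρ (B.param i z))
      (G i) z = 1 + F (B.param i z))
    (e2 : ∀ i, ∀ z ∈ hypBall n 2, innC (fun z => F (B.param i z)) (fun z => ρ (B.param i z))
      (G i) z = a (B.param i z)) :
    ∃ κ C ε₀, 0 ≤ κ ∧ κ < 1 ∧ 0 ≤ C ∧ 0 < ε₀ ∧ ∀ p ∈ (𝓡∂ (n + 1)).interior M, ρ p < ε₀ →
      |F p| ≤ 1 / 2 → ∃ q ∈ (𝓡∂ (n + 1)).interior M, ρ q ≤ κ * ρ p ∧ |a p - a q| ≤ C * ρ p ∧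
        ∃ τ, |τ| ≤ C * ρ p ∧ |ρ p - ρ q - τ * (1 + F p)| ≤ C * ρ p ^ 2 ∧
          |F p - F q - τ * a p| ≤ C * ρ p ^ 2 := by
  have hs := A.isScale h0 h1
  obtain ⟨c, hc, hlo⟩ := A.rho_lower
  obtain ⟨C', hC', hup⟩ := A.rho_upper
  obtain ⟨D, hD0, hD⟩ := hρ.taylor hs
  obtain ⟨D', hD0', hD'⟩ := hF.taylor hs
  obtain ⟨E, hE0, hE⟩ := ha.osc hs
  obtain ⟨δ, hδ, hδB⟩ := exists_add_mem_hypBall n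
  -- the gradient of `ρ`
  let V : B.ι → Coord n → Fin (n + 1) → ℝ := fun i z j => ∑ l, (A.s i ^ 2 * (gramT (G i z))⁻¹ j l) *
    ((A.s i)⁻¹ * WeakAH.pd l (fun z => ρ (B.param i z)) z)
  have hV : ∀ j, UB fun i z => V i z j := fun j => by
    refine UA.ub (α := α) (s := A.s) (m := 0) (k := 0) (UA.sum fun l => ?_)
    exact (hG.inv hs j l).left.mul hs ((hρ.inv_scale_mul_pd l).mono hs (by norm_num) (by norm_num))
  choose CV hCV using hV
  have hVn : ∀ i, ∀ z ∈ hypBall n 2, ‖∑ j, V i z j • (basisVec j : Coord n)‖ ≤ ∑ j, |CV j| :=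
    fun i z hz => (norm_sum_le _ _).trans (Finset.sum_le_sum fun j _ => by
      rw [norm_smul, basisVec, PiLp.norm_single, norm_one, mul_one]
      exact (hCV j i z hz).trans (le_abs_self _))
  set W := ∑ j, |CV j|
  have hW : 0 ≤ W := Finset.sum_nonneg fun _ _ => abs_nonneg _
  have hVi : ∀ (φ : Coord n → ℝ) i z, ∑ j, V i z j * WeakAH.pd j φ z =
      A.s i * innC φ (fun z => ρ (B.param i z)) (G i) z := fun φ i z => by
    have hp := (A.s_pos i).ne'
    simp only [V, innC, Finset.mul_sum, Finset.sum_mul]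
    refine Finset.sum_congr rfl fun j _ => Finset.sum_congr rfl fun l _ => ?_
    field_simp
  -- Step length: `t` times the length of the rescaled gradient is less than `δ`, so a step starting
  -- in `B₁` ends in `B₂`. The constant does not depend on the parametrization.
  set t := δ / (W + 1) / 2 with ht
  have ht0 : 0 < t := by positivity
  -- As `1 + F ≥ 1/2`, a step lowers `ρ` by at least `t s / 2`, up to the Taylor error `D s²`. For
  -- `ρ < ε₀` the scale is so small that this error is at most `t s / 4`, and `s ≥ ρ / C'` turns the
  -- net gain `t s / 4` into the contraction factor. The parameter `τ` is `t s`.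
  refine ⟨max 0 (1 - t / (4 * C')), (D + D') / c ^ 2 + (E + t) / c, c * (t / (4 * D + 1)),
    le_max_left _ _, max_lt one_pos (by linarith [show 0 < t / (4 * C') by positivity]),
    by positivity, by positivity, fun p hp hpε hFp => ?_⟩
  rw [← B.cover] at hp
  obtain ⟨i, z, hz1, rfl⟩ := Set.mem_iUnion.1 hp
  have hz := hypBall_one_subset hz1
  set w := z + (-t) • ∑ j, V i z j • (basisVec j : Coord n) with hw
  have hwz : ∀ j, (w - z) j = -t * V i z j := fun j => by
    rw [hw, add_sub_cancel_left]
    simp [Finset.sum_apply]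
  have hwB : w ∈ hypBall n 2 := by
    refine hδB z hz1 _ ?_
    rw [norm_smul, norm_neg, Real.norm_eq_abs, abs_of_pos ht0]
    calc _ ≤ t * W := by gcongr; exact hVn i z hz
      _ < t * (2 * (W + 1)) := by gcongr; linarith
      _ = δ := by rw [ht]; field_simp
  have hp := A.s_pos i
  have hsp : A.s i ≤ ρ (B.param i z) / c := by
    rw [le_div_iff₀ hc, mul_comm]; exact hlo i z hz
  have hsum : ∀ φ : Coord n → ℝ, ∑ j, (w - z) j * WeakAH.pd j φ z =
      -(t * A.s i) * innC φ (fun z => ρ (B.param i z)) (G i) z := fun φ => by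
    simp only [hwz, mul_assoc, ← Finset.mul_sum]
    rw [hVi]; ring
  have h2 := hD i z hz w hwB
  have h3 := hD' i z hz w hwB
  rw [hsum, e1 i z hz] at h2
  rw [hsum, e2 i z hz] at h3
  have h4 := hE i z hz w hwB
  have hsq : A.s i ^ 2 ≤ ρ (B.param i z) ^ 2 / c ^ 2 := by
    rw [← div_pow]; gcongr
  have hρ0 : 0 < ρ (B.param i z) := A.rho_pos hz
  have hsum_le : ∀ {x y : ℝ}, 0 ≤ x → 0 ≤ y → ∀ K, x ≤ K → x * A.s i ^ 2 ≤
      (K / c ^ 2 + y) * ρ (B.param i z) ^ 2 := fun {x y} hx hy K hK => by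
    calc x * A.s i ^ 2 ≤ K * (ρ (B.param i z) ^ 2 / c ^ 2) :=
          mul_le_mul hK hsq (sq_nonneg _) (hx.trans hK)
      _ = K / c ^ 2 * ρ (B.param i z) ^ 2 := by ring
      _ ≤ _ := by gcongr; linarith
  have hlin : ∀ {x : ℝ}, 0 ≤ x → x ≤ E + t → x * A.s i ≤
      ((D + D') / c ^ 2 + (E + t) / c) * ρ (B.param i z) := fun {x} hx hxE => by
    calc x * A.s i ≤ (E + t) * (ρ (B.param i z) / c) :=
          mul_le_mul hxE hsp hp.le (by positivity)
      _ = (E + t) / c * ρ (B.param i z) := by ring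
      _ ≤ _ := by gcongr; linarith [show 0 ≤ (D + D') / c ^ 2 by positivity]
  refine ⟨B.param i w, (A.isLoc hwB).mem_interior, ?_, ?_, t * A.s i, ?_, ?_, ?_⟩
  · have h5 : A.s i * (4 * D + 1) ≤ t := by
      have h6 : A.s i ≤ t / (4 * D + 1) := by
        have := hlo i z hz
        have h7 := this.trans hpε.le
        exact le_of_mul_le_mul_left h7 hc
      rwa [le_div_iff₀ (by positivity)] at h6
    have h6 := (abs_le.1 h2).2
    have h7 := (abs_le.1 hFp).1
    have h8 : D * A.s i ^ 2 ≤ t * A.s i / 4 := by nlinarith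
    have h9 : t * A.s i * (1 / 2) ≤ t * A.s i * (1 + F (B.param i z)) := by
      gcongr; linarith
    have h10 : ρ (B.param i z) ≤ C' * A.s i := hup i z hz
    have h11 : t / (4 * C') * ρ (B.param i z) ≤ t * A.s i / 4 := by
      calc _ ≤ t / (4 * C') * (C' * A.s i) := by gcongr
        _ = _ := by field_simp
    calc ρ (B.param i w) ≤ (1 - t / (4 * C')) * ρ (B.param i z) := by linarith
      _ ≤ _ := by gcongr; exact le_max_right _ _
  · exact h4.trans (hlin hE0 (by linarith))
  · rw [abs_of_pos (by positivity)]
    exact hlin ht0.le (by linarith)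
  · rw [abs_sub_comm]
    calc _ = |ρ (B.param i w) - ρ (B.param i z) - -(t * A.s i) * (1 + F (B.param i z))| := by
          congr 1; ring
      _ ≤ _ := h2.trans (hsum_le hD0 (by positivity) _ (by linarith))
  · rw [abs_sub_comm]
    calc _ = |F (B.param i w) - F (B.param i z) - -(t * A.s i) * a (B.param i z)| := by
          congr 1; ring
      _ ≤ _ := h3.trans (hsum_le hD0' (by positivity) _ (by linarith))

end Taylor

end

end WeakAH

namespace WeakAH

noncomputable section

/-! ### Functions that vanish to second order -/

section SecondOrder

variable {n : ℕ} {α : ℝ} {I : Type*} {s d : I → ℝ} {k : ℕ}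

/-- The weighted derivative of `φ x` is `s (φ / s) (s⁻¹ ∂x) + (s⁻¹ ∂φ) x`. The explicit factor `s`
in the first summand supplies the weighted derivative that `x` lacks. This is how multiplication by
`ρ` raises the background regularity by one. -/
theorem UL.mul_of_ratio (hs : IsScale α s) {φ x x' : I → Coord n → ℝ} (hφ : UA α s 2 (k + 1) φ)
    (hr : UA α s 0 k fun i z => (s i)⁻¹ * φ i z) (hx : UL α s d 1 (k + 1) x x') :
    UL α s d 2 (k + 1) (fun i z => φ i z * x i z) (fun i z => φ i z * x' i z) := by
  have hφ' : UL α s d 2 (k + 1) φ φ := UL.refl hφ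
  have h0 : UL α s d 1 (k + 1) (fun i z => φ i z * x i z) (fun i z => φ i z * x' i z) :=
    (hφ'.mono hs one_le_two le_rfl).mul hs hx
  refine UL.of_pd_succ (m := 1) (h0.mono hs (by norm_num) (by norm_num))
    (fun i z hz => (h0.left.differentiableAt i hz).differentiableWithinAt)
    (fun i z hz => (h0.right.differentiableAt i hz).differentiableWithinAt) fun j => ?_
  have h1 := ((UL.refl hr : UL α s d 0 k _ _).mul hs (hx.inv_scale_mul_pd j)).scale_mul hs
  have h2 := (hφ'.inv_scale_mul_pd j).mul hs ((hx.mono hs le_rfl (Nat.le_succ k)))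
  refine (h1.add h2).congr (fun i z hz => ?_) fun i z hz => ?_
  · have hp := (hs.pos i).ne'
    rw [pd_mul (hφ.differentiableAt i hz) (hx.differentiableAt i hz).1]
    field_simp
    ring
  · have hp := (hs.pos i).ne'
    rw [pd_mul (hφ.differentiableAt i hz) (hx.differentiableAt i hz).2]
    field_simp
    ring

theorem UA.mul_of_ratio (hs : IsScale α s) {φ x : I → Coord n → ℝ} (hφ : UA α s 2 (k + 1) φ)
    (hr : UA α s 0 k fun i z => (s i)⁻¹ * φ i z) (hx : UA α s 1 (k + 1) x) :
    UA α s 2 (k + 1) (fun i z => φ i z * x i z) :=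
  (UL.mul_of_ratio (d := fun _ => 1) hs hφ hr (UL.refl hx)).left

/-- Only the function and its first derivatives need separate bounds by `s²`. The quotient `s⁻¹ ∂φ`
still has one weighted derivative available, so once it is known to be `O(s)`, `UA.inv_scale_mul`
controls the higher derivatives. -/
theorem UA.inv_scale_sq_mul_of_ub (hs : IsScale α s) {φ : I → Coord n → ℝ}
    (hφ : UA α s 2 (k + 1) φ) (h : UB fun i z => (s i ^ 2)⁻¹ * φ i z)
    (hd : ∀ j, UB fun i z => (s i ^ 2)⁻¹ * WeakAH.pd j (φ i) z) :
    UA α s 0 k fun i z => (s i ^ 2)⁻¹ * φ i z := by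
  have hdiff : ∀ i, DifferentiableOn ℝ (fun z => (s i ^ 2)⁻¹ * φ i z) (hypBall n 2) :=
    fun i z hz => ((hφ.differentiableAt i hz).const_mul _).differentiableWithinAt
  cases k with
  | zero =>
    refine ⟨h, fun i => (hdiff i).continuousOn, UHol.of_pd hs.nonneg hs.le_one hdiff ?_⟩
    choose C hC using hd
    refine ⟨∑ j, |C j|, fun i z hz j => ?_⟩
    rw [pd_const_mul]
    refine (hC j i z hz).trans ((le_abs_self _).trans ?_)
    exact Finset.single_le_sum (f := fun j => |C j|) (fun _ _ => abs_nonneg _) (Finset.mem_univ j)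
  | succ k =>
    refine UA.of_succ hs (UA.of_pd_zero h hdiff fun j => ?_)
    refine ((hφ.inv_scale_mul_pd j).inv_scale_mul hs ((hd j).congr fun i z hz => ?_)).congr
      fun i z hz => ?_
    · rw [← mul_assoc, pow_two, mul_inv]
    · rw [pd_const_mul, ← mul_assoc, pow_two, mul_inv]

/-- A function that vanishes to second order in the scale is, after division by the square of the
scale, controlled with all its derivatives. -/
theorem UA.inv_scale_sq_mul (hs : IsScale α s) {F φ a : I → Coord n → ℝ}
    (hF : UA α s 2 (k + 2) F) (hφ : UA α s 2 (k + 2) φ) (ha : UA α s 1 (k + 1) a)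
    (hr : UA α s 0 k fun i z => (s i)⁻¹ * φ i z)
    (h : UB fun i z => (s i ^ 2)⁻¹ * (F i z - φ i z * a i z)) :
    UA α s 0 k fun i z => (s i ^ 2)⁻¹ * (F i z - φ i z * a i z) := by
  have hφa := UA.mul_of_ratio hs (hφ.mono hs le_rfl (Nat.le_succ _)) hr ha
  refine UA.inv_scale_sq_mul_of_ub hs ((hF.mono hs le_rfl (Nat.le_succ _)).sub hφa) h fun j => ?_
  obtain ⟨D, hD0, hD⟩ := hF.taylor hs
  obtain ⟨D', hD0', hD'⟩ := hφ.taylor hs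
  obtain ⟨O, hO0, hO⟩ := ha.osc hs
  obtain ⟨R, hR0, hR⟩ := hr.ub.nonneg_bound
  obtain ⟨a₀, ha0, ha₀⟩ := ha.ub.nonneg_bound
  obtain ⟨H, hH0, hH⟩ := h.nonneg_bound
  obtain ⟨P, hP0, hP⟩ := (ha.inv_scale_mul_pd j).ub.nonneg_bound
  obtain ⟨δ, hδ, hδB⟩ := exists_add_mem_hypBall n
  have hc : (basisVec 0 : Coord n) ∈ hypBall n 1 := by
    rw [mem_hypBall_iff n one_pos]
    refine ⟨by simp [basisVec], ?_⟩
    simp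
  set K := H + H + D + D' * a₀ + R * O with hK
  -- Compare the Taylor expansions of `F` and `φ`: the values of `F - φ a` are `O(s²)`, and so are
  -- both remainders and the product of `φ = O(s)` with the variation of `a`. Hence the linear part
  -- of `F - a(z) φ` is `O(s²)` as well.
  have key : ∀ i, ∀ z ∈ hypBall n 2, ∀ w ∈ hypBall n 2,
      |∑ l, (w - z) l * (WeakAH.pd l (F i) z - a i z * WeakAH.pd l (φ i) z)| ≤ K * s i ^ 2 := by
    intro i z hz w hw
    have hp := hs.pos i
    have hE : ∀ y ∈ hypBall n 2, |F i y - φ i y * a i y| ≤ H * s i ^ 2 := fun y hy => by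
      have := hH i y hy
      rwa [abs_mul, abs_of_pos (by positivity), inv_mul_le_iff₀ (by positivity),
        mul_comm (s i ^ 2)] at this
    have h1 := hE z hz
    have h2 := hE w hw
    have h3 := hD i z hz w hw
    have h4 : |(φ i w - φ i z - ∑ j, (w - z) j * WeakAH.pd j (φ i) z) * a i z| ≤
        D' * s i ^ 2 * a₀ := by
      rw [abs_mul]
      exact mul_le_mul (hD' i z hz w hw) (ha₀ i z hz) (abs_nonneg _) (by positivity)
    have h5 : |φ i w * (a i w - a i z)| ≤ R * s i * (O * s i) := by
      rw [abs_mul]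
      refine mul_le_mul ?_ (hO i w hw z hz) (abs_nonneg _) (by positivity)
      have := hR i w hw
      rwa [abs_mul, abs_of_pos (inv_pos.2 hp), inv_mul_le_iff₀ hp, mul_comm (s i)] at this
    have e : ∑ l, (w - z) l * (WeakAH.pd l (F i) z - a i z * WeakAH.pd l (φ i) z) =
        ∑ l, (w - z) l * WeakAH.pd l (F i) z - (∑ l, (w - z) l * WeakAH.pd l (φ i) z) * a i z := by
      rw [Finset.sum_mul, ← Finset.sum_sub_distrib]
      exact Finset.sum_congr rfl fun l _ => by ring
    rw [e]
    rw [abs_le] at h1 h2 h3 h4 h5 ⊢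
    constructor <;> nlinarith
  refine ⟨4 * K / δ + R * P, fun i z hz => ?_⟩
  have hp := hs.pos i
  -- Two admissible points that differ by `δ / 2` in direction `j` isolate the single partial
  -- derivative `∂_j` from the estimate of the linear part.
  have hw : basisVec 0 + (δ / 2) • (basisVec j : Coord n) ∈ hypBall n 2 := by
    refine hδB _ hc _ ?_
    rw [norm_smul, basisVec, PiLp.norm_single, norm_one, mul_one, Real.norm_eq_abs,
      abs_of_pos (by positivity)]
    linarith
  have h1 := key i z hz _ hw
  have h2 := key i z hz _ (hypBall_one_subset hc)
  have e : ∀ x : Fin (n + 1) → ℝ,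
      ∑ l, ((basisVec 0 : Coord n) + (δ / 2) • (basisVec j : Coord n) - z) l * x l =
      ∑ l, ((basisVec 0 : Coord n) - z) l * x l + δ / 2 * x j := fun x => by
    have : ∀ l, ((basisVec 0 : Coord n) + (δ / 2) • (basisVec j : Coord n) - z) l * x l =
        ((basisVec 0 : Coord n) - z) l * x l + δ / 2 * ((basisVec j : Coord n) l * x l) :=
      fun l => by
        simp only [PiLp.sub_apply, PiLp.add_apply, PiLp.smul_apply, smul_eq_mul]; ring
    simp only [this, Finset.sum_add_distrib, ← Finset.mul_sum]
    simp [basisVec]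
  rw [e] at h1
  have h3 : |WeakAH.pd j (F i) z - a i z * WeakAH.pd j (φ i) z| ≤ 4 * K / δ * s i ^ 2 := by
    have : δ / 2 * |WeakAH.pd j (F i) z - a i z * WeakAH.pd j (φ i) z| ≤ 2 * K * s i ^ 2 := by
      rw [← abs_of_pos (half_pos hδ), ← abs_mul]
      rw [abs_le] at h1 h2 ⊢
      constructor <;> linarith
    rw [← mul_le_mul_iff_right₀ (half_pos hδ)]
    calc _ ≤ _ := this
      _ = _ := by field_simp; ring
  have h4 : |φ i z * WeakAH.pd j (a i) z| ≤ R * P * s i ^ 2 := by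
    have h5 := hR i z hz
    have h6 := hP i z hz
    rw [abs_mul, abs_of_pos (inv_pos.2 hp), inv_mul_le_iff₀ hp] at h5 h6
    rw [abs_mul]
    calc _ ≤ (s i * R) * (s i * P) := mul_le_mul h5 h6 (abs_nonneg _) (by positivity)
      _ = _ := by ring
  rw [abs_mul, abs_of_pos (by positivity), inv_mul_le_iff₀ (by positivity),
    pd_sub (hF.differentiableAt i hz) (hφa.differentiableAt i hz),
    pd_mul (hφ.differentiableAt i hz) (ha.differentiableAt i hz)]
  rw [abs_le] at h3 h4 ⊢
  constructor <;> linarith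

end SecondOrder

/-! ### Second order vanishing of `F - ρ a`. -/

section Boundary

variable {n : ℕ} {α : ℝ} {M : Type*} [TopologicalSpace M]
  [ChartedSpace (EuclideanHalfSpace (n + 1)) M] {ρ : M → ℝ} {B : Background n M ρ}

theorem UB.exists_interior {f : M → ℝ} (h : UB fun i z => f (B.param i z)) :
    ∃ C, 0 ≤ C ∧ ∀ p ∈ (𝓡∂ (n + 1)).interior M, |f p| ≤ C := by
  obtain ⟨C, hC0, hC⟩ := h.nonneg_bound
  refine ⟨C, hC0, fun p hp => ?_⟩
  rw [← B.cover] at hp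
  obtain ⟨i, z, hz, rfl⟩ := Set.mem_iUnion.1 hp
  exact hC i z (hypBall_one_subset hz)

/-- Since `F` tends to zero at the boundary, it is the sum of its changes along the descent
sequence. A step changes `F` by `τ a + O(ρ²)`, hence by `O(ρ)`, so `F = O(ρ)`. Then `ρ` changes by
`τ (1 + F) = τ + O(ρ²)` and `a` by `O(ρ)`, so `F - ρ a` changes by `O(ρ²)` only. -/
theorem Atl.exists_expansion (A : Atl B) (h0 : 0 ≤ α) (h1 : α ≤ 1)
    {G : B.ι → Coord n → Tens n 2} (hG : ULMet α A.s (fun _ => 1) 0 0 G G)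
    (hρ : UA α A.s 2 2 fun i z => ρ (B.param i z)) {F a : M → ℝ}
    (hF : UA α A.s 2 2 fun i z => F (B.param i z)) (ha : UA α A.s 1 1 fun i z => a (B.param i z))
    (e1 : ∀ i, ∀ z ∈ hypBall n 2, innC (fun z => ρ (B.param i z)) (fun z => ρ (B.param i z))
      (G i) z = 1 + F (B.param i z))
    (e2 : ∀ i, ∀ z ∈ hypBall n 2, innC (fun z => F (B.param i z)) (fun z => ρ (B.param i z))
      (G i) z = a (B.param i z))
    (hlim : ∀ ε > 0, ∃ δ > 0, ∀ p ∈ (𝓡∂ (n + 1)).interior M, ρ p < δ → |F p| ≤ ε) :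
    UB (fun i z => (A.s i)⁻¹ * F (B.param i z)) ∧
      UB fun i z => (A.s i ^ 2)⁻¹ * (F (B.param i z) - ρ (B.param i z) * a (B.param i z)) := by
  obtain ⟨κ, C, ε₀, hκ0, hκ1, hC, hε₀, hdesc⟩ := A.exists_descent h0 h1 hG hρ hF ha e1 e2
  obtain ⟨δ₀, hδ₀, hδF⟩ := hlim (1 / 2) (by norm_num)
  obtain ⟨CF, hCF0, hCF⟩ := hF.ub.exists_interior
  obtain ⟨Ca, hCa0, hCa⟩ := ha.ub.exists_interior
  have hpos : ∀ p ∈ (𝓡∂ (n + 1)).interior M, 0 < ρ p := fun p hp => by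
    rw [← B.cover] at hp
    obtain ⟨i, z, hz, rfl⟩ := Set.mem_iUnion.1 hp
    exact A.rho_pos (hypBall_one_subset hz)
  set ε := min ε₀ δ₀
  have hε : 0 < ε := lt_min hε₀ hδ₀
  let S : Set M := {p | p ∈ (𝓡∂ (n + 1)).interior M ∧ ρ p < ε}
  have hS0 : ∀ p ∈ S, 0 ≤ ρ p := fun p hp => (hpos p hp.1).le
  have hstep : ∀ p ∈ S, ∃ q ∈ S, ρ q ≤ κ * ρ p ∧ |a p - a q| ≤ C * ρ p ∧ ∃ τ, |τ| ≤ C * ρ p ∧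
      |ρ p - ρ q - τ * (1 + F p)| ≤ C * ρ p ^ 2 ∧ |F p - F q - τ * a p| ≤ C * ρ p ^ 2 := by
    rintro p ⟨hp, hpε⟩
    obtain ⟨q, hq, hqρ, h⟩ := hdesc p hp (hpε.trans_le (min_le_left _ _))
      (hδF p hp (hpε.trans_le (min_le_right _ _)))
    refine ⟨q, ⟨hq, hqρ.trans_lt (lt_of_le_of_lt ?_ hpε)⟩, hqρ, h⟩
    exact mul_le_of_le_one_left (hpos p hp).le hκ1.le
  -- First pass, with exponent `1`: only the size of a step is used.
  have hF1 : ∀ p ∈ S, |F p| ≤ (C * Ca + C * ε) / (1 - κ) * ρ p ^ 1 := fun p hp =>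
    abs_le_of_descent hκ0 hκ1 one_ne_zero (by positivity) hS0 (fun p hp => by
      obtain ⟨q, hq, hqρ, -, τ, hτ, -, h3⟩ := hstep p hp
      refine ⟨q, hq, hqρ, ?_⟩
      have h4 : |τ * a p| ≤ C * ρ p * Ca := by
        rw [abs_mul]
        exact mul_le_mul hτ (hCa p hp.1) (abs_nonneg _) (mul_nonneg hC (hS0 p hp))
      have h5 : C * ρ p ^ 2 ≤ C * ε * ρ p := by
        rw [pow_two, ← mul_assoc]
        gcongr
        · exact hS0 p hp
        · exact hp.2.le
      have h6 : F p - F q = (F p - F q - τ * a p) + τ * a p := by ring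
      rw [h6]
      refine (abs_add_le _ _).trans ?_
      nlinarith) (fun ε' hε' => by
      obtain ⟨δ, hδ, h⟩ := hlim ε' hε'
      exact ⟨δ, hδ, fun p hp => h p hp.1⟩) hp
  set C₁ := (C * Ca + C * ε) / (1 - κ)
  have hC₁ : 0 ≤ C₁ := div_nonneg (by positivity) (by linarith)
  -- Second pass, with exponent `2`: the leading terms `τ a` cancel, and the first pass bounds the
  -- term with `τ F`.
  have hF2 : ∀ p ∈ S, |F p - ρ p * a p| ≤ (C + C * Ca + C * C₁ * Ca + C) / (1 - κ) * ρ p ^ 2 :=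
      fun p hp =>
    abs_le_of_descent (f := fun p => F p - ρ p * a p) hκ0 hκ1 two_ne_zero (by positivity) hS0
      (fun p hp => by
      obtain ⟨q, hq, hqρ, ha', τ, hτ, h2, h3⟩ := hstep p hp
      have hp0 := hS0 p hp
      refine ⟨q, hq, hqρ, ?_⟩
      have h4 : |(ρ p - ρ q - τ * (1 + F p)) * a p| ≤ C * ρ p ^ 2 * Ca := by
        rw [abs_mul]
        exact mul_le_mul h2 (hCa p hp.1) (abs_nonneg _) (by positivity)
      have h5 : |τ * F p * a p| ≤ C * ρ p * (C₁ * ρ p ^ 1) * Ca := by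
        rw [abs_mul, abs_mul]
        exact mul_le_mul (mul_le_mul hτ (hF1 p hp) (abs_nonneg _) (by positivity)) (hCa p hp.1)
          (abs_nonneg _) (by positivity)
      have h6 : |ρ q * (a p - a q)| ≤ ρ p * (C * ρ p) := by
        rw [abs_mul, abs_of_nonneg (hS0 q hq)]
        exact mul_le_mul (hqρ.trans (mul_le_of_le_one_left hp0 hκ1.le)) ha' (abs_nonneg _) hp0
      rw [abs_le] at h3 h4 h5 h6 ⊢
      constructor <;> nlinarith) (fun ε' hε' => by
      obtain ⟨δ, hδ, h⟩ := hlim (ε' / 2) (half_pos hε')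
      refine ⟨min δ (ε' / 2 / (Ca + 1)), lt_min hδ (by positivity), fun p hp hpδ => ?_⟩
      have h7 := h p hp.1 (hpδ.trans_le (min_le_left _ _))
      have h8 : |ρ p * a p| ≤ ε' / 2 / (Ca + 1) * (Ca + 1) := by
        rw [abs_mul, abs_of_nonneg (hS0 p hp)]
        exact mul_le_mul (hpδ.le.trans (min_le_right _ _)) ((hCa p hp.1).trans (by linarith))
          (abs_nonneg _) (by positivity)
      rw [div_mul_cancel₀ _ (by positivity)] at h8
      exact (abs_sub _ _).trans (by linarith)) hp
  set C₂ := (C + C * Ca + C * C₁ * Ca + C) / (1 - κ)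
  have hC₂ : 0 ≤ C₂ := div_nonneg (by positivity) (by linarith)
  obtain ⟨Cr, hCr0, hCr⟩ := A.rho_upper
  have hin : ∀ {i : B.ι} {z : Coord n}, z ∈ hypBall n 2 →
      B.param i z ∈ (𝓡∂ (n + 1)).interior M := fun hz => (A.isLoc hz).mem_interior
  constructor
  · refine ⟨(C₁ + CF / ε) * Cr, fun i z hz => ?_⟩
    have hp := A.s_pos i
    have hp' := hpos _ (hin (i := i) hz)
    rw [abs_mul, abs_of_pos (inv_pos.2 hp), inv_mul_le_iff₀ hp]
    have h3 : |F (B.param i z)| ≤ (C₁ + CF / ε) * ρ (B.param i z) := by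
      -- Away from the boundary, where `ρ ≥ ε`, boundedness is enough.
      by_cases h : ρ (B.param i z) < ε
      · refine (hF1 _ ⟨hin hz, h⟩).trans ?_
        rw [pow_one]
        gcongr
        exact le_add_of_nonneg_right (by positivity)
      · refine (hCF _ (hin hz)).trans ?_
        rw [not_lt] at h
        calc CF = CF / ε * ε := by field_simp
          _ ≤ _ := by gcongr; exact le_add_of_nonneg_left hC₁
    calc _ ≤ _ := h3
      _ ≤ (C₁ + CF / ε) * (Cr * A.s i) := by gcongr; exact hCr i z hz
      _ = _ := by ring
  · refine ⟨(C₂ + CF / ε ^ 2 + Ca / ε) * Cr ^ 2, fun i z hz => ?_⟩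
    have hp := A.s_pos i
    have hp' := hpos _ (hin (i := i) hz)
    rw [abs_mul, abs_of_pos (by positivity), inv_mul_le_iff₀ (by positivity)]
    have h3 : |F (B.param i z) - ρ (B.param i z) * a (B.param i z)| ≤
        (C₂ + CF / ε ^ 2 + Ca / ε) * ρ (B.param i z) ^ 2 := by
      by_cases h : ρ (B.param i z) < ε
      · refine (hF2 _ ⟨hin hz, h⟩).trans ?_
        gcongr
        rw [add_assoc]
        exact le_add_of_nonneg_right (by positivity)
      · rw [not_lt] at h
        have h4 := hCF _ (hin (i := i) hz)
        have h5 : |ρ (B.param i z) * a (B.param i z)| ≤ ρ (B.param i z) * Ca := by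
          rw [abs_mul, abs_of_pos hp']
          gcongr
          exact hCa _ (hin hz)
        have h6 : CF ≤ CF / ε ^ 2 * ρ (B.param i z) ^ 2 := by
          calc CF = CF / ε ^ 2 * ε ^ 2 := by field_simp
            _ ≤ _ := by gcongr
        have h7 : ρ (B.param i z) * Ca ≤ Ca / ε * ρ (B.param i z) ^ 2 := by
          calc ρ (B.param i z) * Ca = Ca / ε * (ρ (B.param i z) * ε) := by field_simp
            _ ≤ Ca / ε * (ρ (B.param i z) * ρ (B.param i z)) := by gcongr
            _ = _ := by ring
        have h8 : 0 ≤ C₂ * ρ (B.param i z) ^ 2 := by positivity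
        refine (abs_sub _ _).trans ?_
        linarith
    calc _ ≤ _ := h3
      _ ≤ (C₂ + CF / ε ^ 2 + Ca / ε) * (Cr * A.s i) ^ 2 := by gcongr; exact hCr i z hz
      _ = _ := by ring

end Boundary

end

end WeakAH

/-! ### Curvature and boundary behaviour of `e^{-2v} g`. -/

namespace WeakAH

noncomputable section

/-! ### Conformal compactification -/

section ConformalLog

variable {n : ℕ} {v r : Coord n → ℝ} {G : Coord n → Tens n 2} {y : Coord n}

theorem pd_neg_sub_log (hv : DifferentiableAt ℝ v y) (hr : DifferentiableAt ℝ r y) (h0 : 0 < r y)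
    (j : Fin (n + 1)) :
    pd j (fun z => -v z - Real.log (r z)) y = -pd j v y - (r y)⁻¹ * pd j r y := by
  rw [pd_sub (f := fun z => -v z) hv.neg (hr.log h0.ne'), pd_neg, pd_log hr h0.ne']

theorem hessC_neg_sub_log (hv : ContDiffAt ℝ 2 v y) (hr : ContDiffAt ℝ 2 r y) (h0 : 0 < r y)
    (j q : Fin (n + 1)) :
    hessC (fun z => -v z - Real.log (r z)) G y j q = -hessC v G y j q - (r y)⁻¹ * hessC r G y j q +
      ((r y)⁻¹) ^ 2 * (pd j r y * pd q r y) := by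
  have hd : ∀ {f : Coord n → ℝ}, ContDiffAt ℝ 2 f y → ∀ᶠ z in 𝓝 y, DifferentiableAt ℝ f z :=
    fun h => ((h.of_le (m := 1) (by norm_num)).eventually (by simp)).mono fun z hz =>
      hz.differentiableAt (by norm_num)
  have hp : ∀ {f : Coord n → ℝ}, ContDiffAt ℝ 2 f y → ∀ j, DifferentiableAt ℝ (pd j f) y :=
    fun h j => (contDiffAt_pd (N := 1) (by norm_num; exact h) j).differentiableAt (by norm_num)
  have hr' := hr.differentiableAt (by norm_num)
  have e : pd q (fun z => -v z - Real.log (r z)) =ᶠ[𝓝 y]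
      fun z => -pd q v z - (r z)⁻¹ * pd q r z := by
    filter_upwards [hd hv, hd hr, hr.continuousAt.eventually (lt_mem_nhds h0)] with z h1 h2 h3
    exact pd_neg_sub_log h1 h2 h3 q
  have hrp : DifferentiableAt ℝ (fun z => (r z)⁻¹ * pd q r z) y :=
    (hr'.inv h0.ne').mul (hp hr q)
  rw [hessC, pd_congr e, pd_sub (f := fun z => -pd q v z) (hp hv q).neg hrp, pd_neg,
    pd_mul (f := fun z => (r z)⁻¹) (hr'.inv h0.ne') (hp hr q), pd_inv hr' h0.ne']
  simp only [pd_neg_sub_log (hv.differentiableAt (by norm_num)) hr' h0, hessC, mul_sub,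
    Finset.sum_sub_distrib, mul_neg, Finset.sum_neg_distrib, mul_left_comm _ (r y)⁻¹,
    ← Finset.mul_sum]
  ring

theorem innC_comm {φ ψ : Coord n → ℝ} (hm : IsMet (G y)) : innC φ ψ G y = innC ψ φ G y := by
  rw [innC, Finset.sum_comm, innC]
  exact Finset.sum_congr rfl fun j _ => Finset.sum_congr rfl fun l _ => by
    rw [hm.inv_symm, mul_comm (pd l φ y)]

/-- The scalar curvature of the metric `e^{-2v} r^{-2} G`. -/
theorem scalC_conf_log (hv : ContDiffAt ℝ 2 v y) (hr : ContDiffAt ℝ 2 r y) (h0 : 0 < r y)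
    (hG : ContDiffAt ℝ 2 G y) (hm : ∀ᶠ z in 𝓝 y, IsMet (G z)) :
    scalC (conf (fun z => -v z - Real.log (r z)) G) y = Real.exp (2 * v y) *
      (r y ^ 2 * (scalC G y + 2 * n * lapC v G y - n * ((n : ℝ) - 1) * innC v v G y) +
        2 * n * r y * lapC r G y - 2 * n * ((n : ℝ) - 1) * r y * innC v r G y -
        n * ((n : ℝ) + 1) * innC r r G y) := by
  have hL : lapC (fun z => -v z - Real.log (r z)) G y = -lapC v G y - (r y)⁻¹ * lapC r G y +
      ((r y)⁻¹) ^ 2 * innC r r G y := by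
    simp only [lapC, innC, hessC_neg_sub_log hv hr h0, Finset.mul_sum, ← Finset.sum_neg_distrib,
      ← Finset.sum_sub_distrib, ← Finset.sum_add_distrib]
    exact Finset.sum_congr rfl fun j _ => Finset.sum_congr rfl fun l _ => by ring
  have hN : normSqC (fun z => -v z - Real.log (r z)) G y = innC v v G y +
      (r y)⁻¹ * (innC v r G y + innC r v G y) + ((r y)⁻¹) ^ 2 * innC r r G y := by
    simp only [normSqC, innC, pd_neg_sub_log (hv.differentiableAt (by norm_num))
      (hr.differentiableAt (by norm_num)) h0, Finset.mul_sum, ← Finset.sum_add_distrib]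
    exact Finset.sum_congr rfl fun j _ => Finset.sum_congr rfl fun l _ => by ring
  have hφ : ContDiffAt ℝ 2 (fun z => -v z - Real.log (r z)) y := hv.neg.sub (hr.log h0.ne')
  rw [scalC_conf hφ hG hm, hL, hN, innC_comm (φ := r) (ψ := v) hm.self_of_nhds]
  have e : Real.exp (-(2 * (-v y - Real.log (r y)))) = Real.exp (2 * v y) * r y ^ 2 := by
    rw [show -(2 * (-v y - Real.log (r y))) = 2 * v y + (Real.log (r y) + Real.log (r y)) by ring,
      Real.exp_add, Real.exp_add, Real.exp_log h0, pow_two]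
  rw [e]
  field_simp
  ring

theorem contDiffAt_conf {φ : Coord n → ℝ} (hφ : ContDiffAt ℝ 2 φ y) (hG : ContDiffAt ℝ 2 G y) :
    ContDiffAt ℝ 2 (conf φ G) y := (contDiffAt_const.mul hφ).exp.smul hG

theorem scalC_congr {G' : Coord n → Tens n 2} (h : G =ᶠ[𝓝 y] G') : scalC G y = scalC G' y := by
  simp only [scalC, riemC_congr h]

theorem sum_idOp : ∑ i : Fin (n + 1), ∑ j : Fin (n + 1), idOp i j i j = (n : ℝ) * (n + 1) := by
  simp [idOp, Finset.sum_sub_distrib]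
  ring

/-- For the constant scale `1` all weights are `1`. This allows the curvature estimates to be used
for `g` itself, which has bounded components in the parametrizations without any rescaling. -/
theorem UA.of_zero {α : ℝ} {I : Type*} {s : I → ℝ} : ∀ {m k : ℕ} {φ : I → Coord n → ℝ},
    UA α s 0 k φ → UA α (fun _ => 1) m k φ
  | _, 0, _, h => h
  | m, k + 1, _, h => ⟨h.1, h.2.1, fun j => by
      have := (UA.pd_zero h j).of_zero (m := m - 1)
      cases m <;> simpa [wt] using this⟩

theorem tendsto_boundary_iff {X : Type*} {ρ f : X → ℝ} :
    Filter.Tendsto f (Filter.comap ρ (𝓝[>] 0)) (𝓝 0) ↔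
      ∀ ε > 0, ∃ δ > 0, ∀ p, 0 < ρ p → ρ p < δ → |f p| < ε := by
  rw [((nhdsGT_basis (0 : ℝ)).comap ρ).tendsto_iff Metric.nhds_basis_ball]
  simp [Real.norm_eq_abs]

end ConformalLog

/-! ### Asymptotics of the curvature operator and of `|dρ|²`. -/

section Compactification

variable {n : ℕ} {α : ℝ} {M : Type*} [TopologicalSpace M]
  [ChartedSpace (EuclideanHalfSpace (n + 1)) M] {ρ : M → ℝ} {B : Background n M ρ}

theorem IsDefiningFunction.mem_interior (hρ : IsDefiningFunction n ρ) {p : M} (hp : 0 < ρ p) :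
    p ∈ (𝓡∂ (n + 1)).interior M :=
  ((𝓡∂ (n + 1)).isInteriorPoint_or_isBoundaryPoint p).resolve_right fun h =>
    hp.ne' ((hρ.eq_zero_iff p).2 h)

theorem pullback_smul_fun {r : ℕ} (Φ : Coord n → M) (c : M → ℝ) (u : CovTensor n M r)
    (z : Coord n) : pullback Φ (fun p => c p • u p) z = c (Φ z) • pullback Φ u z := rfl

theorem pullback_bar (Φ : Coord n → M) (g : CovTensor n M 2) (z : Coord n) :
    pullback Φ (bar ρ g) z = ρ (Φ z) ^ 2 • pullback Φ g z := rfl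

/-- In a parametrization, `e^{-2v} g` is conformal to `ρ² g`. -/
theorem Atl.pullback_exp_smul (A : Atl B) (g : CovTensor n M 2) (v : M → ℝ) {i : B.ι} {z : Coord n}
    (hz : z ∈ hypBall n 2) :
    pullback (B.param i) (fun p => Real.exp (-(2 * v p)) • g p) z =
      conf (fun z => -v (B.param i z) - Real.log (ρ (B.param i z)))
        (pullback (B.param i) (bar ρ g)) z := by
  have h0 := A.rho_pos (i := i) hz
  rw [conf, pullback_bar, pullback_smul_fun, smul_smul]
  congr 1
  rw [show 2 * (-v (B.param i z) - Real.log (ρ (B.param i z))) = -(2 * v (B.param i z)) +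
    (-Real.log (ρ (B.param i z)) + -Real.log (ρ (B.param i z))) by ring, Real.exp_add,
    Real.exp_add, Real.exp_neg (Real.log _), Real.exp_log h0]
  field_simp

variable {κ : ℕ} {g : CovTensor n M 2}

/-- The metrics `e^{-2v} g` and `g` are uniformly controlled in the charts, without any scaling, and
they differ by a multiple of the scale. -/
theorem Atl.uLMet_exp_smul (A : Atl B) (h0 : 0 ≤ α) (h1 : α ≤ 1)
    (hρ : IsDefiningFunction n ρ) (hG : ULMet α A.s (fun _ => 1) 2 (κ + 2)
      (fun i => pullback (B.param i) (bar ρ g)) fun i => pullback (B.param i) (bar ρ g))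
    {v : M → ℝ} (hv : UA α A.s 2 (κ + 2) fun i z => v (B.param i z))
    (hvs : UB fun i z => (A.s i)⁻¹ * v (B.param i z)) :
    ULMet α (fun _ => 1) A.s 2 (κ + 2)
      (fun i => pullback (B.param i) fun p => Real.exp (-(2 * v p)) • g p)
      (fun i => pullback (B.param i) g) := by
  have hs := A.isScale h0 h1
  obtain ⟨V, hV0, hV⟩ := hv.ub.nonneg_bound
  obtain ⟨W, hW0, hW⟩ := hvs.nonneg_bound
  obtain ⟨Cr, hCr, hup⟩ := A.rho_upper
  obtain ⟨c, hc0, hell⟩ := hG.ell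
  have hbar : ∀ {i : B.ι} {z}, z ∈ hypBall n 2 → pullback (B.param i) g z =
      (ρ (B.param i z) ^ 2)⁻¹ • pullback (B.param i) (bar ρ g) z := fun {i z} hz => by
    have hp := (A.rho_pos (i := i) hz).ne'
    rw [pullback_bar, smul_smul, inv_mul_cancel₀ (pow_ne_zero 2 hp), one_smul]
  let f : B.ι → Coord n → ℝ := fun i z => Real.exp (-(2 * v (B.param i z)))
  have hf : UA α A.s 2 (κ + 2) f := (((UA.const' 2).mul hs hv).neg.exp hs)
  -- As `v = O(s)`, the conformal factor differs from `1` by `s` times a controlled function. This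
  -- makes the two metrics a Lipschitz pair whose distance parameter is the scale.
  have hf1 : UA α A.s 0 (κ + 2) fun i z => (A.s i)⁻¹ * (f i z - 1) := by
    refine (hf.sub (UA.const' 1)).inv_scale_mul hs ⟨Real.exp (2 * V) * (2 * W), fun i z hz => ?_⟩
    have hp := A.s_pos i
    have h3 := hV i z hz
    have h4 := abs_exp_sub_exp_le (a := -(2 * v (B.param i z))) (b := 0) (C := 2 * V)
      (by linarith [(abs_le.1 h3).1]) (by positivity)
    rw [Real.exp_zero, sub_zero, abs_neg, abs_mul, abs_two] at h4
    have h5 := hW i z hz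
    rw [abs_mul, abs_of_pos (inv_pos.2 hp)] at h5 ⊢
    calc _ ≤ (A.s i)⁻¹ * (Real.exp (2 * V) * (2 * |v (B.param i z)|)) := by gcongr
      _ = Real.exp (2 * V) * (2 * ((A.s i)⁻¹ * |v (B.param i z)|)) := by ring
      _ ≤ _ := by gcongr
  -- the metric `g` is uniformly controlled in the unscaled charts
  have hcomp : ∀ J, UA α A.s 0 (κ + 2)
      (sC (fun _ => 1) 2 (fun i => pullback (B.param i) g) J) := fun J =>
    (((A.uA_ratio_inv hρ h0 h1 (κ + 2)).pow hs 2).mul hs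
      ((hG.comp J).left.mono hs (Nat.zero_le 2) le_rfl)).congr fun i z hz => by
        have := (A.s_pos i).ne'
        have := (A.rho_pos (i := i) hz).ne'
        simp only [sC, cmp]
        rw [hbar hz, smul_apply, smul_eq_mul]
        field_simp
  have hell0 : ∀ i, ∀ z ∈ hypBall n 2, ∀ w, c / Cr ^ 2 * 1 ^ 2 * ‖w‖ ^ 2 ≤
      pullback (B.param i) g z ![w, w] := fun i z hz w => by
    have hp := A.rho_pos (i := i) hz
    rw [hbar hz, smul_apply, smul_eq_mul, ← div_eq_inv_mul, le_div_iff₀ (by positivity)]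
    refine le_trans ?_ (hell i z hz w)
    calc c / Cr ^ 2 * 1 ^ 2 * ‖w‖ ^ 2 * ρ (B.param i z) ^ 2
        ≤ c / Cr ^ 2 * 1 ^ 2 * ‖w‖ ^ 2 * (Cr * A.s i) ^ 2 := by gcongr; exact hup i z hz
      _ = _ := by field_simp
  have hmet0 : ∀ i, ∀ z ∈ hypBall n 2, IsMet (pullback (B.param i) g z) := fun i z hz => by
    rw [hbar hz]
    exact (hG.isMet i z hz).smul (inv_pos.2 (pow_pos (A.rho_pos hz) 2))
  refine ⟨fun J => ⟨?_, (hcomp J).of_zero, ?_⟩, fun i z hz => ?_, hmet0,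
    ⟨Real.exp (-(2 * V)) * (c / Cr ^ 2), by positivity, fun i z hz w => ?_⟩,
    ⟨c / Cr ^ 2, by positivity, hell0⟩⟩
  · refine (((hf.mono hs (Nat.zero_le 2) le_rfl).mul hs (hcomp J)).congr
      fun i z hz => ?_).of_zero
    simp only [sC, cmp]
    rw [pullback_smul_fun, smul_apply, smul_eq_mul]
    ring
  · refine ((hf1.mul hs (hcomp J)).congr fun i z hz => ?_).of_zero
    simp only [sC, cmp]
    rw [pullback_smul_fun, smul_apply, smul_eq_mul]
    ring
  · rw [pullback_smul_fun]
    exact (hmet0 i z hz).smul (Real.exp_pos _)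
  · rw [pullback_smul_fun, smul_apply, smul_eq_mul]
    calc _ = Real.exp (-(2 * V)) * (c / Cr ^ 2 * 1 ^ 2 * ‖w‖ ^ 2) := by ring
      _ ≤ _ := by
        gcongr
        · exact (abs_le.1 (hV i z hz)).2
        · exact hell0 i z hz w

/-- The norm contains two factors of the metric, of size `s²`, and two of its inverse, of size
`s⁻²`. These cancel, so components of size `O(s)` give a squared norm of size `O(s²)`. -/
theorem Atl.Back.exists_opSq_le (h0 : 0 ≤ α) (h1 : α ≤ 1) {A : Atl B} {h : CovTensor n M 2}
    (hh : A.Back α h)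
    {S : B.ι → Coord n → Fin (n + 1) → Fin (n + 1) → Fin (n + 1) → Fin (n + 1) → ℝ}
    (hS : ∀ a b p l, UB fun i z => (A.s i)⁻¹ * S i z a b p l) :
    ∃ K, 0 ≤ K ∧ ∀ i, ∀ z ∈ hypBall n 2,
      opSq (gramT (pullback (B.param i) h z)) (S i z) ≤ K * A.s i ^ 2 := by
  have hs := A.isScale h0 h1
  choose R hR using fun x : (Fin (n + 1) × Fin (n + 1)) × Fin (n + 1) × Fin (n + 1) =>
    hS x.1.1 x.1.2 x.2.1 x.2.2
  choose H hH using fun x : Fin (n + 1) × Fin (n + 1) =>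
    ((hh.met 0 0).gram x.1 x.2).left.ub
  choose H' hH' using fun x : Fin (n + 1) × Fin (n + 1) =>
    ((hh.met 0 0).inv hs x.1 x.2).left.ub
  obtain ⟨m, hm⟩ := Finite.exists_le R
  obtain ⟨C, hC⟩ := Finite.exists_le H
  obtain ⟨C', hC'⟩ := Finite.exists_le H'
  refine ⟨((n : ℝ) + 1) ^ 8 * (C' * C) ^ 2 * m ^ 2, by positivity, fun i z hz => ?_⟩
  have hp := A.s_pos i
  have hp2 : 0 < A.s i ^ 2 := by positivity
  refine (opSq_le (C := A.s i ^ 2 * C) (C' := (A.s i ^ 2)⁻¹ * C') (m := A.s i * m)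
    (fun a b => ?_) (fun a b => ?_) fun a b p l => ?_).trans_eq ?_
  · have h3 := (hH (a, b) i z hz).trans (hC _)
    rwa [abs_mul, abs_of_pos (inv_pos.2 hp2), inv_mul_le_iff₀ hp2] at h3
  · have h3 := (hH' (a, b) i z hz).trans (hC' _)
    rw [abs_mul, abs_of_pos hp2] at h3
    rwa [← div_eq_inv_mul, le_div_iff₀ hp2, mul_comm]
  · have h3 := (hR ((a, b), (p, l)) i z hz).trans (hm _)
    rwa [abs_mul, abs_of_pos (inv_pos.2 hp), inv_mul_le_iff₀ hp] at h3
  · field_simp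

variable [IsManifold (𝓡∂ (n + 1)) ∞ M]

/-- The scalar curvature of `e^{-2v} g` in terms of `ρ² g`. -/
theorem Atl.scalarCurvature_eq (A : Atl B) (h0 : 0 ≤ α) (h1 : α ≤ 1)
    (hρ : IsDefiningFunction n ρ) (hG : ULMet α A.s (fun _ => 1) 2 (κ + 2)
      (fun i => pullback (B.param i) (bar ρ g)) fun i => pullback (B.param i) (bar ρ g))
    {v : M → ℝ} {i : B.ι} (hv : ∀ z ∈ hypBall n 2, ContDiffAt ℝ 2 (fun z => v (B.param i z)) z)
    {z : Coord n} (hz : z ∈ hypBall n 2) :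
    let G := pullback (B.param i) (bar ρ g)
    let r := fun z => ρ (B.param i z)
    let w := fun z => v (B.param i z)
    scalarCurvature (fun p => Real.exp (-(2 * v p)) • g p) (B.param i z) = Real.exp (2 * w z) *
      (r z ^ 2 * (scalC G z + 2 * n * lapC w G z - n * ((n : ℝ) - 1) * innC w w G z) +
        2 * n * r z * lapC r G z - 2 * n * ((n : ℝ) - 1) * r z * innC w r G z -
        n * ((n : ℝ) + 1) * innC r r G z) := by
  intro G r w
  have hs := A.isScale h0 h1
  have hr : ∀ z ∈ hypBall n 2, ContDiffAt ℝ 2 r z := fun z hz =>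
    (A.uA_smooth h0 h1 0 2 hρ.smooth).contDiffAt hs hz
  have hGd : ∀ z ∈ hypBall n 2, ContDiffAt ℝ 2 G z := fun z hz =>
    (hG.contDiffAt hs i hz).1.of_le (by norm_cast; omega)
  have hn := hypBall_mem_nhds hz
  have e := Filter.eventuallyEq_of_mem hn fun z hz => A.pullback_exp_smul g v (i := i) hz
  have hφ : ContDiffAt ℝ 2 (fun z => -w z - Real.log (r z)) z :=
    (hv z hz).neg.sub ((hr z hz).log (A.rho_pos hz).ne')
  rw [(A.isLoc hz).scalarCurvature_eq ((contDiffAt_conf hφ (hGd z hz)).congr_of_eventuallyEq e)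
    (Filter.eventually_of_mem hn fun z hz => by
      rw [A.pullback_exp_smul g v hz]
      exact (hG.isMet i z hz).smul (Real.exp_pos _)), scalC_congr e]
  exact scalC_conf_log (hv z hz) (hr z hz) (A.rho_pos hz) (hGd z hz)
    (Filter.eventually_of_mem hn (hG.isMet i))

/-- If the curvature operator tends to that of hyperbolic space, then `|dρ|² → 1`. -/
theorem Atl.innC_sub_one_small (A : Atl B) (h0 : 0 ≤ α) (h1 : α ≤ 1) (hn : 1 ≤ n)
    (hρ : IsDefiningFunction n ρ) {h : CovTensor n M 2} (hh : IsMetric h)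
    (hG : ULMet α A.s (fun _ => 1) 2 (κ + 2)
      (fun i => pullback (B.param i) (bar ρ g)) fun i => pullback (B.param i) (bar ρ g))
    (hc : Filter.Tendsto (fun p => opNorm h p fun i j k l => riemOp g p i j k l + idOp i j k l)
      (Filter.comap ρ (𝓝[>] 0)) (𝓝 0)) :
    ∀ ε > 0, ∃ δ > 0, ∀ i, ∀ z ∈ hypBall n 2, ρ (B.param i z) < δ →
      |innC (fun z => ρ (B.param i z)) (fun z => ρ (B.param i z))
        (pullback (B.param i) (bar ρ g)) z - 1| ≤ ε := by
  intro ε hε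
  have hs := A.isScale h0 h1
  have hr := fun m k => A.uA_smooth h0 h1 m k hρ.smooth
  obtain ⟨C, hC0, hC⟩ := (hG.scalC hs).left.ub.nonneg_bound
  obtain ⟨D, hD0, hD⟩ := ((hG.mono hs (m' := 1) (k' := 1) (by omega) (by omega)).lapC hs
    (UL.refl (hr 2 2))).left.ub.nonneg_bound
  have hn' : (1 : ℝ) ≤ n := by exact_mod_cast hn
  obtain ⟨δ, hδ, hδ'⟩ := tendsto_boundary_iff.1 hc (ε / (2 * (n + 1) ^ 2)) (by positivity)
  refine ⟨min δ (min 1 (ε / (2 * (C + 2 * n * D + 1)))),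
    lt_min hδ (lt_min one_pos (by positivity)), fun i z hz hzδ => ?_⟩
  have hzδ1 : ρ (B.param i z) < δ := hzδ.trans_le (min_le_left _ _)
  have hz1 : ρ (B.param i z) < 1 := hzδ.trans_le ((min_le_right _ _).trans (min_le_left _ _))
  have hz2 : ρ (B.param i z) < ε / (2 * (C + 2 * n * D + 1)) :=
    hzδ.trans_le ((min_le_right _ _).trans (min_le_right _ _))
  have hp := A.rho_pos (i := i) hz
  have hop := hδ' _ hp hzδ1
  have hg0 : (fun p => Real.exp (-(2 * (0 : ℝ))) • g p) = g := by
    funext p; rw [mul_zero, neg_zero, Real.exp_zero, one_smul]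
  -- With `v = 0` the formula reads `R[g] = ρ² R[ḡ] + 2n ρ Δρ - n(n+1)|dρ|²`, where the first two
  -- terms tend to zero at the boundary.
  have hscal := A.scalarCurvature_eq h0 h1 hρ hG (v := fun _ => 0) (i := i)
    (fun z _ => contDiffAt_const) hz
  simp only [hg0] at hscal
  have hGd : ∀ z ∈ hypBall n 2, ContDiffAt ℝ 2 (pullback (B.param i) g) z ∧
      IsMet (pullback (B.param i) g z) := fun z hz => by
    have e := Filter.eventuallyEq_of_mem (hypBall_mem_nhds hz)
      fun z hz => A.pullback_exp_smul g (fun _ => 0) (i := i) hz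
    simp only [hg0] at e
    refine ⟨(contDiffAt_conf (contDiffAt_const.sub (ContDiffAt.log
      ((hr 0 2).contDiffAt hs hz) (A.rho_pos hz).ne'))
      ((hG.contDiffAt hs i hz).1.of_le (by norm_cast; omega))).congr_of_eventuallyEq e, ?_⟩
    rw [show pullback (B.param i) g z = _ from e.self_of_nhds]
    exact (hG.isMet i z hz).smul (Real.exp_pos _)
  have hm := Filter.eventually_of_mem (hypBall_mem_nhds hz) fun z hz => (hGd z hz).2
  have hhm := (A.isLoc (i := i) hz).isMet_pullback hh
  rw [(A.isLoc hz).opNorm_eq (hGd z hz).1 hm hhm, abs_of_nonneg (Real.sqrt_nonneg _)] at hop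
  -- The trace of the identity is `n(n+1)`, so smallness of the norm of `Riem + Id` bounds `R[g] +
  -- n(n+1)`.
  have htr := abs_trace_le_opSq hhm.posDef fun i' j k l =>
    riemC (pullback (B.param i) g) z i' j k l + idOp i' j k l
  simp only [Finset.sum_add_distrib, sum_idOp] at htr
  change |scalC (pullback (B.param i) g) z + n * (n + 1)| ≤ _ at htr
  rw [← (A.isLoc hz).scalarCurvature_eq (hGd z hz).1 hm, hscal] at htr
  have hp0 : ∀ j, pd j (fun _ : Coord n => (0 : ℝ)) = fun _ => 0 := fun j => by
    funext z; simp [pd]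
  have hl0 : ∀ G : Coord n → Tens n 2, lapC (fun _ => 0) G z = 0 := fun G => by
    simp [lapC, hessC, hp0]
  have hi0 : ∀ (ψ : Coord n → ℝ) (G : Coord n → Tens n 2), innC (fun _ => 0) ψ G z = 0 :=
    fun ψ G => by simp [innC, pd]
  simp only [hl0, hi0, mul_zero, Real.exp_zero, one_mul, add_zero, sub_zero] at htr
  have h3 := htr.trans (mul_le_mul_of_nonneg_left hop.le (by positivity))
  rw [show ((n : ℝ) + 1) ^ 2 * (ε / (2 * (n + 1) ^ 2)) = ε / 2 by field_simp] at h3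
  have h4 := hC i z hz
  have h5 := hD i z hz
  set S := scalC (pullback (B.param i) (bar ρ g)) z
  set L := lapC (fun z => ρ (B.param i z)) (pullback (B.param i) (bar ρ g)) z
  set N := innC (fun z => ρ (B.param i z)) (fun z => ρ (B.param i z))
    (pullback (B.param i) (bar ρ g)) z
  set r := ρ (B.param i z)
  have h6 : |r ^ 2 * S + 2 * n * r * L| ≤ ε / 2 := by
    have h7 : |r ^ 2 * S| ≤ r * C := by
      rw [abs_mul, abs_of_pos (by positivity)]
      exact mul_le_mul (by nlinarith) h4 (abs_nonneg _) hp.le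
    have h8 : |2 * n * r * L| ≤ r * (2 * n * D) := by
      rw [abs_mul, abs_of_nonneg (by positivity)]
      calc 2 * n * r * |L| ≤ 2 * n * r * D := by gcongr
        _ = _ := by ring
    rw [lt_div_iff₀ (by positivity)] at hz2
    refine (abs_add_le _ _).trans ?_
    linarith
  have h9 : |(n : ℝ) * (n + 1) * (N - 1)| ≤ ε := by
    rw [abs_le] at h3 h6 ⊢
    constructor <;> linarith
  rw [abs_mul, abs_of_pos (by positivity)] at h9
  -- The coefficient `n(n+1)` is at least `1` because `n ≥ 1`, and can be dropped.
  have h10 : 1 * |N - 1| ≤ n * (n + 1) * |N - 1| := by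
    gcongr
    nlinarith
  linarith

/-- Asymptotic hyperbolicity does not change under conformal factors tending to one at the
boundary. -/
theorem Atl.tendsto_curvature_exp_smul (A : Atl B) (h0 : 0 ≤ α) (h1 : α ≤ 1)
    (hρ : IsDefiningFunction n ρ) {h : CovTensor n M 2} (hh : A.Back α h)
    (hG : ULMet α A.s (fun _ => 1) 2 (κ + 2)
      (fun i => pullback (B.param i) (bar ρ g)) fun i => pullback (B.param i) (bar ρ g))
    {v : M → ℝ} (hv : UA α A.s 2 (κ + 2) fun i z => v (B.param i z))
    (hvs : UB fun i z => (A.s i)⁻¹ * v (B.param i z))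
    (hc : Filter.Tendsto (fun p => opNorm h p fun i j k l => riemOp g p i j k l + idOp i j k l)
      (Filter.comap ρ (𝓝[>] 0)) (𝓝 0)) :
    Filter.Tendsto (fun p => opNorm h p fun i j k l =>
        riemOp (fun p => Real.exp (-(2 * v p)) • g p) p i j k l + idOp i j k l)
      (Filter.comap ρ (𝓝[>] 0)) (𝓝 0) := by
  have hs := A.isScale h0 h1
  have hs1 : IsScale α fun _ : B.ι => (1 : ℝ) := ⟨h0, h1, fun _ => one_pos, 1, fun _ => le_rfl⟩
  obtain ⟨cr, hcr, hlo⟩ := A.rho_lower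
  have hU := A.uLMet_exp_smul h0 h1 hρ hG hv hvs
  -- The two curvature operators form a Lipschitz pair with distance parameter `s`, so their
  -- difference has components of size `O(s)`.
  obtain ⟨K, hK0, hK⟩ := hh.exists_opSq_le h0 h1 (S := fun i z a b p l =>
      riemC (pullback (B.param i) fun p => Real.exp (-(2 * v p)) • g p) z a b p l -
      riemC (pullback (B.param i) g) z a b p l) fun a b p l => (hU.riemC hs1 a b p l).diff.ub
  rw [tendsto_boundary_iff] at hc ⊢
  intro ε hε
  obtain ⟨δ, hδ, hcδ⟩ := hc (ε / 2) (half_pos hε)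
  refine ⟨min δ (cr * (ε / (2 * (K + 1)))), lt_min hδ (by positivity), fun p hp0 hpδ => ?_⟩
  have hint := hρ.mem_interior hp0
  rw [← B.cover] at hint
  obtain ⟨i, z, hz1, rfl⟩ := Set.mem_iUnion.1 hint
  have hz := hypBall_one_subset hz1
  have hop := hcδ _ hp0 (hpδ.trans_le (min_le_left _ _))
  have hsi : A.s i * (2 * (K + 1)) < ε := by
    rw [← lt_div_iff₀ (by positivity)]
    exact lt_of_mul_lt_mul_left ((hlo i z hz).trans_lt (hpδ.trans_le (min_le_right _ _))) hcr.le
  have hp := A.s_pos i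
  have hhm := (hh.met 0 0).isMet i z hz
  have hd := hU.contDiffAt hs1 i hz
  have hnh := hypBall_mem_nhds hz
  rw [(A.isLoc hz).opNorm_eq (hd.2.of_le (by norm_cast; omega))
    (Filter.eventually_of_mem hnh (hU.isMet' i)) hhm, abs_of_nonneg (Real.sqrt_nonneg _)] at hop
  rw [(A.isLoc hz).opNorm_eq (hd.1.of_le (by norm_cast; omega))
    (Filter.eventually_of_mem hnh (hU.isMet i)) hhm, abs_of_nonneg (Real.sqrt_nonneg _)]
  have hadd := opSq_add_le hhm.posDef
    (fun a b p l => riemC (pullback (B.param i) g) z a b p l + idOp a b p l)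
    (fun a b p l => riemC (pullback (B.param i) fun p => Real.exp (-(2 * v p)) • g p) z a b p l -
      riemC (pullback (B.param i) g) z a b p l)
  have hle := hK i z hz
  have e : (fun a b p l => riemC (pullback (B.param i) g) z a b p l + idOp a b p l +
      (riemC (pullback (B.param i) fun p => Real.exp (-(2 * v p)) • g p) z a b p l -
      riemC (pullback (B.param i) g) z a b p l)) = fun a b p l =>
      riemC (pullback (B.param i) fun p => Real.exp (-(2 * v p)) • g p) z a b p l +
        idOp a b p l := by
    funext a b p l; ring
  rw [e] at hadd
  rw [Real.sqrt_lt' (half_pos hε)] at hop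
  rw [Real.sqrt_lt' hε]
  have h7 : K * A.s i ^ 2 ≤ (ε / 2) ^ 2 := by
    calc K * A.s i ^ 2 ≤ ((K + 1) * A.s i) ^ 2 := by
          rw [mul_pow]; gcongr; nlinarith
      _ ≤ _ := by gcongr; linarith
  nlinarith

end Compactification

end

end WeakAH

namespace WeakAH

noncomputable section

/-! ### Continuous extension to the boundary -/

section Extension

variable {n : ℕ} {M : Type*} [TopologicalSpace M] [ChartedSpace (EuclideanHalfSpace (n + 1)) M]
  [IsManifold (𝓡∂ (n + 1)) ∞ M] {ρ : M → ℝ} {B : Background n M ρ}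

theorem exists_smul_continuousRiemannianMetric
    (G : Bundle.ContinuousRiemannianMetric (Coord n) (fun p : M => TangentSpace (𝓡∂ (n + 1)) p))
    {f : M → ℝ} (hf : Continuous f) (hpos : ∀ p, 0 < f p) :
    ∃ G' : Bundle.ContinuousRiemannianMetric (Coord n)
      (fun p : M => TangentSpace (𝓡∂ (n + 1)) p),
      ∀ p v w, G'.inner p v w = f p * G.inner p v w := by
  have : IsManifold (𝓡∂ (n + 1)) 1 M := IsManifold.of_le (n := ∞) (by norm_num)
  refine ⟨{ inner := fun p => f p • G.inner p, symm := fun p v w => ?_, pos := fun p v hv => ?_,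
            isVonNBounded := fun p => ?_, continuous := ?_ }, fun p v w => rfl⟩
  · simp [G.symm p v w]
  · simpa using mul_pos (hpos p) (G.pos p v hv)
  · refine ((G.isVonNBounded p).image ((√(f p))⁻¹ • ContinuousLinearMap.id ℝ _)).subset ?_
    intro v hv
    -- The unit ball of the new metric is the old one scaled by `f ^ (-1/2)`.
    refine ⟨√(f p) • v, ?_, ?_⟩
    · simp only [Set.mem_ofPred_eq, smul_apply, smul_eq_mul, map_smul] at hv ⊢
      rwa [← mul_assoc, Real.mul_self_sqrt (hpos p).le]
    · simp [smul_smul, mul_inv_cancel₀ (Real.sqrt_pos.2 (hpos p)).ne']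
  · have h1 : ContMDiff (𝓡∂ (n + 1)) 𝓘(ℝ, ℝ) 0 f := contMDiff_zero_iff.2 hf
    exact contMDiff_zero_iff.1 (h1.smul_section (contMDiff_zero_iff.2 G.continuous))

theorem IsLoc.continuousAt_of_comp {Φ : Coord n → M} {z : Coord n} (h : IsLoc Φ z) {f : M → ℝ}
    (hf : ContinuousAt (fun z => f (Φ z)) z) : ContinuousAt f (Φ z) := by
  obtain ⟨τ, hτ, hτz, he, -, -⟩ := h.exists_inverse
  have h1 : ContinuousAt (fun y => f (Φ (τ y))) (ctrPt (Φ z)) := by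
    refine ContinuousAt.comp (g := fun z => f (Φ z)) ?_ hτ.continuousAt
    rwa [hτz]
  have h2 : ContinuousAt (fun y => f (chInv (Φ z) y)) (ctrPt (Φ z)) :=
    h1.congr ((he.self_of_nhds.2.1.fun_comp f).symm)
  have h3 := ContinuousAt.comp (g := fun y => f (chInv (Φ z) y)) (x := Φ z)
    (f := extChartAt (𝓡∂ (n + 1)) (Φ z)) h2 (continuousAt_extChartAt (I := 𝓡∂ (n + 1)) (Φ z))
  refine h3.congr ?_
  filter_upwards [extChartAt_source_mem_nhds (I := 𝓡∂ (n + 1)) (Φ z)] with q hq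
  exact congrArg f ((extChartAt (𝓡∂ (n + 1)) (Φ z)).left_inv hq)

/-- At boundary points `ρ f` tends to `0` because `f` is bounded on the interior; there the values
of `f` do not matter, since `ρ` vanishes. -/
theorem Atl.continuous_mul (A : Atl B) (hρ : IsDefiningFunction n ρ) {f : M → ℝ}
    (hf : ∀ i, ContinuousOn (fun z => f (B.param i z)) (hypBall n 2))
    (hb : UB fun i z => f (B.param i z)) : Continuous fun p => ρ p * f p := by
  obtain ⟨C, hC0, hC⟩ := hb.exists_interior
  have hρc := hρ.smooth.continuous
  refine continuous_iff_continuousAt.2 fun p => ?_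
  rcases (hρ.nonneg p).eq_or_lt with h | h
  · have hle : ∀ q, |ρ q * f q| ≤ ρ q * C := fun q => by
      rw [abs_mul, abs_of_nonneg (hρ.nonneg q)]
      rcases (hρ.nonneg q).eq_or_lt with hq | hq
      · rw [← hq, zero_mul, zero_mul]
      · gcongr
        exact hC q (hρ.mem_interior hq)
    have ht : Filter.Tendsto (fun q => ρ q * C) (𝓝 p) (𝓝 0) := by
      have := (hρc.mul_const C).tendsto p
      rwa [← h, zero_mul] at this
    rw [ContinuousAt, ← h, zero_mul]
    exact squeeze_zero_norm hle ht
  · have hp := hρ.mem_interior h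
    rw [← B.cover] at hp
    obtain ⟨i, z, hz1, rfl⟩ := Set.mem_iUnion.1 hp
    have hz := hypBall_one_subset hz1
    exact hρc.continuousAt.mul ((A.isLoc hz).continuousAt_of_comp
      ((hf i).continuousAt (hypBall_mem_nhds hz)))

end Extension

/-! ### The conformal factor -/

section Factor

variable {n : ℕ} {α : ℝ} {M : Type*} [TopologicalSpace M]
  [ChartedSpace (EuclideanHalfSpace (n + 1)) M] {ρ : M → ℝ} {B : Background n M ρ} {A : Atl B}
  {Λ : Type*} {d : Λ → ℝ} {γ γ' : Λ → CovTensor n M 2} {κ : ℕ}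

/-- `|dρ|² - 1`. -/
def defect (ρ : M → ℝ) (γ : CovTensor n M 2) (p : M) : ℝ := innM γ ρ ρ p - 1

/-- The derivative of `|dρ|² - 1` along the gradient of `ρ`. -/
def defectDeriv (ρ : M → ℝ) (γ : CovTensor n M 2) : M → ℝ := innM γ (defect ρ γ) ρ

/-- The leading coefficient of the logarithm of the conformal factor. -/
def confCoeff (ρ : M → ℝ) (γ : CovTensor n M 2) (p : M) : ℝ :=
  (4 * (n : ℝ) ^ 2)⁻¹ * (2 * n * lapM γ ρ p - n * ((n : ℝ) + 1) * defectDeriv ρ γ p)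

/-- The logarithm of the conformal factor, up to sign. -/
def Bumps.confLog (β : Bumps A α) (γ : CovTensor n M 2) (p : M) : ℝ :=
  ρ p * β.avg (confCoeff ρ γ) p

theorem ULMet.reindex {I I' : Type*} {s d : I → ℝ} {m k : ℕ} {G G' : I → Coord n → Tens n 2}
    (f : I' → I) (h : ULMet α s d m k G G') : ULMet α (fun i => s (f i)) (fun i => d (f i)) m k
      (fun i => G (f i)) fun i => G' (f i) :=
  ⟨fun J => (h.comp J).reindex f, fun i => h.isMet (f i), fun i => h.isMet' (f i),
    h.ell.imp fun _ hc => ⟨hc.1, fun i => hc.2 (f i)⟩,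
    h.ell'.imp fun _ hc => ⟨hc.1, fun i => hc.2 (f i)⟩⟩

theorem Atl.uL_rho (A : Atl B) (hρ : IsDefiningFunction n ρ) (h0 : 0 ≤ α) (h1 : α ≤ 1) (m k : ℕ) :
    UL α (A.sc Λ) (fun x => d x.2) m k (fun x z => ρ (B.param x.1 z))
      (fun x z => ρ (B.param x.1 z)) :=
  UL.refl ((A.uA_smooth h0 h1 m k hρ.smooth).reindex (Prod.fst : B.ι × Λ → B.ι))

variable [IsManifold (𝓡∂ (n + 1)) ∞ M]

/-- Only the smooth function `ρ` is differentiated, so no regularity of the metric is lost. -/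
theorem ULMet.defect (h0 : 0 ≤ α) (h1 : α ≤ 1) (hρ : IsDefiningFunction n ρ)
    (h : ULMet α (A.sc Λ) (fun x => d x.2) 2 (κ + 2) (pbF B γ) (pbF B γ')) :
    UL α (A.sc Λ) (fun x => d x.2) 2 (κ + 2) (fun x z => defect ρ (γ x.2) (B.param x.1 z))
      (fun x z => defect ρ (γ' x.2) (B.param x.1 z)) := by
  have hr := A.uL_rho (Λ := Λ) (d := d) hρ h0 h1 3 (κ + 3)
  have := ULMet.innM (A := A) (γ := γ) (γ' := γ') (f := fun _ => ρ) (f' := fun _ => ρ)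
    (u := fun _ => ρ) (u' := fun _ => ρ) (m := 2) (k := κ + 2) h0 h1 le_rfl le_rfl h hr hr
  exact this.sub (UL.const' 1)

theorem ULMet.defectDeriv (h0 : 0 ≤ α) (h1 : α ≤ 1) (hρ : IsDefiningFunction n ρ)
    (h : ULMet α (A.sc Λ) (fun x => d x.2) 2 (κ + 2) (pbF B γ) (pbF B γ')) :
    UL α (A.sc Λ) (fun x => d x.2) 1 (κ + 1) (fun x z => defectDeriv ρ (γ x.2) (B.param x.1 z))
      (fun x z => defectDeriv ρ (γ' x.2) (B.param x.1 z)) := by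
  have hr := A.uL_rho (Λ := Λ) (d := d) hρ h0 h1 2 (κ + 2)
  have hd := ULMet.defect h0 h1 hρ h
  exact ULMet.innM (A := A) (γ := γ) (γ' := γ') (f := fun l => WeakAH.defect ρ (γ l))
    (f' := fun l => WeakAH.defect ρ (γ' l)) (u := fun _ => ρ) (u' := fun _ => ρ) (m := 1)
    (k := κ + 1) h0 h1 one_le_two (Nat.le_succ _) h hd hr

/-- The Laplacian of `ρ` contains first derivatives of the metric, and the second term one
derivative of the defect; either costs one derivative and one weighted derivative. -/
theorem ULMet.confCoeff (h0 : 0 ≤ α) (h1 : α ≤ 1) (hρ : IsDefiningFunction n ρ)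
    (h : ULMet α (A.sc Λ) (fun x => d x.2) 2 (κ + 2) (pbF B γ) (pbF B γ')) :
    UL α (A.sc Λ) (fun x => d x.2) 1 (κ + 1) (fun x z => confCoeff ρ (γ x.2) (B.param x.1 z))
      (fun x z => confCoeff ρ (γ' x.2) (B.param x.1 z)) := by
  have hr := A.uL_rho (Λ := Λ) (d := d) hρ h0 h1 3 (κ + 3)
  have hl := ULMet.lapM (A := A) (γ := γ) (γ' := γ') (f := fun _ => ρ) (f' := fun _ => ρ) (m := 1)
    (k := κ + 1) h0 h1 h hr
  have hd := ULMet.defectDeriv h0 h1 hρ h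
  exact ((hl.const_mul' (2 * n)).sub (hd.const_mul' (n * ((n : ℝ) + 1)))).const_mul' _

/-- Averaging raises the total number of derivatives back to `κ + 2` while keeping one weighted
derivative; the factor `ρ` then supplies the second one. -/
theorem ULMet.confLog (h0 : 0 ≤ α) (h1 : α ≤ 1) (hρ : IsDefiningFunction n ρ) (β : Bumps A α)
    (h : ULMet α (A.sc Λ) (fun x => d x.2) 2 (κ + 2) (pbF B γ) (pbF B γ')) :
    UL α (A.sc Λ) (fun x => d x.2) 2 (κ + 2) (fun x z => β.confLog (γ x.2) (B.param x.1 z))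
      (fun x z => β.confLog (γ' x.2) (B.param x.1 z)) := by
  have hc := ULMet.confCoeff h0 h1 hρ h
  have hw := (β.uL_avg (d := d) (σ := fun l => WeakAH.confCoeff ρ (γ l))
    (σ' := fun l => WeakAH.confCoeff ρ (γ' l)) h0 h1 hc (κ + 2)).1
  have hr := (A.uL_rho (Λ := Λ) (d := d) hρ h0 h1 2 (κ + 2)).left
  exact UL.mul_of_ratio (A.isScale_sc h0 h1) hr
    ((A.uA_ratio hρ h0 h1 _).reindex (Prod.fst : B.ι × Λ → B.ι)) hw

end Factor

end

end WeakAH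

namespace WeakAH

noncomputable section

/-! ### The scalar curvature of the conformal metric -/

section ScalarCurvature

variable {n : ℕ} {α : ℝ} {I : Type*} {s : I → ℝ} {κ : ℕ}

theorem innC_mul_left {φ ψ χ : Coord n → ℝ} {G : Coord n → Tens n 2} {y : Coord n}
    (hφ : DifferentiableAt ℝ φ y) (hψ : DifferentiableAt ℝ ψ y) :
    innC (fun z => φ z * ψ z) χ G y = ψ y * innC φ χ G y + φ y * innC ψ χ G y := by
  simp only [innC, Finset.mul_sum, ← Finset.sum_add_distrib]
  refine Finset.sum_congr rfl fun j _ => Finset.sum_congr rfl fun l _ => ?_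
  rw [pd_mul hφ hψ]
  ring

theorem UB.reindex {I' : Type*} {φ : I → Coord n → ℝ} (f : I' → I) (h : UB φ) :
    UB fun i => φ (f i) := h.imp fun _ hC i => hC (f i)

theorem abs_exp_sub_one_sub_le (x : ℝ) : |Real.exp x - 1 - x| ≤ |x| ^ 2 * Real.exp |x| := by
  have h := Complex.norm_exp_sub_sum_le_norm_mul_exp x 2
  simp only [Finset.sum_range_succ, Finset.range_zero, Finset.sum_empty, zero_add, pow_zero,
    Nat.factorial_zero, Nat.cast_one, div_one, pow_one, Nat.factorial_one, ← sub_sub,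
    Complex.norm_real, Real.norm_eq_abs] at h
  exact_mod_cast h

/-- The second order Taylor remainder of the exponential. -/
theorem UA.exp_remainder (hs : IsScale α s) {φ : I → Coord n → ℝ} (hφ : UA α s 2 (κ + 2) φ)
    (h : UB fun i z => (s i)⁻¹ * φ i z) :
    UA α s 0 κ fun i z => (s i ^ 2)⁻¹ * (Real.exp (φ i z) - 1 - φ i z) := by
  have h0 : ∀ {m k}, UA (n := n) α s m k fun _ _ => 0 := UA.const' 0
  -- The division lemma for functions vanishing to second order, with the first order part equal to
  -- zero.
  refine (UA.inv_scale_sq_mul hs (φ := fun _ _ => 0) (a := fun _ _ => 0)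
    (((hφ.exp hs).sub (UA.const' 1)).sub hφ) h0 h0 (h0.congr fun _ _ _ => (mul_zero _).symm)
    ?_).congr fun i z _ => by rw [zero_mul, sub_zero]
  obtain ⟨V, hV0, hV⟩ := hφ.ub.nonneg_bound
  obtain ⟨W, hW0, hW⟩ := h.nonneg_bound
  refine ⟨W ^ 2 * Real.exp V, fun i z hz => ?_⟩
  have hp := hs.pos i
  have h3 := hW i z hz
  simp only [zero_mul, sub_zero]
  rw [abs_mul, abs_of_pos (by positivity), inv_mul_le_iff₀ (by positivity)]
  rw [abs_mul, abs_of_pos (inv_pos.2 hp), inv_mul_le_iff₀ hp] at h3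
  calc _ ≤ _ := abs_exp_sub_one_sub_le _
    _ ≤ (s i * W) ^ 2 * Real.exp V := by gcongr; exact hV i z hz
    _ = _ := by ring

variable {M : Type*} [TopologicalSpace M] [ChartedSpace (EuclideanHalfSpace (n + 1)) M]
  [IsManifold (𝓡∂ (n + 1)) ∞ M] {ρ : M → ℝ} {B : Background n M ρ} {A : Atl B}
  {g h : CovTensor n M 2}

theorem Bumps.ub_confLog (h0 : 0 ≤ α) (h1 : α ≤ 1) (hρ : IsDefiningFunction n ρ) (β : Bumps A α)
    {Λ : Type*} {d : Λ → ℝ} {γ γ' : Λ → CovTensor n M 2}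
    (h : ULMet α (A.sc Λ) (fun x => d x.2) 2 (κ + 2) (pbF B γ) (pbF B γ')) :
    UB (fun x : B.ι × Λ => fun z => β.avg (confCoeff ρ (γ x.2)) (B.param x.1 z)) ∧
    UB fun x : B.ι × Λ => fun z => (A.s x.1)⁻¹ * β.confLog (γ x.2) (B.param x.1 z) := by
  have hc := ULMet.confCoeff h0 h1 hρ h
  have hw := (β.uL_avg (d := d) (σ := fun l => confCoeff ρ (γ l))
    (σ' := fun l => confCoeff ρ (γ' l)) h0 h1 hc 0).1.left.ub
  refine ⟨hw, (((A.uA_ratio hρ h0 h1 0).reindex (Prod.fst : B.ι × Λ → B.ι)).ub.mul hw).congr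
    fun x z _ => mul_assoc _ _ _⟩

/-- After insertion of `v = ρ w` into the curvature formula, every term is `s²` times a controlled
function: either it has an explicit factor `ρ²`, or it is `ρ` times one of the small quantities `w -
σ` and `F`, or it is one of the second order remainders `F - ρ a` and `e^{-2v} - 1 + 2v`. -/
theorem Bumps.uA_scalarCurvature (h0 : 0 ≤ α) (h1 : α ≤ 1) (hn : 1 ≤ n)
    (hρ : IsDefiningFunction n ρ) (β : Bumps A α) (hh : IsMetric h)
    (hG : ULMet α (A.sc Unit) (fun _ => 1) 2 (κ + 2) (pbF B fun _ => bar ρ g)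
      (pbF B fun _ => bar ρ g))
    (hc : Filter.Tendsto (fun p => opNorm h p fun i j k l => riemOp g p i j k l + idOp i j k l)
      (Filter.comap ρ (𝓝[>] 0)) (𝓝 0)) :
    UA α A.s 0 κ fun i z => (A.s i ^ 2)⁻¹ *
      (scalarCurvature (fun p => Real.exp (-(2 * β.confLog (bar ρ g) p)) • g p) (B.param i z) +
        (n : ℝ) * (n + 1)) := by
  have hs := A.isScale h0 h1
  let J : B.ι → B.ι × Unit := fun i => (i, ())
  set γ := bar ρ g
  have hM : ULMet α A.s (fun _ => 1) 2 (κ + 2) (fun i => pullback (B.param i) γ)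
    (fun i => pullback (B.param i) γ) := hG.reindex J
  have hF : UA α A.s 2 (κ + 2) fun i z => defect ρ γ (B.param i z) :=
    (ULMet.defect (d := fun _ => 1) h0 h1 hρ hG).left.reindex J
  have ha : UA α A.s 1 (κ + 1) fun i z => defectDeriv ρ γ (B.param i z) :=
    (ULMet.defectDeriv (d := fun _ => 1) h0 h1 hρ hG).left.reindex J
  have hcoL := ULMet.confCoeff (d := fun _ => 1) h0 h1 hρ hG
  have hσ : UA α A.s 1 (κ + 1) fun i z => confCoeff ρ γ (B.param i z) := hcoL.left.reindex J
  have havg := β.uL_avg (d := fun _ : Unit => 1) (σ := fun _ => confCoeff ρ γ)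
    (σ' := fun _ => confCoeff ρ γ) h0 h1 hcoL (κ + 1)
  have hw : UA α A.s 1 (κ + 1) fun i z => β.avg (confCoeff ρ γ) (B.param i z) :=
    havg.1.left.reindex J
  have hv : UA α A.s 2 (κ + 2) fun i z => β.confLog γ (B.param i z) :=
    (ULMet.confLog (d := fun _ => 1) h0 h1 hρ β hG).left.reindex J
  have hr := fun m k => A.uA_smooth h0 h1 m k hρ.smooth
  have hMd : ∀ i, ∀ z ∈ hypBall n 2, DifferentiableAt ℝ (pullback (B.param i) γ) z :=
    fun i z hz => (hM.contDiffAt hs i hz).1.differentiableAt (by simp)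
  have e1 : ∀ i, ∀ z ∈ hypBall n 2, innC (fun z => ρ (B.param i z)) (fun z => ρ (B.param i z))
      (pullback (B.param i) γ) z = 1 + defect ρ γ (B.param i z) := fun i z hz => by
    rw [defect, ← A.innM_eq (hMd i) (hM.isMet i) hz ((hr 0 1).differentiableAt i hz)
      ((hr 0 1).differentiableAt i hz)]
    ring
  have e2 : ∀ i, ∀ z ∈ hypBall n 2, innC (fun z => defect ρ γ (B.param i z))
      (fun z => ρ (B.param i z)) (pullback (B.param i) γ) z = defectDeriv ρ γ (B.param i z) :=
    fun i z hz => (A.innM_eq (hMd i) (hM.isMet i) hz (hF.differentiableAt i hz)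
      ((hr 0 1).differentiableAt i hz)).symm
  have e3 : ∀ i, ∀ z ∈ hypBall n 2, lapM γ ρ (B.param i z) = lapC (fun z => ρ (B.param i z))
      (pullback (B.param i) γ) z := fun i z hz =>
    A.lapM_eq (hMd i) (hM.isMet i) hz fun z hz => (hr 0 2).contDiffAt hs hz
  have hlim : ∀ ε > 0, ∃ δ > 0, ∀ p ∈ (𝓡∂ (n + 1)).interior M, ρ p < δ → |defect ρ γ p| ≤ ε := by
    intro ε hε
    obtain ⟨δ, hδ, H⟩ := A.innC_sub_one_small h0 h1 hn hρ hh hM hc ε hε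
    refine ⟨δ, hδ, fun p hp hpδ => ?_⟩
    rw [← B.cover] at hp
    obtain ⟨i, z, hz1, rfl⟩ := Set.mem_iUnion.1 hp
    have hz := hypBall_one_subset hz1
    have := H i z hz hpδ
    rwa [e1 i z hz, add_sub_cancel_left] at this
  obtain ⟨hFs, hEs⟩ := A.exists_expansion h0 h1 (hM.mono hs (Nat.zero_le _) (Nat.zero_le _))
    (hr 2 2) (hF.mono hs le_rfl (by omega)) (ha.mono hs le_rfl (by omega)) e1 e2 hlim
  have hq := fun k => A.uA_ratio hρ h0 h1 k
  -- the ingredients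
  have t1 := (hM.scalC hs).left
  have t2 := ((hM.mono hs (m' := 1) (k' := κ + 1) (by omega) (by omega)).lapC hs
    (UL.refl (d := fun _ => 1) hv)).left
  have hv1 := UL.refl (d := fun _ => 1) (hv.mono hs (m' := 1) (k' := κ + 1) (by omega) (by omega))
  have hM0 := hM.mono hs (m' := 0) (k' := κ) (by omega) (by omega)
  have t3 := (hM0.innC hs hv1 hv1).left
  -- From here on: `(w - σ) / s`, `F / s`, `⟨dw, dρ⟩`, `(F - ρ a) / s²` and `(e^{-2v} - 1 + 2v) /
  -- s²`.
  have t4 := ((hw.sub hσ).inv_scale_mul hs (havg.2.reindex J)).mono hs le_rfl (Nat.le_succ κ)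
  have t5 := (hF.inv_scale_mul hs hFs).mono hs le_rfl (show κ ≤ κ + 2 by omega)
  have t6 := (hM0.innC hs (UL.refl hw) (UL.refl (hr 1 (κ + 1)))).left
  have t7 := UA.inv_scale_sq_mul hs hF (hr 2 (κ + 2)) ha (hq κ) hEs
  have t8 := UA.exp_remainder hs ((UA.const' 2).mul hs hv).neg
    (((β.ub_confLog (d := fun _ => 1) h0 h1 hρ hG).2.reindex J).mul
      (UA.const' (α := α) (s := A.s) (m := 0) (k := 0) (-2)).ub |>.congr fun i z _ => by ring)
  have te := (((UA.const' 2).mul hs hv).exp hs).mono hs (Nat.zero_le 2) (show κ ≤ κ + 2 by omega)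
  have c := fun x : ℝ => UA.const' (n := n) (α := α) (s := A.s) (m := 0) (k := κ) x
  have hw0 := hw.mono hs (Nat.zero_le 1) (Nat.le_succ κ)
  have hn' : (n : ℝ) ≠ 0 := by positivity
  refine (te.mul hs ((((((((hq κ).pow hs 2).mul hs ((t1.add ((c (2 * n)).mul hs t2)).sub
    ((c (n * ((n : ℝ) - 1))).mul hs t3))).sub ((c (4 * (n : ℝ) ^ 2)).mul hs ((hq κ).mul hs t4))).sub
    ((c (2 * n * ((n : ℝ) - 1))).mul hs (((hq κ).mul hs hw0).mul hs t5))).sub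
    ((c (2 * n * ((n : ℝ) - 1))).mul hs (((hq κ).pow hs 2).mul hs t6))).sub
    ((c (n * ((n : ℝ) + 1))).mul hs t7)).add ((c (n * ((n : ℝ) + 1))).mul hs t8))).congr
    fun i z hz => ?_
  have hscal := A.scalarCurvature_eq h0 h1 hρ hM (v := β.confLog γ) (i := i)
    (fun z hz => (hv.contDiffAt hs hz).of_le (by norm_cast; omega)) hz
  have e4 : innC (fun z => β.confLog γ (B.param i z)) (fun z => ρ (B.param i z))
      (pullback (B.param i) γ) z = β.avg (confCoeff ρ γ) (B.param i z) *
      innC (fun z => ρ (B.param i z)) (fun z => ρ (B.param i z)) (pullback (B.param i) γ) z +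
      ρ (B.param i z) * innC (fun z => β.avg (confCoeff ρ γ) (B.param i z))
        (fun z => ρ (B.param i z)) (pullback (B.param i) γ) z :=
    innC_mul_left ((hr 0 1).differentiableAt i hz) (hw.differentiableAt i hz)
  have e5 : β.confLog γ (B.param i z) = ρ (B.param i z) * β.avg (confCoeff ρ γ) (B.param i z) :=
    rfl
  -- The cancellation at order `ρ`, and the reason for the formula defining `confCoeff`.
  have e6 : 4 * (n : ℝ) ^ 2 * confCoeff ρ γ (B.param i z) = 2 * n * lapC (fun z => ρ (B.param i z))
      (pullback (B.param i) γ) z - n * ((n : ℝ) + 1) * defectDeriv ρ γ (B.param i z) := by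
    rw [confCoeff, e3 i z hz, ← mul_assoc, mul_inv_cancel₀ (by positivity), one_mul]
  have e7 : Real.exp (2 * β.confLog γ (B.param i z)) *
      Real.exp (-(2 * β.confLog γ (B.param i z))) = 1 := by
    rw [← Real.exp_add, add_neg_cancel, Real.exp_zero]
  simp only [] at hscal
  rw [hscal, e4, e1 i z hz]
  rw [e5] at e7 ⊢
  -- The constant `n(n+1)` is written as `e^{2v} e^{-2v} n(n+1)` to share the common factor
  -- `e^{2v}`, and the Laplacian of `ρ` is eliminated through `σ`.
  linear_combination (n * ((n : ℝ) + 1) * (A.s i)⁻¹ ^ 2) * e7 +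
    ((A.s i)⁻¹ ^ 2 * Real.exp (2 * (ρ (B.param i z) * β.avg (confCoeff ρ γ) (B.param i z))) *
      ρ (B.param i z)) * e6

end ScalarCurvature

end

end WeakAH

/-! ### Local Lipschitz dependence on the metric. -/

namespace WeakAH

noncomputable section

/-! ### Homogeneity of the norms, and uniform families of metrics -/

section Homogeneity

/-- For `c ≠ 0` multiplication by `c` is a linear equivalence and commutes with iterated
derivatives, whether or not `F` is differentiable. -/
theorem holderNormOn_smul {n : ℕ} {V : Type*} [NormedAddCommGroup V] [NormedSpace ℝ V] (k : ℕ)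
    (α : ℝ) {c : ℝ} (hc : c ≠ 0) (F : Coord n → V) (S : Set (Coord n)) :
    holderNormOn k α (fun z => c • F z) S = ‖c‖ₑ * holderNormOn k α F S := by
  have e : ∀ j z, iteratedFDeriv ℝ j (fun z => c • F z) z = c • iteratedFDeriv ℝ j F z :=
    fun j z => (ContinuousLinearEquiv.smulLeft (Units.mk0 c hc) : V ≃L[ℝ] V).iteratedFDeriv_comp_left
  simp only [holderNormOn, e, enorm_smul, ← smul_sub, mul_div_assoc, ← ENNReal.mul_iSup,
    ← Finset.mul_sum, ← mul_add]

variable {n r : ℕ} {M : Type*} [TopologicalSpace M] [ChartedSpace (EuclideanHalfSpace (n + 1)) M]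
  {ρ : M → ℝ} {B : Background n M ρ} {α : ℝ}

theorem ofComponents_smul (c : ℝ) (f : (Fin r → Fin (n + 1)) → ℝ) :
    ofComponents (fun J => c * f J) = c • ofComponents f := by
  simp only [ofComponents, Finset.smul_sum, smul_smul]

theorem nabla_smul (h : CovTensor n M 2) (c : ℝ) (u : CovTensor n M r) :
    nabla h (fun p => c • u p) = fun p => c • nabla h u p := by
  funext p
  refine Eq.trans ?_ (ofComponents_smul (n := n) c _)
  refine congrArg ofComponents (funext fun I => ?_)
  have e : ∀ J, comp p (fun p => c • u p) J = fun y => c * comp p u J y := fun J => rfl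
  simp only [e, pd_const_mul, mul_sub, Finset.mul_sum]
  congr 1
  exact Finset.sum_congr rfl fun a _ => Finset.sum_congr rfl fun m _ => by ring

theorem nablaIter_smul (h : CovTensor n M 2) (c : ℝ) (u : CovTensor n M r) (l : ℕ) :
    nablaIter h (fun p => c • u p) l = fun p => c • nablaIter h u l p := by
  induction l with
  | zero => rfl
  | succ l ih => rw [nablaIter, ih, nabla_smul]; rfl

theorem scriptNorm_smul (h : CovTensor n M 2) (k m : ℕ) {c : ℝ} (hc : c ≠ 0)
    (u : CovTensor n M r) :
    scriptNorm B h k α m (fun p => c • u p) = ‖c‖ₑ * scriptNorm B h k α m u := by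
  have e : ∀ {r : ℕ} (i : B.ι) (δ : ℝ) (u : CovTensor n M r),
      pullback (B.param i) (unweight ρ δ fun p => c • u p) =
        fun z => c • pullback (B.param i) (unweight ρ δ u) z := fun i δ u => by
    funext z
    exact congrArg (fun t => ContinuousMultilinearMap.compContinuousLinearMap t _)
      (smul_comm (ρ (B.param i z) ^ (-δ)) c (u (B.param i z)))
  simp only [scriptNorm, holderNorm, nablaIter_smul, e,
    holderNormOn_smul _ α hc, ← ENNReal.mul_iSup, ← Finset.mul_sum]

end Homogeneity

section Families

variable {n r : ℕ} {α : ℝ} {M : Type*} [TopologicalSpace M]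
  [ChartedSpace (EuclideanHalfSpace (n + 1)) M] {ρ : M → ℝ} {B : Background n M ρ} {A : Atl B}
  {Λ : Type*} {d : Λ → ℝ} {m k : ℕ} {h : CovTensor n M 2}

theorem sC_smul_sub {s : B.ι × Λ → ℝ} (c : Λ → ℝ) (u u' : Λ → CovTensor n M r)
    (J : Fin r → Fin (n + 1)) (x : B.ι × Λ) (z : Coord n) :
    sC s r (pbF B fun l p => c l • (u l - u' l) p) J x z =
      c x.2 * (sC s r (pbF B u) J x z - sC s r (pbF B u') J x z) := by
  have e : cmp (pbF B (fun l p => c l • (u l - u' l) p) x) J z =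
    c x.2 * (cmp (pbF B u x) J z - cmp (pbF B u' x) J z) := rfl
  rw [sC, e, sC, sC]
  ring

theorem abs_tens2_le {T : Tens n 2} {m : ℝ} (h : ∀ i j, |gramT T i j| ≤ m) (v : Coord n) :
    |T ![v, v]| ≤ (n + 1) ^ 2 * m * ‖v‖ ^ 2 := by
  have hv : ∀ i, |v i| ≤ ‖v‖ := fun i => PiLp.norm_apply_le v i
  rw [tens2_apply]
  calc _ ≤ ∑ i, ∑ j, |v i * v j * gramT T i j| := (Finset.abs_sum_le_sum_abs _ _).trans
        (Finset.sum_le_sum fun i _ => Finset.abs_sum_le_sum_abs _ _)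
    _ ≤ ∑ _i : Fin (n + 1), ∑ _j : Fin (n + 1), ‖v‖ * ‖v‖ * m := by
      refine Finset.sum_le_sum fun i _ => Finset.sum_le_sum fun j _ => ?_
      rw [abs_mul, abs_mul]
      exact mul_le_mul (mul_le_mul (hv i) (hv j) (abs_nonneg _) (norm_nonneg _)) (h i j)
        (abs_nonneg _) (by positivity)
    _ = _ := by simp; ring

variable [IsManifold (𝓡∂ (n + 1)) ∞ M]

/-- The difference quotients have norm at most `1`, so they form a uniformly controlled family
although the fields themselves may not. -/
theorem Atl.uT_inv_smul_sub (hρ : IsDefiningFunction n ρ) (h0 : 0 ≤ α) (h1 : α ≤ 1)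
    (hh : A.Back α h) (hmk : m ≤ k) {u u' : Λ → CovTensor n M r}
    (hu : ∀ l, A.UT α m k fun _ : Unit => u l) (hu' : ∀ l, A.UT α m k fun _ : Unit => u' l)
    (hd : ∀ l, 0 < d l)
    (hle : ∀ l, scriptNorm B h k α m (u l - u' l) ≤ ENNReal.ofReal (d l)) :
    A.UT α m k fun l p => (d l)⁻¹ • (u l - u' l) p := by
  have hs := A.isScale_sc (Λ := Unit) h0 h1
  refine A.uT_of_scriptNorm_le hρ h0 h1 hh hmk (fun l J => ?_) ⟨1, fun l => ?_⟩
  · exact ((UA.const' (d l)⁻¹).mul hs ((hu l J).sub (hu' l J))).congr fun x z _ =>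
      (sC_smul_sub (fun _ => (d l)⁻¹) (fun _ => u l) (fun _ => u' l) J x z).symm
  · rw [scriptNorm_smul h k m (inv_ne_zero (hd l).ne')]
    have e : ‖(d l)⁻¹‖ₑ = ENNReal.ofReal (d l)⁻¹ := Real.enorm_of_nonneg (inv_pos.2 (hd l)).le
    rw [e]
    calc _ ≤ ENNReal.ofReal (d l)⁻¹ * ENNReal.ofReal (d l) := by gcongr; exact hle l
      _ = 1 := by
        rw [← ENNReal.ofReal_mul (inv_pos.2 (hd l)).le, inv_mul_cancel₀ (hd l).ne',
          ENNReal.ofReal_one]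
      _ ≤ _ := le_rfl

/-- Metrics close to a given one are uniformly controlled. -/
theorem Atl.exists_uLMet (hρ : IsDefiningFunction n ρ) (h0 : 0 ≤ α) (h1 : α ≤ 1)
    (hh : A.Back α h) (hmk : m ≤ k) {γ₀ : CovTensor n M 2} (hγ₀ : A.UT α m k fun _ : Unit => γ₀)
    (hell : ∃ c, 0 < c ∧ ∀ i, ∀ z ∈ hypBall n 2, ∀ v,
      c * A.s i ^ 2 * ‖v‖ ^ 2 ≤ pullback (B.param i) γ₀ z ![v, v]) :
    ∃ ε : ℝ, 0 < ε ∧ ∀ (Λ : Type _) (d : Λ → ℝ) (γ γ' : Λ → CovTensor n M 2),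
      (∀ l, A.UT α m k fun _ : Unit => γ l) → (∀ l, A.UT α m k fun _ : Unit => γ' l) →
      (∀ l i, ∀ z ∈ hypBall n 2, IsMet (pullback (B.param i) (γ l) z)) →
      (∀ l i, ∀ z ∈ hypBall n 2, IsMet (pullback (B.param i) (γ' l) z)) →
      (∀ l, scriptNorm B h k α m (γ l - γ₀) ≤ ENNReal.ofReal ε) →
      (∀ l, scriptNorm B h k α m (γ' l - γ₀) ≤ ENNReal.ofReal ε) → (∀ l, 0 < d l) →
      (∀ l, scriptNorm B h k α m (γ l - γ' l) ≤ ENNReal.ofReal (d l)) →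
      ULMet α (A.sc Λ) (fun x => d x.2) m k (pbF B γ) (pbF B γ') := by
  obtain ⟨c, hc, hell⟩ := hell
  -- a uniform bound for the components of difference quotients at `γ₀`
  let Λ₁ := {x : CovTensor n M 2 × ℝ // (A.UT α m k fun _ : Unit => x.1) ∧ 0 < x.2 ∧
    scriptNorm B h k α m (x.1 - γ₀) ≤ ENNReal.ofReal x.2}
  have hU : A.UT α m k fun (l : Λ₁) p => (l.1.2)⁻¹ • (l.1.1 - γ₀) p :=
    Atl.uT_inv_smul_sub hρ h0 h1 hh hmk (u := fun l : Λ₁ => l.1.1) (u' := fun _ => γ₀)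
      (d := fun l : Λ₁ => l.1.2) (fun l => l.2.1) (fun _ => hγ₀) (fun l => l.2.2.1)
      fun l => l.2.2.2
  choose C hC using fun J => (hU J).ub
  obtain ⟨K, hK⟩ := Finite.exists_le C
  -- With this radius a perturbation of `γ₀` changes the quadratic form by at most half of its
  -- ellipticity constant.
  set ε := c / (2 * ((n + 1) ^ 2 * (|K| + 1))) with hε
  have hε0 : 0 < ε := by positivity
  have hclose : ∀ γ : CovTensor n M 2, (A.UT α m k fun _ : Unit => γ) →
      scriptNorm B h k α m (γ - γ₀) ≤ ENNReal.ofReal ε → ∀ i, ∀ z ∈ hypBall n 2, ∀ v,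
      c / 2 * A.s i ^ 2 * ‖v‖ ^ 2 ≤ pullback (B.param i) γ z ![v, v] := by
    intro γ hγ hle i z hz v
    have hp := A.s_pos i
    let l : Λ₁ := ⟨(γ, ε), hγ, hε0, hle⟩
    have h3 : ∀ a b, |gramT (pullback (B.param i) (γ - γ₀) z) a b| ≤ |K| * ε * A.s i ^ 2 := by
      intro a b
      have h4 := (hC ![a, b] (i, l) z hz).trans ((hK _).trans (le_abs_self K))
      have e : sC (A.sc Λ₁) 2 (pbF B fun (l : Λ₁) p => (l.1.2)⁻¹ • (l.1.1 - γ₀) p) ![a, b] (i, l) z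
          = (A.s i ^ 2)⁻¹ * (ε⁻¹ * gramT (pullback (B.param i) (γ - γ₀) z) a b) := rfl
      rw [e, abs_mul, abs_mul, abs_of_pos (inv_pos.2 (pow_pos hp 2)), abs_of_pos (inv_pos.2 hε0),
        inv_mul_le_iff₀ (by positivity), inv_mul_le_iff₀ hε0] at h4
      linarith
    have h5 := (abs_le.1 (abs_tens2_le h3 v)).1
    have h6 := hell i z hz v
    have h7 : pullback (B.param i) γ z ![v, v] = pullback (B.param i) γ₀ z ![v, v] +
        pullback (B.param i) (γ - γ₀) z ![v, v] := by
      have : pullback (B.param i) (γ - γ₀) z ![v, v] = pullback (B.param i) γ z ![v, v] -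
        pullback (B.param i) γ₀ z ![v, v] := rfl
      rw [this]; ring
    have h8 : ((n : ℝ) + 1) ^ 2 * (|K| * ε * A.s i ^ 2) * ‖v‖ ^ 2 ≤
        c / 2 * A.s i ^ 2 * ‖v‖ ^ 2 := by
      have : ((n : ℝ) + 1) ^ 2 * (|K| * ε) ≤ c / 2 := by
        calc ((n : ℝ) + 1) ^ 2 * (|K| * ε) ≤ (n + 1) ^ 2 * ((|K| + 1) * ε) := by
              gcongr; linarith
          _ = c / 2 := by rw [hε]; field_simp
      calc _ = ((n : ℝ) + 1) ^ 2 * (|K| * ε) * A.s i ^ 2 * ‖v‖ ^ 2 := by ring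
        _ ≤ _ := by gcongr
    rw [h7]
    linarith
  refine ⟨ε, hε0, fun Λ d γ γ' hγ hγ' hm hm' hle hle' hd hdle => ?_⟩
  have hs := A.isScale_sc (Λ := Λ) h0 h1
  -- Each member is `γ₀` plus `ε` times a difference quotient of norm at most `1`.
  have hfam : ∀ γ : Λ → CovTensor n M 2, (∀ l, A.UT α m k fun _ : Unit => γ l) →
      (∀ l, scriptNorm B h k α m (γ l - γ₀) ≤ ENNReal.ofReal ε) → A.UT α m k γ := by
    intro γ hγ hle J
    have h3 := Atl.uT_inv_smul_sub hρ h0 h1 hh hmk (u' := fun _ : Λ => γ₀) (d := fun _ => ε) hγ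
      (fun _ => hγ₀) (fun _ => hε0) hle J
    have h4 := (hγ₀.reindex fun _ : Λ => ()) J
    refine (((UA.const' ε).mul hs h3).add h4).congr fun x z hz => ?_
    rw [sC_smul_sub, ← mul_assoc, mul_inv_cancel₀ hε0.ne', one_mul, sub_add_cancel]
  have hdiff := Atl.uT_inv_smul_sub hρ h0 h1 hh hmk hγ hγ' hd hdle
  refine ⟨fun J => ⟨hfam γ hγ hle J, hfam γ' hγ' hle' J, ?_⟩, fun x z hz => hm x.2 x.1 z hz,
    fun x z hz => hm' x.2 x.1 z hz, ⟨c / 2, half_pos hc, fun x z hz v => ?_⟩,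
    ⟨c / 2, half_pos hc, fun x z hz v => ?_⟩⟩
  · exact (hdiff J).congr fun x z _ => sC_smul_sub (fun l => (d l)⁻¹) γ γ' J x z
  · exact hclose (γ x.2) (hγ x.2) (hle x.2) x.1 z hz v
  · exact hclose (γ' x.2) (hγ' x.2) (hle' x.2) x.1 z hz v

end Families

end

end WeakAH

namespace WeakAH

noncomputable section

/-! ### The conformal metric -/

section ConformalMetric

variable {n : ℕ} {α : ℝ} {M : Type*} [TopologicalSpace M]
  [ChartedSpace (EuclideanHalfSpace (n + 1)) M] {ρ : M → ℝ} {B : Background n M ρ} {A : Atl B}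
  {h g g' : CovTensor n M 2} {κ : ℕ}

/-- The conformal metric with conformal factor `exp (-2 v)`, where `v = β.confLog (ρ² g)`. -/
def Bumps.conformalMetric (β : Bumps A α) (g : CovTensor n M 2) : CovTensor n M 2 :=
  fun p => Real.exp (-(2 * β.confLog (bar ρ g) p)) • g p

theorem bar_smul (ρ c : M → ℝ) (g : CovTensor n M 2) (p : M) :
    bar ρ (fun p => c p • g p) p = c p • bar ρ g p := smul_comm _ _ _

variable [IsManifold (𝓡∂ (n + 1)) ∞ M]

theorem Bumps.uL_bar_conformalMetric (h0 : 0 ≤ α) (h1 : α ≤ 1) (hρ : IsDefiningFunction n ρ)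
    (β : Bumps A α) {Λ : Type*} {d : Λ → ℝ} {g g' : Λ → CovTensor n M 2}
    (hG : ULMet α (A.sc Λ) (fun x => d x.2) 2 (κ + 2) (pbF B fun l => bar ρ (g l))
      (pbF B fun l => bar ρ (g' l))) (J : Fin 2 → Fin (n + 1)) :
    UL α (A.sc Λ) (fun x => d x.2) 2 (κ + 2)
      (sC (A.sc Λ) 2 (pbF B fun l => bar ρ (β.conformalMetric (g l))) J)
      (sC (A.sc Λ) 2 (pbF B fun l => bar ρ (β.conformalMetric (g' l))) J) := by
  have hs := A.isScale_sc (Λ := Λ) h0 h1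
  have hv := (((ULMet.confLog h0 h1 hρ β hG).const_mul' 2).neg).exp hs
  have e : ∀ (f : Λ → CovTensor n M 2) (x : B.ι × Λ) (z : Coord n),
      Real.exp (-(2 * β.confLog (bar ρ (f x.2)) (B.param x.1 z))) *
        sC (A.sc Λ) 2 (pbF B fun l => bar ρ (f l)) J x z =
      sC (A.sc Λ) 2 (pbF B fun l => bar ρ (β.conformalMetric (f l))) J x z := fun f x z => by
    have : cmp (pullback (B.param x.1) (bar ρ (β.conformalMetric (f x.2)))) J z =
        Real.exp (-(2 * β.confLog (bar ρ (f x.2)) (B.param x.1 z))) *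
          cmp (pullback (B.param x.1) (bar ρ (f x.2))) J z := by
      have h3 : bar ρ (β.conformalMetric (f x.2)) = fun p =>
        Real.exp (-(2 * β.confLog (bar ρ (f x.2)) p)) • bar ρ (f x.2) p := by
        funext p; exact bar_smul _ _ _ _
      rw [h3]
      rfl
    simp only [sC]
    rw [this]
    ring
  exact (hv.mul hs (hG.comp J)).congr (fun x z _ => e g x z) fun x z _ => e g' x z

theorem MemWeak.isMet_bar (A : Atl B) {k m : ℕ} (hg : MemWeak B h k α m g) (i : B.ι) {z : Coord n}
    (hz : z ∈ hypBall n 2) : IsMet (pullback (B.param i) (bar ρ g) z) := by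
  rw [pullback_bar]
  exact ((A.isLoc hz).isMet_pullback hg.isMetric).smul (pow_pos (A.rho_pos hz) 2)

theorem MemWeak.exists_elliptic (A : Atl B) {k m : ℕ} (hg : MemWeak B h k α m g) :
    ∃ c, 0 < c ∧ ∀ i, ∀ z ∈ hypBall n 2, ∀ v,
      c * A.s i ^ 2 * ‖v‖ ^ 2 ≤ pullback (B.param i) (bar ρ g) z ![v, v] := by
  obtain ⟨G, hG⟩ := hg.extends_to_boundary
  obtain ⟨c, hc, hcG⟩ := A.exists_elliptic G
  exact ⟨c, hc, fun i z hz v => A.elliptic_pullback hcG hG i hz v⟩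

variable [T2Space M] [CompactSpace M]

theorem MemWeak.uT_bar (A : Atl B) (hρ : IsDefiningFunction n ρ) (h0 : 0 ≤ α) (h1 : α ≤ 1)
    (hg : MemWeak B h (κ + 2) α 2 g) : A.UT α 2 (κ + 2) fun _ : Unit => bar ρ g :=
  A.uT_of_memScript hρ h0 h1 hg.regular

theorem MemWeak.uLMet_bar (A : Atl B) (hρ : IsDefiningFunction n ρ) (h0 : 0 ≤ α) (h1 : α ≤ 1)
    (hg : MemWeak B h (κ + 2) α 2 g) : ULMet α (A.sc Unit) (fun _ => 1) 2 (κ + 2)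
      (pbF B fun _ => bar ρ g) (pbF B fun _ => bar ρ g) := by
  have hm := fun (x : B.ι × Unit) z hz => hg.isMet_bar A x.1 (z := z) hz
  obtain ⟨c, hc, hcG⟩ := hg.exists_elliptic A
  have he : ∃ c, 0 < c ∧ ∀ x : B.ι × Unit, ∀ z ∈ hypBall n 2, ∀ v,
      c * A.s x.1 ^ 2 * ‖v‖ ^ 2 ≤ pullback (B.param x.1) (bar ρ g) z ![v, v] :=
    ⟨c, hc, fun x => hcG x.1⟩
  exact ⟨fun J => UL.refl (hg.uT_bar A hρ h0 h1 J), hm, hm, he, he⟩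

theorem MemWeak.conformalMetric (hρ : IsDefiningFunction n ρ) (h0 : 0 ≤ α) (h1 : α ≤ 1)
    (β : Bumps A α) (hh : A.Back α h) (hg : MemWeak B h (κ + 2) α 2 g) :
    MemWeak B h (κ + 2) α 2 (β.conformalMetric g) := by
  have hG := hg.uLMet_bar A hρ h0 h1
  have hσ := ULMet.confCoeff (d := fun _ => 1) h0 h1 hρ hG
  have havg := (β.uL_avg (d := fun _ : Unit => 1) (σ := fun _ => confCoeff ρ (bar ρ g))
    (σ' := fun _ => confCoeff ρ (bar ρ g)) h0 h1 hσ 0).1.left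
  have hub := β.ub_confLog (d := fun _ => 1) h0 h1 hρ hG
  have hv := (ULMet.confLog (d := fun _ => 1) h0 h1 hρ β hG).left
  let J : B.ι → B.ι × Unit := fun i => (i, ())
  -- The logarithm of the conformal factor is `ρ` times a bounded function, hence continuous up to
  -- the boundary, where it vanishes. So the conformal metric again has a continuous nondegenerate
  -- extension.
  have hcont : Continuous (β.confLog (bar ρ g)) :=
    A.continuous_mul hρ (fun i => havg.continuousOn (i, ())) (hub.1.reindex J)
  refine ⟨fun p hp => ⟨fun v w => ?_, fun v hv => ?_⟩, ?_, ?_, ?_⟩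
  · exact congrArg (Real.exp (-(2 * β.confLog (bar ρ g) p)) * ·) ((hg.isMetric p hp).1 v w)
  · exact mul_pos (Real.exp_pos (-(2 * β.confLog (bar ρ g) p))) ((hg.isMetric p hp).2 v hv)
  · exact Atl.UT.memScript hρ h0 h1
      (fun J => (β.uL_bar_conformalMetric (d := fun _ : Unit => 1) h0 h1 hρ hG J).left)
      (Nat.le_add_left _ _)
  · obtain ⟨G, hGe⟩ := hg.extends_to_boundary
    obtain ⟨G', hG'⟩ := exists_smul_continuousRiemannianMetric G
      (f := fun p => Real.exp (-(2 * β.confLog (bar ρ g) p)))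
      (Real.continuous_exp.comp (continuous_const.mul hcont).neg) fun p => Real.exp_pos _
    refine ⟨G', fun p hp v w => ?_⟩
    rw [hG', ← hGe p hp]
    exact congrArg (fun t : Tens n 2 => t ![v, w])
      (bar_smul ρ (fun p => Real.exp (-(2 * β.confLog (bar ρ g) p))) g p)
  · exact A.tendsto_curvature_exp_smul h0 h1 hρ hh (hG.reindex J) (hv.reindex J)
      (hub.2.reindex J) hg.curvature_tendsto

theorem MemWeak.memHolder_scalarCurvature (hρ : IsDefiningFunction n ρ) (h0 : 0 ≤ α) (h1 : α ≤ 1)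
    (hn : 1 ≤ n) (β : Bumps A α) (hh : IsMetric h) (hg : MemWeak B h (κ + 2) α 2 g) :
    MemHolder B κ α 2 (ofFun (n := n)
      fun p => scalarCurvature (β.conformalMetric g) p + (n : ℝ) * ((n : ℝ) + 1)) := by
  have hu := β.uA_scalarCurvature h0 h1 hn hρ hh (hg.uLMet_bar A hρ h0 h1) hg.curvature_tendsto
  have h3 := A.holder_of_uA (Λ := Unit) (d := 2) (k := κ) (u := fun _ => ofFun (n := n)
      fun p => scalarCurvature (β.conformalMetric g) p + (n : ℝ) * ((n : ℝ) + 1)) hρ h0 h1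
    fun J => hu.reindex (Prod.fst : B.ι × Unit → B.ι)
  rw [Nat.cast_ofNat] at h3
  obtain ⟨C, hC⟩ := h3.2
  exact ⟨h3.1 (), (hC ()).trans_lt ENNReal.coe_lt_top⟩

/-- All triples of two metrics near `g₀` and a number `d > 0` bounding their distance form a single
family. Uniform control of the difference quotients over this family is the Lipschitz estimate. The
parameter is a positive real bound, not the distance, because the distance may be zero and cannot be
divided by. -/
theorem Bumps.exists_metricDist_le (hρ : IsDefiningFunction n ρ) (h0 : 0 ≤ α) (h1 : α ≤ 1)
    (β : Bumps A α) (hh : A.Back α h) {g₀ : CovTensor n M 2}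
    (hg₀ : MemWeak B h (κ + 2) α 2 g₀) :
    ∃ ε : ℝ≥0∞, 0 < ε ∧ ∃ C : NNReal, ∀ g g', MemWeak B h (κ + 2) α 2 g →
      MemWeak B h (κ + 2) α 2 g' → metricDist B h (κ + 2) α 2 g g₀ < ε →
      metricDist B h (κ + 2) α 2 g' g₀ < ε → ∀ d : ℝ, 0 < d →
      metricDist B h (κ + 2) α 2 g g' ≤ ENNReal.ofReal d →
      metricDist B h (κ + 2) α 2 (β.conformalMetric g) (β.conformalMetric g') ≤
        C * ENNReal.ofReal d := by
  obtain ⟨ε, hε, key⟩ := Atl.exists_uLMet hρ h0 h1 hh (Nat.le_add_left 2 κ)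
    (hg₀.uT_bar A hρ h0 h1) (hg₀.exists_elliptic A)
  let Λ := {x : (CovTensor n M 2 × CovTensor n M 2) × ℝ // MemWeak B h (κ + 2) α 2 x.1.1 ∧
    MemWeak B h (κ + 2) α 2 x.1.2 ∧ metricDist B h (κ + 2) α 2 x.1.1 g₀ < ENNReal.ofReal ε ∧
    metricDist B h (κ + 2) α 2 x.1.2 g₀ < ENNReal.ofReal ε ∧ 0 < x.2 ∧
    metricDist B h (κ + 2) α 2 x.1.1 x.1.2 ≤ ENNReal.ofReal x.2}
  have hG := key Λ (fun l => l.1.2) (fun l => bar ρ l.1.1.1) (fun l => bar ρ l.1.1.2)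
    (fun l => l.2.1.uT_bar A hρ h0 h1) (fun l => l.2.2.1.uT_bar A hρ h0 h1)
    (fun l i z hz => l.2.1.isMet_bar A i hz) (fun l i z hz => l.2.2.1.isMet_bar A i hz)
    (fun l => l.2.2.2.1.le) (fun l => l.2.2.2.2.1.le) (fun l => l.2.2.2.2.2.1)
    fun l => l.2.2.2.2.2.2
  have hu : A.UT α 2 (κ + 2) fun (l : Λ) p => (l.1.2)⁻¹ •
      (bar ρ (β.conformalMetric l.1.1.1) - bar ρ (β.conformalMetric l.1.1.2)) p := fun J =>
    (β.uL_bar_conformalMetric (d := fun l : Λ => l.1.2) (g := fun l : Λ => l.1.1.1)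
      (g' := fun l : Λ => l.1.1.2) h0 h1 hρ hG J).diff.congr fun x z _ =>
      (sC_smul_sub (fun l : Λ => (l.1.2)⁻¹) (fun l => bar ρ (β.conformalMetric l.1.1.1))
        (fun l => bar ρ (β.conformalMetric l.1.1.2)) J x z).symm
  obtain ⟨C, hC⟩ := hu.exists_scriptNorm_le hρ h0 h1 hh (Nat.le_add_left _ _)
  refine ⟨ENNReal.ofReal ε, ENNReal.ofReal_pos.2 hε, C, fun g g' hg hg' hd hd' d h0d hle => ?_⟩
  have h3 := hC ⟨((g, g'), d), hg, hg', hd, hd', h0d, hle⟩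
  have h4 := scriptNorm_smul (B := B) (α := α) h (κ + 2) 2 (inv_ne_zero h0d.ne')
    (bar ρ (β.conformalMetric g) - bar ρ (β.conformalMetric g'))
  have h5 : ‖d⁻¹‖ₑ = (ENNReal.ofReal d)⁻¹ := by
    rw [Real.enorm_of_nonneg (inv_nonneg.2 h0d.le), ENNReal.ofReal_inv_of_pos h0d]
  have h6 := h4.symm.le.trans h3
  rw [h5, mul_comm, ← div_eq_mul_inv] at h6
  exact (ENNReal.div_le_iff (ENNReal.ofReal_pos.2 h0d).ne' ENNReal.ofReal_ne_top).1 h6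

/-- Letting `d` decrease to `D` gives the constant `C` when `D` is finite. With `C + 1` the bound
also holds for `D = ⊤`, where a vanishing constant would give the product `0`. -/
theorem le_mul_of_forall_ofReal_le {x D : ℝ≥0∞} {C : NNReal}
    (hx : ∀ d : ℝ, 0 < d → D ≤ ENNReal.ofReal d → x ≤ C * ENNReal.ofReal d) :
    x ≤ (C + 1 : NNReal) * D := by
  rcases eq_or_ne D ⊤ with rfl | hD
  · rw [ENNReal.mul_top (by simp)]; exact le_top
  rw [← ENNReal.ofReal_toReal hD] at hx ⊢
  have hD0 : 0 ≤ D.toReal := ENNReal.toReal_nonneg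
  refine ENNReal.le_of_forall_pos_le_add fun η hη _ => ?_
  have h3 : 0 < (η : ℝ) / (C + 1) := by positivity
  refine (hx (D.toReal + η / (C + 1)) (by positivity)
    (ENNReal.ofReal_le_ofReal (by linarith))).trans ?_
  rw [← ENNReal.ofReal_coe_nnreal (p := C), ← ENNReal.ofReal_coe_nnreal (p := C + 1),
    ← ENNReal.ofReal_coe_nnreal (p := η), ← ENNReal.ofReal_mul C.coe_nonneg, ← ENNReal.ofReal_mul (C + 1).coe_nonneg,
    ← ENNReal.ofReal_add (by positivity) η.coe_nonneg]
  refine ENNReal.ofReal_le_ofReal ?_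
  have h4 : (C : ℝ) * (η / (C + 1)) ≤ η := by
    rw [mul_div_assoc', div_le_iff₀ (by positivity)]
    nlinarith [C.coe_nonneg, η.coe_nonneg]
  push_cast
  nlinarith

end ConformalMetric

end

end WeakAH

theorem mainTheorem11 (n : ℕ) (hn : 1 ≤ n)
    (M : Type*) [TopologicalSpace M] [T2Space M] [CompactSpace M]
    [ChartedSpace (EuclideanHalfSpace (n + 1)) M] [IsManifold (𝓡∂ (n + 1)) ∞ M]
    (ρ : M → ℝ) (hρ : WeakAH.IsDefiningFunction n ρ)
    (B : WeakAH.Background n M ρ)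
    (hbar : Bundle.ContMDiffRiemannianMetric (𝓡∂ (n + 1)) ∞ (WeakAH.Coord n)
      (fun p : M => TangentSpace (𝓡∂ (n + 1)) p))
    (hbar_unit : ∀ p ∈ (𝓡∂ (n + 1)).boundary M, WeakAH.dNormSq hbar ρ p = 1)
    (k : ℕ) (hk : 2 ≤ k) (α : ℝ) (hα0 : 0 ≤ α) (hα1 : α < 1) :
    ∃ T : WeakAH.CovTensor n M 2 → WeakAH.CovTensor n M 2,
      (∀ g, WeakAH.MemWeak B (WeakAH.toCovTensor hbar) k α 2 g →
        WeakAH.MemWeak B (WeakAH.toCovTensor hbar) k α 2 (T g) ∧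
        WeakAH.IsConformal g (T g) ∧
        WeakAH.MemHolder B (k - 2) α 2 (WeakAH.ofFun (n := n)
          (fun p => WeakAH.scalarCurvature (T g) p + (n : ℝ) * ((n : ℝ) + 1)))) ∧
      (∀ g₀, WeakAH.MemWeak B (WeakAH.toCovTensor hbar) k α 2 g₀ →
        ∃ ε : ℝ≥0∞, 0 < ε ∧ ∃ K : NNReal, ∀ g g',
          WeakAH.MemWeak B (WeakAH.toCovTensor hbar) k α 2 g →
          WeakAH.MemWeak B (WeakAH.toCovTensor hbar) k α 2 g' →
          WeakAH.metricDist B (WeakAH.toCovTensor hbar) k α 2 g g₀ < ε →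
          WeakAH.metricDist B (WeakAH.toCovTensor hbar) k α 2 g' g₀ < ε →
          WeakAH.metricDist B (WeakAH.toCovTensor hbar) k α 2 (T g) (T g') ≤
            K * WeakAH.metricDist B (WeakAH.toCovTensor hbar) k α 2 g g') := by
  obtain ⟨κ, rfl⟩ := Nat.exists_eq_add_of_le' hk
  obtain ⟨A⟩ := WeakAH.exists_atl hρ B
  obtain ⟨η, h1, h2, h3, h4⟩ := A.exists_bumps hα0 hα1.le
  -- The cutoff functions depend only on the background, so one choice defines the conformal factor
  -- for all metrics at once.
  let β : WeakAH.Bumps A α := ⟨η, h1, h2, h3, h4⟩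
  have hh := A.back_toCovTensor hα0 hα1.le hbar
  refine ⟨β.conformalMetric, fun g hg => ⟨hg.conformalMetric hρ hα0 hα1.le β hh,
    ⟨fun p => Real.exp (-(2 * β.confLog (WeakAH.bar ρ g) p)), fun p _ => ⟨Real.exp_pos _, rfl⟩⟩,
    hg.memHolder_scalarCurvature hρ hα0 hα1.le hn β (WeakAH.isMetric_toCovTensor hbar)⟩,
    fun g₀ hg₀ => ?_⟩
  obtain ⟨ε, hε, C, hC⟩ := β.exists_metricDist_le hρ hα0 hα1.le hh hg₀
  exact ⟨ε, hε, C + 1, fun g g' hg hg' hd hd' =>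
    WeakAH.le_mul_of_forall_ofReal_le (hC g g' hg hg' hd hd')⟩
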